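/- **Setting.** For each of the nine families below let $\gamma\in\mathbb R$, $\kappa$, an interval $(x_1,x_2)$, parameters $\boldsymbol\lambda$ with a shift $\boldsymbol\delta$, functions $\eta,\varphi,V$, a weight $\phi_0(x;\boldsymbol\lambda)^2$, eigenvalues $\mathcal E_n(\boldsymbol\lambda)$ ($n\in\mathbb Z$), polynomials $\check P_n(x;\boldsymbol\lambda)=P_n(\eta(x);\boldsymbol\lambda)$ and twisted polynomials $\check\xi_n$ be as follows ($f^*(x)=\overline{f(\bar x)}$, $0<q<1$). Group W ($\gamma=\kappa=1$): * continuous dual Hahn: $\boldsymbol\lambda=(a_1,a_2,a_3)$, $\boldsymbol\delta=(\frac12,\frac12,\frac12)$, $(0,\infty)$, $\eta=x^2$, $\varphi=2x$, $V=\frac{\prod_{j\le3}(a_j+ix)}{2ix(2ix+1)}$, $\phi_0^2=\frac{\prod_j\Gamma(a_j+ix)\Gamma(a_j-ix)}{\Gamma(2ix)\Gamma(-2ix)}$, $\mathcal E_n=n$, $P_n=S_n(\eta;a_1,a_2,a_3)$; twist $\mathfrak t$: $a_j\mapsto1-a_j$; range: $\mathrm{Re}\,a_j>0$, $(a_j)$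 closed under conjugation with multiplicity. * continuous Hahn: $\boldsymbol\lambda=(a_1,a_2)$, $(a_3,a_4)=(a_1^*,a_2^*)$, $b_1=\sum_{j\le 4} a_j$, $\boldsymbol\delta=(\frac12,\frac12)$, $\mathbb R$, $\eta=x$, $\varphi=1$, $V=\prod_{j\le2}(a_j+ix)$, $\phi_0^2=\prod_{j\le2}\Gamma(a_j+ix)\Gamma(a_j^*-ix)$, $\mathcal E_n=n(n+b_1-1)$, $P_n=p_n(\eta;a_1,a_2,a_3,a_4)$; $\mathfrak t$: $a_j\mapsto1-a_j^*$; range: $\mathrm{Re}\,a_j>0$. * Meixner–Pollaczek: $\boldsymbol\lambda=(a,\phi)$, $\boldsymbol\delta=(\frac12,0)$, $\mathbb R$, $\eta=x$, $\varphi=1$, $V=e^{i(\pi/2-\phi)}(a+ix)$, $\phi_0^2=e^{2(\phi-\pi/2)x}\Gamma(a+ix)\Gamma(a-ix)$, $\mathcal E_n=2n\sin\phi$, $P_n=P_n^{(a)}(\eta;\phi)$; $\mathfrak t$: $(a,\phi)\mapsto(1-a,\pi-\phi)$; range: $a>0$, $0<\phi<\pi$. In Group W, $\check\xi_n(x;\boldsymbol\lambda)=\check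 P_n(x;\mathfrak t(\boldsymbol\lambda))$. Group AW ($\gamma=\log q$, $\kappa=q^{-1}$, $(0,\pi)$, $\eta=\cos x$, $\varphi=2\sin x$), with $V=\frac{\prod_j(1-a_je^{ix})}{(1-e^{2ix})(1-qe^{2ix})}$ and $\phi_0^2=\frac{(e^{2ix},e^{-2ix};q)_\infty}{\prod_j(a_je^{ix},a_je^{-ix};q)_\infty}$: * continuous $q$-Jacobi: $\boldsymbol\lambda=(\alpha,\beta)$, $\boldsymbol\delta=(1,1)$, $(a_j)=(q^{\frac12(\alpha+\frac12)},q^{\frac12(\alpha+\frac32)},-q^{\frac12(\beta+\frac12)},-q^{\frac12(\beta+\frac32)})$, $\mathcal E_n=(q^{-n}-1)(1-q^{n+\alpha+\beta+1})$, $P_n=P_n^{(\alpha,\beta)}(\eta|q)$; $\mathfrak t(\alpha,\beta)=(-\alpha,-\beta)$, $\check\xi_n=\check P_n(x;\mathfrak t(\boldsymbol\lambda))$; range: $\alpha,\beta\in[-\frac12,\infty)$. * continuous dual $q$-Hahn, Al-Salam–Chihara, continuous big $q$-Hermite, continuous $q$-Hermite: $q^{\boldsymbol\lambda}=(a_1,\dots,a_m)$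 with $m=3,2,1,0$, $\boldsymbol\delta=(\frac12,\dots,\frac12)$, $\mathcal E_n=q^{-n}-1$, $P_n=p_n(\eta;a_1,a_2,a_3|q)$, $Q_n(\eta;a_1,a_2|q)$, $H_n(\eta;a_1|q)$, $H_n(\eta|q)$; $\mathfrak t$: $\lambda_j\mapsto1-\lambda_j$; range: $0<|a_j|<1$, $(a_j)$ closed under conjugation with multiplicity. * continuous $q$-Laguerre: $\boldsymbol\lambda=\alpha$, $\boldsymbol\delta=1$, $(a_j)=(q^{\frac12(\alpha+\frac12)},q^{\frac12(\alpha+\frac32)})$, $\mathcal E_n=q^{-n}-1$, $P_n=P_n^{(\alpha)}(\eta|q)$; $\mathfrak t(\alpha)=-\alpha$; range: $\alpha>-\frac12$. In the last five families $\check\xi_n(x;\boldsymbol\lambda)=\check P_n(x;\mathfrak t(\boldsymbol\lambda),q^{-1})$, i.e. also $q\to q^{-1}$ (so $a_j\to a_jq^{-1}$ when $q^{\boldsymbol\lambda}=(a_j)$). All polynomials are the standard hypergeometric ones, extended to all parameters by cancelling prefactors against lower parameters. **Notation.** $W_\gamma[f_1,\dots,f_n](x)=i^{n(n-1)/2}\det\bigl(f_k(x_j^{(n)})\bigr)$,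 $x_j^{(n)}=x+i(\frac{n+1}2-j)\gamma$; $\varphi_M(x)=\varphi(x)^{[M/2]}\prod_{k=1}^{M-2}\bigl(\varphi(x-\frac{ik\gamma}2)\varphi(x+\frac{ik\gamma}2)\bigr)^{[(M-k)/2]}$. Let $M\ge1$, $\mathcal D=\{d_1,\dots,d_M\}\subset\mathbb Z_{\ge0}$ (distinct), $N\ge\max\mathcal D$, $\bar d_j=N-d_j$, $\bar{\mathcal D}=\{0,\dots,N\}\setminus\{\bar d_1,\dots,\bar d_M\}$, $\bar{\boldsymbol\lambda}=\boldsymbol\lambda-(N+1)\boldsymbol\delta$. Put $$\Xi_{\mathcal D}(\eta(x);\boldsymbol\lambda)=\varphi_M(x)^{-1}W_\gamma[\check\xi_{d_1},\dots,\check\xi_{d_M}](x;\boldsymbol\lambda),\qquad \bar\Xi_{\mathcal D}(\eta(x);\boldsymbol\lambda)=\varphi_M(x)^{-1}W_\gamma[\check P_{d_1},\dots,\check P_{d_M}](x;\boldsymbol\lambda),$$ $$P_{\mathcal D,n}(\eta(x);\boldsymbol\lambda)=\varphi_{M+1}(x)^{-1}i^{M(M+1)/2}\det\bigl(\check\xi_{d_k}(x_j^{(M+1)})\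 \big|\ r_j\check P_n(x_j^{(M+1)})\bigr)_{1\le j\le M+1},\quad r_j=\frac{\nu(x_j^{(M+1)};\boldsymbol\lambda)}{\nu(x;\boldsymbol\lambda-M\boldsymbol\delta)},\ \nu=\frac{\phi_0}{\tilde\phi_0}.$$ Here $\tilde\phi_0(x;\boldsymbol\lambda)=\varphi(x)/\phi_0(x;\boldsymbol\lambda)$; $\phi_0$ and $\sqrt V$ are continued from the real axis along vertical lines, and $\sqrt{V^*}=(\sqrt V)^*$. Put $\phi_n=\phi_0\check P_n$, $\tilde\phi_v=\tilde\phi_0\check\xi_v$, and let $\tilde{\mathcal E}_v$ be $\alpha(\boldsymbol\lambda)$ times the twisted eigenvalue (at $\mathfrak t(\boldsymbol\lambda)$, and at $q^{-1}$ in the last five families) plus $\alpha'(\boldsymbol\lambda)$. The pair $(\alpha(\boldsymbol\lambda),\alpha'(\boldsymbol\lambda))$ is $(-1,-1)$ for continuous dual Hahn, $(1,2-b_1)$ for continuous Hahn, $(-1,-2\sin\phi)$ for Meixner–Pollaczek, $(q^{\alpha+\beta},(q-1)(1-q^{\alpha+\beta}))$ for continuous $q$-Jacobi, and $(q,q-1)$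 for the last five families. For a function $U$ let $(A_Uf)(x)=i\bigl(\sqrt{U^*}f\bigr)(x-\tfrac{i\gamma}2)-i\bigl(\sqrt Uf\bigr)(x+\tfrac{i\gamma}2)$ and $(A_U^\dagger f)(x)=-i\bigl(\sqrt{U(x)}f(x-\tfrac{i\gamma}2)-\sqrt{U^*(x)}f(x+\tfrac{i\gamma}2)\bigr)$. For $d_1<\dots<d_M$, $\mathcal D'=\mathcal D\setminus\{d_M\}$, $W_{\mathcal D}=W_\gamma[\tilde\phi_{d_1},\dots,\tilde\phi_{d_M}](\,\cdot\,;\boldsymbol\lambda)$, let $\mathcal H_{\mathcal D}=A_{\hat V_{\mathcal D}}A^\dagger_{\hat V_{\mathcal D}}+\tilde{\mathcal E}_{d_M}$ with $$\hat V_{\mathcal D}(x)=\sqrt{V(x-i\tfrac{M-1}2\gamma)}\sqrt{V^*(x-i\tfrac{M+1}2\gamma)}\ \frac{W_{\mathcal D'}(x+\frac{i\gamma}2)}{W_{\mathcal D'}(x-\frac{i\gamma}2)}\ \frac{W_{\mathcal D}(x-i\gamma)}{W_{\mathcal D}(x)},$$ and, writing $\Pi_s(x)=\prod_{j=0}^{s-1}V(x+i(\frac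 s2-j)\gamma)V^*(x-i(\frac s2-j)\gamma)$, for real $x$ let $$\Phi_{\mathcal D\,n}=\Bigl(\tfrac{\sqrt{\Pi_M(x)}}{W_{\mathcal D}(x-\frac{i\gamma}2)W_{\mathcal D}(x+\frac{i\gamma}2)}\Bigr)^{1/2}W_\gamma[\tilde\phi_{d_1},\dots,\tilde\phi_{d_M},\phi_n](x),\qquad \breve\Phi_{\mathcal D;d_j}=\mathcal C_M(x)\,\frac{\Pi_M(x)^{-1/4}\,W_{\mathcal D\setminus\{d_j\}}(x)}{\sqrt{W_{\mathcal D}(x-\frac{i\gamma}2)W_{\mathcal D}(x+\frac{i\gamma}2)}},$$ where $\mathcal C_M(x)=\phi_0(x;\boldsymbol\lambda-M\boldsymbol\delta)\tilde\phi_0(x;\boldsymbol\lambda-M\boldsymbol\delta)/\varphi(x)$. On the other side, with all quantities at $\bar{\boldsymbol\lambda}$, let $m=N+1-M$, $\mu=\min_j\bar d_j$, $w_{\mathcal K}=W_\gamma[\phi_k:k\in\mathcal K]$ (increasing order, $\mu$ last in $w_{\bar{\mathcal D},\mu}$), $\mathcal H^{\rm KA}_{\bar{\mathcal D}}=A^\dagger_UA_U+\mathcal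 E_\mu(\bar{\boldsymbol\lambda})$ with $$U(x)=V^{\rm KA}_{\bar{\mathcal D}}(x)=\sqrt{V(x-i\tfrac m2\gamma)}\sqrt{V^*(x-i\tfrac{m+2}2\gamma)}\ \frac{w_{\bar{\mathcal D}}(x+\frac{i\gamma}2)}{w_{\bar{\mathcal D}}(x-\frac{i\gamma}2)}\ \frac{w_{\bar{\mathcal D},\mu}(x-i\gamma)}{w_{\bar{\mathcal D},\mu}(x)},$$ and let $\Phi^{\rm KA}_{\bar{\mathcal D}\,n}$ and $\breve\Phi^{\rm KA}_{\bar{\mathcal D};d_j}$ be $\bigl(\sqrt{\Pi_m}/(w_{\bar{\mathcal D}}(x-\frac{i\gamma}2)w_{\bar{\mathcal D}}(x+\frac{i\gamma}2))\bigr)^{1/2}$ times $w_{\bar{\mathcal D}\cup\{N+1+n\}}(x)$ and $w_{\bar{\mathcal D}\cup\{\bar d_j\}}(x)$. Write $\propto$ for equality up to a nonzero constant factor. Parameters are *generic* for an identity if every polynomial $P_k$, $\xi_k$ occurring in it is well defined and has exact degree $k$. **Theorem.** For every one of the nine families, and all $\mathcal D$, $N$ as above: 1. (Casoratian identities) $\Xi_{\mathcal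 D}(\eta;\boldsymbol\lambda)\propto\bar\Xi_{\bar{\mathcal D}}(\eta;\bar{\boldsymbol\lambda})$ for generic complex parameters, both sides being polynomials in $\eta$. 2. $P_{\mathcal D,n}(\eta;\boldsymbol\lambda)\propto\bar\Xi_{\bar{\mathcal D}\,N+1+n}(\eta;\bar{\boldsymbol\lambda})$ for $n=0,1,\dots$, and $\Xi_{\mathcal D\setminus\{d_j\}}(\eta;\boldsymbol\lambda)\propto\bar\Xi_{\bar{\mathcal D}\,\bar d_j}(\eta;\bar{\boldsymbol\lambda})$ for $j=1,\dots,M$, for generic complex parameters, as polynomials in $\eta$. 3. (Duality) Let $d_1<\dots<d_M$ and let $\bar{\boldsymbol\lambda}$ lie in the range of the family. Then, off finitely many vertical lines, on the strip $x_1<\mathrm{Re}\,x<x_2$ one has $\mathcal H_{\mathcal D}-\mathcal E_{-N-1}(\boldsymbol\lambda)=\kappa^{-N-1}\mathcal H^{\rm KA}_{\bar{\mathcal D}}$ as difference operators, and on $(x_1,x_2)$ one has $\Phi_{\mathcal D\,n}\propto\Phi^{\rm KA}_{\bar{\mathcal D}\,n}$ ($n=0,1,\dots$) and $\breve\Phi_{\mathcal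 D;d_j}\propto\breve\Phi^{\rm KA}_{\bar{\mathcal D};d_j}$ ($j=1,\dots,M$). Moreover, with $\check\Xi(x)=\Xi(\eta(x))$ and $\psi_{\mathcal D}(x)=\phi_0(x;\boldsymbol\lambda-M\boldsymbol\delta)\bigl(\check\Xi_{\mathcal D}(x-\frac{i\gamma}2)\check\Xi_{\mathcal D}(x+\frac{i\gamma}2)\bigr)^{-1/2}$, $$\hat V_{\mathcal D}(x)=\kappa^{-M}V^*(x-\tfrac{i\gamma}2;\boldsymbol\lambda-M\boldsymbol\delta)\frac{\check\Xi_{\mathcal D'}(x+\frac{i\gamma}2)}{\check\Xi_{\mathcal D'}(x-\frac{i\gamma}2)}\frac{\check\Xi_{\mathcal D}(x-i\gamma)}{\check\Xi_{\mathcal D}(x)},\quad \Phi_{\mathcal D\,n}\propto\psi_{\mathcal D}\,P_{\mathcal D,n}(\eta(x)),\quad \breve\Phi_{\mathcal D;d_j}\propto\psi_{\mathcal D}\,\check\Xi_{\mathcal D\setminus\{d_j\}}.$$ 4. For the four families with an unmodified $q$ in the twist (Group W and continuous $q$-Jacobi), $\phi_0(x;\mathfrak t(\boldsymbol\lambda))^2/\tilde\phi_0(x;\boldsymbol\lambda)^2$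 has period $i\gamma$. 5. For the six families of Group AW, all $v\ge0$ and generic parameters, $$\check P_v(x;\mathfrak t(\boldsymbol\lambda),q^{-1})\propto\varphi_v(x)^{-1}\,W_\gamma[\check P_1,\check P_2,\dots,\check P_v]\bigl(x;\boldsymbol\lambda-(v+1)\boldsymbol\delta\bigr).$$ -/

import Mathlib

noncomputable section

namespace CasoratiDuality

open Complex

/-! ## Shifted factorials, the star operation, Casoratians -/

/-- The shifted factorial `(a)_n`. -/
def poch (a : ℂ) (n : ℕ) : ℂ := ∏ k ∈ Finset.range n, (a + k)

/-- The `q`-shifted factorial `(a; q)_n`. -/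
def qpoch (a q : ℂ) (n : ℕ) : ℂ := ∏ k ∈ Finset.range n, (1 - a * q ^ k)

/-- The infinite `q`-shifted factorial `(a; q)_∞` (used for `|q| < 1` only). -/
def qpochInf (a q : ℂ) : ℂ := ∏' k : ℕ, (1 - a * q ^ k)

/-- The star operation `f^*(x) = (f(x^*))^*`. -/
def starFun (f : ℂ → ℂ) (x : ℂ) : ℂ := (starRingEnd ℂ) (f ((starRingEnd ℂ) x))

open Classical in
/-- The square root of `f`, equal to the principal square root on the real axis and continued from
there along vertical lines; along each vertical line free of zeros and singularities of `f` it is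
the unique such continuous square root. -/
def vsqrt (f : ℂ → ℂ) (z : ℂ) : ℂ :=
  if h : ∃ g : ℝ → ℂ, Continuous g ∧ g 0 = f (z.re : ℂ) ^ (1 / 2 : ℂ) ∧
      ∀ t : ℝ, g t ^ 2 = f ((z.re : ℂ) + t * I)
  then h.choose z.im else 0

/-- The points `x_j^{(n)} = x + i ((n+1)/2 - j) γ`, with `j = 1, …, n` written as `j + 1` for
`j = 0, …, n - 1`. -/
def cpt (γ : ℝ) (n : ℕ) (x : ℂ) (j : ℕ) : ℂ :=
  x + I * (((n : ℂ) + 1) / 2 - ((j : ℂ) + 1)) * γ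

/-- The Casorati determinant `W_γ[f_1, …, f_n](x)` of a list of functions. -/
def casoratian (γ : ℝ) (fs : List (ℂ → ℂ)) (x : ℂ) : ℂ :=
  I ^ (fs.length * (fs.length - 1) / 2) *
    Matrix.det (Matrix.of fun j k : Fin fs.length => fs.get k (cpt γ fs.length x j))

/-! ## The data of a family of polynomials -/

/-- The explicit data attached to a family of orthogonal polynomials with pure imaginary shifts.
The nine families are the concrete instances defined below. -/
structure FamilyData where
  /-- the set of (generic) parameters `λ` -/
  Par : Type
  /-- the shift unit -/
  γ : ℝ
  /-- the scale constant `κ` -/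
  κ : ℝ
  /-- the open interval `(x_1, x_2)` -/
  dom : Set ℝ
  /-- `λ + s δ` for an integer `s` -/
  shift : Par → ℤ → Par
  /-- the sinusoidal coordinate -/
  η : ℂ → ℂ
  /-- the auxiliary function `φ(x)` (`\varphi`) -/
  φ : ℂ → ℂ
  /-- the potential function `V(x; λ)` -/
  V : Par → ℂ → ℂ
  /-- the eigenvalue `E_n(λ)`, for all integers `n` -/
  E : Par → ℤ → ℂ
  /-- the pseudo virtual energy `α(λ) E_v(t(λ)) + α'(λ)` -/
  Et : Par → ℕ → ℂ
  /-- the weight function `φ_0(x; λ)^2` -/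
  w : Par → ℂ → ℂ
  /-- the polynomial `P_n(η(x); λ)` as a function of `x` -/
  P : Par → ℕ → ℂ → ℂ
  /-- the twisted polynomial `ξ_v(η(x); λ)` as a function of `x` -/
  ξ : Par → ℕ → ℂ → ℂ
  /-- genericity: `P_n(η; λ)` is well defined and has exact degree `n` in `η` -/
  nondeg : Par → ℕ → Prop
  /-- genericity: `ξ_n(η; λ)` is well defined and has exact degree `n` in `η` -/
  nondegT : Par → ℕ → Prop
  /-- the parameter range of the orthogonal polynomials, in which the Hamiltonian is self-adjoint -/
  adm : Par → Prop

/-- A finite tuple of complex numbers is closed under complex conjugation, with multiplicities. -/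
def ConjClosed {m : ℕ} (a : Fin m → ℂ) : Prop :=
  ∃ σ : Equiv.Perm (Fin m), ∀ j, (starRingEnd ℂ) (a j) = a (σ j)

/-! ## Reductions of the Wilson polynomial

In all hypergeometric sums below a prefactor `(c)_n` has been merged with a lower parameter `c`
by `(c)_n / (c)_k = (c + k)_{n-k}` (and similarly for the `q`-analogue), so that the formulas are
meaningful for all values of the parameters. -/

/-- Continuous dual Hahn polynomial
`S_n(x²; a_1, a_2, a_3) = (a_1+a_2, a_1+a_3)_n 3F2(-n, a_1+ix, a_1-ix; a_1+a_2, a_1+a_3; 1)`. -/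
def cdHPoly (a : Fin 3 → ℂ) (n : ℕ) (x : ℂ) : ℂ :=
  ∑ k ∈ Finset.range (n + 1),
    poch (-(n : ℂ)) k * poch (a 0 + I * x) k * poch (a 0 - I * x) k / (k.factorial : ℂ) *
      poch (a 0 + a 1 + k) (n - k) * poch (a 0 + a 2 + k) (n - k)

/-- Continuous dual Hahn; `λ = (a_1, a_2, a_3)`, twist `a_j ↦ 1 - a_j`. -/
def contDualHahn : FamilyData where
  Par := Fin 3 → ℂ
  γ := 1
  κ := 1
  dom := Set.Ioi 0
  shift a s := fun j => a j + (s : ℂ) / 2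
  η x := x ^ 2
  φ x := 2 * x
  V a x := (∏ j, (a j + I * x)) / (2 * I * x * (2 * I * x + 1))
  E _ n := n
  Et _ v := (-1) * (v : ℂ) + (-1)
  w a x := (∏ j, Gamma (a j + I * x) * Gamma (a j - I * x)) /
    (Gamma (2 * I * x) * Gamma (-(2 * I * x)))
  P := cdHPoly
  ξ a := cdHPoly (fun j => 1 - a j)
  nondeg _ _ := True
  nondegT _ _ := True
  adm a := ConjClosed a ∧ ∀ j, 0 < (a j).re

/-- `b_1 = a_1 + a_2 + a_3 + a_4` with `(a_3, a_4) = (a_1^*, a_2^*)`. -/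
def cHb (a : Fin 2 → ℂ) : ℂ :=
  a 0 + a 1 + (starRingEnd ℂ) (a 0) + (starRingEnd ℂ) (a 1)

/-- Eigenvalue `n (n + b_1 - 1)` of the continuous Hahn family. -/
def cHE (a : Fin 2 → ℂ) (n : ℤ) : ℂ := n * (n + cHb a - 1)

/-- The twist `(a_1, a_2) ↦ (1 - a_1^*, 1 - a_2^*)`. -/
def cHTwist (a : Fin 2 → ℂ) : Fin 2 → ℂ := fun j => 1 - (starRingEnd ℂ) (a j)

/-- Continuous Hahn polynomial `p_n(x; a_1, a_2, a_3, a_4) = i^n (a_1+a_3, a_1+a_4)_n / n! *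
3F2(-n, n+b_1-1, a_1+ix; a_1+a_3, a_1+a_4; 1)` with `(a_3, a_4) = (a_1^*, a_2^*)`. -/
def cHPoly (a : Fin 2 → ℂ) (n : ℕ) (x : ℂ) : ℂ :=
  I ^ n / (n.factorial : ℂ) * ∑ k ∈ Finset.range (n + 1),
    poch (-(n : ℂ)) k * poch (n + cHb a - 1) k * poch (a 0 + I * x) k / (k.factorial : ℂ) *
      poch (a 0 + (starRingEnd ℂ) (a 0) + k) (n - k) *
      poch (a 0 + (starRingEnd ℂ) (a 1) + k) (n - k)

/-- The leading coefficient `(n + b_1 - 1)_n / n!` of the continuous Hahn polynomial is nonzero. -/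
def cHNondeg (a : Fin 2 → ℂ) (n : ℕ) : Prop := ∀ k < n, (n : ℂ) + cHb a - 1 + k ≠ 0

/-- Continuous Hahn; `λ = (a_1, a_2)`. -/
def contHahn : FamilyData where
  Par := Fin 2 → ℂ
  γ := 1
  κ := 1
  dom := Set.univ
  shift a s := fun j => a j + (s : ℂ) / 2
  η x := x
  φ _ := 1
  V a x := ∏ j, (a j + I * x)
  E := cHE
  Et a v := 1 * cHE (cHTwist a) v + (2 - cHb a)
  w a x := ∏ j, Gamma (a j + I * x) * Gamma ((starRingEnd ℂ) (a j) - I * x)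
  P := cHPoly
  ξ a := cHPoly (cHTwist a)
  nondeg := cHNondeg
  nondegT a := cHNondeg (cHTwist a)
  adm a := ∀ j, 0 < (a j).re

/-- Meixner-Pollaczek polynomial
`P_n^{(a)}(x; ϕ) = (2a)_n / n! e^{inϕ} 2F1(-n, a+ix; 2a; 1 - e^{-2iϕ})`, `λ = (a, ϕ)`. -/
def mpPoly (l : ℂ × ℂ) (n : ℕ) (x : ℂ) : ℂ :=
  exp (I * n * l.2) / (n.factorial : ℂ) * ∑ k ∈ Finset.range (n + 1),
    poch (-(n : ℂ)) k * poch (l.1 + I * x) k / (k.factorial : ℂ) *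
      (1 - exp (-(2 * I * l.2))) ^ k * poch (2 * l.1 + k) (n - k)

/-- Meixner-Pollaczek; `λ = (a, ϕ)`, `δ = (1/2, 0)`, twist `(a, ϕ) ↦ (1 - a, π - ϕ)`. The leading
coefficient of the polynomial of degree `n` is `(2 sin ϕ)^n / n!`. -/
def meixnerPollaczek : FamilyData where
  Par := ℂ × ℂ
  γ := 1
  κ := 1
  dom := Set.univ
  shift l s := (l.1 + (s : ℂ) / 2, l.2)
  η x := x
  φ _ := 1
  V l x := exp (I * (Real.pi / 2 - l.2)) * (l.1 + I * x)
  E l n := 2 * n * sin l.2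
  Et l v := (-1) * (2 * v * sin (Real.pi - l.2)) + (-(2 * sin l.2))
  w l x := exp (2 * (l.2 - Real.pi / 2) * x) * (Gamma (l.1 + I * x) * Gamma (l.1 - I * x))
  P := mpPoly
  ξ l := mpPoly (1 - l.1, Real.pi - l.2)
  nondeg l _ := sin l.2 ≠ 0
  nondegT l _ := sin l.2 ≠ 0
  adm l := l.1.im = 0 ∧ 0 < l.1.re ∧ l.2.im = 0 ∧ 0 < l.2.re ∧ l.2.re < Real.pi

/-! ## Reductions of the Askey-Wilson polynomial -/

/-- `(1 - e^{2ix}) (1 - q e^{2ix})` -/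
def awDen (q : ℝ) (x : ℂ) : ℂ := (1 - exp (2 * I * x)) * (1 - q * exp (2 * I * x))

/-- `(e^{2ix}, e^{-2ix}; q)_∞` -/
def awNum (q : ℝ) (x : ℂ) : ℂ := qpochInf (exp (2 * I * x)) q * qpochInf (exp (-(2 * I * x))) q

/-- `(a e^{ix}, a e^{-ix}; p)_n` -/
def qpair (a p : ℂ) (n : ℕ) (x : ℂ) : ℂ :=
  qpoch (a * exp (I * x)) p n * qpoch (a * exp (-(I * x))) p n

/-- `(a e^{ix}, a e^{-ix}; p)_∞` -/
def qpairInf (a p : ℂ) (x : ℂ) : ℂ :=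
  qpochInf (a * exp (I * x)) p * qpochInf (a * exp (-(I * x))) p

/-- Continuous `q`-Jacobi polynomial `P_n^{(α,β)}(cos x | q)`, `λ = (α, β)`:
`(q^{α+1};q)_n / (q;q)_n 4φ3(q^{-n}, q^{n+α+β+1}, q^{(α+1/2)/2} e^{ix}, q^{(α+1/2)/2} e^{-ix};
q^{α+1}, -q^{(α+β+1)/2}, -q^{(α+β+2)/2}; q, q)`. -/
def cqJPoly (q : ℝ) (l : ℂ × ℂ) (n : ℕ) (x : ℂ) : ℂ :=
  1 / qpoch q q n * ∑ k ∈ Finset.range (n + 1),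
    qpoch ((q : ℂ) ^ (-(n : ℤ))) q k * qpoch ((q : ℂ) ^ ((n : ℂ) + l.1 + l.2 + 1)) q k *
      qpair ((q : ℂ) ^ ((l.1 + 1 / 2) / 2)) q k x * (q : ℂ) ^ k /
      (qpoch q q k * qpoch (-(q : ℂ) ^ ((l.1 + l.2 + 1) / 2)) q k *
        qpoch (-(q : ℂ) ^ ((l.1 + l.2 + 2) / 2)) q k) *
      qpoch ((q : ℂ) ^ (l.1 + 1 + k)) q (n - k)

/-- Eigenvalue `(q^{-n} - 1)(1 - q^{n+α+β+1})` of the continuous `q`-Jacobi family. -/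
def cqJE (q : ℝ) (l : ℂ × ℂ) (n : ℤ) : ℂ :=
  ((q : ℂ) ^ (-n) - 1) * (1 - (q : ℂ) ^ ((n : ℂ) + l.1 + l.2 + 1))

/-- The denominators in the continuous `q`-Jacobi polynomial of degree `n` do not vanish, and its
leading coefficient, a nonzero multiple of `(q^{n+α+β+1}; q)_n`, does not vanish. -/
def cqJNondeg (q : ℝ) (l : ℂ × ℂ) (n : ℕ) : Prop :=
  (∀ j < 2 * n, (q : ℂ) ^ ((l.1 + l.2 + 1 + j) / 2) ≠ -1) ∧
    ∀ k < n, (q : ℂ) ^ ((n : ℂ) + l.1 + l.2 + 1 + k) ≠ 1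

/-- Continuous `q`-Jacobi; `λ = (α, β)`, `δ = (1, 1)`, twist `(α, β) ↦ (-α, -β)`. -/
def contQJacobi (q : ℝ) : FamilyData where
  Par := ℂ × ℂ
  γ := Real.log q
  κ := q⁻¹
  dom := Set.Ioo 0 Real.pi
  shift l s := (l.1 + s, l.2 + s)
  η x := cos x
  φ x := 2 * sin x
  V l x := (1 - (q : ℂ) ^ ((l.1 + 1 / 2) / 2) * exp (I * x)) *
    (1 - (q : ℂ) ^ ((l.1 + 3 / 2) / 2) * exp (I * x)) *
    (1 + (q : ℂ) ^ ((l.2 + 1 / 2) / 2) * exp (I * x)) *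
    (1 + (q : ℂ) ^ ((l.2 + 3 / 2) / 2) * exp (I * x)) / awDen q x
  E := cqJE q
  Et l v := (q : ℂ) ^ (l.1 + l.2) * cqJE q (-l.1, -l.2) v +
    ((q : ℂ) - 1) * (1 - (q : ℂ) ^ (l.1 + l.2))
  w l x := awNum q x /
    (qpairInf ((q : ℂ) ^ ((l.1 + 1 / 2) / 2)) (Real.sqrt q : ℝ) x *
      qpairInf (-(q : ℂ) ^ ((l.2 + 1 / 2) / 2)) (Real.sqrt q : ℝ) x)
  P := cqJPoly q
  ξ l := cqJPoly q (-l.1, -l.2)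
  nondeg := cqJNondeg q
  nondegT l := cqJNondeg q (-l.1, -l.2)
  adm l := l.1.im = 0 ∧ -(1 / 2) ≤ l.1.re ∧ l.2.im = 0 ∧ -(1 / 2) ≤ l.2.re

/-- The polynomials with `r` parameters besides `a_1` (with base `q`), `a = (a_1, …, a_{r+1})`:
`a_1^{-n} (a_1a_2, …, a_1a_{r+1}; q)_n 3φ2(q^{-n}, a_1e^{ix}, a_1e^{-ix}; …; q, q)`, where the two
lower parameters are `a_1a_2, a_1a_3` for `r = 2` (continuous dual `q`-Hahn), `a_1a_2, 0` for
`r = 1` (Al-Salam-Chihara), and `0, 0` for `r = 0` (continuous big `q`-Hermite). -/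
def redAWPoly (r : ℕ) (q : ℝ) (a : Fin (r + 1) → ℂ) (n : ℕ) (x : ℂ) : ℂ :=
  a 0 ^ (-(n : ℤ)) * ∑ k ∈ Finset.range (n + 1),
    qpoch ((q : ℂ) ^ (-(n : ℤ))) q k * qpair (a 0) q k x * (q : ℂ) ^ k / qpoch q q k *
      ∏ j : Fin r, qpoch (a 0 * a j.succ * (q : ℂ) ^ k) q (n - k)

/-- The family with parameters `a = q^λ = (a_1, …, a_{r+1})`, `δ = (1/2, …, 1/2)`. The twist is
`λ_j ↦ 1 - λ_j` together with `q ↦ q⁻¹`, that is, `a_j ↦ a_j q⁻¹` together with `q ↦ q⁻¹`. -/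
def redAW (r : ℕ) (q : ℝ) : FamilyData where
  Par := Fin (r + 1) → ℂ
  γ := Real.log q
  κ := q⁻¹
  dom := Set.Ioo 0 Real.pi
  shift a s := fun j => a j * (q : ℂ) ^ ((s : ℂ) / 2)
  η x := cos x
  φ x := 2 * sin x
  V a x := (∏ j, (1 - a j * exp (I * x))) / awDen q x
  E _ n := (q : ℂ) ^ (-n) - 1
  Et _ v := (q : ℂ) * (((q⁻¹ : ℝ) : ℂ) ^ (-(v : ℤ)) - 1) + (q - 1)
  w a x := awNum q x / ∏ j, qpairInf (a j) q x
  P := redAWPoly r q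
  ξ a := redAWPoly r q⁻¹ (fun j => a j * (q : ℂ)⁻¹)
  nondeg a _ := a 0 ≠ 0
  nondegT a _ := a 0 ≠ 0
  adm a := ConjClosed a ∧ ∀ j, a j ≠ 0 ∧ ‖a j‖ < 1

/-- Continuous dual `q`-Hahn. -/
def contDualQHahn (q : ℝ) : FamilyData := redAW 2 q

/-- Al-Salam-Chihara. -/
def alSalamChihara (q : ℝ) : FamilyData := redAW 1 q

/-- Continuous big `q`-Hermite. -/
def contBigQHermite (q : ℝ) : FamilyData := redAW 0 q

/-- Continuous `q`-Hermite polynomial `H_n(cos x | q) = e^{inx} 2φ0(q^{-n}, 0; -; q, q^n e^{-2ix})`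
(there are no parameters). -/
def cqHPoly (q : ℝ) (n : ℕ) (x : ℂ) : ℂ :=
  exp (I * n * x) * ∑ k ∈ Finset.range (n + 1),
    qpoch ((q : ℂ) ^ (-(n : ℤ))) q k / qpoch q q k *
      ((-1) ^ k * (q : ℂ) ^ (k * (k - 1) / 2))⁻¹ * ((q : ℂ) ^ n * exp (-(2 * I * x))) ^ k

/-- Continuous `q`-Hermite; the twist is `q ↦ q⁻¹`. -/
def contQHermite (q : ℝ) : FamilyData where
  Par := Unit
  γ := Real.log q
  κ := q⁻¹
  dom := Set.Ioo 0 Real.pi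
  shift _ _ := ()
  η x := cos x
  φ x := 2 * sin x
  V _ x := 1 / awDen q x
  E _ n := (q : ℂ) ^ (-n) - 1
  Et _ v := (q : ℂ) * (((q⁻¹ : ℝ) : ℂ) ^ (-(v : ℤ)) - 1) + (q - 1)
  w _ x := awNum q x
  P _ := cqHPoly q
  ξ _ := cqHPoly q⁻¹
  nondeg _ _ := True
  nondegT _ _ := True
  adm _ := True

/-- Continuous `q`-Laguerre polynomial `P_n^{(α)}(cos x | q) = (q^{α+1};q)_n / (q;q)_n *
3φ2(q^{-n}, q^{(α+1/2)/2} e^{ix}, q^{(α+1/2)/2} e^{-ix}; q^{α+1}, 0; q, q)`. -/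
def cqLPoly (q : ℝ) (α : ℂ) (n : ℕ) (x : ℂ) : ℂ :=
  1 / qpoch q q n * ∑ k ∈ Finset.range (n + 1),
    qpoch ((q : ℂ) ^ (-(n : ℤ))) q k * qpair ((q : ℂ) ^ ((α + 1 / 2) / 2)) q k x * (q : ℂ) ^ k /
      qpoch q q k * qpoch ((q : ℂ) ^ (α + 1 + k)) q (n - k)

/-- Continuous `q`-Laguerre; `λ = α`, `δ = 1`, the twist is `α ↦ -α` together with `q ↦ q⁻¹`. -/
def contQLaguerre (q : ℝ) : FamilyData where
  Par := ℂ
  γ := Real.log q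
  κ := q⁻¹
  dom := Set.Ioo 0 Real.pi
  shift α s := α + s
  η x := cos x
  φ x := 2 * sin x
  V α x := (1 - (q : ℂ) ^ ((α + 1 / 2) / 2) * exp (I * x)) *
    (1 - (q : ℂ) ^ ((α + 3 / 2) / 2) * exp (I * x)) / awDen q x
  E _ n := (q : ℂ) ^ (-n) - 1
  Et _ v := (q : ℂ) * (((q⁻¹ : ℝ) : ℂ) ^ (-(v : ℤ)) - 1) + (q - 1)
  w α x := awNum q x / qpairInf ((q : ℂ) ^ ((α + 1 / 2) / 2)) (Real.sqrt q : ℝ) x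
  P := cqLPoly q
  ξ α := cqLPoly q⁻¹ (-α)
  nondeg _ _ := True
  nondegT _ _ := True
  adm α := α.im = 0 ∧ -(1 / 2) < α.re

/-! ## The polynomials `Ξ_D`, `\bar Ξ_D` and `P_{D,n}` -/

/-- `φ_M(x) = φ(x)^{[M/2]} ∏_{k=1}^{M-2} (φ(x - ikγ/2) φ(x + ikγ/2))^{[(M-k)/2]}`. -/
def phiM (F : FamilyData) (M : ℕ) (x : ℂ) : ℂ :=
  F.φ x ^ (M / 2) * ∏ k ∈ Finset.Icc 1 (M - 2),
    (F.φ (x - I * ((k : ℂ) / 2) * F.γ) * F.φ (x + I * ((k : ℂ) / 2) * F.γ)) ^ ((M - k) / 2)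

/-- `\bar Ξ_D(η(x); λ) = φ_M(x)⁻¹ W_γ[P_{d_1}, …, P_{d_M}](x; λ)`. -/
def XiBar (F : FamilyData) (l : F.Par) (D : List ℕ) (x : ℂ) : ℂ :=
  (phiM F D.length x)⁻¹ * casoratian F.γ (D.map (F.P l)) x

/-- `Ξ_D(η(x); λ) = φ_M(x)⁻¹ W_γ[ξ_{d_1}, …, ξ_{d_M}](x; λ)`. -/
def Xi (F : FamilyData) (l : F.Par) (D : List ℕ) (x : ℂ) : ℂ :=
  (phiM F D.length x)⁻¹ * casoratian F.γ (D.map (F.ξ l)) x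

/-- `ν(x; λ) = φ_0(x; λ) / \tilde φ_0(x; λ)` with `\tilde φ_0 = φ / φ_0`, that is, `φ_0^2 / φ`. -/
def nu (F : FamilyData) (l : F.Par) (x : ℂ) : ℂ := F.w l x / F.φ x

/-- `r_j(x_j^{(M+1)}; λ, M+1) = ν(x_j^{(M+1)}; λ) / ν(x; λ - M δ)`. -/
def rFac (F : FamilyData) (l : F.Par) (M : ℕ) (x : ℂ) (j : ℕ) : ℂ :=
  nu F l (cpt F.γ (M + 1) x j) / nu F (F.shift l (-(M : ℤ))) x

/-- `P_{D,n}(η(x); λ)`: `φ_{M+1}(x)⁻¹ i^{M(M+1)/2}` times the determinant with the columns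
`ξ_{d_k}(x_j^{(M+1)})`, `k = 1, …, M`, and `r_j P_n(x_j^{(M+1)})`. -/
def PD (F : FamilyData) (l : F.Par) (D : List ℕ) (n : ℕ) (x : ℂ) : ℂ :=
  (phiM F (D.length + 1) x)⁻¹ * I ^ (D.length * (D.length + 1) / 2) *
    Matrix.det (Matrix.of fun j k : Fin (D.length + 1) =>
      if h : (k : ℕ) < D.length then F.ξ l (D.get ⟨k, h⟩) (cpt F.γ (D.length + 1) x j)
      else rFac F l D.length x j * F.P l n (cpt F.γ (D.length + 1) x j))

/-- The points where the defining expression of `P_{D,n}` has no vanishing denominator and no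
singular factor. (A pole of the weight is a zero of the function `F.w`.) -/
def regPD (F : FamilyData) (l : F.Par) (M : ℕ) : Set ℂ :=
  {x | phiM F (M + 1) x ≠ 0 ∧ F.φ x ≠ 0 ∧ F.w (F.shift l (-(M : ℤ))) x ≠ 0 ∧
    ∀ j ≤ M, F.φ (cpt F.γ (M + 1) x j) ≠ 0 ∧ F.w l (cpt F.γ (M + 1) x j) ≠ 0}

/-- The complementary index set `\bar D = {0, 1, …, N} \ {N - d : d ∈ D}`, in increasing order. -/
def Dbar (N : ℕ) (D : List ℕ) : List ℕ :=
  (List.range (N + 1)).filter fun e => decide (N - e ∉ D)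

/-- The shifted parameter `\bar λ = λ - (N+1) δ`. -/
def lamBar (F : FamilyData) (l : F.Par) (N : ℕ) : F.Par := F.shift l (-((N : ℤ) + 1))

/-- The functions `f` and `g` (regular on `Rf`, `Rg`) are polynomials in `η(x)` there, and the two
polynomials are equal up to a nonzero constant factor. -/
def PropInEta (η : ℂ → ℂ) (Rf Rg : Set ℂ) (f g : ℂ → ℂ) : Prop :=
  ∃ p r : Polynomial ℂ, (∀ x ∈ Rf, f x = p.eval (η x)) ∧ (∀ x ∈ Rg, g x = r.eval (η x)) ∧
    ∃ c : ℂ, c ≠ 0 ∧ p = Polynomial.C c * r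

/-- The Casoratian identity `Ξ_D(η; λ) ∝ \bar Ξ_{\bar D}(η; \bar λ)`, for generic `λ`. -/
def CasoratianIdentity (F : FamilyData) (l : F.Par) (N : ℕ) (D : List ℕ) : Prop :=
  (∀ d ∈ D, F.nondegT l d) → (∀ e ∈ Dbar N D, F.nondeg (lamBar F l N) e) →
    PropInEta F.η {x | phiM F D.length x ≠ 0} {x | phiM F (Dbar N D).length x ≠ 0}
      (Xi F l D) (XiBar F (lamBar F l N) (Dbar N D))

/-- `P_{D,n}(η; λ) ∝ \bar Ξ_{\bar D, N+1+n}(η; \bar λ)`, `n = 0, 1, …`, for generic `λ`. -/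
def PolyDualityOne (F : FamilyData) (l : F.Par) (N : ℕ) (D : List ℕ) : Prop :=
  ∀ n : ℕ, (∀ d ∈ D, F.nondegT l d) → F.nondeg l n →
    (∀ e ∈ Dbar N D ++ [N + 1 + n], F.nondeg (lamBar F l N) e) →
    PropInEta F.η (regPD F l D.length) {x | phiM F (Dbar N D ++ [N + 1 + n]).length x ≠ 0}
      (PD F l D n) (XiBar F (lamBar F l N) (Dbar N D ++ [N + 1 + n]))

/-- `Ξ_{D \ {d}}(η; λ) ∝ \bar Ξ_{\bar D, N - d}(η; \bar λ)` for every `d ∈ D`, for generic `λ`. -/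
def PolyDualityTwo (F : FamilyData) (l : F.Par) (N : ℕ) (D : List ℕ) : Prop :=
  ∀ d ∈ D, (∀ d' ∈ D.erase d, F.nondegT l d') →
    (∀ e ∈ Dbar N D ++ [N - d], F.nondeg (lamBar F l N) e) →
    PropInEta F.η {x | phiM F (D.erase d).length x ≠ 0}
      {x | phiM F (Dbar N D ++ [N - d]).length x ≠ 0}
      (Xi F l (D.erase d)) (XiBar F (lamBar F l N) (Dbar N D ++ [N - d]))

/-! ## The deformed Hamiltonian systems -/

/-- The ground state `φ_0(x; λ)`, the square root of the weight. -/
def phi0 (F : FamilyData) (l : F.Par) : ℂ → ℂ := vsqrt (F.w l)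

/-- The eigenfunction `φ_n(x; λ) = φ_0(x; λ) P_n(η(x); λ)`. -/
def phiN (F : FamilyData) (l : F.Par) (n : ℕ) (x : ℂ) : ℂ := phi0 F l x * F.P l n x

/-- The pseudo virtual ground state `\tilde φ_0(x; λ) = φ(x) / φ_0(x; λ)`. Where the twisted
weight makes sense, `φ_0(x; t(λ))` is this function up to a pseudo-constant factor, whose square
has period `iγ` (see `TwistedGroundState`). -/
def phiT0 (F : FamilyData) (l : F.Par) (x : ℂ) : ℂ := F.φ x / phi0 F l x

/-- The pseudo virtual state `\tilde φ_v(x; λ) = \tilde φ_0(x; λ) ξ_v(η(x); λ)`. -/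
def phiT (F : FamilyData) (l : F.Par) (v : ℕ) (x : ℂ) : ℂ := phiT0 F l x * F.ξ l v x

/-- With `tw` a twist of the parameters: `φ_0(x; t(λ))^2 / \tilde φ_0(x; λ)^2` has period `iγ`. -/
def TwistedGroundState (F : FamilyData) (tw : F.Par → F.Par) : Prop :=
  ∀ (l : F.Par) (x : ℂ),
    (∀ y ∈ ({x, x - I * F.γ} : Set ℂ), F.w l y ≠ 0 ∧ F.w (tw l) y ≠ 0 ∧ F.φ y ≠ 0) →
    F.w (tw l) (x - I * F.γ) * F.w l (x - I * F.γ) / F.φ (x - I * F.γ) ^ 2 =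
      F.w (tw l) x * F.w l x / F.φ x ^ 2

/-- `W_γ[\tilde φ_{d_1}, …, \tilde φ_{d_M}](x; λ)`. -/
def WT (F : FamilyData) (l : F.Par) (D : List ℕ) : ℂ → ℂ := casoratian F.γ (D.map (phiT F l))

/-- `W_γ[φ_{e_1}, …, φ_{e_m}](x; λ)`. -/
def WE (F : FamilyData) (l : F.Par) (D : List ℕ) : ℂ → ℂ := casoratian F.γ (D.map (phiN F l))

/-- The operator `A = i (e^{γp/2} √(V^*) - e^{-γp/2} √V)`, where `(e^{±γp/2} f)(x) = f(x ∓ iγ/2)`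
and `√(V^*) = (√V)^*`. -/
def opA (γ : ℝ) (V : ℂ → ℂ) (f : ℂ → ℂ) (x : ℂ) : ℂ :=
  I * (starFun (vsqrt V) (x - I * (γ / 2)) * f (x - I * (γ / 2)) -
    vsqrt V (x + I * (γ / 2)) * f (x + I * (γ / 2)))

/-- The operator `A^† = -i (√V e^{γp/2} - √(V^*) e^{-γp/2})`. -/
def opAdag (γ : ℝ) (V : ℂ → ℂ) (f : ℂ → ℂ) (x : ℂ) : ℂ :=
  -I * (vsqrt V x * f (x - I * (γ / 2)) - starFun (vsqrt V) x * f (x + I * (γ / 2)))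

/-- The product `√(V(u)) √(V^*(u - iγ))`. -/
def sqrtVV (F : FamilyData) (l : F.Par) (u : ℂ) : ℂ :=
  vsqrt (F.V l) u * starFun (vsqrt (F.V l)) (u - I * F.γ)

/-- The potential `\hat V_D` of the system with the pseudo virtual states `D = {d_1, …, d_M}`
added in this order. -/
def Vhat (F : FamilyData) (l : F.Par) (D : List ℕ) (x : ℂ) : ℂ :=
  sqrtVV F l (x - I * (((D.length : ℂ) - 1) / 2) * F.γ) *
    (WT F l D.dropLast (x + I * (F.γ / 2)) / WT F l D.dropLast (x - I * (F.γ / 2))) *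
    (WT F l D (x - I * F.γ) / WT F l D x)

/-- The Hamiltonian `H_D = \hat A_D \hat A_D^† + \tilde E_{d_M}`. -/
def HD (F : FamilyData) (l : F.Par) (D : List ℕ) (f : ℂ → ℂ) (x : ℂ) : ℂ :=
  opA F.γ (Vhat F l D) (opAdag F.γ (Vhat F l D) f) x + F.Et l (D.getLastD 0) * f x

/-- `∏_{j=0}^{s-1} V(x + i(s/2 - j)γ; λ) V^*(x - i(s/2 - j)γ; λ)`. -/
def prodVV (F : FamilyData) (l : F.Par) (s : ℕ) (x : ℂ) : ℂ :=
  ∏ j ∈ Finset.range s, F.V l (x + I * ((s : ℂ) / 2 - j) * F.γ) *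
    starFun (F.V l) (x - I * ((s : ℂ) / 2 - j) * F.γ)

/-- The eigenfunction `φ_{D n}(x)` of `H_D` (for real `x`). -/
def phiD (F : FamilyData) (l : F.Par) (D : List ℕ) (n : ℕ) (x : ℂ) : ℂ :=
  (prodVV F l D.length x ^ (1 / 2 : ℂ) /
      (WT F l D (x - I * (F.γ / 2)) * WT F l D (x + I * (F.γ / 2)))) ^ (1 / 2 : ℂ) *
    casoratian F.γ (D.map (phiT F l) ++ [phiN F l n]) x

/-- The pseudo-constant `C_s(x) = φ_0(x; λ - sδ) \tilde φ_0(x; λ - sδ) / φ(x)`. -/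
def Cs (F : FamilyData) (l : F.Par) (s : ℕ) (x : ℂ) : ℂ :=
  phi0 F (F.shift l (-(s : ℤ))) x * phiT0 F (F.shift l (-(s : ℤ))) x / F.φ x

/-- The added eigenfunction `\breve Φ_{D; d}(x)` of `H_D` (for real `x`), `d ∈ D`. -/
def PhiD (F : FamilyData) (l : F.Par) (D : List ℕ) (d : ℕ) (x : ℂ) : ℂ :=
  Cs F l D.length x * prodVV F l D.length x ^ (-(1 / 4) : ℂ) *
    (WT F l (D.erase d) x /
      (WT F l D (x - I * (F.γ / 2)) * WT F l D (x + I * (F.γ / 2))) ^ (1 / 2 : ℂ))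

/-- The potential of the system in which the eigenstates `e_1, …, e_m` (the list `L`) have been
deleted, `μ` being the lowest remaining one; `l` is the parameter of the original system. -/
def VKA (F : FamilyData) (l : F.Par) (L : List ℕ) (μ : ℕ) (x : ℂ) : ℂ :=
  sqrtVV F l (x - I * ((L.length : ℂ) / 2) * F.γ) *
    (WE F l L (x + I * (F.γ / 2)) / WE F l L (x - I * (F.γ / 2))) *
    (WE F l (L ++ [μ]) (x - I * F.γ) / WE F l (L ++ [μ]) x)

/-- The Hamiltonian `H^{KA} = A^{KA†} A^{KA} + E_μ`. -/
def HKA (F : FamilyData) (l : F.Par) (L : List ℕ) (μ : ℕ) (f : ℂ → ℂ) (x : ℂ) : ℂ :=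
  opAdag F.γ (VKA F l L μ) (opA F.γ (VKA F l L μ) f) x + F.E l μ * f x

/-- `A^{KA}(x) W_γ[φ_{k} : k ∈ K](x)`, where `A^{KA}` belongs to the deleted states `L`
(for real `x`). -/
def PhiKA (F : FamilyData) (l : F.Par) (L K : List ℕ) (x : ℂ) : ℂ :=
  (prodVV F l L.length x ^ (1 / 2 : ℂ) /
      (WE F l L (x - I * (F.γ / 2)) * WE F l L (x + I * (F.γ / 2)))) ^ (1 / 2 : ℂ) *
    WE F l K x

/-- `ψ_D(x; λ) = φ_0(x; λ - Mδ) / √(Ξ_D(x - iγ/2; λ) Ξ_D(x + iγ/2; λ))` (for real `x`). -/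
def psiD (F : FamilyData) (l : F.Par) (D : List ℕ) (x : ℂ) : ℂ :=
  phi0 F (F.shift l (-(D.length : ℤ))) x /
    (Xi F l D (x - I * (F.γ / 2)) * Xi F l D (x + I * (F.γ / 2))) ^ (1 / 2 : ℂ)

/-- The two functions on the real set `U` are equal up to a nonzero constant factor. -/
def PropOn (U : Set ℝ) (f g : ℂ → ℂ) : Prop :=
  ∃ c : ℂ, c ≠ 0 ∧ ∀ x ∈ U, f (x : ℂ) = c * g (x : ℂ)

/-- Expressions of the deformed potential and eigenfunctions through `Ξ` and `P_{D,n}`, off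
vertical lines through the finite set `S`. -/
def DeformedFormulas (F : FamilyData) (l : F.Par) (D : List ℕ) (S : Set ℝ) : Prop :=
  (∀ x : ℂ, x.re ∈ F.dom \ S →
    Vhat F l D x = ((F.κ : ℂ) ^ D.length)⁻¹ *
      starFun (F.V (F.shift l (-(D.length : ℤ)))) (x - I * (F.γ / 2)) *
      (Xi F l D.dropLast (x + I * (F.γ / 2)) / Xi F l D.dropLast (x - I * (F.γ / 2))) *
      (Xi F l D (x - I * F.γ) / Xi F l D x)) ∧
  (∀ n : ℕ, PropOn (F.dom \ S) (phiD F l D n) (fun x => psiD F l D x * PD F l D n x)) ∧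
  ∀ d ∈ D, PropOn (F.dom \ S) (PhiD F l D d) (fun x => psiD F l D x * Xi F l (D.erase d) x)

/-- The duality `H_D - E_{-N-1}(λ) = κ^{-N-1} H^{KA}_{\bar D}` (as difference operators),
`φ_{D n} ∝ Φ^{KA}_{\bar D n}` for `n = 0, 1, …`, and `\breve Φ_{D;d} ∝ \breve Φ^{KA}_{\bar D;d}`
for `d ∈ D`, off vertical lines through the finite set `S`. -/
def SystemDuality (F : FamilyData) (l : F.Par) (N : ℕ) (D : List ℕ) (S : Set ℝ) : Prop :=
  (∀ (f : ℂ → ℂ) (x : ℂ), x.re ∈ F.dom \ S →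
    HD F l D f x - F.E l (-(N : ℤ) - 1) * f x =
      ((F.κ : ℂ) ^ (N + 1))⁻¹ *
        HKA F (lamBar F l N) (Dbar N D) (N - D.getLastD 0) f x) ∧
  (∀ n : ℕ, PropOn (F.dom \ S) (phiD F l D n)
    (PhiKA F (lamBar F l N) (Dbar N D) (Dbar N D ++ [N + 1 + n]))) ∧
  ∀ d ∈ D, PropOn (F.dom \ S) (PhiD F l D d)
    (PhiKA F (lamBar F l N) (Dbar N D) (Dbar N (D.erase d)))

/-- All the identities for one family: for every nonempty list `D` of distinct non-negative
integers and every `N ≥ max D`, the polynomial identities hold for generic parameters, and if `D`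
is in increasing order and `\bar λ` is in the parameter range of the family, then the deformed
systems agree, off finitely many vertical lines. -/
def Identities (F : FamilyData) : Prop :=
  ∀ (N : ℕ) (D : List ℕ) (l : F.Par), D ≠ [] → D.Nodup → (∀ d ∈ D, d ≤ N) →
    CasoratianIdentity F l N D ∧ PolyDualityOne F l N D ∧ PolyDualityTwo F l N D ∧
    (D.Pairwise (· < ·) → F.adm (lamBar F l N) →
      ∃ S : Set ℝ, S.Finite ∧ DeformedFormulas F l D S ∧ SystemDuality F l N D S)

/-- The polynomial `Pinv l v` (the twisted polynomial with `q ↦ q⁻¹`) is proportional to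
`φ_v(x)⁻¹ W_γ[P_1, …, P_v](x; λ - (v+1) δ)`, for generic `λ`. -/
def QInverse (F : FamilyData) (Pinv : F.Par → ℕ → ℂ → ℂ) : Prop :=
  ∀ (v : ℕ) (l : F.Par), F.nondegT l v →
    (∀ e ∈ List.range' 1 v, F.nondeg (F.shift l (-((v : ℤ) + 1))) e) →
    ∃ c : ℂ, c ≠ 0 ∧ ∀ x : ℂ, phiM F v x ≠ 0 →
      Pinv l v x = c * ((phiM F v x)⁻¹ *
        casoratian F.γ ((List.range' 1 v).map (F.P (F.shift l (-((v : ℤ) + 1))))) x)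

end CasoratiDuality

end

noncomputable section

namespace CasoratiDuality

open Complex Finset Polynomial Filter Topology ComplexConjugate

/-! ## Products over pairs -/

/-- The product of `f i j` over all pairs `i < j < n`. -/
def pairProd (f:ℕ → ℕ → ℂ) (n:ℕ) : ℂ := ∏ j ∈ range n, ∏ i ∈ range j, f i j

lemma pairProd_succ (f:ℕ → ℕ → ℂ) (n:ℕ) : pairProd f (n+1) = pairProd f n*∏ i ∈ range n, f i n := prod_range_succ _ _

lemma pairProd_succ' (f:ℕ → ℕ → ℂ) (n:ℕ) : pairProd f (n+1) = (∏ j ∈ range n, f 0 (j+1))*pairProd (fun i j => f (i+1) (j+1)) n := by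
  unfold pairProd; rw [prod_range_succ', prod_range_zero, mul_one, mul_comm, ← prod_mul_distrib]
  exact prod_congr rfl fun j _ => prod_range_succ' _ _

lemma prod_Ioi_eq_pairProd (f:ℕ → ℕ → ℂ) (n:ℕ) : ∏ i : Fin n, ∏ j ∈ Ioi i, f i j = pairProd f n := by
  induction n generalizing f with
  | zero => simp [pairProd]
  | succ n ih =>
    rw [pairProd_succ', Fin.prod_univ_succ, Fin.prod_Ioi_zero, ← ih]; simp_rw [Fin.prod_Ioi_succ]; simp [Finset.prod_range]

lemma pairProd_mul (f g:ℕ → ℕ → ℂ) (n:ℕ) : pairProd (fun i j => f i j*g i j) n = pairProd f n*pairProd g n := by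
  simp [pairProd, prod_mul_distrib]

lemma pairProd_congr {f g:ℕ → ℕ → ℂ} {n:ℕ} (h:∀ i j, i < j → j < n → f i j = g i j) : pairProd f n = pairProd g n :=
  prod_congr rfl fun j hj => prod_congr rfl fun i hi => h i j (mem_range.1 hi) (mem_range.1 hj)

/-! ## The sinusoidal coordinate -/

/-- The shift `iγ`. -/
def FamilyData.stp (F:FamilyData) : ℂ := I*F.γ

/-- The properties of the sinusoidal coordinate `η` and of the auxiliary function `φ`. -/
structure Geom (F:FamilyData) where
  ω : ℕ → ℝ
  σ : ℕ → ℝ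
  σ' : ℕ → ℂ
  τ : ℕ → ℂ
  ω_ne : ∀ n, n ≠ 0 → ω n ≠ 0
  σ_pos : ∀ n, 0 < σ n
  η_sub : ∀ (n:ℕ) (x:ℂ), F.η (x+n/2*F.stp)-F.η (x-n/2*F.stp) = I*ω n*F.φ x
  η_add : ∀ (n:ℕ) (x:ℂ), F.η (x+n/2*F.stp)+F.η (x-n/2*F.stp) = σ n*F.η x+σ' n
  η_mul : ∀ (n:ℕ) (x:ℂ), F.η (x+n/2*F.stp)*F.η (x-n/2*F.stp) = F.η x^2-σ' n*F.η x+τ n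
  φ_ne : ∀ x : ℂ, x.re ∈ F.dom → F.φ x ≠ 0
  η_diff : Differentiable ℂ F.η
  φ_diff : Differentiable ℂ F.φ
  dom_open : IsOpen F.dom
  dom_nonempty : F.dom.Nonempty
  η_fib : ∀ c : ℂ, {r:ℝ | r ∈ F.dom ∧ ∃ x : ℂ, x.re = r ∧ F.η x = c}.Finite
  η_conj : ∀ x, F.η (conj x) = conj (F.η x)
  φ_conj : ∀ x, F.φ (conj x) = conj (F.φ x)
  φ_pos : ∀ r ∈ F.dom, ∃ t : ℝ, 0 < t ∧ F.φ (r:ℂ) = t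

lemma cpt_eq (F:FamilyData) (n:ℕ) (x:ℂ) (j:ℕ) : cpt F.γ n x j = x+(((n:ℂ)-1)/2-j)*F.stp := by unfold cpt FamilyData.stp; ring

lemma stp_re (F:FamilyData) : F.stp.re = 0 := by simp [FamilyData.stp]

lemma stp_conj (F:FamilyData) : conj F.stp = -F.stp := by simp [FamilyData.stp]

lemma half_stp (F:FamilyData) : I*((F.γ:ℂ)/2) = F.stp/2 := by rw [FamilyData.stp]; ring

lemma I_mul_gamma (F:FamilyData) : I*(F.γ:ℂ) = F.stp := rfl

lemma re_add_mul_stp (F:FamilyData) (x:ℂ) (t:ℝ) : (x+t*F.stp).re = x.re := by simp [FamilyData.stp]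

lemma cpt_re (F:FamilyData) (n:ℕ) (x:ℂ) (j:ℕ) : (cpt F.γ n x j).re = x.re := by
  rw [cpt_eq]
  have := re_add_mul_stp F x (((n:ℝ)-1)/2-j); push_cast at this; exact this

lemma phiM_eq_range (F:FamilyData) (n m:ℕ) (h:n ≤ m+2) (x:ℂ) : phiM F n x = F.φ x^(n/2)*∏ k ∈ range m,
      (F.φ (x-((k:ℂ)+1)/2*F.stp)*F.φ (x+((k:ℂ)+1)/2*F.stp))^((n-(k+1))/2) := by
  unfold phiM; congr 1
  have h1 : Icc 1 (n-2) = (range (n-2)).image (·+1) := by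
    ext a; simp only [mem_Icc, mem_image, mem_range]
    constructor
    · rintro ⟨h1, h2⟩; exact ⟨a-1, by omega, by omega⟩
    · rintro ⟨b, hb, rfl⟩; omega
  rw [h1, prod_image (by intro a _ b _ hab; simpa using hab)]; rw [← prod_subset (s₁ := range (n-2)) (s₂ := range m)]
  · refine prod_congr rfl fun k _ => ?_
    unfold FamilyData.stp; push_cast; congr 3 <;> ring_nf
  · exact range_subset_range.2 (by omega)
  · intro k _ hk
    have : (n-(k+1))/2 = 0 := by rw [mem_range] at hk; omega
    rw [this, pow_zero]

lemma phiM_add_two (F:FamilyData) (n:ℕ) (x:ℂ) : phiM F (n+2) x = phiM F n x*(F.φ x*∏ k ∈ range n, (F.φ (x-((k:ℂ)+1)/2*F.stp) *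
      F.φ (x+((k:ℂ)+1)/2*F.stp))) := by
  rw [phiM_eq_range F n n (by omega), phiM_eq_range F (n+2) n (by omega)]
  have e4 : (n+2)/2 = n/2+1 := by omega
  have e5 : ∀ k ∈ range n, (F.φ (x-((k:ℂ)+1)/2*F.stp)*F.φ (x+((k:ℂ)+1)/2*F.stp))^((n+2-(k+1))/2) = (F.φ (x-((k:ℂ)+1)/2*F.stp) *
      F.φ (x+((k:ℂ)+1)/2*F.stp))^((n-(k+1))/2)*(F.φ (x-((k:ℂ)+1)/2*F.stp)*F.φ (x+((k:ℂ)+1)/2*F.stp)) := by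
    intro k hk; rw [mem_range] at hk; rw [← pow_succ]; congr 1; omega
  rw [prod_congr rfl e5, prod_mul_distrib, e4, pow_succ]; ring

lemma pairProd_phi (F:FamilyData) (n:ℕ) (x:ℂ) : pairProd (fun i j => F.φ (x+(((n:ℂ)-1)/2-((i:ℂ)+j)/2)*F.stp)) n = phiM F n x := by
  induction n using Nat.twoStepInduction with
  | zero => simp [pairProd, phiM]
  | one => simp [pairProd, phiM]
  | more n ih _ =>
    rw [pairProd_succ, pairProd_succ']
    have e1 : pairProd (fun i j => F.φ (x+((((n+2:ℕ):ℂ)-1)/2-(((i+1:ℕ):ℂ)+((j+1:ℕ):ℂ))/2)*F.stp)) n = phiM F n x := by grind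
    have e2 : ∏ j ∈ range n, F.φ (x+((((n+2:ℕ):ℂ)-1)/2-(((0:ℕ):ℂ)+((j+1:ℕ):ℂ))/2)*F.stp) = ∏ k ∈ range n, F.φ (x+((k:ℂ)+1)/2*F.stp) := by
      rw [← prod_range_reflect]
      refine prod_congr rfl fun j hj => ?_
      have hj' := mem_range.1 hj
      have : ((n-1-j:ℕ):ℂ) = n-1-j := by rw [Nat.sub_sub, Nat.cast_sub (by omega)]; push_cast; ring
      grind
    have e3 : ∏ i ∈ range (n+1), F.φ (x+((((n+2:ℕ):ℂ)-1)/2-((i:ℂ)+((n+1:ℕ):ℂ))/2)*F.stp) =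
        F.φ x*∏ k ∈ range n, F.φ (x-((k:ℂ)+1)/2*F.stp) := by
      rw [prod_range_succ', mul_comm]; push_cast; ring
    rw [e1, e2, e3, phiM_add_two, prod_mul_distrib]; ring

/-- The Vandermonde determinant of the points `η(x_j^{(n)})`. -/
def Vd (F:FamilyData) (n:ℕ) (x:ℂ) : ℂ := (Matrix.vandermonde fun j:Fin n => F.η (cpt F.γ n x j)).det

namespace Geom
variable {F:FamilyData} (G:Geom F)
include G

lemma η_sub_half (x y z:ℂ) (n:ℕ) (hx:x = z+n/2*F.stp) (hy:y = z-n/2*F.stp) : F.η x-F.η y = I*G.ω n*F.φ z := by rw [hx, hy, G.η_sub]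

/-- The constant relating the Vandermonde determinant to `φ_n`. -/
def vC (n:ℕ) : ℂ := pairProd (fun i j => -(I*G.ω (j-i))) n

lemma vC_ne (n:ℕ) : G.vC n ≠ 0 := by
  unfold vC pairProd
  refine prod_ne_zero_iff.2 fun j _ => prod_ne_zero_iff.2 fun i hi => ?_
  have := G.ω_ne (j-i) (by have := mem_range.1 hi; omega); simp [this]

lemma Vd_eq (n:ℕ) (x:ℂ) : Vd F n x = G.vC n*phiM F n x := by
  unfold Vd
  rw [Matrix.det_vandermonde, prod_Ioi_eq_pairProd (fun i j => F.η (cpt F.γ n x j)-F.η (cpt F.γ n x i)), ← pairProd_phi, vC, ← pairProd_mul]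
  refine pairProd_congr fun i j hij _ => ?_
  rw [← neg_sub, G.η_sub_half (cpt F.γ n x i) (cpt F.γ n x j) (x+(((n:ℂ)-1)/2-((i:ℂ)+j)/2)*F.stp) (j-i)]
  · ring
  · rw [cpt_eq, Nat.cast_sub hij.le]; ring
  · rw [cpt_eq, Nat.cast_sub hij.le]; ring

lemma phiM_ne (n:ℕ) (x:ℂ) (hx:x.re ∈ F.dom) : phiM F n x ≠ 0 := by
  rw [← pairProd_phi]
  refine prod_ne_zero_iff.2 fun j _ => prod_ne_zero_iff.2 fun i _ => G.φ_ne _ ?_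
  have := re_add_mul_stp F x (((n:ℝ)-1)/2-((i:ℝ)+j)/2); push_cast at this; rw [this]; exact hx

lemma Vd_ne (n:ℕ) (x:ℂ) (hx:x.re ∈ F.dom) : Vd F n x ≠ 0 := by rw [G.Vd_eq]; exact mul_ne_zero (G.vC_ne n) (G.phiM_ne n x hx)

lemma phiM_diff (n:ℕ) : Differentiable ℂ (phiM F n) := by
  have : phiM F n = fun x => pairProd (fun i j => F.φ (x+(((n:ℂ)-1)/2-((i:ℂ)+j)/2)*F.stp)) n := by ext x; rw [pairProd_phi]
  rw [this]; unfold pairProd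
  refine Differentiable.fun_finsetProd fun j _ => Differentiable.fun_finsetProd fun i _ => ?_
  exact G.φ_diff.comp (by fun_prop)

lemma infinite_η_dom (S:Set ℝ) (hS:S.Finite) :
    {c:ℂ | ∃ r ∈ F.dom \ S, F.η (r:ℂ) = c}.Infinite := by
  intro hfin
  have hdom : F.dom.Infinite := by
    obtain ⟨r, hr⟩ := G.dom_nonempty; exact infinite_of_mem_nhds r (G.dom_open.mem_nhds hr)
  refine hdom.sdiff hS ?_
  refine (hfin.biUnion fun c _ => G.η_fib c).subset ?_
  intro r hr; simp only [Set.mem_iUnion]; exact ⟨F.η r, ⟨r, hr, rfl⟩, hr.1, r, by simp, rfl⟩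

lemma poly_eq_of_dom (S:Set ℝ) (hS:S.Finite) (p r:Polynomial ℂ) (h:∀ x ∈ F.dom \ S, p.eval (F.η (x:ℂ)) = r.eval (F.η (x:ℂ))) : p = r := by
  refine Polynomial.eq_of_infinite_eval_eq p r ((G.infinite_η_dom S hS).mono ?_)
  rintro c ⟨x, hx, rfl⟩
  exact h x hx

lemma exists_dom (S:Set ℝ) (hS:S.Finite) : ∃ r, r ∈ F.dom \ S := by
  obtain ⟨_, r, hr, -⟩ := (G.infinite_η_dom S hS).nonempty; exact ⟨r, hr⟩

/-- Entire functions that agree on the real interval off a finite set are equal. -/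
lemma entire_eq_of_dom (S:Set ℝ) (hS:S.Finite) {f g:ℂ → ℂ} (hf:Differentiable ℂ f)
    (hg:Differentiable ℂ g) (h:∀ x ∈ F.dom \ S, f (x:ℂ) = g (x:ℂ)) : f = g := by
  obtain ⟨r, hr⟩ := G.exists_dom S hS
  have ho : IsOpen (F.dom \ S) := G.dom_open.sdiff hS.isClosed
  refine AnalyticOnNhd.eq_of_frequently_eq (z₀ := (r:ℂ)) (fun z _ => hf.analyticAt z) (fun z _ => hg.analyticAt z) ?_
  have h1 : ∃ᶠ t : ℝ in nhdsWithin r {r}ᶜ, f (t:ℂ) = g (t:ℂ) := by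
    refine Filter.Eventually.frequently ?_
    exact (ho.mem_nhds hr |> mem_nhdsWithin_of_mem_nhds) |> fun h' => Filter.mem_of_superset h' fun t ht => h t ht
  refine Filter.Tendsto.frequently (f := fun t : ℝ => (t:ℂ)) ?_ h1
  refine tendsto_nhdsWithin_of_tendsto_nhds_of_eventually_within _ ?_ ?_
  · exact (continuous_ofReal.tendsto r).mono_left nhdsWithin_le_nhds
  · filter_upwards [self_mem_nhdsWithin] with t ht
    simpa using ht

end Geom

/-! ## The product `∏_j (η(y) - η(x_j))` -/

/-- The kernel `∏_j (η(y) - η(x_j^{(N)}))`. -/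
def PiK (F:FamilyData) (N:ℕ) (x y:ℂ) : ℂ := ∏ j ∈ range N, (F.η y-F.η (cpt F.γ N x j))

lemma prod_range_two_step (f:ℕ → ℂ) (n:ℕ) : ∏ j ∈ range (n+2), f j = (∏ j ∈ range n, f (j+1))*(f 0*f (n+1)) := by
  rw [prod_range_succ, prod_range_succ', mul_assoc]

lemma cpt_add_two_succ (γ:ℝ) (n:ℕ) (x:ℂ) (j:ℕ) : cpt γ (n+2) x (j+1) = cpt γ n x j := by unfold cpt; push_cast; ring

lemma cpt_add_two_zero (F:FamilyData) (n:ℕ) (x:ℂ) : cpt F.γ (n+2) x 0 = x+((n+1:ℕ):ℂ)/2*F.stp := by rw [cpt_eq]; push_cast; ring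

lemma cpt_add_two_last (F:FamilyData) (n:ℕ) (x:ℂ) : cpt F.γ (n+2) x (n+1) = x-((n+1:ℕ):ℂ)/2*F.stp := by rw [cpt_eq]; push_cast; ring

lemma cpt_one (γ:ℝ) (x:ℂ) : cpt γ 1 x 0 = x := by unfold cpt; push_cast; ring

/-- Block elimination for complementary minors. -/
lemma det_complement {κ τ:Type*} [Fintype κ] [Fintype τ] [DecidableEq κ] [DecidableEq τ] (f:Matrix (κ ⊕ τ) (κ ⊕ τ) ℂ) (A:Matrix τ (κ ⊕ τ) ℂ)
    (h:∀ i j, ∑ k, A i k*f k (Sum.inl j) = 0) : (Matrix.of fun i k:τ => A i (Sum.inr k)).det*f.det =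
      (Matrix.of fun i j:κ => f (Sum.inl i) (Sum.inl j)).det*(Matrix.of fun i j:τ => ∑ k, A i k*f k (Sum.inr j)).det := by
  have h1 : Matrix.fromBlocks (1:Matrix κ κ ℂ) 0 (Matrix.of fun i k => A i (Sum.inl k)) (Matrix.of fun i k => A i (Sum.inr k))*f =
      Matrix.fromBlocks (Matrix.of fun i j:κ => f (Sum.inl i) (Sum.inl j)) (Matrix.of fun i j => f (Sum.inl i) (Sum.inr j)) 0
        (Matrix.of fun i j:τ => ∑ k, A i k*f k (Sum.inr j)) := by
    ext (i | i) (j | j)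
    · simp [Matrix.mul_apply, Matrix.one_apply]
    · simp [Matrix.mul_apply, Matrix.one_apply]
    · have := h i j; simpa [Matrix.mul_apply] using this
    · simp [Matrix.mul_apply]
  have h2 := congrArg Matrix.det h1
  rwa [Matrix.det_mul, Matrix.det_fromBlocks_zero₁₂, Matrix.det_fromBlocks_zero₂₁, Matrix.det_one, one_mul] at h2

lemma det_reindex_two {α β:Type*} [Fintype α] [Fintype β] [DecidableEq α] [DecidableEq β] (e e':α ≃ β) (B:Matrix β β ℂ) :
    (Matrix.of fun i j => B (e i) (e' j)).det = ((Equiv.Perm.sign (e.symm.trans e'):ℤ):ℂ)*B.det := by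
  have : (Matrix.of fun i j => B (e i) (e' j)) = (B.submatrix id (e.symm.trans e')).submatrix e e := by ext i j; simp
  rw [this, Matrix.det_submatrix_equiv_self, Matrix.det_permute']

lemma sign_ne_zero {β:Type*} [Fintype β] [DecidableEq β] (s:Equiv.Perm β) : ((Equiv.Perm.sign s:ℤ):ℂ) ≠ 0 := by
  exact_mod_cast (Equiv.Perm.sign s).ne_zero

lemma det_eval_triangular {n:ℕ} (v:Fin n → ℂ) (p:Fin n → ℂ[X]) (h:∀ i, (p i).natDegree ≤ i) : (Matrix.of fun i j => (p j).eval (v i)).det =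
      (∏ i, (p i).coeff i)*(Matrix.vandermonde v).det := by
  have h1 : (Matrix.of fun i j:Fin n => (p j).coeff i).det = ∏ i, (p i).coeff i := by
    rw [Matrix.det_of_isUpperTriangular]
    · rfl
    · exact Matrix.matrixOfPolynomials_blockTriangular p h
  rw [Matrix.eval_matrixOfPolynomials_eq_vandermonde_mul_matrixOfPolynomials v p h, Matrix.det_mul, h1, mul_comm]

namespace Geom
variable {F:FamilyData} (G:Geom F)
include G

lemma PiK_symm (N:ℕ) (x y:ℂ) : PiK F N x y = ∏ j ∈ range N, (F.η (cpt F.γ N y j)-F.η x) := by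
  unfold PiK
  induction N using Nat.twoStepInduction with
  | zero => simp
  | one => simp [cpt_one]
  | more n ih _ =>
    rw [prod_range_two_step, prod_range_two_step]; simp_rw [cpt_add_two_last, cpt_add_two_zero, cpt_add_two_succ]; rw [ih]
    congr 1; linear_combination (G.η_mul (n+1) x-G.η_mul (n+1) y)-F.η y*G.η_add (n+1) x+F.η x*G.η_add (n+1) y

/-- The polynomial in two variables `η(x)` and `η(y)` that gives the kernel. -/
def Qp : ℕ → ℂ[X][X]
  | 0 => 1
  | 1 => X-C X
  | n+2 => Qp n*(X^2-C (C (G.σ (n+1):ℂ)*X+C (G.σ' (n+1)))*X+C (X^2-C (G.σ' (n+1))*X+C (G.τ (n+1))))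

lemma Qp_map (n:ℕ) (x:ℂ) : (G.Qp n).map (evalRingHom (F.η x)) = ∏ j ∈ range n, (X-C (F.η (cpt F.γ n x j))) := by
  induction n using Nat.twoStepInduction with
  | zero => simp [Qp]
  | one => simp [Qp, cpt_one]
  | more n ih _ =>
    rw [Qp, Polynomial.map_mul, ih]
    have hp : ∀ f : ℕ → ℂ[X], ∏ j ∈ range (n+2), f j = (∏ j ∈ range n, f (j+1))*(f 0*f (n+1)) := fun f => by
      rw [prod_range_succ, prod_range_succ', mul_assoc]
    rw [hp]; simp_rw [cpt_add_two_last, cpt_add_two_zero, cpt_add_two_succ]; congr 1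
    have h1 := congrArg (C:ℂ → ℂ[X]) (G.η_add (n+1) x)
    have h2 := congrArg (C:ℂ → ℂ[X]) (G.η_mul (n+1) x); simp only [map_add, map_mul, map_sub, map_pow] at h1 h2
    simp only [Polynomial.map_add, Polynomial.map_sub, Polynomial.map_mul, Polynomial.map_pow,
      map_X, map_C, coe_evalRingHom, eval_X, eval_C, map_add, map_mul, map_sub, map_pow]
    linear_combination X*h1-h2

lemma Qp_monic (n:ℕ) : (G.Qp n).Monic ∧ (G.Qp n).natDegree = n := by
  induction n using Nat.twoStepInduction with
  | zero => simp [Qp]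
  | one => exact ⟨monic_X_sub_C _, natDegree_X_sub_C _⟩
  | more n ih _ =>
    rw [Qp]
    have hq : ∀ u v : ℂ[X], (X^2-C u*X+C v:ℂ[X][X]).Monic ∧ (X^2-C u*X+C v:ℂ[X][X]).natDegree = 2 := by
      intro u v
      have h1 : (X^2-C u*X+C v:ℂ[X][X]) = X^2+(C (-u)*X+C v) := by rw [map_neg]; ring
      have h2 : (C (-u)*X+C v : ℂ[X][X]).degree < 2 := lt_of_le_of_lt degree_linear_le (by norm_num); rw [h1]
      refine ⟨monic_X_pow_add h2, ?_⟩
      rw [natDegree_add_eq_left_of_degree_lt (by rw [degree_X_pow]; exact h2), natDegree_X_pow]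
    exact ⟨ih.1.mul (hq _ _).1, by rw [ih.1.natDegree_mul (hq _ _).1, ih.2, (hq _ _).2]⟩

lemma Qp_top (n:ℕ) : ∀ k j, (n < k+j → ((G.Qp n).coeff k).coeff j = 0) ∧
    (k+j = n → ∃ b : ℝ, 0 < b ∧ ((G.Qp n).coeff k).coeff j = (-1)^j*b) := by
  induction n using Nat.twoStepInduction with
  | zero =>
    intro k j
    refine ⟨fun h => ?_, fun h => ?_⟩
    · rw [Qp, coeff_one]
      split_ifs with hk
      · rw [coeff_one, if_neg (by omega)]
      · simp
    · obtain ⟨rfl, rfl⟩ : k = 0 ∧ j = 0 := by omega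
      exact ⟨1, one_pos, by simp [Qp]⟩
  | one =>
    intro k j; rw [Qp]
    refine ⟨fun h => ?_, fun h => ?_⟩
    · rw [coeff_sub, coeff_X, coeff_C]
      split_ifs <;> simp [coeff_one, coeff_X] <;> omega
    · obtain ⟨rfl, rfl⟩ | ⟨rfl, rfl⟩ : (k = 0 ∧ j = 1) ∨ (k = 1 ∧ j = 0) := by omega
      · exact ⟨1, one_pos, by simp⟩
      · exact ⟨1, one_pos, by simp⟩
  | more n ih _ =>
    intro k j
    set Q := G.Qp n
    have e : ((G.Qp (n+2)).coeff k).coeff j = (if 2 ≤ k then (Q.coeff (k-2)).coeff j else 0) -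
        (if 1 ≤ k then (if 1 ≤ j then G.σ (n+1)*(Q.coeff (k-1)).coeff (j-1) else 0)+G.σ' (n+1)*(Q.coeff (k-1)).coeff j else 0) +
        ((if 2 ≤ j then (Q.coeff k).coeff (j-2) else 0)-(if 1 ≤ j then G.σ' (n+1)*(Q.coeff k).coeff (j-1) else 0) +
          G.τ (n+1)*(Q.coeff k).coeff j) := by
      have r1 : ∀ a : ℂ[X], (a*(C (G.σ (n+1):ℂ)*X+C (G.σ' (n+1)))).coeff j =
          (if 1 ≤ j then G.σ (n+1)*a.coeff (j-1) else 0)+G.σ' (n+1)*a.coeff j := by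
        intro a
        have : a*(C (G.σ (n+1):ℂ)*X+C (G.σ' (n+1))) = C (G.σ (n+1):ℂ)*(a*X^1)+C (G.σ' (n+1))*a := by ring
        rw [this, coeff_add, coeff_C_mul, coeff_C_mul, coeff_mul_X_pow']
        split_ifs <;> simp
      have r2 : ∀ a : ℂ[X], (a*(X^2-C (G.σ' (n+1))*X+C (G.τ (n+1)))).coeff j = (if 2 ≤ j then a.coeff (j-2) else 0) -
          (if 1 ≤ j then G.σ' (n+1)*a.coeff (j-1) else 0)+G.τ (n+1)*a.coeff j := by
        intro a
        have : a*(X^2-C (G.σ' (n+1))*X+C (G.τ (n+1))) = a*X^2-C (G.σ' (n+1))*(a*X^1)+C (G.τ (n+1))*a := by ring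
        rw [this, coeff_add, coeff_sub, coeff_C_mul, coeff_C_mul, coeff_mul_X_pow', coeff_mul_X_pow']
        split_ifs <;> simp
      rw [Qp]
      have : ∀ u v : ℂ[X], Q*(X^2-C u*X+C v) = Q*X^2-Q*X^1*C u+Q*C v := by intro u v; ring
      rw [this, coeff_add, coeff_sub, coeff_mul_C, coeff_mul_C, coeff_mul_X_pow', coeff_mul_X_pow', coeff_add, coeff_sub, r2]
      congr 2
      · split_ifs <;> simp
      · by_cases h1 : 1 ≤ k
        · rw [if_pos h1, if_pos h1, r1]
        · simp_all
    refine ⟨fun h => ?_, fun h => ?_⟩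
    · grind
    · have b1 : ∃ b : ℝ, 0 ≤ b ∧ (2 ≤ k → 0 < b) ∧ (if 2 ≤ k then (Q.coeff (k-2)).coeff j else 0) = (-1)^j*b := by
        split_ifs with h1
        · obtain ⟨b, hb, hb'⟩ := (ih (k-2) j).2 (by omega); grind
        · simp_all
      have b2 : ∃ b : ℝ, 0 ≤ b ∧ (1 ≤ k → 1 ≤ j → 0 < b) ∧ (if 1 ≤ k then (if 1 ≤ j then G.σ (n+1)*(Q.coeff (k-1)).coeff (j-1) else 0) +
          G.σ' (n+1)*(Q.coeff (k-1)).coeff j else 0) = -((-1)^j*b) := by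
        split_ifs with h1 h2
        · obtain ⟨b, hb, hb'⟩ := (ih (k-1) (j-1)).2 (by omega)
          refine ⟨G.σ (n+1)*b, (mul_pos (G.σ_pos _) hb).le, fun _ _ => mul_pos (G.σ_pos _) hb, ?_⟩
          rw [(ih (k-1) j).1 (by omega), hb']
          obtain ⟨i, rfl⟩ := Nat.exists_eq_add_of_le' h2; push_cast; ring
        · simp_all
        · simp_all
      have b3 : ∃ b : ℝ, 0 ≤ b ∧ (2 ≤ j → 0 < b) ∧ (if 2 ≤ j then (Q.coeff k).coeff (j-2) else 0) = (-1)^j*b := by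
        split_ifs with h1
        · obtain ⟨b, hb, hb'⟩ := (ih k (j-2)).2 (by omega)
          refine ⟨b, hb.le, fun _ => hb, ?_⟩
          rw [hb']
          obtain ⟨i, rfl⟩ := Nat.exists_eq_add_of_le' h1; grind
        · simp_all
      have a4 : (if 1 ≤ j then G.σ' (n+1)*(Q.coeff k).coeff (j-1) else 0) = 0 := by grind
      obtain ⟨c1, p1, q1, r1⟩ := b1
      obtain ⟨c2, p2, q2, r2⟩ := b2
      obtain ⟨c3, p3, q3, r3⟩ := b3
      refine ⟨c1+c2+c3, ?_, ?_⟩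
      · grind
      · rw [e, r1, r2, r3, a4, (ih k j).1 (by omega)]; push_cast; ring

/-- The coefficient of `η(x)^{N-k} η(y)^k` in the kernel. -/
def bK (N k:ℕ) : ℂ := ((G.Qp N).coeff k).coeff (N-k)

lemma bK_ne {N k:ℕ} (h:k ≤ N) : G.bK N k ≠ 0 := by
  obtain ⟨b, hb, hb'⟩ := (G.Qp_top N k (N-k)).2 (by omega); rw [bK, hb']
  exact mul_ne_zero (pow_ne_zero _ (by norm_num)) (by exact_mod_cast hb.ne')

lemma Qp_coeff_natDegree (N k:ℕ) (h:k ≤ N) : ((G.Qp N).coeff k).natDegree ≤ N-k := by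
  rw [natDegree_le_iff_coeff_eq_zero]; intro j hj; exact (G.Qp_top N k j).1 (by omega)

lemma PiK_eq_sum (N:ℕ) (x y:ℂ) : PiK F N x y = ∑ k : Fin (N+1), F.η y^(k:ℕ)*((G.Qp N).coeff k).eval (F.η x) := by
  have h1 : PiK F N x y = ((G.Qp N).map (evalRingHom (F.η x))).eval (F.η y) := by rw [Qp_map, eval_prod]; simp [PiK]
  rw [h1, eval_eq_sum_range' (n := N+1), Finset.sum_range]
  · simp [mul_comm]
  · exact lt_of_le_of_lt natDegree_map_le (by rw [(G.Qp_monic N).2]; omega)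

/-- A Casorati matrix of polynomials in `η` has as determinant the Vandermonde determinant times a
polynomial in `η`. -/
lemma exists_det_eq (n:ℕ) (p:Fin n → ℂ[X]) : ∃ A : ℂ[X], ∀ x, (Matrix.of fun j k:Fin n => (p k).eval (F.η (cpt F.γ n x j))).det =
      A.eval (F.η x)*Vd F n x := by
  set r : Fin n → ℂ[X][X] := fun k => (p k).map C %ₘ G.Qp n
  refine ⟨(Matrix.of fun i k:Fin n => (r k).coeff i).det, fun x => ?_⟩
  have h1 : (Matrix.of fun j k:Fin n => (p k).eval (F.η (cpt F.γ n x j))) = Matrix.vandermonde (fun j:Fin n => F.η (cpt F.γ n x j)) *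
        (evalRingHom (F.η x)).mapMatrix (Matrix.of fun i k:Fin n => (r k).coeff i) := by
    ext j k
    have hd : ((r k).map (evalRingHom (F.η x))).natDegree < n := by
      refine lt_of_le_of_lt natDegree_map_le ?_
      have := natDegree_modByMonic_lt ((p k).map C) (G.Qp_monic n).1 (by
        intro h
        have := (G.Qp_monic n).2; rw [h, natDegree_one] at this
        exact absurd j.2 (by omega))
      rwa [(G.Qp_monic n).2] at this
    have h2 := congrArg (fun f:ℂ[X][X] => (f.map (evalRingHom (F.η x))).eval
      (F.η (cpt F.γ n x j))) (modByMonic_add_div ((p k).map C) (G.Qp n))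
    simp only [Polynomial.map_add, Polynomial.map_mul, eval_add, eval_mul, Qp_map, eval_prod, Polynomial.map_map] at h2
    rw [prod_eq_zero (mem_range.2 j.2) (by simp), zero_mul, add_zero,
      show (evalRingHom (F.η x)).comp C = RingHom.id ℂ by ext; simp, Polynomial.map_id] at h2
    simp only [Matrix.of_apply, Matrix.mul_apply, Matrix.vandermonde_apply, RingHom.mapMatrix_apply, Matrix.map_apply, coe_evalRingHom]
    rw [← h2, eval_eq_sum_range' hd, Finset.sum_range]; simp [r, mul_comm]
  rw [h1, Matrix.det_mul, ← RingHom.map_det, mul_comm]; rfl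

end Geom

/-- The points `x_{j}^{(m)}` (for `p = M + j`), continued upwards by `M` steps. -/
def chainPt (F:FamilyData) (m M:ℕ) (x:ℂ) (p:ℕ) : ℂ := x+(((m:ℂ)-1)/2+M-p)*F.stp

lemma chainPt_add (F:FamilyData) (m M:ℕ) (x:ℂ) (j:ℕ) : chainPt F m M x (M+j) = cpt F.γ m x j := by rw [cpt_eq, chainPt]; push_cast; ring

lemma cpt_cpt_eq_chainPt (F:FamilyData) {N m M:ℕ} (h:m+M = N+1) (x:ℂ) (i j:ℕ) : cpt F.γ N (cpt F.γ M x i) j = chainPt F m M x (i+1+j) := by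
  have h' : (m:ℂ) = N+1-M := by
    have : ((m+M:ℕ):ℂ) = ((N+1:ℕ):ℂ) := by rw [h]
    grind
  rw [cpt_eq, cpt_eq, chainPt, h']; push_cast; ring

lemma PiK_chain (F:FamilyData) {N m M:ℕ} (h:m+M = N+1) (x y:ℂ) (i:ℕ) :
    PiK F N (cpt F.γ M x i) y = ∏ j ∈ range N, (F.η y-F.η (chainPt F m M x (i+1+j))) := by
  unfold PiK; exact prod_congr rfl fun j _ => by rw [cpt_cpt_eq_chainPt F h]

lemma PiK_chain_zero (F:FamilyData) {N m M:ℕ} (h:m+M = N+1) (x:ℂ) (i p:ℕ) (h1:i < p) (h2:p ≤ i+N) :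
    PiK F N (cpt F.γ M x i) (chainPt F m M x p) = 0 := by
  rw [PiK_chain F h]
  refine prod_eq_zero (i := p-(i+1)) (mem_range.2 (by omega)) ?_
  simp_all

/-- The index of a point of the chain. -/
def chainIdx {N m M:ℕ} (h:m+M = N+1) : Fin m ⊕ Fin M ≃ Fin (N+1) := (Equiv.sumComm _ _).trans (finSumFinEquiv.trans (finCongr (by omega)))

lemma chainIdx_inl {N m M:ℕ} (h:m+M = N+1) (j:Fin m) : ((chainIdx h (Sum.inl j) : Fin (N+1)):ℕ) = M+j := by simp [chainIdx]

lemma chainIdx_inr {N m M:ℕ} (h:m+M = N+1) (j:Fin M) : ((chainIdx h (Sum.inr j) : Fin (N+1)):ℕ) = j := by simp [chainIdx]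

/-- The Vandermonde determinant of the whole chain of points. -/
def chainVd (F:FamilyData) (N m M:ℕ) (x:ℂ) : ℂ := (Matrix.vandermonde fun p:Fin (N+1) => F.η (chainPt F m M x p)).det

/-- The product of the kernel over the diagonal. -/
def chainPi (F:FamilyData) (N m M:ℕ) (x:ℂ) : ℂ := ∏ i : Fin M, PiK F N (cpt F.γ M x i) (chainPt F m M x i)

lemma chain_complement (F:FamilyData) {N m M:ℕ} (h:m+M = N+1) (e:Fin m ⊕ Fin M ≃ Fin (N+1)) (q r:Fin (N+1) → ℂ → ℂ) (x:ℂ)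
    (hK:∀ (i:Fin M) (y:ℂ), PiK F N (cpt F.γ M x i) y = ∑ k, q k y*r k (cpt F.γ M x i)) :
    (Matrix.of fun i k:Fin M => r (e (Sum.inr k)) (cpt F.γ M x i)).det *
      (Matrix.of fun k p => q (e k) (chainPt F m M x (chainIdx h p))).det =
    (Matrix.of fun k j:Fin m => q (e (Sum.inl k)) (cpt F.γ m x j)).det*chainPi F N m M x := by
  have hs : ∀ (i:Fin M) (y:ℂ), ∑ k, r (e k) (cpt F.γ M x i)*q (e k) y = PiK F N (cpt F.γ M x i) y := by
    intro i y; rw [hK i y, ← e.sum_comp]; grind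
  have := det_complement (Matrix.of fun k p => q (e k) (chainPt F m M x (chainIdx h p)))
    (Matrix.of fun (i:Fin M) k => r (e k) (cpt F.γ M x i)) (by
      intro i j; simp only [Matrix.of_apply]; rw [hs, chainIdx_inl]
      exact PiK_chain_zero F h x i _ (by omega) (by have := j.2; have := i.2; omega))
  simp only [Matrix.of_apply, chainIdx_inl, chainIdx_inr, chainPt_add, hs] at this; rw [this]; congr 1
  rw [Matrix.det_of_isLowerTriangular]
  · rfl
  · intro i j hij
    have hij' : i < j := by simpa using hij
    simp only [Matrix.of_apply]; exact PiK_chain_zero F h x i j hij' (by have := j.2; have := i.2; omega)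

lemma chain_det (F:FamilyData) {N m M:ℕ} (h:m+M = N+1) (e:Fin m ⊕ Fin M ≃ Fin (N+1)) (p:Fin (N+1) → ℂ[X]) (hp:∀ k, (p k).natDegree ≤ k)
    (x:ℂ) : (Matrix.of fun k i => (p (e k)).eval (F.η (chainPt F m M x (chainIdx h i)))).det =
      ((Equiv.Perm.sign (e.symm.trans (chainIdx h)):ℤ):ℂ)*((∏ k, (p k).coeff k)*chainVd F N m M x) := by
  have := det_reindex_two e (chainIdx h) (Matrix.of fun k i:Fin (N+1) => (p k).eval (F.η (chainPt F m M x i)))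
  simp only [Matrix.of_apply] at this; rw [this]; congr 1; rw [← Matrix.det_transpose, chainVd, ← det_eval_triangular _ _ hp]; rfl

namespace Geom
variable {F:FamilyData} (G:Geom F)
include G

lemma chainVd_ne (N m M:ℕ) (x:ℂ) (hx:x.re ∈ F.dom) : chainVd F N m M x ≠ 0 := by
  have h1 : chainVd F N m M x = Vd F (N+1) (x+(((m:ℝ)-1)/2+M-N/2 : ℝ)*F.stp) := by
    unfold chainVd Vd; congr 2; ext p; congr 1; rw [cpt_eq, chainPt]; push_cast; ring
  rw [h1]; exact G.Vd_ne _ _ (by rw [re_add_mul_stp]; exact hx)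

lemma chain_Vd {N m M:ℕ} (h:m+M = N+1) : ∃ c : ℂ, c ≠ 0 ∧ ∀ x, c*Vd F M x*chainVd F N m M x = Vd F m x*chainPi F N m M x := by
  have hinj : Function.Injective (Sum.elim (fun j:Fin m => (⟨j, by omega⟩ : Fin (N+1)))
      (fun i:Fin M => (⟨N-i, by omega⟩ : Fin (N+1)))) := by
    rintro (a | a) (b | b) hab
    all_goals
      simp only [Sum.elim_inl, Sum.elim_inr, Fin.mk.injEq] at hab
      have := a.2
      have := b.2
    · rw [Fin.ext hab]
    · omega
    · omega
    · grind
  set e : Fin m ⊕ Fin M ≃ Fin (N+1) := Equiv.ofBijective _ ((Fintype.bijective_iff_injective_and_card _).2 ⟨hinj, by simp [h]⟩)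
  have e1 : ∀ j, ((e (Sum.inl j) : Fin (N+1)):ℕ) = j := fun j => rfl
  have e2 : ∀ i, ((e (Sum.inr i) : Fin (N+1)):ℕ) = N-i := fun i => rfl
  refine ⟨(∏ i:Fin M, G.bK N (N-i))*((Equiv.Perm.sign (e.symm.trans (chainIdx h)):ℤ):ℂ), ?_, fun x => ?_⟩
  · exact mul_ne_zero (prod_ne_zero_iff.2 fun i _ => G.bK_ne (by omega)) (sign_ne_zero _)
  · have h1 := chain_complement F h e (fun k y => (X^(k:ℕ) : ℂ[X]).eval (F.η y))
      (fun k z => ((G.Qp N).coeff k).eval (F.η z)) x (fun i y => by rw [G.PiK_eq_sum]; simp)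
    rw [chain_det F h e (fun k => X^(k:ℕ)) (fun k => by simp) x] at h1; simp only [e1, e2] at h1
    rw [det_eval_triangular _ (fun i:Fin M => (G.Qp N).coeff (N-i)) (fun i => by
      have := G.Qp_coeff_natDegree N (N-i) (by omega)
      have := i.2
      omega)] at h1
    have h2 : (Matrix.of fun k j:Fin m => (X^(k:ℕ) : ℂ[X]).eval (F.η (cpt F.γ m x j))).det = Vd F m x := by
      rw [← Matrix.det_transpose, Vd]; congr 1; ext i j; simp [Matrix.vandermonde_apply]
    rw [h2] at h1; rw [← h1, Vd]
    have h3 : ∏ i : Fin M, ((G.Qp N).coeff (N-i)).coeff i = ∏ i : Fin M, G.bK N (N-i) := prod_congr rfl fun i _ => by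
        rw [bK, show N-(N-(i:ℕ)) = i by have := i.2; omega]
    rw [h3]; simp only [coeff_X_pow, if_true, prod_const_one]; ring

/-- The kernel is diagonal in the polynomials `p_k(η(y))` and `t_{N-k}(η(x))`, normalised by their
leading coefficients. -/
def KernelDiag (N:ℕ) (p t:ℕ → ℂ[X]) : Prop := (∀ k ≤ N, (p k).natDegree ≤ k ∧ (p k).coeff k ≠ 0) ∧
  (∀ k ≤ N, (t k).natDegree ≤ k ∧ (t k).coeff k ≠ 0) ∧ ∀ x y, PiK F N x y = ∑ k : Fin (N+1), (p k).eval (F.η y) *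
    (G.bK N k/((p k).coeff k*(t (N-k)).coeff (N-k))*(t (N-k)).eval (F.η x))

/-- The complementary Casoratians of two families of polynomials that diagonalise the kernel are
proportional. -/
lemma casorati_complement {N m M:ℕ} (h:m+M = N+1) (e:Fin m ⊕ Fin M ≃ Fin (N+1)) :
    ∃ c : ℂ, c ≠ 0 ∧ ∀ p t : ℕ → ℂ[X], G.KernelDiag N p t → ∀ x : ℂ, x.re ∈ F.dom → (∏ k:Fin m, (p (e (Sum.inl k))).coeff (e (Sum.inl k))) *
        (Matrix.of fun i k:Fin M => (t (N-e (Sum.inr k))).eval (F.η (cpt F.γ M x i))).det*Vd F m x =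
      c*((∏ k:Fin M, (t (N-e (Sum.inr k))).coeff (N-e (Sum.inr k)))*(Matrix.of fun j k:Fin m =>
          (p (e (Sum.inl k))).eval (F.η (cpt F.γ m x j))).det*Vd F M x) := by
  obtain ⟨c0, hc0, hV⟩ := G.chain_Vd h
  set s := ((Equiv.Perm.sign (e.symm.trans (chainIdx h)):ℤ):ℂ)
  have hs : s ≠ 0 := sign_ne_zero _
  have hb : ∏ k : Fin M, G.bK N (e (Sum.inr k)) ≠ 0 := prod_ne_zero_iff.2 fun k _ => G.bK_ne (by have := (e (Sum.inr k)).2; omega)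
  refine ⟨c0/(s*∏ k:Fin M, G.bK N (e (Sum.inr k))), div_ne_zero hc0 (mul_ne_zero hs hb), fun p t ⟨hp, ht, hK⟩ x hx => ?_⟩
  have h1 := chain_complement F h e (fun k y => (p k).eval (F.η y)) (fun k z => G.bK N k/((p k).coeff k*(t (N-k)).coeff (N-k)) *
        (t (N-k)).eval (F.η z)) x (fun i y => hK _ _)
  rw [chain_det F h e (fun k => p k) (fun k => (hp k (by omega)).1) x] at h1
  have h2 : (Matrix.of fun i k:Fin M => G.bK N (e (Sum.inr k))/((p (e (Sum.inr k))).coeff (e (Sum.inr k)) *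
        (t (N-e (Sum.inr k))).coeff (N-e (Sum.inr k)))*(t (N-e (Sum.inr k))).eval (F.η (cpt F.γ M x i))).det =
      (∏ k:Fin M, G.bK N (e (Sum.inr k))/((p (e (Sum.inr k))).coeff (e (Sum.inr k))*(t (N-e (Sum.inr k))).coeff (N-e (Sum.inr k)))) *
      (Matrix.of fun i k:Fin M =>
          (t (N-e (Sum.inr k))).eval (F.η (cpt F.γ M x i))).det := by
    rw [← Matrix.det_mul_row]; rfl
  have h3 : (Matrix.of fun k j:Fin m => (p (e (Sum.inl k))).eval (F.η (cpt F.γ m x j))).det =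
      (Matrix.of fun j k:Fin m => (p (e (Sum.inl k))).eval (F.η (cpt F.γ m x j))).det := by
    rw [← Matrix.det_transpose]; rfl
  rw [h2, h3, prod_div_distrib, prod_mul_distrib] at h1
  have h4 : ∏ k : Fin (N+1), (p k).coeff k = (∏ k:Fin m, (p (e (Sum.inl k))).coeff (e (Sum.inl k))) *
      ∏ k : Fin M, (p (e (Sum.inr k))).coeff (e (Sum.inr k)) := by
    rw [← e.prod_comp, Fintype.prod_sum_type]
  rw [h4] at h1
  have hA : ∏ k : Fin M, (p (e (Sum.inr k))).coeff (e (Sum.inr k)) ≠ 0 :=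
    prod_ne_zero_iff.2 fun k _ => (hp _ (by have := (e (Sum.inr k)).2; omega)).2
  have hB : ∏ k : Fin M, (t (N-e (Sum.inr k))).coeff (N-e (Sum.inr k)) ≠ 0 := prod_ne_zero_iff.2 fun k _ => (ht _ (Nat.sub_le _ _)).2
  have hW := G.chainVd_ne N m M x hx; grind

end Geom

/-- A perturbation of the parameters to generic ones, along which the polynomials and their leading
coefficients converge. -/
structure Perturbation (F:FamilyData) where
  base : F.Par → Prop := fun _ => True
  pert : F.Par → ℝ → F.Par := fun l _ => l
  lcP : F.Par → ℕ → ℂ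
  lcT : F.Par → ℕ → ℂ
  nondeg_base : ∀ l n, F.nondeg l n → base l := by exact fun _ _ _ => trivial
  nondegT_base : ∀ l n, F.nondegT l n → base l := by exact fun _ _ _ => trivial
  base_shift : ∀ l k, base l → base (F.shift l k) := by exact fun _ _ _ => trivial
  pert_shift : ∀ l k t, pert (F.shift l k) t = F.shift (pert l t) k := by exact fun _ _ _ => rfl
  pert_gen : ∀ l, base l → ∀ n, ∀ᶠ t in 𝓝[≠] (0:ℝ), F.nondeg (pert l t) n ∧ F.nondegT (pert l t) n := by
      exact fun _ _ _ => .of_forall fun _ => ⟨trivial, trivial⟩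
  P_lim : ∀ l n, F.nondeg l n → ∀ x, Tendsto (fun t => F.P (pert l t) n x) (𝓝[≠] 0) (𝓝 (F.P l n x)) := by
      exact fun _ _ _ _ => tendsto_const_nhds
  T_lim : ∀ l n, F.nondegT l n → ∀ x, Tendsto (fun t => F.ξ (pert l t) n x) (𝓝[≠] 0) (𝓝 (F.ξ l n x)) := by
      exact fun _ _ _ _ => tendsto_const_nhds
  lcP_lim : ∀ l n, F.nondeg l n → Tendsto (fun t => lcP (pert l t) n) (𝓝[≠] 0) (𝓝 (lcP l n)) := by exact fun _ _ _ => tendsto_const_nhds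
  lcT_lim : ∀ l n, F.nondegT l n → Tendsto (fun t => lcT (pert l t) n) (𝓝[≠] 0) (𝓝 (lcT l n)) := by exact fun _ _ _ => tendsto_const_nhds

/-- The structure shared by the nine families: potential functions, difference equations of the
polynomials and of the twisted polynomials, the kernel identity, the parameter shift of the weight,
and a perturbation of the parameters. -/
structure Model (F:FamilyData) extends Geom F, Perturbation F where
  np : F.Par → ℂ → ℂ
  nm : F.Par → ℂ → ℂ
  np_diff : ∀ l, Differentiable ℂ (np l)
  nm_diff : ∀ l, Differentiable ℂ (nm l)
  np_fin : ∀ l, ∃ S : Set ℝ, S.Finite ∧ ∀ x : ℂ, x.re ∈ F.dom \ S → np l x ≠ 0 ∧ nm l x ≠ 0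
  κ_pos : 0 < F.κ
  V_eq : ∀ l x, F.V l x = np l x/(F.φ x*F.φ (x-F.stp/2))
  shift_shift : ∀ l a b, F.shift (F.shift l a) b = F.shift l (a+b)
  shift_zero : ∀ l, F.shift l 0 = l
  np_shift : ∀ l x, np (F.shift l (-1)) x = F.κ*np l (x+F.stp/2)
  nm_shift : ∀ l x, nm (F.shift l (-1)) x = F.κ*nm l (x-F.stp/2)
  P_poly : ∀ l n, ∃ p : ℂ[X], p.natDegree ≤ n ∧ (∀ x, F.P l n x = p.eval (F.η x)) ∧ (F.nondeg l n → p.coeff n = lcP l n)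
  T_poly : ∀ l n, ∃ p : ℂ[X], p.natDegree ≤ n ∧ (∀ x, F.ξ l n x = p.eval (F.η x)) ∧ (F.nondegT l n → p.coeff n = lcT l n)
  lcP_ne : ∀ l n, F.nondeg l n → lcP l n ≠ 0
  lcT_ne : ∀ l n, F.nondegT l n → lcT l n ≠ 0
  P_eq : ∀ l n, F.nondeg l n → ∀ x : ℂ, x.re ∈ F.dom → np l x/(F.φ x*F.φ (x-F.stp/2))*(F.P l n (x-F.stp)-F.P l n x) +
      nm l x/(F.φ x*F.φ (x+F.stp/2))*(F.P l n (x+F.stp)-F.P l n x) = F.E l n*F.P l n x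
  T_eq : ∀ l n, F.nondegT l n → ∀ x : ℂ, x.re ∈ F.dom → nm l (x-F.stp)/(F.φ x*F.φ (x-F.stp/2))*(F.ξ l n (x-F.stp)-F.ξ l n x) +
      np l (x+F.stp)/(F.φ x*F.φ (x+F.stp/2))*(F.ξ l n (x+F.stp)-F.ξ l n x) = (F.Et l n-F.Et l 0)*F.ξ l n x
  VV : ∀ l, ∀ x : ℂ, x.re ∈ F.dom → nm l (x-F.stp)/(F.φ x*F.φ (x-F.stp/2))+np l (x+F.stp)/(F.φ x*F.φ (x+F.stp/2)) -
      np l x/(F.φ x*F.φ (x-F.stp/2))-nm l x/(F.φ x*F.φ (x+F.stp/2)) = F.Et l 0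
  E_zero : ∀ l, F.E l 0 = 0
  E_step : ∀ l n, (F.κ:ℂ)⁻¹*F.E (F.shift l (-1)) (n+1) = F.E l n-F.E l (-1)
  Et_eq : ∀ l (v:ℕ), F.Et l v = F.E l (-(v:ℤ)-1)
  E_ne : ∀ l n, F.nondeg l n → ∀ k < n, F.E l k ≠ F.E l n
  kernel : ∀ (l:F.Par) (N:ℕ) (x y a:ℂ), a = ((N:ℂ)-1)/2*F.stp → F.φ x ≠ 0 → F.φ y ≠ 0 → F.η (y+a)-F.η x ≠ 0 → F.η (y-a)-F.η x ≠ 0 →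
    F.η y-F.η (x+a) ≠ 0 → F.η y-F.η (x-a) ≠ 0 → I*ω N*(-np l (y+a+F.stp)/(F.φ y*(F.η (y+a)-F.η x)) +
      nm l (y-a-F.stp)/(F.φ y*(F.η (y-a)-F.η x))-nm l (x-F.stp)/(F.φ x*(F.η y-F.η (x+a)))+np l (x+F.stp)/(F.φ x*(F.η y-F.η (x-a)))) =
      F.Et l 0-F.E l (-(N:ℤ)-1)
  w_step : ∀ l y, F.w l y ≠ 0 → np l y ≠ 0 ∧ nm l y ≠ 0 ∧ F.w (F.shift l 1) (y-F.stp/2) ≠ 0 ∧ F.w (F.shift l 1) (y+F.stp/2) ≠ 0 ∧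
    nu F (F.shift l 1) (y-F.stp/2) = np l y*nu F l y ∧ nu F (F.shift l 1) (y+F.stp/2) = nm l y*nu F l y
  np_lim : ∀ l x, Tendsto (fun t => np (pert l t) x) (𝓝[≠] 0) (𝓝 (np l x)) := by exact fun _ _ => tendsto_const_nhds
  nm_lim : ∀ l x, Tendsto (fun t => nm (pert l t) x) (𝓝[≠] 0) (𝓝 (nm l x)) := by exact fun _ _ => tendsto_const_nhds
  E_lim : ∀ l n, Tendsto (fun t => F.E (pert l t) n) (𝓝[≠] 0) (𝓝 (F.E l n)) := by exact fun _ _ => tendsto_const_nhds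

/-- The polynomials `p_0, …, p_N` span the polynomials of degree at most `N`. -/
lemma exists_sum_of_degree {N:ℕ} (p:ℕ → ℂ[X]) (hp:∀ k ≤ N, (p k).natDegree ≤ k ∧ (p k).coeff k ≠ 0) (f:ℂ[X]) (hf:f.natDegree ≤ N) :
    ∃ c : ℕ → ℂ, f = ∑ k ∈ range (N+1), C (c k)*p k := by
  induction N generalizing f with
  | zero =>
    have h0 := hp 0 le_rfl
    refine ⟨fun _ => f.coeff 0/(p 0).coeff 0, ?_⟩
    rw [zero_add, sum_range_one]
    have h1 := eq_C_of_natDegree_le_zero hf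
    have h2 := eq_C_of_natDegree_le_zero h0.1; rw [h2, ← C_mul, coeff_C_zero, div_mul_cancel₀ _ h0.2]; exact h1
  | succ N ih =>
    have h0 := hp (N+1) le_rfl
    set a := f.coeff (N+1)/(p (N+1)).coeff (N+1)
    obtain ⟨c, hc⟩ := ih (fun k hk => hp k (by omega)) (f-C a*p (N+1)) (by
      rw [natDegree_le_iff_coeff_eq_zero]; intro j hj; rw [coeff_sub, coeff_C_mul]
      obtain rfl | hj' : j = N+1 ∨ N+1 < j := by omega
      · grind
      · rw [coeff_eq_zero_of_natDegree_lt (by omega), coeff_eq_zero_of_natDegree_lt (by omega)]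
        simp)
    refine ⟨fun k => if k = N+1 then a else c k, ?_⟩
    rw [sum_range_succ]
    beta_reduce
    rw [if_pos rfl]
    have : ∑ k ∈ range (N+1), C (if k = N+1 then a else c k)*p k = ∑ k ∈ range (N+1), C (c k)*p k :=
      sum_congr rfl fun k hk => by rw [if_neg (by have := mem_range.1 hk; omega)]
    rw [this, ← hc]; ring

lemma coeff_eq_zero_of_sum {N:ℕ} (p:ℕ → ℂ[X]) (hp:∀ k ≤ N, (p k).natDegree ≤ k ∧ (p k).coeff k ≠ 0) (c:ℕ → ℂ)
    (h:∑ k ∈ range (N+1), C (c k)*p k = 0) : ∀ k ≤ N, c k = 0 := by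
  induction N with
  | zero =>
    intro k hk
    obtain rfl : k = 0 := by omega
    have := congrArg (fun f => f.coeff 0) h; simpa [(hp 0 le_rfl).2] using this
  | succ N ih =>
    have h1 : c (N+1) = 0 := by
      have := congrArg (fun f => f.coeff (N+1)) h; simp only [finsetSum_coeff, coeff_C_mul, coeff_zero] at this
      rw [sum_range_succ, sum_eq_zero, zero_add] at this
      · simpa [(hp _ le_rfl).2] using this
      · intro k hk; rw [mem_range] at hk; rw [coeff_eq_zero_of_natDegree_lt, mul_zero]; grind
    rw [sum_range_succ, h1, C_0, zero_mul, add_zero] at h; intro k hk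
    obtain rfl | hk' : k = N+1 ∨ k ≤ N := by omega
    · exact h1
    · exact ih (fun k hk => hp k (by omega)) h k hk'

namespace Model
variable {F:FamilyData} (G:Model F)
include G

/-- `P_n` as a polynomial in `η`. -/
def pP (l:F.Par) (n:ℕ) : ℂ[X] := (G.P_poly l n).choose

/-- `ξ_n` as a polynomial in `η`. -/
def pT (l:F.Par) (n:ℕ) : ℂ[X] := (G.T_poly l n).choose

lemma pP_deg (l:F.Par) (n:ℕ) : (G.pP l n).natDegree ≤ n := (G.P_poly l n).choose_spec.1
lemma pT_deg (l:F.Par) (n:ℕ) : (G.pT l n).natDegree ≤ n := (G.T_poly l n).choose_spec.1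
lemma P_eval (l:F.Par) (n:ℕ) (x:ℂ) : F.P l n x = (G.pP l n).eval (F.η x) := (G.P_poly l n).choose_spec.2.1 x
lemma T_eval (l:F.Par) (n:ℕ) (x:ℂ) : F.ξ l n x = (G.pT l n).eval (F.η x) := (G.T_poly l n).choose_spec.2.1 x
lemma pP_coeff (l:F.Par) (n:ℕ) (h:F.nondeg l n) : (G.pP l n).coeff n = G.lcP l n := (G.P_poly l n).choose_spec.2.2 h
lemma pT_coeff (l:F.Par) (n:ℕ) (h:F.nondegT l n) : (G.pT l n).coeff n = G.lcT l n := (G.T_poly l n).choose_spec.2.2 h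

lemma κ_ne : (F.κ:ℂ) ≠ 0 := by exact_mod_cast G.κ_pos.ne'

lemma shift_neg_succ (l:F.Par) (k:ℕ) : F.shift l (-((k+1:ℕ):ℤ)) = F.shift (F.shift l (-(k:ℤ))) (-1) := by
  rw [G.shift_shift]; congr 1; push_cast; ring

lemma np_shift_neg (l:F.Par) (k:ℕ) (x:ℂ) : G.np (F.shift l (-(k:ℤ))) x = (F.κ:ℂ)^k*G.np l (x+k/2*F.stp) := by
  induction k generalizing x with
  | zero => simp [G.shift_zero]
  | succ k ih =>
    rw [G.shift_neg_succ, G.np_shift, ih, pow_succ]; grind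

lemma nm_shift_neg (l:F.Par) (k:ℕ) (x:ℂ) : G.nm (F.shift l (-(k:ℤ))) x = (F.κ:ℂ)^k*G.nm l (x-k/2*F.stp) := by
  induction k generalizing x with
  | zero => simp [G.shift_zero]
  | succ k ih =>
    rw [G.shift_neg_succ, G.nm_shift, ih, pow_succ]; grind

lemma E_shift_neg (l:F.Par) (j:ℕ) (n:ℤ) : ((F.κ:ℂ)^j)⁻¹*F.E (F.shift l (-(j:ℤ))) (n+j) = F.E l n-F.E l (-(j:ℤ)) := by
  induction j generalizing n with
  | zero => simp [G.shift_zero, G.E_zero]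
  | succ j ih =>
    have h1 := G.E_step (F.shift l (-(j:ℤ))) (n+j)
    have h2 := ih (-((j+1:ℕ):ℤ)); rw [show -((j+1:ℕ):ℤ)+j = -1 by push_cast; ring] at h2
    have h3 : ((F.κ:ℂ)^(j+1))⁻¹ = ((F.κ:ℂ)^j)⁻¹*(F.κ:ℂ)⁻¹ := by rw [pow_succ, mul_inv]
    rw [G.shift_neg_succ, h3, show n+((j+1:ℕ):ℤ) = n+j+1 by push_cast; ring]; linear_combination ((F.κ:ℂ)^j)⁻¹*h1+ih n-h2

lemma E_bar (l:F.Par) (N:ℕ) (k:ℤ) : ((F.κ:ℂ)^(N+1))⁻¹*F.E (lamBar F l N) k = F.E l (k-N-1)-F.E l (-(N:ℤ)-1) := by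
  have := G.E_shift_neg l (N+1) (k-N-1); rw [show k-N-1+((N+1:ℕ):ℤ) = k by push_cast; ring] at this; rw [lamBar]; grind

lemma np_bar (l:F.Par) (N:ℕ) (x:ℂ) : G.np (lamBar F l N) x = (F.κ:ℂ)^(N+1)*G.np l (x+((N:ℂ)+1)/2*F.stp) := by
  exact_mod_cast G.np_shift_neg l (N+1) x

lemma nm_bar (l:F.Par) (N:ℕ) (x:ℂ) : G.nm (lamBar F l N) x = (F.κ:ℂ)^(N+1)*G.nm l (x-((N:ℂ)+1)/2*F.stp) := by
  exact_mod_cast G.nm_shift_neg l (N+1) x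

lemma PiK_shift_y (N:ℕ) (x y a:ℂ) (ha:a = (N-1)/2*F.stp) : (PiK F N x (y-F.stp)-PiK F N x y)*(F.η (y+a)-F.η x) =
      -(I*G.ω N*F.φ (y-F.stp/2))*PiK F N x y ∧
    (PiK F N x (y+F.stp)-PiK F N x y)*(F.η (y-a)-F.η x) = I*G.ω N*F.φ (y+F.stp/2)*PiK F N x y := by
  subst ha
  have h1 : ∀ u, PiK F N x (u-F.stp)*(F.η (u+((N:ℂ)-1)/2*F.stp)-F.η x) = PiK F N x u*(F.η (u-((N:ℂ)+1)/2*F.stp)-F.η x) := by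
    intro u; rw [G.PiK_symm, G.PiK_symm]
    have a1 : ∀ j, cpt F.γ N (u-F.stp) j = cpt F.γ N u (j+1) := fun j => by rw [cpt_eq, cpt_eq]; push_cast; ring
    have a2 : F.η (u+((N:ℂ)-1)/2*F.stp)-F.η x = F.η (cpt F.γ N u 0)-F.η x := by congr 2; rw [cpt_eq]; push_cast; ring
    have a3 : F.η (u-((N:ℂ)+1)/2*F.stp)-F.η x = F.η (cpt F.γ N u N)-F.η x := by congr 2; rw [cpt_eq]; push_cast; ring
    simp only [a1]; rw [a2, a3, ← prod_range_succ' (fun j => F.η (cpt F.γ N u j)-F.η x), prod_range_succ]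
  have h2 := G.η_sub_half (y+((N:ℂ)-1)/2*F.stp) (y-((N:ℂ)+1)/2*F.stp) (y-F.stp/2) N (by ring) (by ring)
  have h3 := G.η_sub_half (y+((N:ℂ)+1)/2*F.stp) (y-((N:ℂ)-1)/2*F.stp) (y+F.stp/2) N (by ring) (by ring); grind

lemma PiK_shift_x (N:ℕ) (x y a:ℂ) (ha:a = (N-1)/2*F.stp) : (PiK F N (x-F.stp) y-PiK F N x y)*(F.η y-F.η (x+a)) =
      I*G.ω N*F.φ (x-F.stp/2)*PiK F N x y ∧
    (PiK F N (x+F.stp) y-PiK F N x y)*(F.η y-F.η (x-a)) = -(I*G.ω N*F.φ (x+F.stp/2))*PiK F N x y := by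
  have h := G.PiK_shift_y N y x a ha
  have h0 : ∀ u, PiK F N u y = (-1)^N*PiK F N y u := by
    intro u; rw [G.PiK_symm, PiK]
    have : ∀ j ∈ range N, (F.η (cpt F.γ N y j)-F.η u) = (-1)*(F.η u-F.η (cpt F.γ N y j)) := fun j _ => by ring
    rw [prod_congr rfl this, prod_mul_distrib, prod_const, card_range]
  grind

/-- The kernel intertwines the difference operators in `y` (at `\bar λ`) and in `x` (twisted). -/
lemma PiK_intertwine (l:F.Par) (N:ℕ) (x y a:ℂ) (hx:x.re ∈ F.dom) (hy:y.re ∈ F.dom)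
    (ha:a = (N-1)/2*F.stp) (h1:F.η (y+a)-F.η x ≠ 0) (h2:F.η (y-a)-F.η x ≠ 0) (h3:F.η y-F.η (x+a) ≠ 0) (h4:F.η y-F.η (x-a) ≠ 0) :
    ((F.κ:ℂ)^(N+1))⁻¹*(G.np (lamBar F l N) y/(F.φ y*F.φ (y-F.stp/2))*(PiK F N x (y-F.stp)-PiK F N x y) +
      G.nm (lamBar F l N) y/(F.φ y*F.φ (y+F.stp/2))*(PiK F N x (y+F.stp)-PiK F N x y)) -
    (G.nm l (x-F.stp)/(F.φ x*F.φ (x-F.stp/2))*(PiK F N (x-F.stp) y-PiK F N x y)+G.np l (x+F.stp)/(F.φ x*F.φ (x+F.stp/2)) *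
        (PiK F N (x+F.stp) y-PiK F N x y)) =
    (F.Et l 0-F.E l (-(N:ℤ)-1))*PiK F N x y := by
  have hre : (F.stp/2).re = 0 := by simp [FamilyData.stp]
  have x0 := G.φ_ne x hx
  have y0 := G.φ_ne y hy
  have xm := G.φ_ne (x-F.stp/2) (by simpa [hre] using hx)
  have xp := G.φ_ne (x+F.stp/2) (by simpa [hre] using hx)
  have ym := G.φ_ne (y-F.stp/2) (by simpa [hre] using hy)
  have yp := G.φ_ne (y+F.stp/2) (by simpa [hre] using hy)
  have hk := G.kernel l N x y a ha x0 y0 h1 h2 h3 h4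
  rw [G.np_bar, G.nm_bar, ← hk, eq_div_of_mul_eq h1 (G.PiK_shift_y N x y a ha).1,
    eq_div_of_mul_eq h2 (G.PiK_shift_y N x y a ha).2, eq_div_of_mul_eq h3 (G.PiK_shift_x N x y a ha).1,
    eq_div_of_mul_eq h4 (G.PiK_shift_x N x y a ha).2,
    show y+a+F.stp = y+((N:ℂ)+1)/2*F.stp by rw [ha]; ring,
    show y-a-F.stp = y-((N:ℂ)+1)/2*F.stp by rw [ha]; ring]
  have k0 := pow_ne_zero (N+1) G.κ_ne
  generalize F.φ (x-F.stp/2) = e1 at *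
  generalize F.φ (x+F.stp/2) = e2 at *
  generalize F.φ (y-F.stp/2) = e3 at *
  generalize F.φ (y+F.stp/2) = e4 at *
  field_simp; ring

/-- The kernel is diagonal in `P_k(η(y); \bar λ)` and `ξ_{N-k}(η(x); λ)`. -/
lemma kernelDiag (l:F.Par) (N:ℕ) (hP:∀ k ≤ N, F.nondeg (lamBar F l N) k)
    (hT:∀ k ≤ N, F.nondegT l k) : G.KernelDiag N (G.pP (lamBar F l N)) (G.pT l) := by
  set p := G.pP (lamBar F l N) with hpdef
  set t := G.pT l with htdef
  have hp : ∀ k ≤ N, (p k).natDegree ≤ k ∧ (p k).coeff k ≠ 0 := fun k hk =>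
    ⟨G.pP_deg _ _, by rw [hpdef, G.pP_coeff _ _ (hP k hk)]; exact G.lcP_ne _ _ (hP k hk)⟩
  have ht : ∀ k ≤ N, (t k).natDegree ≤ k ∧ (t k).coeff k ≠ 0 := fun k hk =>
    ⟨G.pT_deg _ _, by rw [htdef, G.pT_coeff _ _ (hT k hk)]; exact G.lcT_ne _ _ (hT k hk)⟩
  refine ⟨hp, ht, ?_⟩
  have hA : ∀ j : Fin (N+1), ∃ c : ℕ → ℂ, (X^(j:ℕ) : ℂ[X]) = ∑ k ∈ range (N+1), C (c k)*p k := fun j =>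
    exists_sum_of_degree p hp _ (by rw [natDegree_X_pow]; omega)
  have hB : ∀ j : Fin (N+1), ∃ c : ℕ → ℂ, (G.Qp N).coeff j = ∑ k ∈ range (N+1), C (c k)*t k := fun j =>
    exists_sum_of_degree t ht _ ((G.Qp_coeff_natDegree N j (by omega)).trans (Nat.sub_le _ _))
  choose A hA using hA
  choose B hB using hB
  set g : ℕ → ℕ → ℂ := fun k v => ∑ j, A j k*B j v
  have hexp : ∀ x y, PiK F N x y = ∑ k ∈ range (N+1), ∑ v ∈ range (N+1), g k v*((p k).eval (F.η y)*(t v).eval (F.η x)) := by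
    intro x y; rw [G.PiK_eq_sum]
    have : ∀ j : Fin (N+1), F.η y^(j:ℕ)*((G.Qp N).coeff j).eval (F.η x) = ∑ k ∈ range (N+1), ∑ v ∈ range (N+1),
          A j k*B j v*((p k).eval (F.η y)*(t v).eval (F.η x)) := by
      intro j
      have a1 : F.η y^(j:ℕ) = ∑ k ∈ range (N+1), A j k*(p k).eval (F.η y) := by
        have := congrArg (fun f => f.eval (F.η y)) (hA j); simpa [eval_finsetSum] using this
      have a2 : ((G.Qp N).coeff j).eval (F.η x) = ∑ k ∈ range (N+1), B j k*(t k).eval (F.η x) := by rw [hB j]; simp [eval_finsetSum]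
      rw [a1, a2, sum_mul_sum]; exact sum_congr rfl fun k _ => sum_congr rfl fun v _ => by ring
    rw [sum_congr rfl fun j _ => this j, sum_comm]
    refine sum_congr rfl fun k _ => ?_
    rw [sum_comm]; exact sum_congr rfl fun v _ => by rw [← sum_mul]
  set a : ℂ := (N-1)/2*F.stp with ha
  set μ : ℕ → ℕ → ℂ := fun k v => F.E l ((k:ℤ)-N-1)-F.E l (-(v:ℤ)-1)
  have hop : ∀ x y : ℂ, x.re ∈ F.dom → y.re ∈ F.dom → F.η (y+a)-F.η x ≠ 0 → F.η (y-a)-F.η x ≠ 0 →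
      F.η y-F.η (x+a) ≠ 0 → F.η y-F.η (x-a) ≠ 0 → ∑ k ∈ range (N+1), ∑ v ∈ range (N+1),
        g k v*μ k v*((p k).eval (F.η y)*(t v).eval (F.η x)) = 0 := by
    intro x y hx hy h1 h2 h3 h4
    have hi := G.PiK_intertwine l N x y a hx hy rfl h1 h2 h3 h4; rw [← sub_eq_zero] at hi; rw [← hi]
    simp only [hexp, mul_sum, ← sum_sub_distrib, ← sum_add_distrib]
    refine sum_congr rfl fun k hk => sum_congr rfl fun v hv => ?_
    rw [mem_range] at hk hv
    have e1 := G.P_eq _ k (hP k (by omega)) y hy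
    have e2 := G.T_eq l v (hT v (by omega)) x hx
    have e3 := G.E_bar l N k; simp only [G.P_eval, G.T_eval, ← hpdef, ← htdef] at e1 e2
    have e4 := G.Et_eq l v; grind
  have hzero : ∀ k ≤ N, ∀ v ≤ N, g k v*μ k v = 0 := by
    have hy : ∀ x ∈ F.dom \ (∅:Set ℝ), ∀ k ≤ N, ∑ v ∈ range (N+1), g k v*μ k v*(t v).eval (F.η (x:ℂ)) = 0 := by
      intro x hx
      refine coeff_eq_zero_of_sum p hp _ ?_
      set S : ℂ → Set ℝ := fun c => {r:ℝ | r ∈ F.dom ∧ ∃ z : ℂ, z.re = r ∧ F.η z = c} with hS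
      refine G.poly_eq_of_dom (S (F.η x) ∪ (S (F.η (x+a)) ∪ S (F.η (x-a))))
        ((G.η_fib _).union ((G.η_fib _).union (G.η_fib _))) _ _ fun y hy => ?_
      have hre : a.re = 0 := by simp [ha, FamilyData.stp]
      have hyS : ∀ z : ℂ, z.re = y → F.η z ≠ F.η x ∧ F.η z ≠ F.η (x+a) ∧ F.η z ≠ F.η (x-a) :=
        fun z hz => ⟨fun h => hy.2 (.inl ⟨hy.1, z, hz, h⟩),
          fun h => hy.2 (.inr (.inl ⟨hy.1, z, hz, h⟩)), fun h => hy.2 (.inr (.inr ⟨hy.1, z, hz, h⟩))⟩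
      have := hop x y (by simpa using hx.1) (by simpa using hy.1)
        (sub_ne_zero.2 (hyS _ (by simp [hre])).1) (sub_ne_zero.2 (hyS _ (by simp [hre])).1)
        (sub_ne_zero.2 (hyS y (by simp)).2.1) (sub_ne_zero.2 (hyS y (by simp)).2.2)
      rw [eval_zero, ← this, eval_finsetSum]
      refine sum_congr rfl fun k _ => ?_
      rw [eval_mul, eval_C, sum_mul]; exact sum_congr rfl fun v _ => by ring
    intro k hk
    refine coeff_eq_zero_of_sum t ht _ ?_
    refine G.poly_eq_of_dom ∅ Set.finite_empty _ _ fun x hx => ?_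
    rw [eval_zero, ← hy x hx k hk, eval_finsetSum]; exact sum_congr rfl fun v _ => by simp
  have hdiag : ∀ k ≤ N, ∀ v ≤ N, v ≠ N-k → g k v = 0 := by
    intro k hk v hv hne
    refine (mul_eq_zero.1 (hzero k hk v hv)).resolve_right ?_
    have e1 := G.E_bar l N k
    have e2 := G.E_bar l N ((N-v:ℕ):ℤ); rw [show ((N-v:ℕ):ℤ)-N-1 = -(v:ℤ)-1 by omega] at e2; intro h0
    have h1 : F.E (lamBar F l N) k = F.E (lamBar F l N) ((N-v:ℕ):ℤ) := by
      have k0 := inv_ne_zero (pow_ne_zero (N+1) G.κ_ne); grind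
    rcases lt_trichotomy k (N-v) with h2 | h2 | h2
    · exact G.E_ne _ _ (hP (N-v) (by omega)) k h2 h1
    · omega
    · exact G.E_ne _ _ (hP k hk) (N-v) h2 h1.symm
  have hexp2 : ∀ x y, PiK F N x y = ∑ k ∈ range (N+1), g k (N-k)*((p k).eval (F.η y)*(t (N-k)).eval (F.η x)) := by
    intro x y; rw [hexp]
    refine sum_congr rfl fun k hk => ?_
    rw [mem_range] at hk; rw [sum_eq_single (N-k)]
    · grind
    · simp
  have hQ : ∀ k, (G.Qp N).coeff k = ∑ i ∈ range (N+1), C (g i (N-i)*(p i).coeff k)*t (N-i) := by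
    intro k
    refine G.poly_eq_of_dom ∅ Set.finite_empty _ _ fun x _ => ?_
    have h1 : (G.Qp N).map (evalRingHom (F.η x)) = ∑ i ∈ range (N+1), C (g i (N-i)*(t (N-i)).eval (F.η x))*p i := by
      refine G.poly_eq_of_dom ∅ Set.finite_empty _ _ fun y _ => ?_
      have h2 := hexp2 x y; rw [G.Qp_map, eval_prod, eval_finsetSum]; rw [PiK] at h2
      simp only [eval_sub, eval_X, eval_C, eval_mul]; grind
    have h2 := congrArg (fun f => f.coeff k) h1; simp only [coeff_map, coe_evalRingHom, finsetSum_coeff, coeff_C_mul] at h2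
    rw [h2, eval_finsetSum]; exact sum_congr rfl fun i _ => by simp; ring
  intro x y; rw [hexp2, Finset.sum_range]
  refine sum_congr rfl fun k _ => ?_
  have hk : (k:ℕ) ≤ N := by omega
  have hb : G.bK N k = g k (N-k)*(p k).coeff k*(t (N-k)).coeff (N-k) := by
    rw [Geom.bK, hQ, finsetSum_coeff, sum_eq_single (k:ℕ)]
    · rw [coeff_C_mul]
    · intro i hi hne; rw [mem_range] at hi; rw [coeff_C_mul]
      rcases lt_or_gt_of_ne hne with h | h
      · rw [coeff_eq_zero_of_natDegree_lt (lt_of_le_of_lt (hp i (by omega)).1 h)]; ring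
      · rw [coeff_eq_zero_of_natDegree_lt (lt_of_le_of_lt (ht (N-i) (by omega)).1 (by omega)), mul_zero]
    · grind
  grind

end Model

/-- `D` and `K` are duplicate-free lists in `{0, …, N}` with `K = {0, …, N} \ {N - d : d ∈ D}`. -/
structure Compl (N:ℕ) (D K:List ℕ) : Prop where
  nodupD : D.Nodup
  nodupK : K.Nodup
  leD : ∀ d ∈ D, d ≤ N
  leK : ∀ e ∈ K, e ≤ N
  mem : ∀ e ≤ N, e ∈ K ↔ N-e ∉ D

namespace Compl
variable {N:ℕ} {D K:List ℕ} (h:Compl N D K)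
include h

/-- The enumeration of `{0, …, N}` by `K` and the reflection of `D`. -/
lemma exists_equiv : ∃ e : Fin K.length ⊕ Fin D.length ≃ Fin (N+1),
    (∀ k, (e (Sum.inl k):ℕ) = K.get k) ∧ ∀ k, N-(e (Sum.inr k):ℕ) = D.get k := by
  set f : Fin K.length ⊕ Fin D.length → Fin (N+1) := Sum.elim (fun k => ⟨K.get k, by have := h.leK _ (K.get_mem k); omega⟩)
      (fun k => ⟨N-D.get k, by omega⟩) with hf
  have f1 : ∀ k, ((f (Sum.inl k) : Fin (N+1)):ℕ) = K.get k := fun k => rfl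
  have f2 : ∀ k, ((f (Sum.inr k) : Fin (N+1)):ℕ) = N-D.get k := fun k => rfl
  have hd : ∀ k, D.get k ≤ N := fun k => h.leD _ (D.get_mem k)
  have hKD : ∀ a b, K.get a ≠ N-D.get b := by
    intro a b hab
    refine (h.mem _ (h.leK _ (K.get_mem a))).1 (K.get_mem a) ?_
    rw [hab, show N-(N-D.get b) = D.get b by have := hd b; omega]; exact D.get_mem b
  have hbij : Function.Bijective f := by
    constructor
    · rintro (a | a) (b | b) hab
      all_goals
        have hab' := congrArg (fun z:Fin (N+1) => (z:ℕ)) hab; simp only [f1, f2] at hab'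
      · rw [h.nodupK.injective_get hab']
      · exact absurd hab' (hKD _ _)
      · exact absurd hab'.symm (hKD _ _)
      · have : D.get a = D.get b := by have := hd a; have := hd b; omega
        rw [h.nodupD.injective_get this]
    · intro e
      by_cases he : (e:ℕ) ∈ K
      · obtain ⟨k, hk⟩ := List.get_of_mem he; grind
      · have := (not_iff_not.2 (h.mem e (by omega))).1 he; rw [not_not] at this
        obtain ⟨k, hk⟩ := List.get_of_mem this; grind
  refine ⟨Equiv.ofBijective f hbij, f1, fun k => ?_⟩
  grind

lemma length_add : K.length+D.length = N+1 := by
  obtain ⟨e, -, -⟩ := h.exists_equiv; simpa using Fintype.card_congr e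

end Compl

lemma compl_Dbar {N:ℕ} {D:List ℕ} (hD:D.Nodup) (hN:∀ d ∈ D, d ≤ N) : Compl N D (Dbar N D) where
  nodupD := hD
  nodupK := List.nodup_range.filter _
  leD := hN
  leK e he := by
    have := (List.mem_filter.1 he).1; rw [List.mem_range] at this; omega
  mem e he := by simp [Dbar]; omega

lemma compl_Dbar_erase {N:ℕ} {D:List ℕ} (hD:D.Nodup) (hN:∀ d ∈ D, d ≤ N) {d:ℕ} (hd:d ∈ D) : Compl N (D.erase d) (Dbar N D ++ [N-d]) where
  nodupD := hD.erase d
  nodupK := by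
    refine List.Nodup.append (List.nodup_range.filter _) (List.nodup_singleton _) ?_
    intro a ha hb; rw [List.mem_singleton] at hb; subst hb
    have := (List.mem_filter.1 ha).2; grind
  leD e he := hN e (List.mem_of_mem_erase he)
  leK e he := by
    rcases List.mem_append.1 he with h | h
    · exact (compl_Dbar hD hN).leK e h
    · rw [List.mem_singleton] at h; omega
  mem e he := by
    rw [List.mem_append, List.mem_singleton, (compl_Dbar hD hN).mem e he, hD.mem_erase_iff]; grind

lemma compl_single (v:ℕ) : Compl v [v] (List.range' 1 v) where
  nodupD := List.nodup_singleton v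
  nodupK := List.nodup_range'
  leD d hd := by rw [List.mem_singleton] at hd; omega
  leK e he := by rw [List.mem_range'_1] at he; omega
  mem e he := by rw [List.mem_range'_1, List.mem_singleton]; omega

lemma casoratian_eq_det (γ:ℝ) (fs:List (ℂ → ℂ)) (n:ℕ) (h:fs.length = n)
    (g:Fin n → ℂ → ℂ) (hg:∀ k : Fin n, fs.get (k.cast h.symm) = g k) (x:ℂ) : casoratian γ fs x = I ^ (n*(n-1)/2) *
      (Matrix.of fun j k:Fin n => g k (cpt γ n x j)).det := by
  subst h; unfold casoratian; congr 3; ext j k; rw [← hg]; rfl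

lemma casoratian_map (γ:ℝ) {α:Type*} (D:List α) (f:α → ℂ → ℂ) (x:ℂ) : casoratian γ (D.map f) x = I ^ (D.length*(D.length-1)/2) *
      (Matrix.of fun j k:Fin D.length => f (D.get k) (cpt γ D.length x j)).det :=
  casoratian_eq_det γ _ _ (by simp) _ (fun k => by simp) x

namespace Geom
variable {F:FamilyData} (G:Geom F)
include G

lemma exists_pCas (L:List ℂ[X]) : ∃ A : ℂ[X], ∀ x,
    casoratian F.γ (L.map fun p x => p.eval (F.η x)) x = phiM F L.length x*A.eval (F.η x) := by
  obtain ⟨A, hA⟩ := G.exists_det_eq L.length (fun k => L.get k)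
  refine ⟨C (I ^ (L.length*(L.length-1)/2)*G.vC L.length)*A, fun x => ?_⟩
  rw [casoratian_map, hA, G.Vd_eq, eval_mul, eval_C]; ring

/-- The Casoratian of polynomials in `η`, divided by `φ_M`, as a polynomial in `η`. -/
def pCas (L:List ℂ[X]) : ℂ[X] := (G.exists_pCas L).choose

lemma pCas_spec (L:List ℂ[X]) (x:ℂ) : casoratian F.γ (L.map fun p x => p.eval (F.η x)) x =
      phiM F L.length x*(G.pCas L).eval (F.η x) := (G.exists_pCas L).choose_spec x

end Geom

lemma tendsto_det {n:ℕ} {α:Type*} {f:Filter α} {A:α → Matrix (Fin n) (Fin n) ℂ}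
    {B:Matrix (Fin n) (Fin n) ℂ} (h:∀ i j, Tendsto (fun t => A t i j) f (𝓝 (B i j))) :
    Tendsto (fun t => (A t).det) f (𝓝 B.det) := by
  have h1 : Tendsto A f (𝓝 B) := tendsto_pi_nhds.2 fun i => tendsto_pi_nhds.2 fun j => h i j
  exact ((continuous_id.matrix_det).tendsto B).comp h1

namespace Model
variable {F:FamilyData} (G:Model F)
include G

lemma lamBar_shift (l:F.Par) (N:ℕ) : F.shift (lamBar F l N) ((N:ℤ)+1) = l := by rw [lamBar, G.shift_shift, neg_add_cancel, G.shift_zero]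

lemma lamBar_pert (l:F.Par) (N:ℕ) (t:ℝ) : lamBar F (G.pert l t) N = G.pert (lamBar F l N) t := by rw [lamBar, lamBar, G.pert_shift]

lemma cas_ξ (l:F.Par) (D:List ℕ) (x:ℂ) : casoratian F.γ (D.map (F.ξ l)) x = phiM F D.length x*(G.pCas (D.map (G.pT l))).eval (F.η x) := by
  have := G.pCas_spec (D.map (G.pT l)) x; rw [List.length_map] at this; rw [← this, List.map_map]; congr 1
  exact List.map_congr_left fun d _ => funext fun y => G.T_eval l d y

lemma cas_P (l:F.Par) (D:List ℕ) (x:ℂ) : casoratian F.γ (D.map (F.P l)) x = phiM F D.length x*(G.pCas (D.map (G.pP l))).eval (F.η x) := by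
  have := G.pCas_spec (D.map (G.pP l)) x; rw [List.length_map] at this; rw [← this, List.map_map]; congr 1
  exact List.map_congr_left fun d _ => funext fun y => G.P_eval l d y

lemma base_of_compl {N:ℕ} {D K:List ℕ} (h:Compl N D K) (l:F.Par)
    (hT:∀ d ∈ D, F.nondegT l d) (hP:∀ e ∈ K, F.nondeg (lamBar F l N) e) : G.base l := by
  by_cases h0 : 0 ∈ K
  · have := G.base_shift _ ((N:ℤ)+1) (G.nondeg_base _ _ (hP 0 h0))
    rwa [G.lamBar_shift] at this
  · have := (not_iff_not.2 (h.mem 0 (Nat.zero_le _))).1 h0; rw [not_not] at this; exact G.nondegT_base _ _ (hT _ this)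

lemma pert_gen_le (l:F.Par) (hl:G.base l) (N:ℕ) : ∀ᶠ t in 𝓝[≠] (0:ℝ), ∀ k ≤ N, F.nondeg (G.pert l t) k ∧ F.nondegT (G.pert l t) k := by
  have : ∀ᶠ t in 𝓝[≠] (0:ℝ), ∀ k ∈ Finset.range (N+1), F.nondeg (G.pert l t) k ∧ F.nondegT (G.pert l t) k :=
    (Finset.eventually_all _).2 fun k _ => G.pert_gen l hl k
  simp_all

/-- The Casoratians of the twisted polynomials and the complementary Casoratians of the
polynomials are proportional. -/
lemma det_dual {N:ℕ} {D K:List ℕ} (h:Compl N D K) : ∃ c : ℂ, c ≠ 0 ∧ ∀ l : F.Par,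
    (∀ d ∈ D, F.nondegT l d) → (∀ e ∈ K, F.nondeg (lamBar F l N) e) → ∀ x : ℂ, x.re ∈ F.dom →
      (∏ k:Fin K.length, G.lcP (lamBar F l N) (K.get k))*(Matrix.of fun i k:Fin D.length =>
          F.ξ l (D.get k) (cpt F.γ D.length x i)).det*Vd F K.length x =
      c*((∏ k:Fin D.length, G.lcT l (D.get k))*(Matrix.of fun j k:Fin K.length =>
          F.P (lamBar F l N) (K.get k) (cpt F.γ K.length x j)).det*Vd F D.length x) := by
  obtain ⟨e, e1, e2⟩ := h.exists_equiv
  obtain ⟨c, hc, hc'⟩ := G.casorati_complement h.length_add e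
  refine ⟨c, hc, fun l hT hP x hx => ?_⟩
  have hb := G.base_of_compl h l hT hP
  refine tendsto_nhds_unique_of_eventuallyEq (((tendsto_finsetProd univ fun k _ => G.lcP_lim _ _ (hP _ (K.get_mem k))).mul
      (tendsto_det fun i j => G.T_lim _ _ (hT _ (D.get_mem j)) (cpt F.γ D.length x i))).mul_const _)
    ((((tendsto_finsetProd univ fun k _ => G.lcT_lim _ _ (hT _ (D.get_mem k))).mul
      (tendsto_det fun i j => G.P_lim _ _ (hP _ (K.get_mem j)) (cpt F.γ K.length x i))).mul_const _).const_mul c) ?_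
  filter_upwards [G.pert_gen_le l hb N, G.pert_gen_le (lamBar F l N) (G.base_shift l (-((N:ℤ)+1)) hb) N] with t t1 t2
  have hP' := fun k hk => (t2 k hk).1
  have hT' := fun k hk => (t1 k hk).2
  have := hc' _ _ (G.kernelDiag _ N (by rwa [G.lamBar_pert]) hT') x hx
  simp only [e1, e2, ← G.P_eval, ← G.T_eval, fun k => G.pP_coeff _ _ (hP' _ (h.leK _ (K.get_mem k))),
    fun k => G.pT_coeff _ _ (hT' _ (h.leD _ (D.get_mem k))), G.lamBar_pert] at this
  exact this

/-- The identity between Casoratians as an identity of polynomials in `η`. -/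
lemma pCas_dual {N:ℕ} {D K:List ℕ} (h:Compl N D K) (l:F.Par) (hT:∀ d ∈ D, F.nondegT l d) (hP:∀ e ∈ K, F.nondeg (lamBar F l N) e) :
    ∃ c : ℂ, c ≠ 0 ∧ G.pCas (D.map (G.pT l)) = C c*G.pCas (K.map (G.pP (lamBar F l N))) := by
  obtain ⟨c, hc, hc'⟩ := G.det_dual h
  have hA := prod_ne_zero_iff.2 fun (k:Fin K.length) (_:k ∈ univ) => G.lcP_ne _ _ (hP _ (K.get_mem k))
  have hB := prod_ne_zero_iff.2 fun (k:Fin D.length) (_:k ∈ univ) => G.lcT_ne _ _ (hT _ (D.get_mem k))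
  have i1 := pow_ne_zero (D.length*(D.length-1)/2) I_ne_zero
  have i2 := pow_ne_zero (K.length*(K.length-1)/2) I_ne_zero
  have v1 := G.vC_ne D.length
  have v2 := G.vC_ne K.length
  refine ⟨c*(∏ k:Fin D.length, G.lcT l (D.get k))*G.vC D.length *
    I ^ (D.length*(D.length-1)/2)/((∏ k:Fin K.length, G.lcP (lamBar F l N) (K.get k)) *
      G.vC K.length*I ^ (K.length*(K.length-1)/2)), by positivity, ?_⟩
  refine G.poly_eq_of_dom ∅ Set.finite_empty _ _ fun x hx => ?_
  have h1 := hc' l hT hP x (by simpa using hx.1)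
  have h2 := G.cas_ξ l D x
  have h3 := G.cas_P (lamBar F l N) K x; rw [casoratian_map] at h2 h3; rw [G.Vd_eq, G.Vd_eq] at h1
  have p1 := G.phiM_ne D.length x (by simpa using hx.1)
  have p2 := G.phiM_ne K.length x (by simpa using hx.1); rw [eval_mul, eval_C]
  have h2' := eq_div_of_mul_eq i1 ((mul_comm _ _).trans h2)
  have h3' := eq_div_of_mul_eq i2 ((mul_comm _ _).trans h3); rw [h2', h3'] at h1; field_simp at h1 ⊢; linear_combination h1

lemma Xi_eq (l:F.Par) (D:List ℕ) (x:ℂ) (hx:phiM F D.length x ≠ 0) : Xi F l D x = (G.pCas (D.map (G.pT l))).eval (F.η x) := by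
  rw [Xi, G.cas_ξ, inv_mul_cancel_left₀ hx]

lemma XiBar_eq (l:F.Par) (D:List ℕ) (x:ℂ) (hx:phiM F D.length x ≠ 0) : XiBar F l D x = (G.pCas (D.map (G.pP l))).eval (F.η x) := by
  rw [XiBar, G.cas_P, inv_mul_cancel_left₀ hx]

lemma propInEta {N:ℕ} {D K:List ℕ} (h:Compl N D K) (l:F.Par) (hT:∀ d ∈ D, F.nondegT l d) (hP:∀ e ∈ K, F.nondeg (lamBar F l N) e) :
    PropInEta F.η {x | phiM F D.length x ≠ 0} {x | phiM F K.length x ≠ 0} (Xi F l D) (XiBar F (lamBar F l N) K) :=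
  ⟨_, _, fun x hx => G.Xi_eq l D x hx, fun x hx => G.XiBar_eq _ K x hx, G.pCas_dual h l hT hP⟩

theorem casoratianIdentity {N:ℕ} {D:List ℕ} (hD:D.Nodup) (hN:∀ d ∈ D, d ≤ N) (l:F.Par) : CasoratianIdentity F l N D :=
  fun hT hP => G.propInEta (compl_Dbar hD hN) l hT hP

theorem polyDualityTwo {N:ℕ} {D:List ℕ} (hD:D.Nodup) (hN:∀ d ∈ D, d ≤ N) (l:F.Par) : PolyDualityTwo F l N D :=
  fun _ hd hT hP => G.propInEta (compl_Dbar_erase hD hN hd) l hT hP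

theorem qInverse : QInverse F F.ξ := by
  intro v l hT hP
  obtain ⟨c, hc, h⟩ := G.pCas_dual (compl_single v) l (fun d hd => by rw [List.mem_singleton.1 hd]; exact hT) hP
  refine ⟨c, hc, fun x hx => ?_⟩
  have h1 := G.cas_ξ l [v] x; rw [h] at h1
  have h2 := G.cas_P (lamBar F l v) (List.range' 1 v) x; rw [List.length_range'] at h2
  have h3 : casoratian F.γ ([v].map (F.ξ l)) x = F.ξ l v x := by rw [casoratian_map]; simp [cpt_one]
  have h4 : phiM F [v].length x = 1 := by simp [phiM]
  rw [h3, h4, eval_mul, eval_C] at h1; rw [lamBar] at h1 h2; simp_all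

lemma qInverse_of_prop {Pinv:F.Par → ℕ → ℂ → ℂ} (h:∀ l n, F.nondegT l n → ∃ c : ℂ, c ≠ 0 ∧ ∀ x, Pinv l n x = c*F.ξ l n x) :
    QInverse F Pinv := by
  intro v l hT hP
  obtain ⟨c, hc, h1⟩ := G.qInverse v l hT hP
  obtain ⟨c', hc', h2⟩ := h l v hT; exact ⟨c'*c, mul_ne_zero hc' hc, fun x hx => by rw [h2, h1 x hx, mul_assoc]⟩

end Model

/-- A determinant whose last function is replaced by a remainder that vanishes at all but the last
point. -/
lemma det_remainder {n:ℕ} (p:Fin (n+1) → ℂ[X]) (Q:ℂ[X]) (a:Fin n → ℂ) (hQ:Q = p (Fin.last n)-∑ k, C (a k)*p k.castSucc) (v:Fin (n+1) → ℂ)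
    (hv:∀ j : Fin n, Q.eval (v j.castSucc) = 0) : (Matrix.of fun i k => (p k).eval (v i)).det =
      (Matrix.of fun i k:Fin n => (p k.castSucc).eval (v i.castSucc)).det*Q.eval (v (Fin.last n)) := by
  set e : Fin n ⊕ Fin 1 ≃ Fin (n+1) := finSumFinEquiv
  have e1 : ∀ j, e (Sum.inl j) = j.castSucc := fun j => rfl
  have e2 : ∀ j, e (Sum.inr j) = Fin.last n := fun j => by rw [Subsingleton.elim j 0]; rfl
  have hQe : ∀ y, ∑ k, (Sum.elim (fun k => -a k) (fun _:Fin 1 => (1:ℂ)) k)*(p (e k)).eval y = Q.eval y := by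
    intro y; rw [Fintype.sum_sum_type, hQ]; simp [e1, e2, eval_finsetSum]; ring
  have h1 := det_complement (Matrix.of fun k i:Fin n ⊕ Fin 1 => (p (e k)).eval (v (e i)))
    (Matrix.of fun (_:Fin 1) k => Sum.elim (fun k => -a k) (fun _ => 1) k) (by simp_all)
  simp only [Matrix.of_apply, hQe, e2] at h1
  have h2 : (Matrix.of fun k i:Fin n ⊕ Fin 1 => (p (e k)).eval (v (e i))).det = (Matrix.of fun i k => (p k).eval (v i)).det := by
    rw [← Matrix.det_transpose, ← Matrix.det_submatrix_equiv_self e]; rfl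
  rw [h2] at h1; simp only [e1, Sum.elim_inr, Matrix.det_fin_one, Matrix.of_apply, one_mul] at h1; rw [h1, ← Matrix.det_transpose]
  rfl

lemma vandermonde_last {n:ℕ} (v:Fin (n+1) → ℂ) : (Matrix.vandermonde v).det = (Matrix.vandermonde fun i:Fin n => v i.castSucc).det *
      ∏ j : Fin n, (v (Fin.last n)-v j.castSucc) := by
  set Q : ℂ[X] := ∏ j : Fin n, (X-C (v j.castSucc)) with hQ
  have hm : Q.Monic := monic_prod_of_monic _ _ fun j _ => monic_X_sub_C _
  have hd : Q.natDegree = n := by simp_all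
  have h1 : Q = (X:ℂ[X])^n-∑ k : Fin n, C (-Q.coeff k)*X^(k:ℕ) := by
    conv_lhs => rw [hm.as_sum, hd, Finset.sum_range]
    simp
  have := det_remainder (fun k:Fin (n+1) => (X:ℂ[X])^(k:ℕ)) Q _ h1 v (fun j => by
    rw [hQ, eval_prod]
    exact prod_eq_zero (mem_univ j) (by simp))
  simp only [eval_pow, eval_X] at this
  refine this.trans ?_
  rw [hQ, eval_prod]; simp only [eval_sub, eval_X, eval_C]; rfl

lemma det_get {L:List ℕ} {n:ℕ} (h:L.length = n) (g:Fin n → ℕ) (hg:∀ k : Fin n, L.get (k.cast h.symm) = g k) (γ:ℝ) (f:ℕ → ℂ → ℂ) (x:ℂ) :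
    (Matrix.of fun i k:Fin L.length => f (L.get k) (cpt γ L.length x i)).det = (Matrix.of fun i k:Fin n => f (g k) (cpt γ n x i)).det := by
  subst h; congr 2; ext i k; rw [← hg]; rfl

lemma prod_get {L:List ℕ} {n:ℕ} (h:L.length = n) (g:Fin n → ℕ) (hg:∀ k : Fin n, L.get (k.cast h.symm) = g k) (f:ℕ → ℂ) :
    ∏ k : Fin L.length, f (L.get k) = ∏ k : Fin n, f (g k) := by
  subst h; simp_all

/-- The degrees `0, 1, …, N, N + 1 + n`. -/
def gapDeg (N n:ℕ) (k:Fin (N+2)) : ℕ := if (k:ℕ) < N+1 then k else N+1+n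

lemma gapDeg_castSucc (N n:ℕ) (k:Fin (N+1)) : gapDeg N n k.castSucc = k := by unfold gapDeg; rw [if_pos (by exact k.2)]; rfl

lemma gapDeg_last (N n:ℕ) : gapDeg N n (Fin.last (N+1)) = N+1+n := by unfold gapDeg; rw [if_neg (by simp)]

lemma range_append_get (N n:ℕ) (h:(List.range (N+1) ++ [N+1+n]).length = N+2) (k:Fin (N+2)) :
    (List.range (N+1) ++ [N+1+n]).get (k.cast h.symm) = gapDeg N n k := by
  unfold gapDeg; grind

lemma compl_gap (N n:ℕ) : Compl (N+1+n) (List.range' 1 n) (List.range (N+1) ++ [N+1+n]) where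
  nodupD := List.nodup_range'
  nodupK := by grind
  leD d hd := by rw [List.mem_range'_1] at hd; omega
  leK e he := by grind
  mem e he := by grind

lemma compl_full (n:ℕ) : Compl n (List.range' 1 n) [n] where
  nodupD := List.nodup_range'
  nodupK := List.nodup_singleton n
  leD d hd := by rw [List.mem_range'_1] at hd; omega
  leK e he := by rw [List.mem_singleton] at he; omega
  mem e he := by rw [List.mem_singleton, List.mem_range'_1]; omega

namespace Geom
variable {F:FamilyData} (G:Geom F)
include G

lemma cpt_η_injective (n:ℕ) (x:ℂ) (hx:x.re ∈ F.dom) : Function.Injective fun j : Fin n => F.η (cpt F.γ n x j) :=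
  Matrix.det_vandermonde_ne_zero_iff.1 (G.Vd_ne n x hx)

lemma prod_η_sub_up (N:ℕ) (c:ℂ) : (∏ p ∈ range (N+1), (F.η (c+((N:ℂ)/2+1)*F.stp)-F.η (cpt F.γ (N+1) c p))) *
      F.φ c = I*G.ω (N+1)*(F.φ (c+((N:ℂ)/2+1/2)*F.stp)*F.φ (c+(N:ℂ)/2*F.stp))*PiK F N (c-F.stp/2) (c+(N:ℂ)/2*F.stp) := by
  set h : ℕ → ℂ := fun j => F.φ (c+((N:ℂ)/2+1-((j:ℂ)+1)/2)*F.stp) with hh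
  have h1 : ∏ p ∈ range (N+1), (F.η (c+((N:ℂ)/2+1)*F.stp)-F.η (cpt F.γ (N+1) c p)) = ∏ p ∈ range (N+1), I*G.ω (p+1)*h p := by
    refine prod_congr rfl fun p _ => ?_
    refine G.η_sub_half _ _ _ _ ?_ ?_
    · push_cast; ring
    · rw [cpt_eq]; push_cast; ring
  have h2 : PiK F N (c-F.stp/2) (c+(N:ℂ)/2*F.stp) = ∏ p ∈ range N, I*G.ω (p+1)*h (p+2) := by
    unfold PiK
    refine prod_congr rfl fun p _ => ?_
    refine G.η_sub_half _ _ _ _ ?_ ?_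
    · push_cast; ring
    · rw [cpt_eq]; push_cast; ring
  have h3 : ∏ p ∈ range (N+2), h p = (∏ p ∈ range N, h (p+2))*(h 1*h 0) := by rw [prod_range_succ', prod_range_succ']; ring
  rw [prod_range_succ] at h3
  have h4 : h (N+1) = F.φ c := by simp only [hh]; congr 1; push_cast; ring
  have h5 : h 0 = F.φ (c+((N:ℂ)/2+1/2)*F.stp) := by simp only [hh]; congr 1; push_cast; ring
  have h6 : h 1 = F.φ (c+(N:ℂ)/2*F.stp) := by simp only [hh]; congr 1; push_cast; ring
  rw [h1, h2, ← h5, ← h6, prod_mul_distrib, prod_mul_distrib (s := range N), prod_range_succ (fun p => I*(G.ω (p+1):ℂ))]; grind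

lemma prod_η_sub_down (N:ℕ) (c:ℂ) : (∏ p ∈ range (N+1), (F.η (c-((N:ℂ)/2+1)*F.stp)-F.η (cpt F.γ (N+1) c p))) *
      F.φ c = -(I*G.ω (N+1))*(F.φ (c-((N:ℂ)/2+1/2)*F.stp)*F.φ (c-(N:ℂ)/2*F.stp))*PiK F N (c+F.stp/2) (c-(N:ℂ)/2*F.stp) := by
  set h : ℕ → ℂ := fun j => F.φ (c-((N:ℂ)/2+1-((j:ℂ)+1)/2)*F.stp) with hh
  have h1 : ∏ p ∈ range (N+1), (F.η (c-((N:ℂ)/2+1)*F.stp)-F.η (cpt F.γ (N+1) c p)) = ∏ p ∈ range (N+1), -(I*G.ω (p+1))*h p := by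
    rw [← prod_range_reflect]
    refine prod_congr rfl fun p hp => ?_
    rw [mem_range] at hp
    have hc : ((N+1-1-p:ℕ):ℂ) = N-p := by simp_all
    have := G.η_sub_half (cpt F.γ (N+1) c (N+1-1-p)) (c-((N:ℂ)/2+1)*F.stp) (c-((N:ℂ)/2+1-((p:ℂ)+1)/2)*F.stp) (p+1)
      (by rw [cpt_eq, hc]; push_cast; ring) (by push_cast; ring)
    linear_combination -this
  have h2 : PiK F N (c+F.stp/2) (c-(N:ℂ)/2*F.stp) = ∏ p ∈ range N, -(I*G.ω (p+1))*h (p+2) := by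
    unfold PiK; rw [← prod_range_reflect]
    refine prod_congr rfl fun p hp => ?_
    rw [mem_range] at hp
    have hc : ((N-1-p:ℕ):ℂ) = N-1-p := by rw [Nat.sub_sub, Nat.cast_sub (by omega)]; push_cast; ring
    have := G.η_sub_half (cpt F.γ N (c+F.stp/2) (N-1-p)) (c-(N:ℂ)/2*F.stp) (c-((N:ℂ)/2+1-(((p+2:ℕ):ℂ)+1)/2)*F.stp) (p+1)
      (by rw [cpt_eq, hc]; push_cast; ring) (by push_cast; ring)
    grind
  have h3 : ∏ p ∈ range (N+2), h p = (∏ p ∈ range N, h (p+2))*(h 1*h 0) := by rw [prod_range_succ', prod_range_succ']; ring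
  rw [prod_range_succ] at h3
  have h4 : h (N+1) = F.φ c := by simp only [hh]; congr 1; push_cast; ring
  have h5 : h 0 = F.φ (c-((N:ℂ)/2+1/2)*F.stp) := by simp only [hh]; congr 1; push_cast; ring
  have h6 : h 1 = F.φ (c-(N:ℂ)/2*F.stp) := by simp only [hh]; congr 1; push_cast; ring
  rw [h1, h2, ← h5, ← h6, prod_mul_distrib, prod_mul_distrib (s := range N), prod_range_succ (fun p => -(I*(G.ω (p+1):ℂ)))]; grind

end Geom

namespace Model
variable {F:FamilyData} (G:Model F)
include G

/-- The Casorati determinant of `P_0, …, P_N, P_{N+1+n}` at `\bar λ` is `P_n(λ)` up to the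
Vandermonde determinant. -/
lemma det_gap (N n:ℕ) : ∃ c : ℂ, c ≠ 0 ∧ ∀ l : F.Par, (∀ k ≤ n, F.nondegT (F.shift l (n+1)) k) → F.nondeg l n →
    (∀ k ≤ N, F.nondeg (lamBar F l N) k) → F.nondeg (lamBar F l N) (N+1+n) → ∀ x : ℂ, x.re ∈ F.dom →
    G.lcP l n*(Matrix.of fun i k:Fin (N+2) => F.P (lamBar F l N) (gapDeg N n k) (cpt F.γ (N+2) x i)).det =
    c*((∏ k:Fin (N+2), G.lcP (lamBar F l N) (gapDeg N n k))*F.P l n x*Vd F (N+2) x) := by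
  obtain ⟨c1, hc1, h1⟩ := G.det_dual (compl_gap N n)
  obtain ⟨c2, hc2, h2⟩ := G.det_dual (compl_full n)
  refine ⟨c2/c1, div_ne_zero hc2 hc1, fun l hT hn hP hF x hx => ?_⟩
  have a1 : lamBar F (F.shift l (n+1)) (N+1+n) = lamBar F l N := by
    unfold lamBar; rw [G.shift_shift]; congr 1; push_cast; ring
  have a2 : lamBar F (F.shift l (n+1)) n = l := by
    unfold lamBar; rw [G.shift_shift, add_neg_cancel, G.shift_zero]
  have hT' : ∀ d ∈ List.range' 1 n, F.nondegT (F.shift l (n+1)) d := fun d hd => by grind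
  have b1 := h1 (F.shift l (n+1)) hT' (by grind) x hx
  have b2 := h2 (F.shift l (n+1)) hT' (by grind) x hx; rw [a1] at b1; rw [a2] at b2
  have hlen : (List.range (N+1) ++ [N+1+n]).length = N+2 := by simp
  rw [det_get hlen (gapDeg N n) (range_append_get N n hlen),
    prod_get hlen (gapDeg N n) (range_append_get N n hlen) (G.lcP (lamBar F l N)), hlen] at b1
  rw [det_get (L := [n]) (n := 1) rfl (fun _ => n) (fun k => by simp),
    prod_get (L := [n]) (n := 1) rfl (fun _ => n) (fun k => by simp) (G.lcP l)] at b2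
  have hV1 : Vd F [n].length x = 1 := by
    change Vd F 1 x = 1
    simp [Vd, Matrix.vandermonde]
  rw [hV1] at b2
  simp only [Finset.univ_unique, Fin.default_eq_zero, Fin.isValue, prod_const, card_singleton,
    pow_one, mul_one, Matrix.det_fin_one, Matrix.of_apply, Fin.val_zero, cpt_one] at b2
  have hA : ∏ k : Fin (List.range' 1 n).length, G.lcT (F.shift l (n+1)) ((List.range' 1 n).get k) ≠ 0 :=
    prod_ne_zero_iff.2 fun k _ => G.lcT_ne _ _ (hT' _ (List.get_mem _ k))
  have hV := G.Vd_ne (List.range' 1 n).length x hx; grind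

end Model

/-- Genericity of all the parameters that occur in the proof of the duality for `P_{D,n}`. -/
structure GenericPar (F:FamilyData) (l:F.Par) (N n:ℕ) : Prop where
  T : ∀ k ≤ N, F.nondegT l k
  T' : ∀ k ≤ n, F.nondegT (F.shift l (n+1)) k
  P : F.nondeg l n
  bar : ∀ k ≤ N, F.nondeg (lamBar F l N) k
  top : F.nondeg (lamBar F l N) (N+1+n)

lemma exists_interpolant {N:ℕ} (p:ℕ → ℂ[X]) (hp:∀ k ≤ N, (p k).natDegree ≤ k ∧ (p k).coeff k ≠ 0) (v:Fin (N+1) → ℂ)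
    (hv:Function.Injective v) (f:ℂ[X]) : ∃ a : ℕ → ℂ, ∀ j, (f-∑ k ∈ range (N+1), C (a k)*p k).eval (v j) = 0 := by
  have hd := Lagrange.degree_interpolate_lt (s := univ) (v := v) (fun j => f.eval (v j)) (hv.injOn)
  rw [card_univ, Fintype.card_fin] at hd
  have hd' : (Lagrange.interpolate univ v fun j => f.eval (v j)).natDegree ≤ N := by
    rcases eq_or_ne (Lagrange.interpolate univ v fun j => f.eval (v j)) 0 with h | h
    · simp_all
    · rw [← Nat.lt_succ_iff, natDegree_lt_iff_degree_lt h]; exact hd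
  obtain ⟨a, ha⟩ := exists_sum_of_degree p hp _ hd'
  refine ⟨a, fun j => ?_⟩
  rw [← ha, eval_sub, Lagrange.eval_interpolate_at_node _ hv.injOn (mem_univ j), sub_self]

namespace Model
variable {F:FamilyData} (G:Model F)
include G

omit G in
lemma gapDeg_sum (N n:ℕ) (p:ℕ → ℂ[X]) (a:ℕ → ℂ) : p (N+1+n)-∑ k ∈ range (N+1), C (a k)*p k = p (gapDeg N n (Fin.last (N+1))) -
        ∑ k : Fin (N+1), C (a k)*p (gapDeg N n k.castSucc) := by
  rw [Finset.sum_range, gapDeg_last]; simp only [gapDeg_castSucc]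

lemma remainder_eval (N n:ℕ) : ∃ c : ℂ, c ≠ 0 ∧ ∀ l : F.Par, GenericPar F l N n →
    ∀ x : ℂ, x.re ∈ F.dom → ∀ (σ:Equiv.Perm (Fin (N+2))) (a:ℕ → ℂ) (Q:ℂ[X]), Q = G.pP (lamBar F l N) (N+1+n) -
      ∑ k ∈ range (N+1), C (a k)*G.pP (lamBar F l N) k →
    (∀ j:Fin (N+1), Q.eval (F.η (cpt F.γ (N+2) x (σ j.castSucc))) = 0) →
    G.lcP l n*Q.eval (F.η (cpt F.γ (N+2) x (σ (Fin.last _)))) = c*(G.lcP (lamBar F l N) (N+1+n)*F.P l n x *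
        ∏ j : Fin (N+1), (F.η (cpt F.γ (N+2) x (σ (Fin.last _)))-F.η (cpt F.γ (N+2) x (σ j.castSucc)))) := by
  obtain ⟨c, hc, h⟩ := G.det_gap N n
  refine ⟨c, hc, fun l hl x hx σ a Q hQ hv => ?_⟩
  have h1 := h l hl.T' hl.P hl.bar hl.top x hx; simp only [G.P_eval (lamBar F l N)] at h1
  set p : Fin (N+2) → ℂ[X] := fun k => G.pP (lamBar F l N) (gapDeg N n k) with hp
  set v : Fin (N+2) → ℂ := fun i => F.η (cpt F.γ (N+2) x (σ i)) with hv'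
  have h2 : G.lcP l n*(Matrix.of fun i k => (p k).eval (v i)).det = c*((∏ k:Fin (N+2), G.lcP (lamBar F l N) (gapDeg N n k))*F.P l n x *
        (Matrix.vandermonde v).det) := by
    have a1 : (Matrix.of fun i k => (p k).eval (v i)).det = ((Equiv.Perm.sign σ:ℤ):ℂ) *
        (Matrix.of fun i k:Fin (N+2) => (p k).eval (F.η (cpt F.γ (N+2) x i))).det := by
      rw [← Matrix.det_permute]; rfl
    have a2 : (Matrix.vandermonde v).det = ((Equiv.Perm.sign σ:ℤ):ℂ)*Vd F (N+2) x := by rw [Vd, ← Matrix.det_permute]; rfl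
    grind
  have hQ' := hQ.trans (gapDeg_sum N n (G.pP (lamBar F l N)) a)
  rw [det_remainder p Q (fun k => a k) hQ' v hv, vandermonde_last, Fin.prod_univ_castSucc] at h2
  simp only [gapDeg_castSucc, gapDeg_last] at h2
  rw [det_eval_triangular _ (fun k:Fin (N+1) => p k.castSucc) (fun k => by simp only [hp, gapDeg_castSucc]; exact G.pP_deg _ _)] at h2
  have h3 : ∏ i : Fin (N+1), (p i.castSucc).coeff i = ∏ i : Fin (N+1), G.lcP (lamBar F l N) i := by
    refine prod_congr rfl fun i _ => ?_
    simp only [hp, gapDeg_castSucc]; exact G.pP_coeff _ _ (hl.bar _ (by omega))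
  rw [h3] at h2
  have n1 : ∏ i : Fin (N+1), G.lcP (lamBar F l N) i ≠ 0 := prod_ne_zero_iff.2 fun i _ => G.lcP_ne _ _ (hl.bar _ (by omega))
  have n2 : (Matrix.vandermonde fun i:Fin (N+1) => v i.castSucc).det ≠ 0 := by
    rw [Matrix.det_vandermonde_ne_zero_iff]
    exact (G.cpt_η_injective (N+2) x hx).comp (σ.injective.comp (Fin.castSucc_injective _))
  grind

/-- The interpolation of `P_{N+1+n}` by `P_0, …, P_N` on `N + 1` consecutive points. -/
lemma interp_coeff (N n:ℕ) : ∃ c0 : ℂ, c0 ≠ 0 ∧ ∀ l : F.Par, GenericPar F l N n → ∀ c : ℂ, c.re ∈ F.dom → ∃ (f:ℂ) (a:ℕ → ℂ) (Q:ℂ[X]),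
    G.lcP l n*f = c0*G.lcP (lamBar F l N) (N+1+n) ∧ Q = G.pP (lamBar F l N) (N+1+n)-∑ k ∈ range (N+1), C (a k)*G.pP (lamBar F l N) k ∧
    (∀ p < N+1, Q.eval (F.η (cpt F.γ (N+1) c p)) = 0) ∧ Q.eval (F.η (c+((N:ℂ)/2+1)*F.stp)) = f*F.P l n (c+F.stp/2)*∏ p ∈ range (N+1),
        (F.η (c+((N:ℂ)/2+1)*F.stp)-F.η (cpt F.γ (N+1) c p)) ∧
    ∀ k ≤ N, (F.E (lamBar F l N) k-F.E (lamBar F l N) (N+1+n:ℕ))*a k*F.φ c =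
      (F.κ:ℂ)^(N+1)*(G.bK N k/(G.lcP (lamBar F l N) k*G.lcT l (N-k)))*f*(I*G.ω (N+1)) *
        (G.np l (c+F.stp/2)*F.P l n (c-F.stp/2)*F.ξ l (N-k) (c+F.stp/2)-G.nm l (c-F.stp/2)*F.P l n (c+F.stp/2) *
            F.ξ l (N-k) (c-F.stp/2)) := by
  obtain ⟨c0, hc0, h0⟩ := G.remainder_eval N n
  refine ⟨c0, hc0, fun l hl c hc => ?_⟩
  have hre1 : (c+F.stp/2).re ∈ F.dom := by simpa [stp_re] using hc
  have hre2 : (c-F.stp/2).re ∈ F.dom := by simpa [stp_re] using hc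
  have hp : ∀ k ≤ N, (G.pP (lamBar F l N) k).natDegree ≤ k ∧ (G.pP (lamBar F l N) k).coeff k ≠ 0 := fun k hk =>
    ⟨G.pP_deg _ _, by rw [G.pP_coeff _ _ (hl.bar k hk)]; exact G.lcP_ne _ _ (hl.bar k hk)⟩
  have hinj := G.cpt_η_injective (N+1) c hc
  obtain ⟨a, ha⟩ := exists_interpolant _ hp _ hinj (G.pP (lamBar F l N) (N+1+n))
  set Q := G.pP (lamBar F l N) (N+1+n)-∑ k ∈ range (N+1), C (a k)*G.pP (lamBar F l N) k with hQ
  set f := c0*G.lcP (lamBar F l N) (N+1+n)/G.lcP l n with hf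
  have hlc := G.lcP_ne l n hl.P
  have hfl : G.lcP l n*f = c0*G.lcP (lamBar F l N) (N+1+n) := mul_div_cancel₀ _ hlc
  have hzero : ∀ p < N+1, Q.eval (F.η (cpt F.γ (N+1) c p)) = 0 := fun p hp => ha ⟨p, hp⟩
  have hev : ∀ b u : ℂ, b.re ∈ F.dom → ∀ σ : Equiv.Perm (Fin (N+2)), (∀ j:Fin (N+1), cpt F.γ (N+2) b (σ j.castSucc) = cpt F.γ (N+1) c j) →
      cpt F.γ (N+2) b (σ (Fin.last _)) = u → Q.eval (F.η u) = f*F.P l n b*∏ p ∈ range (N+1), (F.η u-F.η (cpt F.γ (N+1) c p)) := by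
    intro b u hb σ e1 e2
    have := h0 l hl b hb σ a Q hQ fun j => by rw [e1]; exact ha j
    simp only [e1, e2] at this; rw [← Finset.prod_range fun p => F.η u-F.η (cpt F.γ (N+1) c p)] at this; grind
  have hup := hev _ (c+((N:ℂ)/2+1)*F.stp) hre1 (finRotate (N+2)) (fun j => by
    rw [finRotate_apply, Fin.coeSucc_eq_succ, cpt_eq, cpt_eq]; push_cast [Fin.val_succ]; ring) (by
    rw [finRotate_last, cpt_eq]; push_cast [Fin.val_zero]; ring)
  have hdown := hev _ (c-((N:ℂ)/2+1)*F.stp) hre2 1 (fun j => by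
    rw [Equiv.Perm.one_apply, cpt_eq, cpt_eq]; push_cast [Fin.val_castSucc]; ring) (by
    rw [Equiv.Perm.one_apply, cpt_eq]; push_cast [Fin.val_last]; ring)
  refine ⟨f, a, Q, hfl, hQ, hzero, hup, ?_⟩
  set lb := lamBar F l N with hlb
  have hkd := (G.kernelDiag l N hl.bar hl.T).2.2
  set A : ℂ := (F.κ:ℂ)^(N+1)*f*(I*G.ω (N+1)) with hA
  set B0 : ℂ := G.np l (c+F.stp/2)*F.P l n (c-F.stp/2) with hB0
  set B1 : ℂ := G.nm l (c-F.stp/2)*F.P l n (c+F.stp/2) with hB1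
  set g : ℕ → ℂ := fun k => G.bK N k/(G.lcP lb k*G.lcT l (N-k)) with hg
  have hkd' : ∀ x y, PiK F N x y = ∑ k ∈ range (N+1), (G.pP lb k).eval (F.η y)*(g k*F.ξ l (N-k) x) := by
    intro x y; rw [hkd, Finset.sum_range]
    refine sum_congr rfl fun k _ => ?_
    rw [G.pP_coeff _ _ (hl.bar k (by omega)), G.pT_coeff _ _ (hl.T (N-k) (by omega)), G.T_eval]
  have hnode : ∀ p < N+1, ∑ k ∈ range (N+1), ((F.E lb k-F.E lb (N+1+n:ℕ))*a k*F.φ c)*(G.pP lb k).eval (F.η (cpt F.γ (N+1) c p)) =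
      A*(B0*PiK F N (c+F.stp/2) (cpt F.γ (N+1) c p)-B1*PiK F N (c-F.stp/2) (cpt F.γ (N+1) c p)) := by
    intro p hp'
    set y := cpt F.γ (N+1) c p with hy
    have hyre : y.re ∈ F.dom := by rw [hy, cpt_re]; exact hc
    have hym : (y-F.stp).re = y.re := by simp [stp_re]
    have hyp : (y+F.stp).re = y.re := by simp [stp_re]
    have hQe : ∀ u, Q.eval (F.η u) = F.P lb (N+1+n) u-∑ k ∈ range (N+1), a k*F.P lb k u := by
      intro u; rw [hQ, eval_sub, eval_finsetSum, ← G.P_eval]; congr 1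
      exact sum_congr rfl fun k _ => by rw [eval_mul, eval_C, ← G.P_eval]
    have hT := G.P_eq lb (N+1+n) hl.top y hyre
    have hTk : ∀ k ∈ range (N+1), a k*(G.np lb y/(F.φ y*F.φ (y-F.stp/2))*(F.P lb k (y-F.stp)-F.P lb k y) +
        G.nm lb y/(F.φ y*F.φ (y+F.stp/2))*(F.P lb k (y+F.stp)-F.P lb k y)) = F.E lb k*(a k*F.P lb k y) := fun k hk => by
      rw [G.P_eq lb k (hl.bar k (by rw [mem_range] at hk; omega)) y hyre]; ring
    have hTs := sum_congr rfl hTk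
    have hTs' : G.np lb y/(F.φ y*F.φ (y-F.stp/2))*((∑ k ∈ range (N+1), a k*F.P lb k (y-F.stp))-∑ k ∈ range (N+1), a k*F.P lb k y) +
        G.nm lb y/(F.φ y*F.φ (y+F.stp/2))*((∑ k ∈ range (N+1), a k*F.P lb k (y+F.stp))-∑ k ∈ range (N+1), a k*F.P lb k y) =
        ∑ k ∈ range (N+1), F.E lb k*(a k*F.P lb k y) := by
      rw [← hTs]; simp only [← sum_sub_distrib, mul_sum, ← sum_add_distrib]; exact sum_congr rfl fun k _ => by ring
    have hQy := hzero p hp'; rw [← hy, hQe] at hQy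
    have key : ∑ k ∈ range (N+1), ((F.E lb k-F.E lb (N+1+n:ℕ))*a k*F.φ c)*(G.pP lb k).eval (F.η y) =
        -F.φ c*(G.np lb y/(F.φ y*F.φ (y-F.stp/2))*Q.eval (F.η (y-F.stp))+G.nm lb y/(F.φ y*F.φ (y+F.stp/2))*Q.eval (F.η (y+F.stp))) := by
      have e1 : ∑ k ∈ range (N+1), ((F.E lb k-F.E lb (N+1+n:ℕ))*a k*F.φ c)*(G.pP lb k).eval (F.η y) =
          F.φ c*((∑ k ∈ range (N+1), F.E lb k*(a k*F.P lb k y))-F.E lb (N+1+n:ℕ)*∑ k ∈ range (N+1), a k*F.P lb k y) := by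
        rw [mul_sum, ← sum_sub_distrib, mul_sum]; exact sum_congr rfl fun k _ => by rw [← G.P_eval]; ring
      grind
    rw [key]
    have hφ0 := G.φ_ne y hyre
    have hφm : F.φ (y-F.stp/2) ≠ 0 := G.φ_ne _ (by simpa [stp_re] using hyre)
    have hφp : F.φ (y+F.stp/2) ≠ 0 := G.φ_ne _ (by simpa [stp_re] using hyre)
    have t1 : F.φ c*(G.np lb y/(F.φ y*F.φ (y-F.stp/2))*Q.eval (F.η (y-F.stp))) = -(A*(B0*PiK F N (c+F.stp/2) y)) := by
      by_cases hpN : p = N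
      · have ey : y = c-(N:ℂ)/2*F.stp := by
          rw [hy, cpt_eq, hpN]; push_cast; ring
        have e2 : y-F.stp = c-((N:ℂ)/2+1)*F.stp := by rw [ey]; ring
        have e3 : G.np lb y = (F.κ:ℂ)^(N+1)*G.np l (c+F.stp/2) := by rw [hlb, G.np_bar, ey]; congr 2; ring
        have e4 : y-F.stp/2 = c-((N:ℂ)/2+1/2)*F.stp := by rw [ey]; ring
        have e5 := G.prod_η_sub_down N c; rw [← e4, ← ey] at e5
        rw [e2, hdown, e3, hA, hB0, div_mul_eq_mul_div, mul_div_assoc', div_eq_iff (mul_ne_zero hφ0 hφm)]; grind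
      · have e1 : y-F.stp = cpt F.γ (N+1) c (p+1) := by
          rw [hy, cpt_eq, cpt_eq]; push_cast; ring
        have e2 : PiK F N (c+F.stp/2) y = 0 := by
          unfold PiK
          refine prod_eq_zero (i := p) (mem_range.2 (by omega)) ?_
          rw [sub_eq_zero, hy, cpt_eq, cpt_eq]; congr 1; push_cast; ring
        rw [e1, hzero _ (by omega), e2]; ring
    have t2 : F.φ c*(G.nm lb y/(F.φ y*F.φ (y+F.stp/2))*Q.eval (F.η (y+F.stp))) = A*(B1*PiK F N (c-F.stp/2) y) := by
      by_cases hp0 : p = 0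
      · have ey : y = c+(N:ℂ)/2*F.stp := by
          rw [hy, cpt_eq, hp0]; push_cast; ring
        have e2 : y+F.stp = c+((N:ℂ)/2+1)*F.stp := by rw [ey]; ring
        have e3 : G.nm lb y = (F.κ:ℂ)^(N+1)*G.nm l (c-F.stp/2) := by rw [hlb, G.nm_bar, ey]; congr 2; ring
        have e4 : y+F.stp/2 = c+((N:ℂ)/2+1/2)*F.stp := by rw [ey]; ring
        have e5 := G.prod_η_sub_up N c; rw [← e4, ← ey] at e5
        rw [e2, hup, e3, hA, hB1, div_mul_eq_mul_div, mul_div_assoc', div_eq_iff (mul_ne_zero hφ0 hφp)]; grind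
      · have e1 : y+F.stp = cpt F.γ (N+1) c (p-1) := by
          obtain ⟨q, rfl⟩ := Nat.exists_eq_succ_of_ne_zero hp0; rw [hy, cpt_eq, cpt_eq]; push_cast; ring_nf
        have e2 : PiK F N (c-F.stp/2) y = 0 := by
          obtain ⟨q, rfl⟩ := Nat.exists_eq_succ_of_ne_zero hp0; unfold PiK
          refine prod_eq_zero (i := q) (mem_range.2 (by omega)) ?_
          rw [sub_eq_zero, hy, cpt_eq, cpt_eq]; congr 1; push_cast; ring
        grind
    linear_combination -t1-t2
  have hpoly : ∑ k ∈ range (N+1), C ((F.E lb k-F.E lb (N+1+n:ℕ))*a k*F.φ c -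
      A*g k*(B0*F.ξ l (N-k) (c+F.stp/2)-B1*F.ξ l (N-k) (c-F.stp/2)))*G.pP lb k = 0 := by
    refine Polynomial.eq_zero_of_degree_lt_of_eval_index_eq_zero (s := univ) hinj.injOn ?_ ?_
    · rw [card_univ, Fintype.card_fin]
      refine lt_of_le_of_lt (degree_sum_le _ _) ?_
      rw [Finset.sup_lt_iff (by exact_mod_cast WithBot.bot_lt_coe (N+1))]; intro k hk; rw [mem_range] at hk
      refine lt_of_le_of_lt degree_le_natDegree ?_
      exact lt_of_le_of_lt (Nat.cast_le.2 ((natDegree_C_mul_le _ _).trans (hp k (by omega)).1)) (Nat.cast_lt.2 hk)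
    · intro j _
      have := hnode j j.2; rw [hkd', hkd', ← sub_eq_zero] at this; rw [eval_finsetSum, ← this]
      simp only [mul_sum, ← sum_sub_distrib]
      refine sum_congr rfl fun k _ => ?_
      rw [eval_mul, eval_C]; ring
  intro k hk
  have := coeff_eq_zero_of_sum _ hp _ hpoly k hk; grind

end Model

/-- Moving one index from the second block to the first. -/
def splitEquiv (m M:ℕ) : Fin (m+1) ⊕ Fin M ≃ Fin m ⊕ Fin (M+1) where
  toFun := Sum.elim (fun j => Fin.lastCases (Sum.inr 0) (fun j => Sum.inl j) j) (fun i => Sum.inr i.succ)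
  invFun := Sum.elim (fun j => Sum.inl j.castSucc) (fun i => Fin.cases (Sum.inl (Fin.last m)) Sum.inr i)
  left_inv := by
    rintro (j | i)
    · refine Fin.lastCases ?_ (fun j => ?_) j <;> simp
    · simp
  right_inv := by
    rintro (j | i)
    · simp
    · refine Fin.cases ?_ (fun i => ?_) i <;> simp

lemma splitEquiv_castSucc (m M:ℕ) (j:Fin m) : splitEquiv m M (Sum.inl j.castSucc) = Sum.inl j := by simp [splitEquiv]

lemma splitEquiv_last (m M:ℕ) : splitEquiv m M (Sum.inl (Fin.last m)) = Sum.inr 0 := by simp [splitEquiv]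

lemma splitEquiv_inr (m M:ℕ) (i:Fin M) : splitEquiv m M (Sum.inr i) = Sum.inr i.succ := by simp [splitEquiv]

lemma det_split {m M:ℕ} (L:Matrix (Fin (M+1)) (Fin m ⊕ Fin (M+1)) ℂ) (f:Matrix (Fin m ⊕ Fin (M+1)) (Fin m ⊕ Fin (M+1)) ℂ)
    (T:Matrix (Fin (m+1)) (Fin (m+1)) ℂ) (h0:∀ (i:Fin M) j, ∑ k, L i.succ k*f k (splitEquiv m M (Sum.inl j)) = 0)
    (h1:∀ k j, T k.castSucc j = f (Sum.inl k) (splitEquiv m M (Sum.inl j)))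
    (h2:∀ j, T (Fin.last m) j = ∑ k, L 0 k*f k (splitEquiv m M (Sum.inl j))) : (Matrix.of fun i d:Fin (M+1) => L i (Sum.inr d)).det*f.det =
      T.det*(Matrix.of fun i j:Fin M =>
        ∑ k, L i.succ k*f k (splitEquiv m M (Sum.inr j))).det := by
  set B := Matrix.fromBlocks (1:Matrix (Fin m) (Fin m) ℂ) 0
      (Matrix.of fun i k => L i (Sum.inl k)) (Matrix.of fun i k => L i (Sum.inr k)) with hB
  have hrow : ∀ (i:Fin (M+1)) p, (B*f) (Sum.inr i) p = ∑ k, L i k*f k p := by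
    intro i p; simp [hB, Matrix.mul_apply]
  have hrow' : ∀ (i:Fin m) p, (B*f) (Sum.inl i) p = f (Sum.inl i) p := by
    intro i p; simp [hB, Matrix.mul_apply, Matrix.one_apply]
  have hdB : B.det = (Matrix.of fun i d:Fin (M+1) => L i (Sum.inr d)).det := by simp_all
  set A := B*f with hA
  have h3 : A.submatrix (splitEquiv m M) (splitEquiv m M) = Matrix.fromBlocks T (Matrix.of fun (k:Fin (m+1)) (i:Fin M) =>
        A (splitEquiv m M (Sum.inl k)) (splitEquiv m M (Sum.inr i))) 0
      (Matrix.of fun i j:Fin M => ∑ k, L i.succ k*f k (splitEquiv m M (Sum.inr j))) := by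
    ext (k | i) (j | j)
    · rw [Matrix.submatrix_apply, Matrix.fromBlocks_apply₁₁]
      refine Fin.lastCases ?_ (fun k => ?_) k
      · rw [splitEquiv_last, hrow, h2]
      · rw [splitEquiv_castSucc, hrow', h1]
    · simp
    · rw [Matrix.submatrix_apply, Matrix.fromBlocks_apply₂₁, Matrix.zero_apply, splitEquiv_inr, hrow, h0]
    · rw [Matrix.submatrix_apply, Matrix.fromBlocks_apply₂₂, splitEquiv_inr, hrow, Matrix.of_apply]
  rw [← hdB, ← Matrix.det_mul, ← hA, ← Matrix.det_submatrix_equiv_self (splitEquiv m M), h3, Matrix.det_fromBlocks_zero₂₁]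

lemma interp_complement (F:FamilyData) {N m M:ℕ} (h:m+1+M = N+1) (e:Fin m ⊕ Fin (M+1) ≃ Fin (N+1)) : ∃ s : ℂ, s ≠ 0 ∧
    ∀ (q:Fin (N+1) → ℂ[X]), (∀ k, (q k).natDegree ≤ k) → ∀ (r:Fin (N+1) → ℂ → ℂ) (a:Fin (N+1) → ℂ) (w:Fin (m+1) → ℂ → ℂ) (x:ℂ),
    (∀ (i:Fin M) (y:ℂ), PiK F N (cpt F.γ M x i) y = ∑ k, (q k).eval (F.η y)*r k (cpt F.γ M x i)) →
    (∀ k y, w k.castSucc y = (q (e (Sum.inl k))).eval (F.η y)) → (∀ j:Fin (m+1), w (Fin.last m) (cpt F.γ (m+1) x j) =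
      ∑ k, a k*(q k).eval (F.η (cpt F.γ (m+1) x j))) →
    ∀ B : Matrix (Fin (M+1)) (Fin (M+1)) ℂ, (∀ d, B 0 d = a (e (Sum.inr d))) →
    (∀ i d, B (Fin.succ i) d = r (e (Sum.inr d)) (cpt F.γ M x i)) →
    B.det*(s*((∏ k, (q k).coeff k)*chainVd F N (m+1) M x)) =
    (Matrix.of fun j k:Fin (m+1) => w k (cpt F.γ (m+1) x j)).det*chainPi F N (m+1) M x := by
  refine ⟨_, sign_ne_zero (e.symm.trans ((splitEquiv m M).symm.trans (chainIdx h))), fun q hq r a w x hK hw1 hw2 B hB0 hB1 => ?_⟩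
  have hdf := det_reindex_two e ((splitEquiv m M).symm.trans (chainIdx h))
      (Matrix.of fun k i:Fin (N+1) => (q k).eval (F.η (chainPt F (m+1) M x i)))
  have hv : (Matrix.of fun k i:Fin (N+1) =>
      (q k).eval (F.η (chainPt F (m+1) M x i))).det =
      (∏ k, (q k).coeff k)*chainVd F N (m+1) M x := by
    rw [← Matrix.det_transpose, chainVd, ← det_eval_triangular _ _ hq]; rfl
  rw [hv] at hdf
  have hs : ∀ (i:Fin M) (y:ℂ), ∑ k, r (e k) (cpt F.γ M x i)*(q (e k)).eval (F.η y) = PiK F N (cpt F.γ M x i) y := by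
    intro i y; rw [hK i y, ← e.sum_comp]; grind
  set f : Matrix (Fin m ⊕ Fin (M+1)) (Fin m ⊕ Fin (M+1)) ℂ := Matrix.of fun k p =>
    (Matrix.of fun k i:Fin (N+1) => (q k).eval (F.η (chainPt F (m+1) M x i))) (e k) (((splitEquiv m M).symm.trans (chainIdx h)) p) with hf
  set L : Matrix (Fin (M+1)) (Fin m ⊕ Fin (M+1)) ℂ := Matrix.of fun i k => Fin.cases (a (e k)) (fun i => r (e k) (cpt F.γ M x i)) i with hL
  have hL0 : ∀ k, L 0 k = a (e k) := fun k => rfl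
  have hL1 : ∀ i k, L (Fin.succ i) k = r (e k) (cpt F.γ M x i) := fun i k => rfl
  have hp1 : ∀ k (j:Fin (m+1)), f k (splitEquiv m M (Sum.inl j)) = (q (e k)).eval (F.η (cpt F.γ (m+1) x j)) := by
    intro k j; simp only [hf, Matrix.of_apply, Equiv.trans_apply, Equiv.symm_apply_apply, chainIdx_inl, chainPt_add]
  have hp2 : ∀ k (j:Fin M), f k (splitEquiv m M (Sum.inr j)) = (q (e k)).eval (F.η (chainPt F (m+1) M x j)) := by
    intro k j; simp only [hf, Matrix.of_apply, Equiv.trans_apply, Equiv.symm_apply_apply, chainIdx_inr]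
  have hBL : B = Matrix.of fun i d : Fin (M+1) => L i (Sum.inr d) := by
    ext i d
    refine Fin.cases ?_ (fun i => ?_) i
    · rw [hB0, Matrix.of_apply, hL0]
    · rw [hB1, Matrix.of_apply, hL1]
  clear_value f L
  have h1 := det_split L f (Matrix.of fun k j:Fin (m+1) => w k (cpt F.γ (m+1) x j)) (fun i j => by
      simp only [hp1, hL1]; rw [hs, ← chainPt_add F (m+1) M x j]
      exact PiK_chain_zero F h x i _ (by have := i.2; omega) (by have := j.2; have := i.2; omega))
    (fun k j => by rw [hp1, Matrix.of_apply, hw1])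
    (fun j => by
      rw [Matrix.of_apply, hw2, ← e.sum_comp]
      simp_all)
  have h3 : (Matrix.of fun i j:Fin M =>
      ∑ k, L i.succ k*f k (splitEquiv m M (Sum.inr j))).det = chainPi F N (m+1) M x := by
    simp only [hp2, hL1, hs]; rw [Matrix.det_of_isLowerTriangular]
    · rfl
    · intro i j hij
      have hij' : i < j := by simpa using hij
      simp only [Matrix.of_apply]; exact PiK_chain_zero F h x i j hij' (by have := j.2; have := i.2; omega)
  rw [h3, hdf, ← hBL] at h1; rw [← Matrix.det_transpose (Matrix.of fun j k:Fin (m+1) => w k (cpt F.γ (m+1) x j))]; exact h1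

/-- The factors `∏_{i<j} np(z_i) ∏_{j<i<n} nm(z_i)`. -/
def shiftProd (F:FamilyData) (a b:ℂ → ℂ) (n:ℕ) (x:ℂ) (j:ℕ) : ℂ := (∏ i ∈ range j, a (cpt F.γ n x i))*∏ i ∈ Ico (j+1) n, b (cpt F.γ n x i)

lemma shiftProd_step (F:FamilyData) (a b:ℂ → ℂ) (n:ℕ) (x:ℂ) (j:ℕ) (hj:j+1 < n) : a (cpt F.γ n x j)*shiftProd F a b n x j =
      b (cpt F.γ n x (j+1))*shiftProd F a b n x (j+1) := by
  unfold shiftProd; rw [prod_range_succ, prod_eq_prod_Ico_succ_bot hj]; ring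

lemma fin_sum_ite {n:ℕ} (a:ℕ) (ha:a < n) (c:ℂ) (Y:ℕ → ℂ) : ∑ j : Fin n, (if (j:ℕ) = a then c else 0)*Y j = c*Y a := by
  rw [← Finset.sum_range (fun j => (if j = a then c else 0)*Y j), sum_eq_single a]
  · rw [if_pos rfl]
  · intro b _ hb; rw [if_neg hb, zero_mul]
  · simp_all

/-- If `T` is lower triangular and `T Y` has a last column that vanishes except for its first
entry, then the determinants of `Y` and of the remaining block of `T Y` are related. -/
lemma det_kernel_column {n:ℕ} (T Y:Matrix (Fin (n+1)) (Fin (n+1)) ℂ) (hT:∀ i j, i < j → T i j = 0)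
    (h:∀ i : Fin n, (T*Y) i.succ (Fin.last n) = 0) : (∏ i, T i i)*Y.det = (-1)^n*(T*Y) 0 (Fin.last n) *
      (Matrix.of fun i k:Fin n => (T*Y) i.succ k.castSucc).det := by
  have h1 : T.det = ∏ i, T i i := Matrix.det_of_isLowerTriangular (M := T) (fun i j hij => hT i j (by simpa using hij))
  rw [← h1, ← Matrix.det_mul, Matrix.det_succ_column _ (Fin.last n), Fin.sum_univ_succ, sum_eq_zero (fun i _ => by rw [h]; ring), add_zero]
  congr 1
  · simp
  · congr 1; ext i k; simp

namespace Model
variable {F:FamilyData} (G:Model F)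
include G

/-- The matrix with columns `ξ_{d_k}(z_j)` and `r_j P_n(z_j)`, with the ratio `r_j` of weights
replaced by the product that it equals up to a constant. -/
def dualMat (l:F.Par) (n M:ℕ) (d:Fin M → ℕ) (x:ℂ) : Matrix (Fin (M+1)) (Fin (M+1)) ℂ :=
  Matrix.of fun j k => if h : (k:ℕ) < M then F.ξ l (d ⟨k, h⟩) (cpt F.γ (M+1) x j)
    else shiftProd F (G.np l) (G.nm l) (M+1) x j*F.P l n (cpt F.γ (M+1) x j)

lemma det_dualMat (l:F.Par) (n M:ℕ) (d:Fin (M+1) → ℕ) (hn:F.nondeg l n) (hd:∀ k, F.nondegT l (d k)) (x:ℂ) (hx:x.re ∈ F.dom)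
    (hP:F.P l n (cpt F.γ (M+2) x 0) ≠ 0) (hnm:∀ i ≤ M+1, G.nm l (cpt F.γ (M+2) x i) ≠ 0) (X:Matrix (Fin (M+1)) (Fin (M+1)) ℂ)
    (hX0:∀ k, X 0 k = G.nm l (cpt F.γ (M+2) x 1)*F.P l n (cpt F.γ (M+2) x 0)*F.ξ l (d k) (cpt F.γ (M+2) x 1) -
      G.np l (cpt F.γ (M+2) x 0)*F.P l n (cpt F.γ (M+2) x 1)*F.ξ l (d k) (cpt F.γ (M+2) x 0))
    (hX1:∀ (i:Fin M) k, X i.succ k = (F.Et l (d k)-F.E l n)*F.ξ l (d k) (cpt F.γ (M+2) x (i+1))) :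
    (G.dualMat l n (M+1) d x).det = (-1)^(M+1)*(∏ i ∈ range M, (F.φ (cpt F.γ (M+2) x (i+1))*F.φ (cpt F.γ (M+2) x (i+1)-F.stp/2))) *
      X.det := by
  set z : ℕ → ℂ := cpt F.γ (M+2) x with hz
  have hzm : ∀ i, z i-F.stp = z (i+1) := fun i => by rw [hz, cpt_eq, cpt_eq]; push_cast; ring
  have hzp : ∀ i, z (i+1)+F.stp = z i := fun i => by rw [← hzm]; ring
  have hzre : ∀ i, (z i).re ∈ F.dom := fun i => by rw [hz, cpt_re]; exact hx
  have hφ0 : ∀ i, F.φ (z i) ≠ 0 := fun i => G.φ_ne _ (hzre i)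
  have hφm : ∀ i, F.φ (z i-F.stp/2) ≠ 0 := fun i => G.φ_ne _ (by have := hzre i; simpa [stp_re] using this)
  set R : ℕ → ℂ := shiftProd F (G.np l) (G.nm l) (M+2) x with hR
  have hRs : ∀ j, j+1 < M+2 → G.np l (z j)*R j = G.nm l (z (j+1))*R (j+1) := fun j hj => shiftProd_step F (G.np l) (G.nm l) (M+2) x j hj
  have hR0 : R 0 = G.nm l (z 1)*∏ i ∈ range M, G.nm l (z (i+2)) := by
    rw [hR, shiftProd, prod_range_zero, one_mul, prod_Ico_eq_prod_range, zero_add,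
      show M+2-1 = M+1 by omega, prod_range_succ', mul_comm]
    grind
  set Y : ℕ → Fin (M+2) → ℂ := fun j k => if h : (k:ℕ) < M+1 then F.ξ l (d ⟨k, h⟩) (z j) else R j*F.P l n (z j) with hY
  have hYl : ∀ j, Y j (Fin.last _) = R j*F.P l n (z j) := fun j => by simp [hY]
  have hYc : ∀ j (k:Fin (M+1)), Y j k.castSucc = F.ξ l (d k) (z j) := fun j k => dif_pos (show (k.castSucc:ℕ) < M+1 from k.2)
  set Ym : Matrix (Fin (M+2)) (Fin (M+2)) ℂ := Matrix.of fun j k => Y j k with hYm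
  have hdm : G.dualMat l n (M+1) d x = Ym := rfl
  set α : ℕ → ℂ := fun i => G.np l (z i)/(F.φ (z (i+1))*F.φ (z (i+1)+F.stp/2)) with hα
  set β : ℕ → ℂ := fun i => G.nm l (z (i+2))/(F.φ (z (i+1))*F.φ (z (i+1)-F.stp/2)) with hβ
  set T : Matrix (Fin (M+2)) (Fin (M+2)) ℂ := Matrix.of fun i j =>
    (Fin.cases (fun j => if j = 0 then 1 else 0) (fun i => Fin.cases (fun j => (if j = 0 then -(G.np l (z 0)*F.P l n (z 1)) else 0) +
        (if j = 1 then G.nm l (z 1)*F.P l n (z 0) else 0))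
      (fun i j => (if j = (i:ℕ) then α i else 0)+(if j = (i:ℕ)+1 then F.Et l 0-F.E l n-α i-β i else 0) +
        (if j = (i:ℕ)+2 then β i else 0)) i) i : ℕ → ℂ) j with hT
  have T0 : ∀ j, T 0 j = if (j:ℕ) = 0 then 1 else 0 := fun j => rfl
  have T1 : ∀ j, T (Fin.succ 0) j = (if (j:ℕ) = 0 then -(G.np l (z 0)*F.P l n (z 1)) else 0) +
        (if (j:ℕ) = 1 then G.nm l (z 1)*F.P l n (z 0) else 0) := fun j => rfl
  have T2 : ∀ (i:Fin M) j, T i.succ.succ j = (if (j:ℕ) = (i:ℕ) then α i else 0) +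
        (if (j:ℕ) = (i:ℕ)+1 then F.Et l 0-F.E l n-α i-β i else 0)+(if (j:ℕ) = (i:ℕ)+2 then β i else 0) := fun i j => rfl
  clear_value T
  have m0 : ∀ k, (T*Ym) 0 k = Y 0 k := fun k => by
    simp only [Matrix.mul_apply, T0, hYm, Matrix.of_apply]; simp
  have m1 : ∀ k, (T*Ym) (Fin.succ 0) k = -(G.np l (z 0)*F.P l n (z 1))*Y 0 k+G.nm l (z 1)*F.P l n (z 0)*Y 1 k := fun k => by
    simp only [Matrix.mul_apply, T1, hYm, Matrix.of_apply, add_mul, sum_add_distrib]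
    rw [fin_sum_ite 0 (by omega) _ (fun j => Y j k), fin_sum_ite 1 (by omega) _ (fun j => Y j k)]
  have m2 : ∀ (i:Fin M) k, (T*Ym) i.succ.succ k = α i*Y i k+(F.Et l 0-F.E l n-α i-β i)*Y (i+1) k+β i*Y (i+2) k := fun i k => by
    have hi := i.2; simp only [Matrix.mul_apply, T2, hYm, Matrix.of_apply, add_mul, sum_add_distrib]
    rw [fin_sum_ite i (by omega) _ (fun j => Y j k), fin_sum_ite (i+1) (by omega) _ (fun j => Y j k),
      fin_sum_ite (i+2) (by omega) _ (fun j => Y j k)]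
  have hlast : ∀ i : Fin (M+1), (T*Ym) i.succ (Fin.last _) = 0 := by
    intro i
    refine Fin.cases ?_ (fun i => ?_) i
    · grind
    · rw [m2, hYl, hYl, hYl]
      have e1 := G.P_eq l n hn (z (i+1)) (hzre _)
      have e2 := G.VV l (z (i+1)) (hzre _); grind
  have hblock : (Matrix.of fun i k:Fin (M+1) => (T*Ym) i.succ k.castSucc) = X := by
    ext i k; rw [Matrix.of_apply]
    refine Fin.cases ?_ (fun i => ?_) i
    · rw [m1, hYc, hYc, hX0]; ring
    · rw [m2, hYc, hYc, hYc, hX1]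
      have e1 := G.T_eq l (d k) (hd k) (z (i+1)) (hzre _); grind
  have hTl : ∀ i j, i < j → T i j = 0 := by
    intro i j
    refine Fin.cases (fun hij => ?_) (fun i => ?_) i
    · rw [T0, if_neg]; grind
    · refine Fin.cases (fun hij => ?_) (fun i hij => ?_) i
      · have : (1:ℕ) < j := hij; rw [T1, if_neg (by omega), if_neg (by omega), add_zero]
      · have : (i:ℕ)+1+1 < j := hij; rw [T2, if_neg (by omega), if_neg (by omega), if_neg (by omega)]; simp
  have hdiag : ∏ i, T i i = G.nm l (z 1)*F.P l n (z 0)*∏ i ∈ range M, β i := by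
    have d0 : T 0 0 = 1 := by rw [T0]; simp
    have d1 : T (Fin.succ 0) (Fin.succ 0) = G.nm l (z 1)*F.P l n (z 0) := by rw [T1]; simp
    rw [Fin.prod_univ_succ, Fin.prod_univ_succ, d0, d1, one_mul, Finset.prod_range]; congr 1
    refine prod_congr rfl fun i _ => ?_
    rw [T2, if_neg (by rw [Fin.val_succ, Fin.val_succ]; omega), if_neg (by simp), if_pos (by simp)]; simp
  have key := det_kernel_column T Ym hTl hlast; rw [hblock, m0, hYl, hdiag, hR0] at key
  have hβp : (∏ i ∈ range M, β i)*(∏ i ∈ range M, (F.φ (z (i+1))*F.φ (z (i+1)-F.stp/2))) = ∏ i ∈ range M, G.nm l (z (i+2)) := by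
    rw [← prod_mul_distrib]; exact prod_congr rfl fun i _ => div_mul_cancel₀ _ (mul_ne_zero (hφ0 _) (hφm _))
  have hne : G.nm l (z 1)*F.P l n (z 0)*∏ i ∈ range M, G.nm l (z (i+2)) ≠ 0 :=
    mul_ne_zero (mul_ne_zero (hnm 1 (by omega)) hP) (prod_ne_zero_iff.2 fun i hi => hnm _ (by have := mem_range.1 hi; omega))
  grind

end Model

lemma prod_center (h:ℤ → ℂ) (n:ℕ) : ∏ l ∈ range (2*n+1), h (n-l) = h 0*∏ k ∈ range n, (h (k+1)*h (-(k+1))) := by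
  induction n with
  | zero => simp
  | succ n ih =>
    rw [show 2*(n+1)+1 = 2*n+1+1+1 by ring, prod_range_succ, prod_range_succ', prod_range_succ (n := n), ← mul_assoc, ← ih, mul_assoc]
    congr 1
    · simp
    · congr 2 <;> (push_cast; ring)

lemma prod_odd_even (h:ℕ → ℂ) (n:ℕ) : ∏ l ∈ range (2*n+1), h l = h 0*∏ i ∈ range n, (h (2*i+1)*h (2*i+2)) := by
  induction n with
  | zero => simp
  | succ n ih =>
    rw [show 2*(n+1)+1 = 2*n+1+1+1 by ring, prod_range_succ, prod_range_succ, ih, prod_range_succ (n := n)]; ring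

lemma phiM_add_two_chain (F:FamilyData) (M:ℕ) (x:ℂ) : phiM F (M+2) x = phiM F M x*(F.φ (cpt F.γ (M+2) x 0-F.stp/2)*∏ i ∈ range M,
      (F.φ (cpt F.γ (M+2) x (i+1))*F.φ (cpt F.γ (M+2) x (i+1)-F.stp/2))) := by
  rw [phiM_add_two]; congr 1
  have h1 := prod_center (fun l => F.φ (x+(l:ℂ)/2*F.stp)) M
  rw [prod_odd_even (fun l => F.φ (x+(((M:ℤ)-(l:ℤ):ℤ):ℂ)/2*F.stp))] at h1
  have e1 : F.φ x*∏ k ∈ range M, (F.φ (x-((k:ℂ)+1)/2*F.stp)*F.φ (x+((k:ℂ)+1)/2*F.stp)) = F.φ (x+((0:ℤ):ℂ)/2*F.stp)*∏ k ∈ range M,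
        (F.φ (x+(((k:ℤ)+1 : ℤ):ℂ)/2*F.stp)*F.φ (x+((-((k:ℤ)+1):ℤ):ℂ)/2*F.stp)) := by
    congr 1
    · congr 1; push_cast; ring
    · refine prod_congr rfl fun k _ => ?_
      push_cast; ring
  rw [e1, ← h1]; congr 1
  · congr 1; rw [cpt_eq]; push_cast; ring
  · refine prod_congr rfl fun i _ => ?_
    congr 2 <;> rw [cpt_eq] <;> push_cast <;> ring

lemma differentiable_det {n:ℕ} (A:ℂ → Matrix (Fin n) (Fin n) ℂ)
    (h:∀ i j, Differentiable ℂ fun x => A x i j) : Differentiable ℂ fun x => (A x).det := by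
  simp only [Matrix.det_apply']
  refine Differentiable.fun_sum fun σ _ => ?_
  refine Differentiable.mul (differentiable_const _) ?_
  exact Differentiable.fun_finsetProd fun i _ => h _ _

namespace Model
variable {F:FamilyData} (G:Model F)
include G

lemma det_dual_top_generic {N m M:ℕ} (n:ℕ) (h:m+1+M = N+1) (e:Fin m ⊕ Fin (M+1) ≃ Fin (N+1)) (d:Fin (M+1) → ℕ)
    (hd:∀ k, N-(e (Sum.inr k):ℕ) = d k) (g:Fin (m+1) → ℕ) (hg:∀ k : Fin m, g k.castSucc = e (Sum.inl k)) (hg':g (Fin.last m) = N+1+n) :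
    ∃ c1 c2 : ℂ, c1 ≠ 0 ∧ c2 ≠ 0 ∧ ∀ l : F.Par, GenericPar F l N n → ∀ x : ℂ, x.re ∈ F.dom →
    F.P l n (cpt F.γ (M+2) x 0) ≠ 0 → (∀ i ≤ M+1, G.nm l (cpt F.γ (M+2) x i) ≠ 0) →
    c1*((∏ k:Fin (m+1), G.lcP (lamBar F l N) (g k))*(G.dualMat l n (M+1) d x).det*Vd F (m+1) x) =
    c2*(G.lcP l n*(∏ k, (F.Et l (d k)-F.E l n))*(∏ k, G.lcT l (d k)) *
      (Matrix.of fun j k:Fin (m+1) => F.P (lamBar F l N) (g k) (cpt F.γ (m+1) x j)).det*Vd F (M+2) x) := by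
  obtain ⟨c0, hc0, hint⟩ := G.interp_coeff N n
  obtain ⟨s, hs, hcomp⟩ := interp_complement F h e
  obtain ⟨cV, hcV, hV⟩ := G.chain_Vd h
  have hb : ∏ k : Fin (M+1), G.bK N (e (Sum.inr k)) ≠ 0 := prod_ne_zero_iff.2 fun k _ => G.bK_ne (by have := (e (Sum.inr k)).2; omega)
  have hω : I*(G.ω (N+1):ℂ) ≠ 0 := mul_ne_zero I_ne_zero (by exact_mod_cast G.ω_ne _ (Nat.succ_ne_zero N))
  refine ⟨(∏ k:Fin (M+1), G.bK N (e (Sum.inr k)))*(I*G.ω (N+1))*(-1)^M*s*c0 *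
    G.vC (M+2), cV*G.vC M, ?_, mul_ne_zero hcV (G.vC_ne M), fun l hl x hx hP hnm => ?_⟩
  · exact mul_ne_zero (mul_ne_zero (mul_ne_zero (mul_ne_zero (mul_ne_zero hb hω) (pow_ne_zero _ (by norm_num))) hs) hc0) (G.vC_ne _)
  set z : ℕ → ℂ := cpt F.γ (M+2) x with hz
  set c := z 0-F.stp/2 with hc
  have hmN : m+M = N := by omega
  have hmN' : (m:ℂ)+M = N := by exact_mod_cast hmN
  have hz1 : c-F.stp/2 = z 1 := by rw [hc, hz, cpt_eq, cpt_eq]; push_cast; ring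
  have hz0 : c+F.stp/2 = z 0 := by rw [hc]; ring
  have hcx : c = x+(M:ℂ)/2*F.stp := by rw [hc, hz, cpt_eq]; push_cast; ring
  have hcre : c.re ∈ F.dom := by
    have := re_add_mul_stp F x ((M:ℝ)/2); push_cast at this; rw [hcx, this]; exact hx
  have hzM : ∀ i : ℕ, cpt F.γ M x i = z (i+1) := fun i => (cpt_add_two_succ F.γ M x i).symm
  obtain ⟨f, a, Q, hf, hQ, hQ0, -, ha⟩ := hint l hl c hcre; rw [hz1, hz0] at ha
  set lb := lamBar F l N with hlb
  -- the coefficients through θ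
  have hθ : ∀ k : Fin (M+1), ((F.κ:ℂ)^(N+1))⁻¹*(F.E lb ((e (Sum.inr k) : Fin (N+1)):ℕ)-F.E lb (N+1+n:ℕ)) = F.Et l (d k)-F.E l n := by
    intro k
    have hk := (e (Sum.inr k)).2; rw [mul_sub, G.E_bar, G.E_bar, G.Et_eq, ← hd k]; grind
  have hκ := pow_ne_zero (N+1) G.κ_ne
  have hθne : ∀ k, F.Et l (d k)-F.E l n ≠ 0 := by
    intro k; rw [← hθ]
    refine mul_ne_zero (inv_ne_zero hκ) (sub_ne_zero.2 ?_)
    exact G.E_ne _ _ hl.top _ (by have := (e (Sum.inr k)).2; omega)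
  have hφc : F.φ c ≠ 0 := G.φ_ne c hcre
  set X : Matrix (Fin (M+1)) (Fin (M+1)) ℂ := Matrix.of fun i k =>
    (Fin.cases (G.nm l (z 1)*F.P l n (z 0)*F.ξ l (d k) (z 1)-G.np l (z 0)*F.P l n (z 1)*F.ξ l (d k) (z 0))
      (fun i => (F.Et l (d k)-F.E l n)*F.ξ l (d k) (z (i+1))) i : ℂ) with hX
  have hX0 : ∀ k, X 0 k = G.nm l (z 1)*F.P l n (z 0)*F.ξ l (d k) (z 1)-G.np l (z 0)*F.P l n (z 1)*F.ξ l (d k) (z 0) := fun k => rfl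
  have hX1 : ∀ (i:Fin M) k, X i.succ k = (F.Et l (d k)-F.E l n)*F.ξ l (d k) (z (i+1)) := fun i k => rfl
  have hdT : ∀ k, F.nondegT l (d k) := fun k => hl.T _ (by rw [← hd]; exact Nat.sub_le _ _)
  have hdet := G.det_dualMat l n M d hl.P hdT x hx hP hnm X hX0 hX1
  -- the matrix of the interpolation problem
  set gk : Fin (M+1) → ℂ := fun k => G.bK N (e (Sum.inr k))/(G.lcP lb (e (Sum.inr k))*G.lcT l (d k)) with hgk
  set v : Fin (M+1) → ℂ := Fin.cons (-(f*(I*G.ω (N+1))/F.φ c)) (fun _ => 1) with hv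
  set u : Fin (M+1) → ℂ := fun k => gk k/(F.Et l (d k)-F.E l n) with hu
  clear_value X
  have hB := hcomp (fun k => G.pP lb k) (fun k => G.pP_deg _ _) (fun k y => G.bK N k/(G.lcP lb k*G.lcT l (N-k))*F.ξ l (N-k) y)
    (fun k => a k) (fun k y => F.P lb (g k) y) x (fun i y => by
      rw [(G.kernelDiag l N hl.bar hl.T).2.2]
      refine sum_congr rfl fun k _ => ?_
      rw [G.pP_coeff _ _ (hl.bar k (by omega)), G.pT_coeff _ _ (hl.T (N-k) (by omega)), G.T_eval])
    (fun k y => by rw [hg, G.P_eval])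
    (fun j => by
      have h1 : cpt F.γ (m+1) x j = cpt F.γ (N+1) c (M+j) := by rw [cpt_eq, cpt_eq, hcx]; push_cast [← hmN']; ring
      have h2 := hQ0 (M+j) (by have := j.2; omega); rw [← h1, hQ, eval_sub, sub_eq_zero, eval_finsetSum] at h2
      rw [hg', G.P_eval, h2, Finset.sum_range]
      simp)
    (Matrix.of fun i k => v i*(u k*X i k)) (fun k => by
      rw [Matrix.of_apply, hX0]
      have h1 := ha (e (Sum.inr k)) (by have := (e (Sum.inr k)).2; omega); rw [hd k] at h1
      have h2 := hθ k; rw [inv_mul_eq_iff_eq_mul₀ hκ] at h2; rw [h2] at h1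
      have h3 : v 0 = -(f*(I*G.ω (N+1))/F.φ c) := rfl; rw [h3]; simp only [hu]
      have h5 := hθne k
      rw [div_mul_eq_mul_div, mul_div_assoc', neg_mul, div_mul_eq_mul_div, ← neg_div, div_div, div_eq_iff (mul_ne_zero hφc h5)]
      refine mul_left_cancel₀ hκ ?_
      linear_combination -h1) (fun i k => by
      rw [Matrix.of_apply, hX1]
      have h3 : v i.succ = 1 := rfl
      grind)
  have hBdet : (Matrix.of fun i k => v i*(u k*X i k)).det = (-(f*(I*G.ω (N+1))/F.φ c))*((∏ k, u k)*X.det) := by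
    have h1 := Matrix.det_mul_column v (Matrix.of fun i k => u k*X i k)
    have h2 := Matrix.det_mul_row u X; rw [h2] at h1; simp only [Matrix.of_apply] at h1; rw [h1]; congr 1; rw [Fin.prod_univ_succ]
    simp [hv]
  rw [hBdet] at hB
  have hV' := hV x
  have hW := G.chainVd_ne N (m+1) M x hx
  have hlc : ∏ k : Fin (N+1), (G.pP lb k).coeff k = (∏ k:Fin m, G.lcP lb (e (Sum.inl k)))*∏ k : Fin (M+1), G.lcP lb (e (Sum.inr k)) := by
    rw [← e.prod_comp, Fintype.prod_sum_type]; congr 1 <;> exact prod_congr rfl fun k _ => G.pP_coeff _ _ (hl.bar _ (by grind))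
  rw [hlc] at hB
  have hgl : ∏ k : Fin (m+1), G.lcP lb (g k) = (∏ k:Fin m, G.lcP lb (e (Sum.inl k)))*G.lcP lb (N+1+n) := by
    rw [Fin.prod_univ_castSucc, hg']; simp only [hg]
  have hup : (∏ k, u k)*((∏ k:Fin (M+1), G.lcP lb (e (Sum.inr k)))*((∏ k, (F.Et l (d k)-F.E l n))*(∏ k, G.lcT l (d k)))) =
      ∏ k : Fin (M+1), G.bK N (e (Sum.inr k)) := by
    rw [← prod_mul_distrib, ← prod_mul_distrib, ← prod_mul_distrib]
    refine prod_congr rfl fun k _ => ?_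
    have h1 := hθne k
    have h2 : G.lcP lb (e (Sum.inr k)) ≠ 0 := G.lcP_ne _ _ (hl.bar (e (Sum.inr k)) (by have := (e (Sum.inr k)).2; omega))
    have h3 := G.lcT_ne _ _ (hdT k); simp only [hu, hgk]; field_simp
  rw [hgl, hdet, G.Vd_eq (M+2), phiM_add_two_chain]; rw [G.Vd_eq M] at hV'
  have hφc' : f*(I*G.ω (N+1))/F.φ c*F.φ c = f*(I*G.ω (N+1)) := div_mul_cancel₀ _ hφc
  change _ = _*(_*(G.vC (M+2)*(phiM F M x*(F.φ c*_))))
  refine mul_left_cancel₀ hW ?_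
  have hpow : ((-1:ℂ))^M*(-1)^(M+1) = -1 := by rw [pow_succ, ← mul_assoc, ← mul_pow]; simp
  grind

end Model

namespace Geom
variable {F:FamilyData} (G:Geom F)
include G

lemma exists_eval_ne (A:ℂ[X]) (hA:A ≠ 0) : ∃ S : Set ℝ, S.Finite ∧ ∀ x : ℂ, x.re ∈ F.dom \ S → A.eval (F.η x) ≠ 0 := by
  refine ⟨⋃ c ∈ A.roots.toFinset, {r:ℝ | r ∈ F.dom ∧ ∃ x : ℂ, x.re = r ∧ F.η x = c},
    (Finset.finite_toSet _).biUnion fun c _ => G.η_fib c, fun x hx h0 => hx.2 ?_⟩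
  simp only [Set.mem_iUnion]
  refine ⟨F.η x, ?_, hx.1, x, rfl, rfl⟩
  simp_all

end Geom

namespace Model
variable {F:FamilyData} (G:Model F)
include G

lemma E_diff_ne {N:ℕ} (n d:ℕ) (l:F.Par) (hd:d ≤ N) (h:F.nondeg (lamBar F l N) (N+1+n)) : F.Et l d-F.E l n ≠ 0 := by
  have hκ := pow_ne_zero (N+1) G.κ_ne
  have h1 := G.E_bar l N ((N-d:ℕ):ℤ)
  have h2 := G.E_bar l N ((N+1+n:ℕ):ℤ); rw [show ((N-d:ℕ):ℤ)-N-1 = -(d:ℤ)-1 by omega] at h1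
  rw [show ((N+1+n:ℕ):ℤ)-N-1 = n by push_cast; ring] at h2; rw [G.Et_eq]
  have h3 := G.E_ne _ _ h (N-d) (by omega); grind

lemma det_dual_top {N m M:ℕ} (n:ℕ) (h:m+1+M = N+1) (e:Fin m ⊕ Fin (M+1) ≃ Fin (N+1)) (d:Fin (M+1) → ℕ)
    (hd:∀ k, N-(e (Sum.inr k):ℕ) = d k) (g:Fin (m+1) → ℕ) (hg:∀ k : Fin m, g k.castSucc = e (Sum.inl k)) (hg':g (Fin.last m) = N+1+n) :
    ∃ c1 c2 : ℂ, c1 ≠ 0 ∧ c2 ≠ 0 ∧ ∀ l : F.Par, (∀ k, F.nondegT l (d k)) → F.nondeg l n →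
    (∀ k, F.nondeg (lamBar F l N) (g k)) → ∀ x : ℂ, x.re ∈ F.dom →
    F.P l n (cpt F.γ (M+2) x 0) ≠ 0 → (∀ i ≤ M+1, G.nm l (cpt F.γ (M+2) x i) ≠ 0) →
    c1*((∏ k:Fin (m+1), G.lcP (lamBar F l N) (g k))*(G.dualMat l n (M+1) d x).det*Vd F (m+1) x) =
    c2*(G.lcP l n*(∏ k, (F.Et l (d k)-F.E l n))*(∏ k, G.lcT l (d k)) *
      (Matrix.of fun j k:Fin (m+1) => F.P (lamBar F l N) (g k) (cpt F.γ (m+1) x j)).det*Vd F (M+2) x) := by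
  obtain ⟨c1, c2, h1, h2, gen⟩ := G.det_dual_top_generic n h e d hd g hg hg'
  refine ⟨c1, c2, h1, h2, fun l hT hn hP x hx hPx hnm => ?_⟩
  have hb := G.nondeg_base _ _ hn
  have hEn : ∀ᶠ t in 𝓝[≠] (0:ℝ), ∀ i ∈ range (M+2), G.nm (G.pert l t) (cpt F.γ (M+2) x i) ≠ 0 := (Finset.eventually_all _).2 fun i hi =>
      (G.nm_lim l _).eventually_ne (hnm i (by have := mem_range.1 hi; omega))
  simp only [G.Et_eq]
  refine tendsto_nhds_unique_of_eventuallyEq ((((tendsto_finsetProd univ fun k _ => G.lcP_lim _ _ (hP k)).mul (tendsto_det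
      (A := fun t => G.dualMat (G.pert l t) n (M+1) d x) (B := G.dualMat l n (M+1) d x)
      fun i j => ?_)).mul_const (Vd F (m+1) x)).const_mul c1)
    ((((((G.lcP_lim _ _ hn).mul (tendsto_finsetProd univ fun k _ =>
      (G.E_lim _ (-(d k:ℤ)-1)).sub (G.E_lim _ _))).mul
      (tendsto_finsetProd univ fun k _ => G.lcT_lim _ _ (hT k))).mul
      (tendsto_det fun i j => G.P_lim _ _ (hP j) (cpt F.γ (m+1) x i))).mul_const
      (Vd F (M+2) x)).const_mul c2) ?_
  · simp only [dualMat, Matrix.of_apply]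
    by_cases hj : (j:ℕ) < M+1
    · simp only [dif_pos hj]; exact G.T_lim _ _ (hT _) _
    · simp only [dif_neg hj]
      exact ((tendsto_finsetProd _ fun k _ => G.np_lim _ _).mul (tendsto_finsetProd _ fun k _ => G.nm_lim _ _)).mul (G.P_lim _ _ hn _)
  · filter_upwards [G.pert_gen_le l hb (N+1+n), G.pert_gen_le (lamBar F l N)
      (G.base_shift l _ hb) (N+1+n), G.pert_gen_le _ (G.base_shift l (n+1) hb) n,
      (G.P_lim l n hn _).eventually_ne hPx, hEn] with t t1 t2 t3 htP htn
    have := gen _ ⟨fun k hk => (t1 k (by omega)).2, fun k hk => by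
        rw [← G.pert_shift]; exact (t3 k hk).2, (t1 n (by omega)).1,
      fun k hk => by rw [G.lamBar_pert]; exact (t2 k (by omega)).1,
      by rw [G.lamBar_pert]; exact (t2 _ le_rfl).1⟩ x hx htP
      fun i hi => htn i (mem_range.2 (by omega))
    simp only [G.lamBar_pert, G.Et_eq] at this; exact this

lemma dualMat_diff (l:F.Par) (n M:ℕ) (d:Fin M → ℕ) : Differentiable ℂ fun x => (G.dualMat l n M d x).det := by
  have hη : ∀ j, Differentiable ℂ fun x => F.η (cpt F.γ (M+1) x j) := fun j => G.η_diff.comp (by unfold cpt; fun_prop)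
  have hpoly : ∀ (p:ℂ[X]) j, Differentiable ℂ fun x => p.eval (F.η (cpt F.γ (M+1) x j)) := fun p j => p.differentiable.comp (hη j)
  refine differentiable_det _ fun j k => ?_
  simp only [dualMat, Matrix.of_apply]
  by_cases hk : (k:ℕ) < M
  · simp only [dif_pos hk, G.T_eval]; exact hpoly _ _
  · simp only [dif_neg hk, G.P_eval]
    refine Differentiable.mul (Differentiable.mul ?_ ?_) (hpoly _ _) <;>
      refine Differentiable.fun_finsetProd fun i _ => ?_
    · exact (G.np_diff l).comp (by unfold cpt; fun_prop)
    · exact (G.nm_diff l).comp (by unfold cpt; fun_prop)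

lemma exists_P_ne (l:F.Par) (n:ℕ) (hn:F.nondeg l n) : ∃ S : Set ℝ, S.Finite ∧ ∀ x : ℂ, x.re ∈ F.dom \ S → F.P l n x ≠ 0 := by
  have hp : G.pP l n ≠ 0 := fun h0 => by
    have := G.pP_coeff l n hn; rw [h0, coeff_zero] at this; exact G.lcP_ne l n hn this.symm
  simp only [G.P_eval]; exact G.exists_eval_ne _ hp

lemma det_dual_top_poly {N m M:ℕ} (n:ℕ) (h:m+1+M = N+1) (e:Fin m ⊕ Fin (M+1) ≃ Fin (N+1)) (d:Fin (M+1) → ℕ)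
    (hd:∀ k, N-(e (Sum.inr k):ℕ) = d k) (K:List ℕ) (hKm:K.length = m+1) (hg:∀ k : Fin m, K.get (k.castSucc.cast hKm.symm) = e (Sum.inl k))
    (hg':K.get ((Fin.last m).cast hKm.symm) = N+1+n) (l:F.Par) (hT:∀ k, F.nondegT l (d k)) (hn:F.nondeg l n)
    (hP:∀ k ∈ K, F.nondeg (lamBar F l N) k) : ∃ c : ℂ, c ≠ 0 ∧ ∀ x : ℂ, (G.dualMat l n (M+1) d x).det =
      c*(phiM F (M+2) x*(G.pCas (K.map (G.pP (lamBar F l N)))).eval (F.η x)) := by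
  set g : Fin (m+1) → ℕ := fun k => K.get (k.cast hKm.symm) with hgdef
  obtain ⟨c1, c2, h1, h2, key⟩ := G.det_dual_top n h e d hd g hg hg'
  have hPg : ∀ k, F.nondeg (lamBar F l N) (g k) := fun k => hP _ (K.get_mem _)
  have hA : ∏ k : Fin (m+1), G.lcP (lamBar F l N) (g k) ≠ 0 := prod_ne_zero_iff.2 fun k _ => G.lcP_ne _ _ (hPg k)
  have hB : ∏ k, G.lcT l (d k) ≠ 0 := prod_ne_zero_iff.2 fun k _ => G.lcT_ne _ _ (hT k)
  have hθ : ∏ k, (F.Et l (d k)-F.E l n) ≠ 0 := prod_ne_zero_iff.2 fun k _ =>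
    G.E_diff_ne n (d k) l ((hd k).ge.trans (Nat.sub_le _ _)) (by rw [← hg']; exact hPg (Fin.last m))
  have hL := G.lcP_ne _ _ hn
  have i2 := pow_ne_zero ((m+1)*(m+1-1)/2) I_ne_zero
  have v1 := G.vC_ne (m+1)
  have v2 := G.vC_ne (M+2)
  obtain ⟨S1, hS1, hP1⟩ := G.exists_P_ne l n hn
  obtain ⟨S2, hS2, hnm⟩ := G.np_fin l
  set c := c2*G.lcP l n*(∏ k, (F.Et l (d k)-F.E l n))*(∏ k, G.lcT l (d k))*G.vC (M+2)/(c1*(∏ k:Fin (m+1), G.lcP (lamBar F l N) (g k)) *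
      G.vC (m+1)*I ^ ((m+1)*(m+1-1)/2)) with hc
  refine ⟨c, by positivity, fun x => ?_⟩
  refine congrFun (G.entire_eq_of_dom (S1 ∪ S2) (hS1.union hS2) (G.dualMat_diff l n (M+1) d)
    (g := fun x => c*(phiM F (M+2) x*(G.pCas (K.map (G.pP (lamBar F l N)))).eval (F.η x))) ?_ fun r hr => ?_) x
  · refine Differentiable.const_mul (Differentiable.mul (G.phiM_diff _) ?_) _
    exact (Polynomial.differentiable _).comp G.η_diff
  · have hr1 : r ∈ F.dom \ S1 := ⟨hr.1, fun h => hr.2 (Or.inl h)⟩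
    have hr2 : r ∈ F.dom \ S2 := ⟨hr.1, fun h => hr.2 (Or.inr h)⟩
    have k1 := key l hT hn hPg r (by simpa using hr.1) (hP1 _ (by rw [cpt_re]; simpa using hr1))
      (fun i _ => (hnm _ (by rw [cpt_re]; simpa using hr2)).2)
    have h3 := G.cas_P (lamBar F l N) K r
    rw [casoratian_eq_det _ _ (m+1) (by simpa using hKm) (fun k y => F.P (lamBar F l N) (g k) y) (fun k => by simp [hgdef]), hKm] at h3
    rw [G.Vd_eq, G.Vd_eq] at k1
    have p1 := G.phiM_ne (m+1) r (by simpa using hr.1)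
    have h3' := eq_div_of_mul_eq i2 ((mul_comm _ _).trans h3); rw [h3'] at k1; rw [hc]; field_simp at k1 ⊢; linear_combination k1

/-- The weight along the chain of points, relative to the shifted weight at the centre. -/
lemma nu_chain (l:F.Par) (M:ℕ) : ∃ C : ℂ, C ≠ 0 ∧ ∀ x : ℂ, F.w (F.shift l (-(M:ℤ))) x ≠ 0 → (∀ j ≤ M, F.w l (cpt F.γ (M+1) x j) ≠ 0) →
    ∀ j ≤ M, nu F l (cpt F.γ (M+1) x j) = C*(shiftProd F (G.np l) (G.nm l) (M+1) x j*nu F (F.shift l (-(M:ℤ))) x) := by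
  have climb : ∀ (x:ℂ), F.w (F.shift l (-(M:ℤ))) x ≠ 0 → ∀ k ≤ M, F.w (F.shift l (-((M-k:ℕ):ℤ))) (x+k/2*F.stp) ≠ 0 ∧
      nu F (F.shift l (-((M-k:ℕ):ℤ))) (x+k/2*F.stp) = (∏ i ∈ range k, ((F.κ:ℂ)^(M-i)*G.nm l (x+((i:ℂ)-M/2)*F.stp))) *
          nu F (F.shift l (-(M:ℤ))) x := by
    intro x hx k
    induction k with
    | zero => intro _; simpa using hx
    | succ k ih =>
      intro hk
      obtain ⟨a1, a2⟩ := ih (by omega)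
      obtain ⟨-, -, -, b4, -, b6⟩ := G.w_step _ _ a1
      rw [G.shift_shift, show -((M-k:ℕ):ℤ)+1 = -((M-(k+1):ℕ):ℤ) by omega,
        show x+k/2*F.stp+F.stp/2 = x+((k+1:ℕ):ℂ)/2*F.stp by push_cast; ring] at b4 b6
      refine ⟨b4, ?_⟩
      rw [b6, a2, prod_range_succ, G.nm_shift_neg]
      rw [show x+k/2*F.stp-((M-k:ℕ):ℂ)/2*F.stp = x+((k:ℂ)-M/2)*F.stp by rw [Nat.cast_sub (by omega)]; ring]; ring
  refine ⟨∏ i ∈ range M, (F.κ:ℂ)^(M-i), prod_ne_zero_iff.2 fun i _ => pow_ne_zero _ G.κ_ne, fun x hx hw j => ?_⟩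
  induction j with
  | zero =>
    intro _
    have h1 := (climb x hx M le_rfl).2; rw [Nat.sub_self, Nat.cast_zero, neg_zero, G.shift_zero] at h1
    have h2 : cpt F.γ (M+1) x 0 = x+M/2*F.stp := by rw [cpt_eq]; push_cast; ring
    rw [h2, h1, prod_mul_distrib, mul_assoc]; congr 2
    rw [shiftProd, prod_range_zero, one_mul, prod_Ico_eq_prod_range, ← prod_range_reflect]
    refine prod_congr rfl fun i hi => ?_
    have hi' := mem_range.1 hi; congr 1; rw [cpt_eq]
    have hc : ((M-1-i:ℕ):ℂ) = M-1-i := by rw [Nat.cast_sub (by omega), Nat.cast_sub (by omega)]; simp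
    push_cast; rw [hc]; ring
  | succ j ih =>
    intro hj
    have h1 := ih (by omega)
    obtain ⟨-, -, -, -, a5, -⟩ := G.w_step _ _ (hw j (by omega))
    obtain ⟨-, b2, -, -, -, b6⟩ := G.w_step _ _ (hw (j+1) hj)
    have h2 : cpt F.γ (M+1) x (j+1)+F.stp/2 = cpt F.γ (M+1) x j-F.stp/2 := by rw [cpt_eq, cpt_eq]; push_cast; ring
    rw [h2, a5, h1] at b6
    have h3 := shiftProd_step F (G.np l) (G.nm l) (M+1) x j (by omega)
    refine mul_left_cancel₀ b2 ?_
    rw [← b6]; linear_combination ((∏ i ∈ range M, (F.κ:ℂ)^(M-i))*nu F (F.shift l (-(M:ℤ))) x)*h3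

lemma PD_eq (l:F.Par) (D:List ℕ) (n:ℕ) : ∃ C : ℂ, C ≠ 0 ∧ ∀ x ∈ regPD F l D.length,
    PD F l D n x = C*((phiM F (D.length+1) x)⁻¹*(G.dualMat l n D.length D.get x).det) := by
  obtain ⟨C, hC, h⟩ := G.nu_chain l D.length
  refine ⟨I ^ (D.length*(D.length+1)/2)*C, mul_ne_zero (pow_ne_zero _ I_ne_zero) hC, fun x hx => ?_⟩
  obtain ⟨hx1, hx2, hx3, hx4⟩ := hx
  have hnu : nu F (F.shift l (-(D.length:ℤ))) x ≠ 0 := div_ne_zero hx3 hx2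
  have h1 : (Matrix.of fun j k:Fin (D.length+1) =>
      if h : (k:ℕ) < D.length then F.ξ l (D.get ⟨k, h⟩) (cpt F.γ (D.length+1) x j)
      else rFac F l D.length x j*F.P l n (cpt F.γ (D.length+1) x j)) =
      Matrix.of fun j k : Fin (D.length+1) => (if (k:ℕ) < D.length then 1 else C)*G.dualMat l n D.length D.get x j k := by
    ext j k; simp only [Matrix.of_apply, dualMat]
    by_cases hk : (k:ℕ) < D.length
    · simp [hk]
    · rw [dif_neg hk, dif_neg hk, if_neg hk, rFac, h x hx3 (fun j hj => (hx4 j hj).2) j (by omega)]; field_simp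
  rw [PD, h1]
  have h2 := Matrix.det_mul_row (fun k:Fin (D.length+1) => if (k:ℕ) < D.length then 1 else C) (G.dualMat l n D.length D.get x)
  rw [h2, Fin.prod_univ_castSucc]; simp; ring

theorem polyDualityOne {N:ℕ} {D:List ℕ} (h0:D ≠ []) (hD:D.Nodup) (hN:∀ d ∈ D, d ≤ N) (l:F.Par) : PolyDualityOne F l N D := by
  intro n hT hn hP
  obtain ⟨C, hC, hPD⟩ := G.PD_eq l D n
  have hcom := compl_Dbar hD hN
  obtain ⟨e, e1, e2⟩ := hcom.exists_equiv
  have hlen := hcom.length_add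
  have hdet : ∃ c : ℂ, c ≠ 0 ∧ ∀ x : ℂ, (G.dualMat l n D.length D.get x).det = c*(phiM F (D.length+1) x *
        (G.pCas ((Dbar N D ++ [N+1+n]).map (G.pP (lamBar F l N)))).eval (F.η x)) := by
    have hT' : ∀ k, F.nondegT l (D.get k) := fun k => hT _ (D.get_mem k)
    have h0' : D.length ≠ 0 := by simpa using h0
    generalize D.get = d at *
    generalize D.length = L at *
    obtain ⟨M, rfl⟩ := Nat.exists_eq_succ_of_ne_zero h0'
    refine G.det_dual_top_poly n (by omega) e d e2 (Dbar N D ++ [N+1+n]) (by simp) (fun k => ?_) ?_ l hT' hn hP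
    · simp_all
    · simp
  obtain ⟨c, hc, hdet⟩ := hdet
  refine ⟨Polynomial.C (C*c)*G.pCas ((Dbar N D ++ [N+1+n]).map (G.pP (lamBar F l N))), _, fun x hx => ?_,
    fun x hx => G.XiBar_eq _ _ x hx, C*c, mul_ne_zero hC hc, rfl⟩
  rw [hPD x hx, hdet, eval_mul, eval_C]
  have := hx.1; field_simp

end Model

/-- The vertical line through the real number `r`. -/
def vline (r:ℝ) : Set ℂ := {z | z.re = r}

@[simp]
lemma mem_vline {r:ℝ} {z:ℂ} : z ∈ vline r ↔ z.re = r := Iff.rfl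

lemma ofReal_mem_vline (r:ℝ) : (r:ℂ) ∈ vline r := Complex.ofReal_re r

lemma isPreconnected_vline (r:ℝ) : IsPreconnected (vline r) :=
  Convex.isPreconnected (convex_hyperplane (f := Complex.re) ⟨Complex.add_re, by simp⟩ r)

/-- The function is continuous and has no zeros on the vertical line through `r`. -/
structure LineReg (f:ℂ → ℂ) (r:ℝ) : Prop where
  cont : ContinuousOn f (vline r)
  ne : ∀ z ∈ vline r, f z ≠ 0

namespace LineReg
variable {f g:ℂ → ℂ} {r:ℝ}

lemma mul (hf:LineReg f r) (hg:LineReg g r) : LineReg (fun x => f x*g x) r :=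
  ⟨hf.cont.mul hg.cont, fun z hz => mul_ne_zero (hf.ne z hz) (hg.ne z hz)⟩

lemma div (hf:LineReg f r) (hg:LineReg g r) : LineReg (fun x => f x/g x) r :=
  ⟨hf.cont.div hg.cont hg.ne, fun z hz => div_ne_zero (hf.ne z hz) (hg.ne z hz)⟩

lemma const {c:ℂ} (hc:c ≠ 0) : LineReg (fun _ => c) r := ⟨continuousOn_const, fun _ _ => hc⟩

lemma add_im (hf:LineReg f r) {c:ℂ} (hc:c.re = 0) : LineReg (fun x => f (x+c)) r := by
  have hm : Set.MapsTo (fun x => x+c) (vline r) (vline r) := fun z hz => by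
    change (z+c).re = r
    rw [add_re, hc, add_zero]; exact hz
  exact ⟨hf.cont.comp (by fun_prop) hm, fun z hz => hf.ne _ (hm hz)⟩

lemma sub_im (hf:LineReg f r) {c:ℂ} (hc:c.re = 0) : LineReg (fun x => f (x-c)) r := by
  simp only [sub_eq_add_neg]; exact hf.add_im (by simpa using hc)

lemma star (hf:LineReg f r) : LineReg (starFun f) r := by
  have hm : Set.MapsTo conj (vline r) (vline r) := fun z hz => by
    change (conj z).re = r
    rw [conj_re]; exact hz
  refine ⟨continuous_conj.comp_continuousOn (hf.cont.comp continuous_conj.continuousOn hm), fun z hz => ?_⟩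
  have := hf.ne _ (hm hz); unfold starFun
  rwa [Ne, map_eq_zero]

lemma congr (hf:LineReg f r) (h:∀ z ∈ vline r, g z = f z) : LineReg g r := ⟨hf.cont.congr h, fun z hz => by rw [h z hz]; exact hf.ne z hz⟩

lemma of_entire (hf:Differentiable ℂ f) (h:∀ z ∈ vline r, f z ≠ 0) : LineReg f r := ⟨hf.continuous.continuousOn, h⟩

/-- Two functions on a vertical line with the same square that agree at the real point are
equal. -/
lemma eq_of_sq (hf:LineReg f r) (hg:LineReg g r) (hsq:∀ z ∈ vline r, f z^2 = g z^2) (h0:f r = g r) : ∀ z ∈ vline r, f z = g z :=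
  (isPreconnected_vline r).eq_of_sq_eq hf.cont hg.cont hsq (fun {z} hz => hg.ne z hz) (ofReal_mem_vline r) h0

lemma exists_vsqrt (hf:LineReg f r) : ∃ g : ℝ → ℂ, Continuous g ∧ (∀ z ∈ vline r, vsqrt f z = g z.im) ∧ g 0 = f r^(1/2:ℂ) ∧
    ∀ t : ℝ, g t^2 = f (r+t*I) := by
  have hline : ∀ t : ℝ, (r+t*I:ℂ) ∈ vline r := fun t => by
    change (r+t*I:ℂ).re = r
    simp
  have hc : Continuous fun t : ℝ => f (r+t*I) := hf.cont.comp_continuous (by fun_prop) hline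
  have hex : ∃ g : ℝ → ℂ, Continuous g ∧ g 0 = f (r:ℂ)^(1/2:ℂ) ∧ ∀ t : ℝ, g t^2 = f ((r:ℂ)+t*I) := by
    obtain ⟨h, h1, h2⟩ := Complex.exists_continuousOn_pow_eq (U := (Set.univ:Set ℝ)) (by
        have : ContractibleSpace (Set.univ:Set ℝ) := convex_univ.contractibleSpace Set.univ_nonempty
        exact SimplyConnectedSpace.ofContractible _) isOpen_univ (g := fun t : ℝ => f (r+t*I)) hc.continuousOn
      (by rintro ⟨t, -, ht⟩; exact hf.ne _ (hline t) ht) two_ne_zero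
    have h1' : Continuous h := continuousOn_univ.1 h1
    have hs : (f (r:ℂ)^(1/2:ℂ))^2 = h 0^2 := by rw [h2, ← cpow_nat_mul]; simp
    rcases sq_eq_sq_iff_eq_or_eq_neg.1 hs with h3 | h3
    · exact ⟨h, h1', h3.symm, h2⟩
    · exact ⟨fun t => -h t, h1'.neg, h3.symm, fun t => by rw [neg_sq, h2]⟩
  refine ⟨hex.choose, hex.choose_spec.1, fun z hz => ?_, hex.choose_spec.2.1, hex.choose_spec.2.2⟩
  have hz' : z.re = r := hz; subst hz'; unfold vsqrt; rw [dif_pos hex]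

lemma vsqrt_sq (hf:LineReg f r) : ∀ z ∈ vline r, vsqrt f z^2 = f z := by
  obtain ⟨g, -, h1, -, h3⟩ := hf.exists_vsqrt; intro z hz
  have hz' : z.re = r := hz; rw [h1 z hz, h3, ← hz', re_add_im]

lemma vsqrt_real (hf:LineReg f r) : vsqrt f r = f r^(1/2:ℂ) := by
  obtain ⟨g, -, h1, h2, -⟩ := hf.exists_vsqrt; rw [h1 _ (ofReal_mem_vline r), ofReal_im, h2]

lemma vsqrt_reg (hf:LineReg f r) : LineReg (vsqrt f) r := by
  obtain ⟨g, h0, h1, -, -⟩ := hf.exists_vsqrt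
  refine ⟨(h0.comp continuous_im).continuousOn.congr h1, fun z hz h => hf.ne z hz ?_⟩
  rw [← hf.vsqrt_sq z hz, h]; simp

end LineReg

/-- The complex number is a positive real number. -/
def PosR (z:ℂ) : Prop := ∃ r : ℝ, 0 < r ∧ z = r

namespace PosR
variable {z w:ℂ}

lemma ne (h:PosR z) : z ≠ 0 := by
  obtain ⟨r, hr, rfl⟩ := h
  exact_mod_cast hr.ne'

lemma one : PosR 1 := ⟨1, one_pos, by simp⟩

lemma mul (hz:PosR z) (hw:PosR w) : PosR (z*w) := by
  obtain ⟨a, ha, rfl⟩ := hz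
  obtain ⟨b, hb, rfl⟩ := hw; exact ⟨a*b, mul_pos ha hb, by push_cast; ring⟩

lemma inv (hz:PosR z) : PosR z⁻¹ := by
  obtain ⟨a, ha, rfl⟩ := hz; exact ⟨a⁻¹, inv_pos.2 ha, by push_cast; ring⟩

lemma div (hz:PosR z) (hw:PosR w) : PosR (z/w) := by rw [div_eq_mul_inv]; exact hz.mul hw.inv

lemma pow (hz:PosR z) (n:ℕ) : PosR (z^n) := by
  obtain ⟨a, ha, rfl⟩ := hz; exact ⟨a^n, pow_pos ha n, by push_cast; ring⟩

lemma prod {ι:Type*} (s:Finset ι) {f:ι → ℂ} (h:∀ i ∈ s, PosR (f i)) : PosR (∏ i ∈ s, f i) := by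
  classical
  induction s using Finset.induction_on with
  | empty => simpa using one
  | insert a s ha ih =>
    rw [prod_insert ha]; exact (h a (mem_insert_self a s)).mul (ih fun i hi => h i (mem_insert_of_mem hi))

lemma rpow (hz:PosR z) (a:ℝ) : PosR (z^(a:ℂ)) := by
  obtain ⟨r, hr, rfl⟩ := hz; exact ⟨r^a, Real.rpow_pos_of_pos hr a, (ofReal_cpow hr.le a).symm⟩

lemma sqrt (hz:PosR z) : PosR (z^(1/2:ℂ)) := by
  have := hz.rpow (1/2); push_cast at this; exact this

lemma sqrt_sq (z:ℂ) : (z^(1/2:ℂ))^2 = z := by rw [← cpow_nat_mul]; simp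

lemma conj_mul (hz:z ≠ 0) : PosR (conj z*z) := ⟨normSq z, normSq_pos.2 hz, by rw [mul_comm, mul_conj]⟩

lemma mul_conj (hz:z ≠ 0) : PosR (z*conj z) := by rw [mul_comm]; exact conj_mul hz

lemma eq_of_pow (hz:PosR z) (hw:PosR w) {n:ℕ} (hn:n ≠ 0) (h:z^n = w^n) : z = w := by
  obtain ⟨a, ha, rfl⟩ := hz
  obtain ⟨b, hb, rfl⟩ := hw; congr 1; exact (pow_left_inj₀ ha.le hb.le hn).1 (by exact_mod_cast h)

lemma conj_eq (hz:PosR z) : conj z = z := by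
  obtain ⟨a, -, rfl⟩ := hz; exact conj_ofReal a

/-- A real number with a positive square root of its square is nonzero; here in the form: a
self-conjugate number whose square is positive. -/
lemma real_of_sq (h:PosR (z^2)) : conj z = z := by
  obtain ⟨a, ha, h⟩ := h
  have h1 : z^2 = ((Real.sqrt a:ℝ):ℂ)^2 := by rw [h, ← ofReal_pow, Real.sq_sqrt ha.le]
  rcases sq_eq_sq_iff_eq_or_eq_neg.1 h1 with h2 | h2 <;> rw [h2] <;> simp

end PosR

lemma vsqrt_pos {f:ℂ → ℂ} {r:ℝ} (hf:LineReg f r) (h:PosR (f r)) : PosR (vsqrt f r) := by rw [hf.vsqrt_real]; exact h.sqrt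

lemma vsqrt_conj {f:ℂ → ℂ} {r:ℝ} (hf:LineReg f r) (h:PosR (f r)) (hc:∀ z, conj (f z) = f (conj z)) :
    ∀ z ∈ vline r, conj (vsqrt f z) = vsqrt f (conj z) := by
  have h1 := hf.vsqrt_reg.star.eq_of_sq hf.vsqrt_reg (fun z hz => by
    have hz' : conj z ∈ vline r := by
      change (conj z).re = r
      rw [conj_re]; exact hz
    rw [starFun, ← map_pow, hf.vsqrt_sq _ hz', hf.vsqrt_sq z hz, hc, conj_conj]) (by
    rw [starFun, conj_ofReal, (vsqrt_pos hf h).conj_eq])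
  intro z hz
  have hz' : conj z ∈ vline r := by
    change (conj z).re = r
    rw [conj_re]; exact hz
  rw [← h1 _ hz', starFun, conj_conj]

/-- The two Schrödinger operators with potentials `V̂` and `U`, where `V̂` is `κ'` times the star of
`U`, moved by half a step. -/
lemma opA_opAdag_eq {γ:ℝ} {V U:ℂ → ℂ} {r:ℝ} {k:ℝ} (hk:0 < k) (hV:LineReg V r)
    (hU:LineReg U r) (h:∀ z ∈ vline r, V z = k*starFun U (z-I*(γ/2))) (f:ℂ → ℂ) (x:ℂ) (hx:x ∈ vline r) :
    opA γ V (opAdag γ V f) x = k*opAdag γ U (opA γ U f) x := by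
  have hre : ∀ c : ℝ, (I*(c:ℂ)).re = 0 := fun c => by simp
  have hhalf : (I*((γ:ℂ)/2)).re = 0 := by have := hre (γ/2); push_cast at this; exact this
  have hconj : ∀ z, conj (z-I*((γ:ℂ)/2)) = conj z+I*((γ:ℂ)/2) := fun z => by simp [Complex.conj_ofNat]
  have hm : ∀ z ∈ vline r, ∀ c : ℂ, c.re = 0 → z+c ∈ vline r := fun z hz c hc => by
    change (z+c).re = r
    rw [add_re, hc, add_zero]; exact hz
  have hm' : ∀ z ∈ vline r, ∀ c : ℂ, c.re = 0 → z-c ∈ vline r := fun z hz c hc => by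
    change (z-c).re = r
    rw [sub_re, hc, sub_zero]; exact hz
  have hmc : ∀ z ∈ vline r, conj z ∈ vline r := fun z hz => by
    change (conj z).re = r
    rw [conj_re]; exact hz
  have v1 := hV.vsqrt_reg
  have u1 := hU.vsqrt_reg
  have sv : ∀ z ∈ vline r, starFun (vsqrt V) z^2 = k*U (z+I*(γ/2)) := by
    intro z hz
    rw [starFun, ← map_pow, hV.vsqrt_sq _ (hmc z hz), h _ (hmc z hz), starFun, map_mul, conj_ofReal, conj_conj, map_sub, conj_conj]
    congr 2; simp [Complex.conj_ofNat]
  have su : ∀ z ∈ vline r, starFun (vsqrt U) z^2 = starFun U z := by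
    intro z hz; rw [starFun, ← map_pow, hU.vsqrt_sq _ (hmc z hz), starFun]
  have key : ∀ z ∈ vline r, vsqrt V z*starFun (vsqrt V) z = k*(vsqrt U (z+I*(γ/2))*starFun (vsqrt U) (z-I*(γ/2))) := by
    refine LineReg.eq_of_sq (v1.mul v1.star) ((LineReg.const (by exact_mod_cast hk.ne')).mul
      ((u1.add_im hhalf).mul (u1.star.sub_im hhalf))) ?_ ?_
    · intro z hz
      rw [mul_pow, mul_pow, mul_pow, hV.vsqrt_sq z hz, sv z hz, su _ (hm' z hz _ hhalf), hU.vsqrt_sq _ (hm z hz _ hhalf), h z hz]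
      ring
    · have hr := ofReal_mem_vline r
      refine PosR.eq_of_pow (n := 2) ?_ ?_ two_ne_zero ?_
      · rw [starFun, conj_ofReal]; exact PosR.mul_conj (v1.ne _ hr)
      · refine PosR.mul ⟨k, hk, rfl⟩ ?_
        rw [starFun, hconj, conj_ofReal]; exact PosR.mul_conj (u1.ne _ (hm _ hr _ hhalf))
      · rw [mul_pow, mul_pow, mul_pow, hV.vsqrt_sq _ hr, sv _ hr, su _ (hm' _ hr _ hhalf), hU.vsqrt_sq _ (hm _ hr _ hhalf), h _ hr]
        ring
  have xm := hm' x hx _ hhalf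
  have xp := hm x hx _ hhalf
  have k1 := key _ xm
  have k2 := key _ xp
  have d1 := sv _ xm
  have d2 := hV.vsqrt_sq _ xp
  have d3 := hU.vsqrt_sq x hx
  have d4 := su x hx; rw [h _ xp, add_sub_cancel_right] at d2; rw [sub_add_cancel] at k1 d1; rw [add_sub_cancel_right] at k2
  simp only [opA, opAdag]; rw [sub_add_cancel, add_sub_cancel_right]; grind

lemma linearIndependent_of_coeff {N:ℕ} (p:ℕ → ℂ[X]) (hp:∀ k ≤ N, (p k).natDegree ≤ k ∧ (p k).coeff k ≠ 0) {m:ℕ} (d:Fin m → ℕ)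
    (hd:Function.Injective d) (hN:∀ k, d k ≤ N) : LinearIndependent ℂ fun k => p (d k) := by
  let S : Polynomial.Sequence ℂ :=
    { elems' := fun k => if k ≤ N then p k else X^k
      degree_eq' := fun k => by
        by_cases hk : k ≤ N
        · simp only [if_pos hk]
          refine le_antisymm (degree_le_of_natDegree_le (hp k hk).1) (le_degree_of_ne_zero (hp k hk).2)
        · simp only [if_neg hk]
          exact degree_X_pow k }
  have h := S.linearIndependent.comp d hd
  have h2 : (fun k => p (d k)) = S ∘ d := funext fun k => (if_pos (hN k)).symm
  rw [h2]; exact h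

namespace Geom
variable {F:FamilyData} (G:Geom F)
include G

/-- The Casoratian of linearly independent polynomials in `η` does not vanish identically. -/
lemma exists_det_ne (m:ℕ) (p:Fin m → ℂ[X]) (hp:LinearIndependent ℂ p) : ∃ S : Set ℝ, S.Finite ∧ ∀ x : ℂ, x.re ∈ F.dom \ S →
      (Matrix.of fun j k:Fin m => (p k).eval (F.η (cpt F.γ m x j))).det ≠ 0 := by
  induction m with
  | zero => exact ⟨∅, Set.finite_empty, fun x _ => by simp⟩
  | succ m ih =>
    obtain ⟨S, hS, hne⟩ := ih (fun k => p k.castSucc) (hp.comp _ (Fin.castSucc_injective m))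
    obtain ⟨A, hA⟩ := G.exists_det_eq (m+1) p
    suffices hA0 : A ≠ 0 by
      obtain ⟨S', hS', h'⟩ := G.exists_eval_ne A hA0
      exact ⟨S', hS', fun x hx => by rw [hA]; exact mul_ne_zero (h' x hx) (G.Vd_ne _ x hx.1)⟩
    rintro rfl
    obtain ⟨r, hr⟩ := G.exists_dom S hS
    set y : ℕ → ℂ := fun n => r-n*F.stp with hy
    have hyre : ∀ (n:ℕ) (t:ℝ), (y n-t*F.stp).re = r := fun n t => by
      have := re_add_mul_stp F r (-n-t); rw [ofReal_re, ofReal_sub, ofReal_neg, ofReal_natCast] at this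
      rw [← this, hy]; congr 1; ring
    have hrow : ∀ (n m:ℕ) (j:ℕ), cpt F.γ m (y n-(((m:ℝ)-1)/2 : ℝ)*F.stp) j = y (n+j) := fun n m j => by rw [cpt_eq, hy]; push_cast; ring
    have hinv : ∀ n, (Matrix.of fun j k:Fin m =>
        (p k.castSucc).eval (F.η (y (n+j)))).det ≠ 0 := fun n => by
      have := hne (y n-(((m:ℝ)-1)/2 : ℝ)*F.stp) (by rw [hyre]; exact hr); simp_all
    have hdep : ∀ n, ∃ v : Fin (m+1) → ℂ, v (Fin.last m) = 1 ∧ ∀ j : Fin (m+1), ∑ k, (p k).eval (F.η (y (n+j)))*v k = 0 := by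
      intro n
      have h0 := hA (y n-((((m+1:ℕ):ℝ)-1)/2 : ℝ)*F.stp); simp only [hrow, eval_zero, zero_mul] at h0
      obtain ⟨v, hv, hv0⟩ := Matrix.exists_mulVec_eq_zero_iff.2 h0
      have hv0' : ∀ j : Fin (m+1), ∑ k, (p k).eval (F.η (y (n+j)))*v k = 0 := fun j => congrFun hv0 j
      have hl : v (Fin.last m) ≠ 0 := by
        intro hl
        refine hv ?_
        have h1 : (fun k:Fin m => v k.castSucc) = 0 := by
          by_contra hne'
          refine hinv n (Matrix.exists_mulVec_eq_zero_iff.1 ⟨_, hne', ?_⟩)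
          ext j
          have := hv0' j.castSucc; rw [Fin.sum_univ_castSucc, hl, mul_zero, add_zero] at this; exact this
        ext k
        refine Fin.lastCases hl (fun k => congrFun h1 k) k
      refine ⟨fun k => v k/v (Fin.last m), div_self hl, fun j => ?_⟩
      simp only [← mul_div_assoc]; rw [← sum_div, hv0', zero_div]
    choose v hv1 hv2 using hdep
    have hstep : ∀ n, v (n+1) = v n := by
      intro n
      have h1 : (fun k:Fin m => v (n+1) k.castSucc-v n k.castSucc) = 0 := by
        by_contra hne'
        refine hinv (n+1) (Matrix.exists_mulVec_eq_zero_iff.1 ⟨_, hne', ?_⟩)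
        ext j
        have a1 := hv2 (n+1) j.castSucc
        have a2 := hv2 n j.succ; rw [Fin.sum_univ_castSucc, hv1] at a1 a2
        rw [Fin.val_succ, show n+((j:ℕ)+1) = n+1+j by ring] at a2
        change ∑ k : Fin m, _*(_-_) = 0
        simp only [mul_sub, sum_sub_distrib]; simp only [Fin.val_castSucc] at a1
        change ∑ k : Fin m, eval (F.η (y (n+1+j))) (p k.castSucc)*_-∑ k : Fin m, eval (F.η (y (n+1+j))) (p k.castSucc)*_ = 0
        linear_combination a1-a2
      ext k
      refine Fin.lastCases (by rw [hv1, hv1]) (fun k => sub_eq_zero.1 (congrFun h1 k)) k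
    have hconst : ∀ n, v n = v 0 := fun n => by
      induction n with
      | zero => rfl
      | succ n ih => rw [hstep, ih]
    set g : ℂ[X] := ∑ k, v 0 k • p k with hg
    have hg0 : g = 0 := by
      refine eq_zero_of_natDegree_lt_card_of_eval_eq_zero g (f := fun j : Fin (g.natDegree+1) => F.η (cpt F.γ (g.natDegree+1)
          (y 0-((((g.natDegree+1:ℕ):ℝ)-1)/2 : ℝ)*F.stp) j))
        (G.cpt_η_injective _ _ (by rw [hyre]; exact hr.1)) (fun j => ?_) (by simp)
      have h1 : ∀ c, g.eval c = ∑ k, (p k).eval c*v 0 k := fun c => by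
        rw [hg, eval_finsetSum]; exact sum_congr rfl fun k _ => by rw [eval_smul, smul_eq_mul, mul_comm]
      have h2 := hv2 j 0; rw [hconst, Fin.val_zero, add_zero] at h2; rw [hrow, h1, zero_add, h2]
    have := Fintype.linearIndependent_iff.1 hp (v 0) hg0 (Fin.last m); rw [hv1] at this; exact one_ne_zero this

lemma pCas_ne_zero (L:List ℂ[X]) (hL:LinearIndependent ℂ L.get) : G.pCas L ≠ 0 := by
  intro h0
  obtain ⟨S, hS, h⟩ := G.exists_det_ne _ L.get hL
  obtain ⟨r, hr⟩ := G.exists_dom S hS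
  have h1 := G.pCas_spec L r; rw [h0, eval_zero, mul_zero, casoratian_map] at h1; simp_all

omit G in
lemma cpt_conj (n:ℕ) (x:ℂ) (j:Fin n) : conj (cpt F.γ n x j) = cpt F.γ n (conj x) (Fin.revPerm j) := by
  have h : ((Fin.rev j:Fin n):ℕ)+j+1 = n := by rw [Fin.val_rev]; omega
  have h' : ((Fin.rev j:Fin n):ℂ) = n-j-1 := by rw [eq_sub_iff_add_eq, eq_sub_iff_add_eq]; exact_mod_cast (by omega)
  rw [Fin.revPerm_apply]; unfold cpt
  simp only [map_mul, map_sub, map_add, conj_I, conj_ofReal, map_div₀, map_natCast, Complex.conj_ofNat, map_one]; rw [h']; ring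

lemma det_conj (n:ℕ) (p:Fin n → ℂ[X]) (hp:∀ k, (p k).map conj = p k) (x:ℂ) :
    conj (Matrix.of fun j k:Fin n => (p k).eval (F.η (cpt F.γ n x j))).det =
      ((Equiv.Perm.sign (Fin.revPerm:Equiv.Perm (Fin n)):ℤ):ℂ)*(Matrix.of fun j k:Fin n =>
        (p k).eval (F.η (cpt F.γ n (conj x) j))).det := by
  rw [← Matrix.det_permute, RingHom.map_det]; congr 1; ext j k
  simp only [RingHom.mapMatrix_apply, Matrix.map_apply, Matrix.of_apply, Matrix.submatrix_apply, id]
  rw [← cpt_conj, G.η_conj, ← eval_map_apply, hp]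

lemma pCas_conj (L:List ℂ[X]) (hL:∀ p ∈ L, p.map conj = p) : (G.pCas L).map conj = G.pCas L := by
  have hd := G.det_conj L.length L.get (fun k => hL _ (L.get_mem k))
  have hv := G.det_conj L.length (fun k => X^(k:ℕ)) (fun k => by simp)
  refine G.poly_eq_of_dom ∅ Set.finite_empty _ _ fun x hx => ?_
  have hx' : (x:ℂ).re ∈ F.dom := by simpa using hx.1
  have h1 := G.pCas_spec L x; rw [casoratian_map] at h1
  have hV : (Matrix.of fun j k:Fin L.length =>
      ((X:ℂ[X])^(k:ℕ)).eval (F.η (cpt F.γ L.length x j))).det = Vd F L.length x := by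
    simp only [eval_pow, eval_X]; rfl
  have e1 := hd x
  have e2 := hv x; rw [conj_ofReal] at e1 e2; rw [hV] at e2
  have hV0 := G.Vd_ne L.length x hx'
  have hphi := G.phiM_ne L.length x hx'
  have hI := pow_ne_zero (L.length*(L.length-1)/2) I_ne_zero
  have hvC := G.vC_ne L.length
  have h2 : (Matrix.of fun j k:Fin L.length => (L.get k).eval (F.η (cpt F.γ L.length x j))).det = Vd F L.length x*((G.pCas L).eval (F.η x) /
        (I ^ (L.length*(L.length-1)/2)*G.vC L.length)) := by
    rw [G.Vd_eq]; field_simp; linear_combination h1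
  have hreal : conj (I ^ (L.length*(L.length-1)/2)*G.vC L.length) = I ^ (L.length*(L.length-1)/2)*G.vC L.length := by
    have h3 : I ^ (L.length*(L.length-1)/2) = pairProd (fun _ _ => I) L.length := by
      unfold pairProd; simp only [prod_const, card_range]; rw [prod_pow_eq_pow_sum, sum_range_id]
    rw [vC, h3, ← pairProd_mul]; unfold pairProd; simp
  rw [h2, map_mul, map_div₀, hreal, e2, ← mul_assoc] at e1
  have h4 : ((Equiv.Perm.sign (Fin.revPerm:Equiv.Perm (Fin L.length)):ℤ):ℂ) ≠ 0 := sign_ne_zero _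
  have h5 := mul_left_cancel₀ (mul_ne_zero h4 hV0) e1; rw [div_left_inj' (mul_ne_zero hI hvC)] at h5
  have h6 : F.η (x:ℂ) = conj (F.η x) := by rw [← G.η_conj, conj_ofReal]
  rw [h6, eval_map_apply, h5, ← h6]

end Geom

/-- The product of the values of a function at the points `x_1^{(n)}, …, x_n^{(n)}`. -/
def cprod (F:FamilyData) (h:ℂ → ℂ) (n:ℕ) (x:ℂ) : ℂ := ∏ j ∈ range n, h (cpt F.γ n x j)

lemma cprod_succ (F:FamilyData) (h:ℂ → ℂ) (n:ℕ) (x:ℂ) : cprod F h (n+1) x = cprod F h n (x+F.stp/2)*h (x-(n:ℂ)/2*F.stp) := by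
  unfold cprod; rw [prod_range_succ]; congr 1
  · refine prod_congr rfl fun j _ => ?_
    congr 1; rw [cpt_eq, cpt_eq]; push_cast; ring
  · congr 1; rw [cpt_eq]; push_cast; ring

lemma cprod_succ' (F:FamilyData) (h:ℂ → ℂ) (n:ℕ) (x:ℂ) : cprod F h (n+1) x = cprod F h n (x-F.stp/2)*h (x+(n:ℂ)/2*F.stp) := by
  unfold cprod; rw [prod_range_succ']; congr 1
  · refine prod_congr rfl fun j _ => ?_
    congr 1; rw [cpt_eq, cpt_eq]; push_cast; ring
  · congr 1; rw [cpt_eq]; push_cast; ring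

lemma phiM_succ (F:FamilyData) (n:ℕ) (x:ℂ) : phiM F (n+1) x = phiM F n (x+F.stp/2)*∏ i ∈ range n, F.φ (x-(i:ℂ)/2*F.stp) := by
  rw [← pairProd_phi, ← pairProd_phi, pairProd_succ]; grind

lemma phiM_succ' (F:FamilyData) (n:ℕ) (x:ℂ) : phiM F (n+1) x = phiM F n (x-F.stp/2)*∏ i ∈ range n, F.φ (x+(i:ℂ)/2*F.stp) := by
  rw [← pairProd_phi, ← pairProd_phi, pairProd_succ', mul_comm]; congr 1
  · grind
  · rw [← prod_range_reflect]
    refine prod_congr rfl fun i hi => ?_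
    have h1 : ((n-1-i:ℕ):ℂ) = n-1-i := by
      have := mem_range.1 hi; rw [Nat.cast_sub (by omega), Nat.cast_sub (by omega)]; simp
    congr 1; push_cast; rw [h1]; ring

lemma casoratian_mul (F:FamilyData) (g:ℂ → ℂ) (f:ℕ → ℂ → ℂ) (D:List ℕ) (x:ℂ) : casoratian F.γ (D.map fun d x => g x*f d x) x =
      cprod F g D.length x*casoratian F.γ (D.map f) x := by
  rw [casoratian_map, casoratian_map]
  have := Matrix.det_mul_column (fun j:Fin D.length => g (cpt F.γ D.length x j))
    (Matrix.of fun j k:Fin D.length => f (D.get k) (cpt F.γ D.length x j))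
  simp only [Matrix.of_apply] at this; rw [this, cprod, Finset.prod_range]; ring

lemma prod_telescope_two (h:ℕ → ℂ) (n:ℕ) : (∏ i ∈ range n, h (i+2))*(h 0*h 1) = (∏ i ∈ range n, h i)*(h n*h (n+1)) := by
  induction n with
  | zero => simp
  | succ n ih => rw [prod_range_succ, prod_range_succ]; linear_combination h (n+2)*ih

namespace Geom
variable {F:FamilyData} (G:Geom F)
include G

lemma potential_ratio {r:ℝ} (hr:r ∈ F.dom) (h:ℂ → ℂ) (hh:∀ z ∈ vline r, h z ≠ 0) (n:ℕ) (x:ℂ) (hx:x ∈ vline r) (a1 a2 a3 a4:ℂ) :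
    cprod F h n (x+F.stp/2)*(phiM F n (x+F.stp/2)*a1)/(cprod F h n (x-F.stp/2)*(phiM F n (x-F.stp/2)*a2)) *
    (cprod F h (n+1) (x-F.stp)*(phiM F (n+1) (x-F.stp)*a3)/(cprod F h (n+1) x*(phiM F (n+1) x*a4))) =
    h (x-((n:ℂ)/2+1)*F.stp)/h (x-(n:ℂ)/2*F.stp)*(F.φ (x-(n:ℂ)/2*F.stp)*F.φ (x-((n:ℂ)+1)/2*F.stp) /
        (F.φ x*F.φ (x-F.stp/2)))*(a1/a2)*(a3/a4) := by
  have hline : ∀ t : ℝ, x+t*F.stp ∈ vline r := fun t => by simpa [FamilyData.stp] using hx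
  have hdom : ∀ t : ℝ, (x+t*F.stp).re ∈ F.dom := fun t => by
    have : (x+t*F.stp).re = r := hline t; rw [this]; exact hr
  have hxp : (x+F.stp/2).re ∈ F.dom := by
    have := hdom (1/2); push_cast at this; grind
  have hxm : (x-F.stp/2).re ∈ F.dom := by
    have := hdom (-1/2); push_cast at this; grind
  have hx0 : x.re ∈ F.dom := by simpa using hdom 0
  have hc : ∀ y : ℂ, y.re = x.re → cprod F h n y ≠ 0 := fun y hy =>
    prod_ne_zero_iff.2 fun j _ => hh _ (by
      change (cpt F.γ n y j).re = r
      rw [cpt_re, hy]; exact hx)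
  have c1 := hc (x+F.stp/2) (by simp [stp_re])
  have c2 := hc (x-F.stp/2) (by simp [stp_re])
  have p1 := G.phiM_ne n _ hxp
  have p2 := G.phiM_ne n _ hxm
  have f0 := G.φ_ne _ hx0
  have f1 := G.φ_ne _ hxm
  have h0 : h (x-(n:ℂ)/2*F.stp) ≠ 0 := by
    have := hh _ (hline (-n/2)); push_cast at this; grind
  have hprod : ∏ i ∈ range n, F.φ (x-(i:ℂ)/2*F.stp) ≠ 0 := prod_ne_zero_iff.2 fun i _ =>
    G.φ_ne _ (by
      have := hdom (-i/2); push_cast at this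
      grind)
  have htel := prod_telescope_two (fun i => F.φ (x-(i:ℂ)/2*F.stp)) n
  have e0 : x-((0:ℕ):ℂ)/2*F.stp = x := by simp
  have e1 : x-((1:ℕ):ℂ)/2*F.stp = x-F.stp/2 := by push_cast; ring
  have e2 : ∏ i ∈ range n, F.φ (x-((i+2:ℕ):ℂ)/2*F.stp) = ∏ i ∈ range n, F.φ (x-F.stp-(i:ℂ)/2*F.stp) :=
    prod_congr rfl fun i _ => by congr 1; push_cast; ring
  simp only [e0, e1, e2] at htel; push_cast at htel
  rw [cprod_succ, cprod_succ, phiM_succ, phiM_succ,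
    show x-F.stp+F.stp/2 = x-F.stp/2 by ring,
    show x-F.stp-(n:ℂ)/2*F.stp = x-((n:ℂ)/2+1)*F.stp by ring]
  rcases eq_or_ne a2 0 with rfl | ha2
  · simp
  rcases eq_or_ne a4 0 with rfl | ha4
  · simp
  generalize (∏ i ∈ range n, F.φ (x-F.stp-(i:ℂ)/2*F.stp)) = Q at *
  generalize (∏ i ∈ range n, F.φ (x-(i:ℂ)/2*F.stp)) = R at *
  generalize cprod F h n (x+F.stp/2) = C1 at *
  generalize cprod F h n (x-F.stp/2) = C2 at *
  generalize phiM F n (x+F.stp/2) = P1 at *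
  generalize phiM F n (x-F.stp/2) = P2 at *
  generalize F.φ (x-F.stp/2) = B1 at *
  generalize F.φ (x-(n:ℂ)/2*F.stp) = B2 at *
  generalize F.φ (x-((n:ℂ)+1)/2*F.stp) = B3 at *
  generalize h (x-(n:ℂ)/2*F.stp) = H0 at *
  generalize h (x-((n:ℂ)/2+1)*F.stp) = H1 at *
  field_simp; linear_combination a1*H1*a3*htel

end Geom

/-- The models with the reality and positivity properties in the parameter range. -/
structure AdmModel (F:FamilyData) extends Model F where
  adm_shift : ∀ l, F.adm l → F.adm (F.shift l 1)
  np_conj : ∀ l, F.adm l → ∀ x, conj (np l x) = nm l (conj x)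
  E_real : ∀ l, F.adm l → ∀ n, conj (F.E l n) = F.E l n
  lcP_real : ∀ l, F.adm l → ∀ n, conj (lcP l n) = lcP l n
  lcT_real : ∀ l, F.adm l → ∀ n, conj (lcT l n) = lcT l n
  w_pos : ∀ l, F.adm l → ∀ r ∈ F.dom, PosR (F.w l (r:ℂ))
  w_conj : ∀ l, F.adm l → ∀ x, conj (F.w l x) = F.w l (conj x)
  w_line : ∀ l, F.adm l → ∃ S : Set ℝ, S.Finite ∧ ∀ r ∈ F.dom \ S, LineReg (F.w l) r
  adm_nondeg : ∀ l, F.adm l → ∀ n, F.nondeg l n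
  adm_nondegT : ∀ l N, F.adm (lamBar F l N) → ∀ v ≤ N, F.nondegT l v

/-- The vertical line through `r` avoids the zeros and singularities of the weight and of the
potential functions. -/
structure Model.Good {F:FamilyData} (G:Model F) (l:F.Par) (r:ℝ) : Prop where
  dom : r ∈ F.dom
  w : LineReg (F.w l) r
  np : LineReg (G.np l) r
  nm : LineReg (G.nm l) r

namespace AdmModel
variable {F:FamilyData} (G:AdmModel F)
include G

lemma exists_good (l:F.Par) (hl:F.adm l) : ∃ S : Set ℝ, S.Finite ∧ ∀ r ∈ F.dom \ S, G.Good l r := by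
  obtain ⟨S, hS, h⟩ := G.w_line l hl
  obtain ⟨S', hS', h'⟩ := G.np_fin l
  refine ⟨S ∪ S', hS.union hS', fun r hr => ?_⟩
  have h2 : r ∈ F.dom \ S' := ⟨hr.1, fun h => hr.2 (Or.inr h)⟩
  have h3 : ∀ z ∈ vline r, z.re ∈ F.dom \ S' := fun z hz => by
    have : z.re = r := hz; rw [this]; exact h2
  exact ⟨hr.1, h r ⟨hr.1, fun h => hr.2 (Or.inl h)⟩, LineReg.of_entire (G.np_diff l) fun z hz => (h' z (h3 z hz)).1,
    LineReg.of_entire (G.nm_diff l) fun z hz => (h' z (h3 z hz)).2⟩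

lemma adm_shift_nat (l:F.Par) (hl:F.adm l) (k:ℕ) : F.adm (F.shift l k) := by
  induction k with
  | zero => simpa [G.shift_zero] using hl
  | succ k ih =>
    have := G.adm_shift _ ih; rw [G.shift_shift] at this
    exact_mod_cast this

end AdmModel

namespace Model
variable {F:FamilyData} {G:Model F} {l:F.Par} {r:ℝ}

lemma half_re (F:FamilyData) : (F.stp/2).re = 0 := by
  have := re_add_mul_stp F 0 (1/2); simp_all

lemma phi_reg (G:Model F) (hr:r ∈ F.dom) : LineReg F.φ r := LineReg.of_entire G.φ_diff fun z hz => G.φ_ne z (by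
    have : z.re = r := hz
    rw [this]; exact hr)

namespace Good

lemma V_reg (h:G.Good l r) : LineReg (F.V l) r := (h.np.div ((G.phi_reg h.dom).mul ((G.phi_reg h.dom).sub_im (half_re F)))).congr
    fun z _ => G.V_eq l z

lemma nu_step (h:G.Good l r) (u:ℂ) (hu:u ∈ vline r) : G.np l u*nu F l u = G.nm l (u-F.stp)*nu F l (u-F.stp) := by
  have hu' : u-F.stp ∈ vline r := by simpa [FamilyData.stp] using hu
  obtain ⟨-, -, -, -, a, -⟩ := G.w_step _ _ (h.w.ne u hu)
  obtain ⟨-, -, -, -, -, b⟩ := G.w_step _ _ (h.w.ne _ hu'); rw [← a, ← b]; congr 1; ring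

end Good
end Model

namespace AdmModel
variable {F:FamilyData} {G:AdmModel F} {l:F.Par} {r:ℝ}

lemma phi0_sq (h:G.Good l r) : ∀ z ∈ vline r, phi0 F l z^2 = F.w l z := h.w.vsqrt_sq

lemma phi0_reg (h:G.Good l r) : LineReg (phi0 F l) r := h.w.vsqrt_reg

lemma phi0_pos (hl:F.adm l) (h:G.Good l r) : PosR (phi0 F l r) := vsqrt_pos h.w (G.w_pos l hl r h.dom)

lemma phi0_conj (hl:F.adm l) (h:G.Good l r) : ∀ z ∈ vline r, conj (phi0 F l z) = phi0 F l (conj z) :=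
  vsqrt_conj h.w (G.w_pos l hl r h.dom) (G.w_conj l hl)

lemma phi_pos (G:AdmModel F) (hr:r ∈ F.dom) : PosR (F.φ r) := by
  obtain ⟨t, ht, h⟩ := G.φ_pos r hr; exact ⟨t, ht, h⟩

lemma phiT0_reg (h:G.Good l r) : LineReg (phiT0 F l) r := (G.phi_reg h.dom).div (phi0_reg h)

lemma phiT0_pos (hl:F.adm l) (h:G.Good l r) : PosR (phiT0 F l r) := (G.phi_pos h.dom).div (phi0_pos hl h)

lemma phiT0_conj (hl:F.adm l) (h:G.Good l r) : ∀ z ∈ vline r, conj (phiT0 F l z) = phiT0 F l (conj z) := by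
  intro z hz; rw [phiT0, map_div₀, ← G.φ_conj, phi0_conj hl h z hz, phiT0]

lemma starV (hl:F.adm l) (x:ℂ) (G:AdmModel F) : starFun (F.V l) x = G.nm l x/(F.φ x*F.φ (x+F.stp/2)) := by
  unfold starFun
  rw [G.V_eq, map_div₀, map_mul, G.np_conj l hl, conj_conj, ← G.φ_conj, ← G.φ_conj, conj_conj,
    map_sub, conj_conj, map_div₀, stp_conj, Complex.conj_ofNat]
  congr 3; ring

lemma V_mul_w (h:G.Good l r) (u:ℂ) (hu:u ∈ vline r) : F.V l u*F.w l u = F.w (F.shift l 1) (u-F.stp/2)/F.φ (u-F.stp/2)^2 := by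
  obtain ⟨-, -, -, -, a, -⟩ := G.w_step _ _ (h.w.ne u hu)
  have h1 := (G.phi_reg h.dom).ne u hu
  have h2 := ((G.phi_reg h.dom).sub_im (Model.half_re F)).ne u hu; rw [nu, nu] at a; rw [G.V_eq]; grind

/-- The ground state is annihilated: `√(V^*) φ_0` and `√V φ_0`, moved by half a step in opposite
directions, agree. -/
lemma zero_mode (hl:F.adm l) (h:G.Good l r) (u:ℂ) (hu:u ∈ vline r) : starFun (vsqrt (F.V l)) (u-F.stp)*phi0 F l (u-F.stp) =
      vsqrt (F.V l) u*phi0 F l u := by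
  have hV := h.V_reg
  have hs := Model.half_re F
  have hmc : ∀ z ∈ vline r, conj z ∈ vline r := fun z hz => by simpa [FamilyData.stp] using hz
  have hm : ∀ z ∈ vline r, z+F.stp/2 ∈ vline r := fun z hz => by simpa [FamilyData.stp] using hz
  have hm' : ∀ z ∈ vline r, z-F.stp/2 ∈ vline r := fun z hz => by simpa [FamilyData.stp] using hz
  have hconj : ∀ z, conj (z-F.stp/2) = conj z+F.stp/2 := fun z => by rw [map_sub, map_div₀, stp_conj, Complex.conj_ofNat]; ring
  have hstar : ∀ z ∈ vline r, (starFun (vsqrt (F.V l)) (z-F.stp/2)*phi0 F l (z-F.stp/2)) = starFun (fun z => vsqrt (F.V l) (z+F.stp/2) *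
      phi0 F l (z+F.stp/2)) z := fun z hz => by
    simp only [starFun, map_mul]; rw [hconj, phi0_conj hl h _ (hm _ (hmc z hz))]; congr 2; rw [← hconj, conj_conj]
  have hB := (hV.vsqrt_reg.add_im hs).mul ((phi0_reg h).add_im hs)
  have hsq : ∀ z ∈ vline r, (vsqrt (F.V l) (z+F.stp/2)*phi0 F l (z+F.stp/2))^2 = F.w (F.shift l 1) z/F.φ z^2 := fun z hz => by
    rw [mul_pow, hV.vsqrt_sq _ (hm z hz), phi0_sq h _ (hm z hz), V_mul_w h _ (hm z hz), add_sub_cancel_right]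
  have key := hB.star.eq_of_sq hB (fun z hz => by
    rw [starFun, ← map_pow, hsq _ (hmc z hz), hsq z hz, map_div₀, map_pow,
      G.w_conj _ (G.adm_shift l hl), conj_conj, ← G.φ_conj, conj_conj]) (by
    rw [starFun, conj_ofReal]
    apply PosR.real_of_sq
    rw [hsq _ (ofReal_mem_vline r)]
    exact (G.w_pos _ (G.adm_shift l hl) r h.dom).div ((G.phi_pos h.dom).pow 2))
  grind

lemma sqrtVV_eq (hl:F.adm l) (h:G.Good l r) (u:ℂ) (hu:u ∈ vline r) : sqrtVV F l u = F.V l u*(phi0 F l u/phi0 F l (u-F.stp)) := by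
  have h1 := zero_mode hl h u hu
  have hu' : u-F.stp ∈ vline r := by simpa [FamilyData.stp] using hu
  have h2 := (phi0_reg h).ne _ hu'; rw [← h.V_reg.vsqrt_sq u hu]
  change vsqrt (F.V l) u*starFun (vsqrt (F.V l)) (u-F.stp) = _
  grind

lemma WT_eq (G:AdmModel F) (l:F.Par) (D:List ℕ) (x:ℂ) : WT F l D x = cprod F (phiT0 F l) D.length x *
      (phiM F D.length x*(G.pCas (D.map (G.pT l))).eval (F.η x)) := by
  rw [← G.cas_ξ]; exact casoratian_mul F (phiT0 F l) (F.ξ l) D x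

lemma WE_eq (G:AdmModel F) (l:F.Par) (D:List ℕ) (x:ℂ) : WE F l D x = cprod F (phi0 F l) D.length x *
      (phiM F D.length x*(G.pCas (D.map (G.pP l))).eval (F.η x)) := by
  rw [← G.cas_P]; exact casoratian_mul F (phi0 F l) (F.P l) D x

lemma Vhat_eq (hl:F.adm l) (h:G.Good l r) (D:List ℕ) (hD:D ≠ []) (x:ℂ) (hx:x ∈ vline r) : Vhat F l D x =
    G.nm l (x-((D.length:ℂ)+1)/2*F.stp)/(F.φ x*F.φ (x-F.stp/2))*((G.pCas (D.dropLast.map (G.pT l))).eval (F.η (x+F.stp/2)) /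
        (G.pCas (D.dropLast.map (G.pT l))).eval (F.η (x-F.stp/2))) *
      ((G.pCas (D.map (G.pT l))).eval (F.η (x-F.stp))/(G.pCas (D.map (G.pT l))).eval (F.η x)) := by
  obtain ⟨n, hn⟩ : ∃ n, D.length = n+1 := Nat.exists_eq_succ_of_ne_zero (by simpa using hD)
  have hn' : D.dropLast.length = n := by rw [List.length_dropLast, hn]; rfl
  set u := x-(n:ℂ)/2*F.stp with hu
  have hul : u ∈ vline r := by simpa [hu, FamilyData.stp] using hx
  have hul' : u-F.stp ∈ vline r := by simpa [FamilyData.stp] using hul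
  have e1 : x-I*(((D.length:ℂ)-1)/2)*F.γ = u := by rw [hn, hu, FamilyData.stp]; push_cast; ring
  have e4 : x-((n:ℂ)/2+1)*F.stp = u-F.stp := by rw [hu]; ring
  have e5 : x-((n:ℂ)+1)/2*F.stp = u-F.stp/2 := by rw [hu]; ring
  have e6 : x-(((n+1:ℕ):ℂ)+1)/2*F.stp = u-F.stp := by rw [hu]; push_cast; ring
  have key := G.potential_ratio h.dom (phiT0 F l) (phiT0_reg h).ne n x hx ((G.pCas (D.dropLast.map (G.pT l))).eval (F.η (x+F.stp/2)))
    ((G.pCas (D.dropLast.map (G.pT l))).eval (F.η (x-F.stp/2))) ((G.pCas (D.map (G.pT l))).eval (F.η (x-F.stp)))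
    ((G.pCas (D.map (G.pT l))).eval (F.η x))
  rw [e4, e5, ← hu] at key
  rw [Vhat, e1, half_stp, I_mul_gamma, sqrtVV_eq hl h u hul, WT_eq G, WT_eq G, WT_eq G, WT_eq G, hn, hn', mul_assoc, key, e6, G.V_eq]
  have hnu := h.nu_step u hul; rw [nu, nu, ← phi0_sq h u hul, ← phi0_sq h _ hul'] at hnu
  have p0 := (phi0_reg h).ne u hul
  have p1 := (phi0_reg h).ne _ hul'
  have f0 := (G.phi_reg h.dom).ne u hul
  have f1 := (G.phi_reg h.dom).ne _ hul'
  have f2 := ((G.phi_reg h.dom).sub_im (Model.half_re F)).ne u hul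
  have f3 := (G.phi_reg h.dom).ne x hx
  have f4 := ((G.phi_reg h.dom).sub_im (Model.half_re F)).ne x hx; rw [← mul_assoc, ← mul_assoc, ← mul_assoc]; congr 2
  unfold phiT0; grind

lemma VKA_eq (hl:F.adm l) (h:G.Good l r) (L:List ℕ) (μ:ℕ) (x:ℂ) (hx:x ∈ vline r) : VKA F l L μ x =
    G.np l (x-(L.length:ℂ)/2*F.stp)/(F.φ x*F.φ (x-F.stp/2))*((G.pCas (L.map (G.pP l))).eval (F.η (x+F.stp/2)) /
        (G.pCas (L.map (G.pP l))).eval (F.η (x-F.stp/2))) *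
      ((G.pCas ((L ++ [μ]).map (G.pP l))).eval (F.η (x-F.stp))/(G.pCas ((L ++ [μ]).map (G.pP l))).eval (F.η x)) := by
  have hn' : (L ++ [μ]).length = L.length+1 := by simp
  set n := L.length with hn
  set u := x-(n:ℂ)/2*F.stp with hu
  have hul : u ∈ vline r := by simpa [hu, FamilyData.stp] using hx
  have hul' : u-F.stp ∈ vline r := by simpa [FamilyData.stp] using hul
  have e1 : x-I*((n:ℂ)/2)*F.γ = u := by rw [hu, FamilyData.stp]; ring
  have e4 : x-((n:ℂ)/2+1)*F.stp = u-F.stp := by rw [hu]; ring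
  have e5 : x-((n:ℂ)+1)/2*F.stp = u-F.stp/2 := by rw [hu]; ring
  have key := G.potential_ratio h.dom (phi0 F l) (phi0_reg h).ne n x hx ((G.pCas (L.map (G.pP l))).eval (F.η (x+F.stp/2)))
    ((G.pCas (L.map (G.pP l))).eval (F.η (x-F.stp/2))) ((G.pCas ((L ++ [μ]).map (G.pP l))).eval (F.η (x-F.stp)))
    ((G.pCas ((L ++ [μ]).map (G.pP l))).eval (F.η x))
  rw [e4, e5, ← hu] at key
  rw [VKA, ← hn, e1, half_stp, I_mul_gamma, sqrtVV_eq hl h u hul, WE_eq G, WE_eq G, WE_eq G, WE_eq G, hn', ← hn, mul_assoc, key, G.V_eq]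
  have p0 := (phi0_reg h).ne u hul
  have p1 := (phi0_reg h).ne _ hul'
  have f0 := (G.phi_reg h.dom).ne u hul
  have f2 := ((G.phi_reg h.dom).sub_im (Model.half_re F)).ne u hul; grind

end AdmModel

/-- Polynomial eigenfunctions of a real difference operator with distinct real eigenvalues and real
leading coefficients have real coefficients. -/
lemma Geom.map_conj_eq_self {F:FamilyData} (G:Geom F) {n:ℕ} (p:ℕ → ℂ[X]) (e:ℕ → ℂ)
    (A B:ℂ → ℂ) (hp:∀ k ≤ n, (p k).natDegree ≤ k ∧ (p k).coeff k ≠ 0) (hAB:∀ r ∈ F.dom, conj (A (r:ℂ)) = B r)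
    (heq:∀ k ≤ n, ∀ r ∈ F.dom, A (r:ℂ)*((p k).eval (F.η (r-F.stp))-(p k).eval (F.η r)) +
      B r*((p k).eval (F.η (r+F.stp))-(p k).eval (F.η r)) = e k*(p k).eval (F.η r))
    (he:∀ k < n, e k ≠ e n) (hen:conj (e n) = e n)
    (hc:conj ((p n).coeff n) = (p n).coeff n) :
    (p n).map conj = p n := by
  set q := (p n).map conj-p n with hq
  obtain ⟨c, hc'⟩ := exists_sum_of_degree p hp q
    ((natDegree_sub_le _ _).trans (max_le ((natDegree_map_le).trans (hp n le_rfl).1) (hp n le_rfl).1))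
  have hconj : ∀ r ∈ F.dom, A (r:ℂ)*(((p n).map conj).eval (F.η (r-F.stp))-((p n).map conj).eval (F.η r)) +
      B r*(((p n).map conj).eval (F.η (r+F.stp))-((p n).map conj).eval (F.η r)) = e n*((p n).map conj).eval (F.η r) := by
    intro r hr
    have h1 := congrArg conj (heq n le_rfl r hr)
    have h2 : ∀ y : ℂ, conj ((p n).eval (F.η y)) = ((p n).map conj).eval (F.η (conj y)) := fun y => by rw [G.η_conj, eval_map_apply]
    have h3 : conj (B r) = A r := by rw [← hAB r hr, conj_conj]
    simp only [map_add, map_mul, map_sub, h2, hAB r hr, h3, conj_ofReal, stp_conj, hen] at h1; grind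
  have hzero : ∑ k ∈ range (n+1), C (c k*(e k-e n))*p k = 0 := by
    refine G.poly_eq_of_dom ∅ Set.finite_empty _ _ fun r hr => ?_
    have hr' : r ∈ F.dom := by simpa using hr.1
    have h1 := hconj r hr'
    have h2 := heq n le_rfl r hr'
    have hs : ∀ y, ((p n).map conj).eval y = (p n).eval y+∑ k ∈ range (n+1), c k*(p k).eval y := fun y => by
      have h5 : ∑ k ∈ range (n+1), c k*(p k).eval y = q.eval y := by
        rw [hc', eval_finsetSum]; simp
      rw [h5, hq, eval_sub]; ring
    simp only [hs] at h1
    have h3 : ∑ k ∈ range (n+1), c k*(e k*(p k).eval (F.η r)) = A r*(∑ k ∈ range (n+1), c k*(p k).eval (F.η (r-F.stp)) -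
          ∑ k ∈ range (n+1), c k*(p k).eval (F.η r)) +
        B r*(∑ k ∈ range (n+1), c k*(p k).eval (F.η (r+F.stp))-∑ k ∈ range (n+1), c k*(p k).eval (F.η r)) := by
      rw [← sum_sub_distrib, ← sum_sub_distrib, mul_sum, mul_sum, ← sum_add_distrib]
      refine sum_congr rfl fun k hk => ?_
      grind
    rw [eval_finsetSum, eval_zero]
    have h4 : ∑ k ∈ range (n+1), (C (c k*(e k-e n))*p k).eval (F.η r) = ∑ k ∈ range (n+1), c k*(e k*(p k).eval (F.η r)) -
          e n*∑ k ∈ range (n+1), c k*(p k).eval (F.η r) := by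
      rw [mul_sum, ← sum_sub_distrib]; exact sum_congr rfl fun k _ => by rw [eval_mul, eval_C]; ring
    grind
  have hck := coeff_eq_zero_of_sum p hp _ hzero
  have hq1 : q = C (c n)*p n := by
    rw [hc', sum_range_succ, sum_eq_zero, zero_add]; grind
  have hq2 : q.coeff n = 0 := by rw [hq, coeff_sub, coeff_map, hc, sub_self]
  grind

lemma dropLast_eq_erase {D:List ℕ} (hD0:D ≠ []) (hD:D.Nodup) : D.dropLast = D.erase (D.getLast hD0) := by
  have h3 := List.dropLast_append_getLast hD0; grind

namespace AdmModel
variable {F:FamilyData} (G:AdmModel F) {l:F.Par} {r:ℝ}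
include G

lemma pP_real (hl:F.adm l) (n:ℕ) : (G.pP l n).map conj = G.pP l n := by
  have hnd := G.adm_nondeg l hl
  refine G.map_conj_eq_self (fun k => G.pP l k) (fun k => F.E l k) (fun x => G.np l x/(F.φ x*F.φ (x-F.stp/2)))
    (fun x => G.nm l x/(F.φ x*F.φ (x+F.stp/2))) (fun k _ => ⟨G.pP_deg l k, by rw [G.pP_coeff l k (hnd k)]; exact G.lcP_ne l k (hnd k)⟩)
    (fun r hr => ?_) (fun k _ r hr => ?_) (fun k hk => G.E_ne l n (hnd n) k hk)
    (G.E_real l hl n) (by rw [G.pP_coeff l n (hnd n), G.lcP_real l hl])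
  · have h1 := starV hl (r:ℂ) G; rw [starFun, conj_ofReal, G.V_eq] at h1; exact h1
  · simp only [← G.P_eval]; exact G.P_eq l k (hnd k) r (by simpa using hr)

lemma adm_of_bar {N:ℕ} (hl:F.adm (lamBar F l N)) (k:ℕ) : F.adm (F.shift l ((k:ℤ)-(N+1))) := by
  have := G.adm_shift_nat _ hl k; rw [lamBar, G.shift_shift] at this; grind

lemma adm_self {N:ℕ} (hl:F.adm (lamBar F l N)) : F.adm l := by
  have := G.adm_of_bar hl (N+1)
  rwa [show ((N+1:ℕ):ℤ)-(N+1) = 0 by push_cast; ring, G.shift_zero] at this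

lemma Et_ne {N:ℕ} (hl:F.adm (lamBar F l N)) {v:ℕ} (hv:v ≤ N) (k:ℕ) (hk:k < v) : F.Et l k ≠ F.Et l v := by
  have h1 := G.E_bar l N ((N-k:ℕ):ℤ)
  have h2 := G.E_bar l N ((N-v:ℕ):ℤ); rw [show ((N-k:ℕ):ℤ)-N-1 = -(k:ℤ)-1 by omega] at h1
  rw [show ((N-v:ℕ):ℤ)-N-1 = -(v:ℤ)-1 by omega] at h2; rw [G.Et_eq, G.Et_eq]; intro h
  have h3 := G.E_ne _ _ (G.adm_nondeg _ hl (N-k)) (N-v) (by omega)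
  apply h3
  refine mul_left_cancel₀ (inv_ne_zero (pow_ne_zero (N+1) G.κ_ne)) ?_
  linear_combination h2-h1-h

lemma pT_real {N:ℕ} (hl:F.adm (lamBar F l N)) {v:ℕ} (hv:v ≤ N) : (G.pT l v).map conj = G.pT l v := by
  have hnd := G.adm_nondegT l N hl
  have hl' := G.adm_self hl
  have hEt : ∀ k, conj (F.Et l k) = F.Et l k := fun k => by rw [G.Et_eq, G.E_real l hl']
  refine G.map_conj_eq_self (fun k => G.pT l k) (fun k => F.Et l k-F.Et l 0) (fun x => G.nm l (x-F.stp)/(F.φ x*F.φ (x-F.stp/2)))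
    (fun x => G.np l (x+F.stp)/(F.φ x*F.φ (x+F.stp/2))) (fun k hk => ⟨G.pT_deg l k, by
      rw [G.pT_coeff l k (hnd k (hk.trans hv))]; exact G.lcT_ne l k (hnd k (hk.trans hv))⟩)
    (fun r hr => ?_) (fun k hk r hr => ?_)
    (fun k hk h => G.Et_ne hl hv k hk (sub_left_inj.1 h))
    (by rw [map_sub, hEt, hEt]) (by rw [G.pT_coeff l v (hnd v hv), G.lcT_real l hl'])
  · have hnm : ∀ x, conj (G.nm l x) = G.np l (conj x) := fun x => by
      rw [← conj_conj x, ← G.np_conj l hl', conj_conj, conj_conj]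
    rw [map_div₀, map_mul, hnm, ← G.φ_conj, ← G.φ_conj, map_sub, map_sub, map_div₀, stp_conj,
      Complex.conj_ofNat, conj_ofReal, sub_neg_eq_add, neg_div, sub_neg_eq_add]
  · simp only [← G.T_eval]; exact G.T_eq l k (hnd k (hk.trans hv)) r (by simpa using hr)

lemma pCas_T_ne {N:ℕ} (hl:F.adm (lamBar F l N)) {D:List ℕ} (hD:D.Nodup) (hN:∀ d ∈ D, d ≤ N) : G.pCas (D.map (G.pT l)) ≠ 0 := by
  have hnd := G.adm_nondegT l N hl
  refine G.pCas_ne_zero _ ?_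
  have h := linearIndependent_of_coeff (G.pT l) (N := N) (fun k hk => ⟨G.pT_deg l k, by
    rw [G.pT_coeff l k (hnd k hk)]; exact G.lcT_ne l k (hnd k hk)⟩)
    (fun k:Fin (D.map (G.pT l)).length => D.get (k.cast (by simp)))
    (fun a b hab => by simpa using hD.injective_get hab) (fun k => hN _ (D.get_mem _))
  convert h using 2 with k
  simp

lemma pCas_T_real {N:ℕ} (hl:F.adm (lamBar F l N)) {D:List ℕ} (hN:∀ d ∈ D, d ≤ N) :
    (G.pCas (D.map (G.pT l))).map conj = G.pCas (D.map (G.pT l)) := by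
  refine G.pCas_conj _ fun p hp => ?_
  obtain ⟨d, hd, rfl⟩ := List.mem_map.1 hp; exact G.pT_real hl (hN d hd)

lemma pCas_P_real (hl:F.adm l) (D:List ℕ) : (G.pCas (D.map (G.pP l))).map conj = G.pCas (D.map (G.pP l)) := by
  refine G.pCas_conj _ fun p hp => ?_
  obtain ⟨d, hd, rfl⟩ := List.mem_map.1 hp; exact G.pP_real hl d

/-- Good lines for all the shifted parameters between `λ` and its complement. -/
lemma exists_good_all {N:ℕ} (hl:F.adm (lamBar F l N)) : ∃ S : Set ℝ, S.Finite ∧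
    ∀ r ∈ F.dom \ S, ∀ k ≤ N+1, G.Good (F.shift l (-(k:ℤ))) r := by
  have h : ∀ k : ℕ, ∃ S : Set ℝ, S.Finite ∧ (k ≤ N+1 → ∀ r ∈ F.dom \ S, G.Good (F.shift l (-(k:ℤ))) r) := fun k => by
    by_cases hk : k ≤ N+1
    · have := G.adm_of_bar hl (N+1-k); rw [show ((N+1-k:ℕ):ℤ)-(N+1) = -(k:ℤ) by omega] at this
      obtain ⟨S, hS, h⟩ := G.exists_good _ this; exact ⟨S, hS, fun _ => h⟩
    · exact ⟨∅, Set.finite_empty, fun h => absurd h hk⟩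
  choose S hS h using h
  refine ⟨⋃ k ∈ range (N+2), S k, (Finset.finite_toSet _).biUnion fun k _ => hS k, fun r hr k hk => h k hk r ⟨hr.1, fun hrk => hr.2 ?_⟩⟩
  simp only [Set.mem_iUnion]; exact ⟨k, mem_range.2 (by omega), hrk⟩

omit G in
lemma eval_conj {G:Geom F} (A:ℂ[X]) (hA:A.map conj = A) (x:ℂ) : conj (A.eval (F.η x)) = A.eval (F.η (conj x)) := by
  rw [G.η_conj, ← eval_map_apply, hA]

/-- The duality of the potential functions. -/
lemma Vhat_eq_star_VKA {N:ℕ} {D:List ℕ} (hD0:D ≠ []) (hD:D.Nodup) (hN:∀ d ∈ D, d ≤ N)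
    (hl:F.adm (lamBar F l N)) (h1:G.Good l r) (h2:G.Good (lamBar F l N) r) (x:ℂ) (hx:x ∈ vline r) : Vhat F l D x = (((F.κ^(N+1))⁻¹ : ℝ):ℂ) *
      starFun (VKA F (lamBar F l N) (Dbar N D) (N-D.getLastD 0)) (x-I*(F.γ/2)) := by
  have hl' := G.adm_self hl
  have hcom := compl_Dbar hD hN
  have hlast : D.getLastD 0 = D.getLast hD0 := by grind
  have herase := dropLast_eq_erase hD0 hD
  have hcom' := compl_Dbar_erase hD hN (List.getLast_mem hD0); rw [← herase] at hcom'
  obtain ⟨c, hc, e1⟩ := G.pCas_dual hcom l (fun d hd => G.adm_nondegT l N hl d (hN d hd)) fun e _ => G.adm_nondeg _ hl e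
  obtain ⟨c', hc', e2⟩ := G.pCas_dual hcom' l (fun d hd => G.adm_nondegT l N hl d (hN d (List.dropLast_subset D hd)))
    fun e _ => G.adm_nondeg _ hl e
  have hlen := hcom.length_add
  have hlen' : ((Dbar N D).length : ℂ)+D.length = N+1 := by exact_mod_cast hlen
  have hxc : conj (x-F.stp/2) ∈ vline r := by rw [mem_vline, conj_re]; simpa [FamilyData.stp] using hx
  have r1 := eval_conj (G := G.toGeom) _ (G.pCas_P_real hl (Dbar N D))
  have r2 := eval_conj (G := G.toGeom) _ (G.pCas_P_real hl (Dbar N D ++ [N-D.getLast hD0]))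
  rw [half_stp, hlast, Vhat_eq hl' h1 D hD0 x hx, starFun, VKA_eq hl h2 _ _ _ hxc, e1, e2]; simp only [eval_mul, eval_C]
  simp only [map_mul, map_div₀, r1, r2, ← G.φ_conj]
  have hnp : ∀ z, conj (G.np (lamBar F l N) z) = G.nm (lamBar F l N) (conj z) := G.np_conj _ hl
  simp only [hnp, map_sub, map_add, map_mul, map_div₀, conj_conj, stp_conj, map_neg, neg_neg, Complex.conj_ofNat, map_natCast]
  rw [G.nm_bar, mul_div_mul_left _ _ hc', mul_div_mul_left _ _ hc]
  have hκ := pow_ne_zero (N+1) G.κ_ne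
  have a1 : x-F.stp/2-((Dbar N D).length : ℂ)/2 * -F.stp-((N:ℂ)+1)/2*F.stp = x-((D.length:ℂ)+1)/2*F.stp := by rw [← hlen']; ring
  have a2 : x-F.stp/2 - -F.stp/2 = x := by ring
  have a3 : x-F.stp/2 + -F.stp/2 = x-F.stp := by ring
  have a4 : x-F.stp/2 - -F.stp = x+F.stp/2 := by ring
  rw [a1, a2, a3, a4]; push_cast; grind

end AdmModel

lemma prod_even_odd (h:ℕ → ℂ) (n:ℕ) : ∏ l ∈ range (2*n+1), h l = (∏ i ∈ range n, (h (2*i)*h (2*i+1)))*h (2*n) := by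
  rw [prod_range_succ]; congr 1
  induction n with
  | zero => simp
  | succ n ih =>
    rw [show 2*(n+1) = 2*n+1+1 by ring, prod_range_succ, prod_range_succ, ih, prod_range_succ (n := n)]; ring

/-- The product of the values of `φ` in the denominator of `∏ V V^*`. -/
def phiDen (F:FamilyData) (M:ℕ) (x:ℂ) : ℂ := ∏ j ∈ range M, (F.φ (cpt F.γ (M+1) x j)*F.φ (cpt F.γ (M+1) x (j+1)) *
    F.φ (cpt F.γ (M+1) x j-F.stp/2)^2)

/-- The product of the values of `φ` relating `φ_{M+1}(x)²` to `φ_M(x + iγ/2) φ_M(x - iγ/2)`. -/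
def phiCen (F:FamilyData) (M:ℕ) (x:ℂ) : ℂ := ∏ i ∈ range M, (F.φ (x-(i:ℂ)/2*F.stp)*F.φ (x+(i:ℂ)/2*F.stp))

lemma phiCen_sq (F:FamilyData) (M:ℕ) (x:ℂ) (h0:F.φ (cpt F.γ (M+1) x 0) ≠ 0) (hM:F.φ (cpt F.γ (M+1) x M) ≠ 0) :
    F.φ (cpt F.γ (M+1) x 0)*F.φ (cpt F.γ (M+1) x M)*phiCen F M x^2 = F.φ x^2*phiDen F M x := by
  set h : ℤ → ℂ := fun k => F.φ (x+(k:ℂ)/2*F.stp) with hh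
  set a : ℕ → ℂ := fun l => h (M-l) with ha
  have ea : ∀ j, F.φ (cpt F.γ (M+1) x j) = a (2*j) := fun j => by rw [ha, hh, cpt_eq]; congr 1; push_cast; ring
  have eb : ∀ j, F.φ (cpt F.γ (M+1) x j-F.stp/2) = a (2*j+1) := fun j => by rw [ha, hh, cpt_eq]; congr 1; push_cast; ring
  have h1 := prod_center h M
  have h2 := prod_odd_even a M
  have h3 := prod_even_odd a M
  have hx : F.φ x = h 0 := by rw [hh]; simp
  have hden : phiDen F M x*(a 0*a (2*M)) = (∏ l ∈ range (2*M+1), a l)^2 := by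
    rw [pow_two]; nth_rewrite 1 [h2]; rw [h3, phiDen]
    have : ∏ j ∈ range M, (F.φ (cpt F.γ (M+1) x j)*F.φ (cpt F.γ (M+1) x (j+1)) *
        F.φ (cpt F.γ (M+1) x j-F.stp/2)^2) = (∏ i ∈ range M, (a (2*i+1)*a (2*i+2)))*∏ i ∈ range M, (a (2*i)*a (2*i+1)) := by
      rw [← prod_mul_distrib]; grind
    rw [this]; ring
  have hcen : phiCen F M x*(a 0*a (2*M)) = h 0*∏ l ∈ range (2*M+1), a l := by
    have e1 : phiCen F M x = ∏ i ∈ range M, (h i*h (-i)) := by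
      refine prod_congr rfl fun i _ => ?_
      rw [mul_comm, hh]; congr 2; push_cast; ring
    have e2 : a 0*a (2*M) = h M*h (-M) := by grind
    have e3 : (∏ l ∈ range (2*M+1), a l) = h 0*∏ k ∈ range M, (h (k+1)*h (-(k+1))) := h1
    rw [e3, e1, e2, ← prod_range_succ (fun i:ℕ => h i*h (-i)), prod_range_succ']; push_cast; rw [neg_zero]; ring
  grind

lemma phiM_succ_sq (F:FamilyData) (n:ℕ) (x:ℂ) : phiM F (n+1) x^2 = phiM F n (x+F.stp/2)*phiM F n (x-F.stp/2)*phiCen F n x := by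
  rw [pow_two]; nth_rewrite 1 [phiM_succ]; rw [phiM_succ', phiCen, prod_mul_distrib]; ring

lemma phiCen_succ (F:FamilyData) (n:ℕ) (x:ℂ) : phiM F (n+1) (x+F.stp/2)*phiM F (n+1) (x-F.stp/2)*F.φ x^2 =
      phiM F n x^2*phiCen F (n+1) x := by
  rw [phiM_succ', phiM_succ, phiCen, prod_range_succ', prod_mul_distrib, add_sub_cancel_right, sub_add_cancel]; push_cast; ring

lemma cprod_succ_sq (F:FamilyData) (h:ℂ → ℂ) (n:ℕ) (x:ℂ) : cprod F h (n+1) x^2 = cprod F h n (x+F.stp/2)*cprod F h n (x-F.stp/2) *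
      (h (cpt F.γ (n+1) x 0)*h (cpt F.γ (n+1) x n)) := by
  rw [pow_two]; nth_rewrite 1 [cprod_succ]; rw [cprod_succ', cpt_eq, cpt_eq]; grind

lemma cprod_half (F:FamilyData) (h:ℂ → ℂ) (n:ℕ) (x:ℂ) : cprod F h (n+1) (x+F.stp/2)*cprod F h (n+1) (x-F.stp/2) = cprod F h n x^2 *
      (h (cpt F.γ (n+2) x 0)*h (cpt F.γ (n+2) x (n+1))) := by
  rw [cprod_succ', cprod_succ, add_sub_cancel_right, sub_add_cancel, cpt_eq, cpt_eq,
    show x+F.stp/2+(n:ℂ)/2*F.stp = x+((((n+2:ℕ):ℂ)-1)/2-((0:ℕ):ℂ))*F.stp by push_cast; ring,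
    show x-F.stp/2-(n:ℂ)/2*F.stp = x+((((n+2:ℕ):ℂ)-1)/2-((n+1:ℕ):ℂ))*F.stp by push_cast; ring]
  ring

namespace AdmModel
variable {F:FamilyData} (G:AdmModel F) {l:F.Par} {r:ℝ}
include G

lemma prodVV_eq (hl:F.adm l) (M:ℕ) (x:ℂ) : prodVV F l M x =
    shiftProd F (G.np l) (G.nm l) (M+1) x 0*shiftProd F (G.np l) (G.nm l) (M+1) x M/phiDen F M x := by
  have e1 : ∀ j : ℕ, x+I*((M:ℂ)/2-j)*F.γ = cpt F.γ (M+1) x j := fun j => by rw [cpt_eq, FamilyData.stp]; push_cast; ring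
  have e2 : ∀ j < M, x-I*((M:ℂ)/2-j)*F.γ = cpt F.γ (M+1) x (M-1-j+1) := fun j hj => by
    have h1 : ((M-1-j:ℕ):ℂ) = M-1-j := by rw [Nat.cast_sub (by omega), Nat.cast_sub (by omega)]; simp
    grind
  have e3 : ∀ j : ℕ, cpt F.γ (M+1) x (j+1)+F.stp/2 = cpt F.γ (M+1) x j-F.stp/2 := fun j => by rw [cpt_eq, cpt_eq]; push_cast; ring
  have h1 : prodVV F l M x = (∏ j ∈ range M, F.V l (cpt F.γ (M+1) x j))*∏ j ∈ range M, starFun (F.V l) (cpt F.γ (M+1) x (j+1)) := by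
    unfold prodVV; rw [prod_mul_distrib]; congr 1
    · simp_all
    · rw [← prod_range_reflect (fun j => starFun (F.V l) (cpt F.γ (M+1) x (j+1)))]
      exact prod_congr rfl fun j hj => by rw [e2 j (mem_range.1 hj)]
  have h2 : shiftProd F (G.np l) (G.nm l) (M+1) x 0 = ∏ j ∈ range M, G.nm l (cpt F.γ (M+1) x (j+1)) := by
    rw [shiftProd, prod_range_zero, one_mul, prod_Ico_eq_prod_range]; grind
  have h3 : shiftProd F (G.np l) (G.nm l) (M+1) x M = ∏ j ∈ range M, G.np l (cpt F.γ (M+1) x j) := by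
    rw [shiftProd, Ico_self, prod_empty, mul_one]
  rw [h1, h2, h3, ← prod_mul_distrib, ← prod_mul_distrib, phiDen, ← prod_div_distrib]
  refine prod_congr rfl fun j _ => ?_
  rw [starV hl _ G, G.V_eq, e3, div_mul_div_comm]; congr 1 <;> ring

lemma prodVV_pos (h:G.Good l r) (M:ℕ) : PosR (prodVV F l M r) := by
  refine PosR.prod _ fun j _ => ?_
  have e1 : (r:ℂ)-I*((M:ℂ)/2-j)*F.γ = conj (r+I*((M:ℂ)/2-j)*F.γ) := by simp [Complex.conj_ofNat]; ring
  rw [e1, starFun, conj_conj]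
  refine PosR.mul_conj (h.V_reg.ne _ ?_)
  change ((r:ℂ)+I*((M:ℂ)/2-j)*F.γ).re = r
  simp

omit G in
lemma cpt_mem_vline (F:FamilyData) (r:ℝ) (n j:ℕ) : cpt F.γ n r j ∈ vline r := by
  change (cpt F.γ n r j).re = r
  rw [cpt_re, ofReal_re]

/-- The weights at the ends of the chain of points, in terms of the shifted weight. -/
lemma identity_T (hl:F.adm l) (M:ℕ) : ∃ C : ℂ, C ≠ 0 ∧ ∀ r : ℝ, G.Good l r →
    G.Good (F.shift l (-(M:ℤ))) r → prodVV F l M r*(phiT0 F l (cpt F.γ (M+1) r 0)*phiT0 F l (cpt F.γ (M+1) r M))^2 *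
      phiCen F M r^2*nu F (F.shift l (-(M:ℤ))) r^2*C^2 = F.φ r^2 := by
  obtain ⟨C, hC, hchain⟩ := G.nu_chain l M
  refine ⟨C, hC, fun r h h' => ?_⟩
  have hc := hchain r (h'.w.ne _ (ofReal_mem_vline r)) (fun j _ => h.w.ne _ (cpt_mem_vline F r _ j))
  have h0 := hc 0 (Nat.zero_le _)
  have hM := hc M le_rfl
  have hφ : ∀ j, F.φ (cpt F.γ (M+1) r j) ≠ 0 := fun j => (G.phi_reg h.dom).ne _ (cpt_mem_vline F r _ j)
  have hw : ∀ j, F.w l (cpt F.γ (M+1) r j) ≠ 0 := fun j => h.w.ne _ (cpt_mem_vline F r _ j)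
  have hT : ∀ j, phiT0 F l (cpt F.γ (M+1) r j)^2 = F.φ (cpt F.γ (M+1) r j)^2/F.w l (cpt F.γ (M+1) r j) := fun j => by
    rw [phiT0, div_pow, phi0_sq h _ (cpt_mem_vline F r _ j)]
  have hcen := phiCen_sq F M r (hφ 0) (hφ M)
  have hden : phiDen F M r ≠ 0 := prod_ne_zero_iff.2 fun j _ =>
    mul_ne_zero (mul_ne_zero (hφ _) (hφ _)) (pow_ne_zero _ (((G.phi_reg h.dom).sub_im (Model.half_re F)).ne _ (cpt_mem_vline F r _ j)))
  have hν : nu F (F.shift l (-(M:ℤ))) r ≠ 0 := div_ne_zero (h'.w.ne _ (ofReal_mem_vline r)) ((G.phi_reg h.dom).ne _ (ofReal_mem_vline r))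
  rw [mul_pow, hT, hT, G.prodVV_eq hl]
  have hw0 := hw 0
  have hwM := hw M
  have hφ0 := hφ 0
  have hφM := hφ M; rw [nu] at h0 hM; grind

/-- The weight at the centre of the chain of points, for the parameter shifted upwards. -/
lemma nu_chain_up (l:F.Par) (m:ℕ) : ∃ C : ℂ, C ≠ 0 ∧ ∀ x : ℂ, F.w l (cpt F.γ (m+1) x 0) ≠ 0 → F.w l (cpt F.γ (m+1) x m) ≠ 0 →
    nu F (F.shift l m) x = C*(shiftProd F (G.np l) (G.nm l) (m+1) x m*nu F l (cpt F.γ (m+1) x 0)) ∧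
    nu F (F.shift l m) x = C*(shiftProd F (G.np l) (G.nm l) (m+1) x 0*nu F l (cpt F.γ (m+1) x m)) := by
  have hnp : ∀ (i:ℕ) (y:ℂ), G.np l (y-i/2*F.stp) = (F.κ:ℂ)^i*G.np (F.shift l i) y := fun i y => by
    have := G.np_shift_neg (F.shift l i) i (y-i/2*F.stp)
    rwa [G.shift_shift, add_neg_cancel, G.shift_zero, sub_add_cancel] at this
  have hnm : ∀ (i:ℕ) (y:ℂ), G.nm l (y+i/2*F.stp) = (F.κ:ℂ)^i*G.nm (F.shift l i) y := fun i y => by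
    have := G.nm_shift_neg (F.shift l i) i (y+i/2*F.stp)
    rwa [G.shift_shift, add_neg_cancel, G.shift_zero, add_sub_cancel_right] at this
  have down : ∀ y : ℂ, F.w l y ≠ 0 → ∀ k : ℕ, F.w (F.shift l k) (y-k/2*F.stp) ≠ 0 ∧ nu F (F.shift l k) (y-k/2*F.stp) =
        (∏ i ∈ range k, (((F.κ:ℂ)^i)⁻¹*G.np l (y-i*F.stp)))*nu F l y := by
    intro y hy k
    induction k with
    | zero => simpa [G.shift_zero] using hy
    | succ k ih =>
      obtain ⟨-, -, b3, -, b5, -⟩ := G.w_step _ _ ih.1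
      rw [G.shift_shift, show y-k/2*F.stp-F.stp/2 = y-((k+1:ℕ):ℂ)/2*F.stp by push_cast; ring] at b3 b5
      refine ⟨by exact_mod_cast b3, ?_⟩
      have e := hnp k (y-k/2*F.stp); rw [show y-k/2*F.stp-k/2*F.stp = y-k*F.stp by ring] at e; push_cast at b5 ⊢
      rw [b5, ih.2, prod_range_succ, e, inv_mul_cancel_left₀ (pow_ne_zero _ G.κ_ne)]; ring
  have up : ∀ y : ℂ, F.w l y ≠ 0 → ∀ k : ℕ, F.w (F.shift l k) (y+k/2*F.stp) ≠ 0 ∧ nu F (F.shift l k) (y+k/2*F.stp) =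
        (∏ i ∈ range k, (((F.κ:ℂ)^i)⁻¹*G.nm l (y+i*F.stp)))*nu F l y := by
    intro y hy k
    induction k with
    | zero => simpa [G.shift_zero] using hy
    | succ k ih =>
      obtain ⟨-, -, -, b4, -, b6⟩ := G.w_step _ _ ih.1
      rw [G.shift_shift, show y+k/2*F.stp+F.stp/2 = y+((k+1:ℕ):ℂ)/2*F.stp by push_cast; ring] at b4 b6
      refine ⟨by exact_mod_cast b4, ?_⟩
      have e := hnm k (y+k/2*F.stp); rw [show y+k/2*F.stp+k/2*F.stp = y+k*F.stp by ring] at e; push_cast at b6 ⊢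
      rw [b6, ih.2, prod_range_succ, e, inv_mul_cancel_left₀ (pow_ne_zero _ G.κ_ne)]; ring
  refine ⟨∏ i ∈ range m, ((F.κ:ℂ)^i)⁻¹, prod_ne_zero_iff.2 fun i _ => inv_ne_zero (pow_ne_zero _ G.κ_ne), fun x h0 hm => ⟨?_, ?_⟩⟩
  · have := (down _ h0 m).2; rw [show cpt F.γ (m+1) x 0-m/2*F.stp = x by rw [cpt_eq]; push_cast; ring] at this
    rw [this, prod_mul_distrib, mul_assoc, shiftProd, Ico_self, prod_empty, mul_one]; congr 2
    refine prod_congr rfl fun i _ => ?_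
    congr 1; rw [cpt_eq, cpt_eq]; push_cast; ring
  · have := (up _ hm m).2; rw [show cpt F.γ (m+1) x m+m/2*F.stp = x by rw [cpt_eq]; push_cast; ring] at this
    rw [this, prod_mul_distrib, mul_assoc, shiftProd, prod_range_zero, one_mul, prod_Ico_eq_prod_range]; congr 2
    rw [← prod_range_reflect]
    refine prod_congr (by simp) fun i hi => ?_
    have hi' := mem_range.1 hi
    have hc : ((m-1-i:ℕ):ℂ) = m-1-i := by rw [Nat.cast_sub (by omega), Nat.cast_sub (by omega)]; simp
    congr 1; rw [cpt_eq, cpt_eq, hc]; push_cast; ring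

lemma identity_E (hl:F.adm l) (m:ℕ) : ∃ C : ℂ, C ≠ 0 ∧ ∀ r : ℝ, G.Good l r →
    prodVV F l m r*(phi0 F l (cpt F.γ (m+1) r 0)*phi0 F l (cpt F.γ (m+1) r m))^2*phiCen F m r^2*C^2 = F.w (F.shift l m) r^2 := by
  obtain ⟨C, hC, hchain⟩ := G.nu_chain_up l m
  refine ⟨C, hC, fun r h => ?_⟩
  have hw : ∀ j, F.w l (cpt F.γ (m+1) r j) ≠ 0 := fun j => h.w.ne _ (cpt_mem_vline F r _ j)
  obtain ⟨h0, hM⟩ := hchain r (hw 0) (hw m)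
  have hφ : ∀ j, F.φ (cpt F.γ (m+1) r j) ≠ 0 := fun j => (G.phi_reg h.dom).ne _ (cpt_mem_vline F r _ j)
  have hcen := phiCen_sq F m r (hφ 0) (hφ m)
  have hden : phiDen F m r ≠ 0 := prod_ne_zero_iff.2 fun j _ =>
    mul_ne_zero (mul_ne_zero (hφ _) (hφ _)) (pow_ne_zero _ (((G.phi_reg h.dom).sub_im (Model.half_re F)).ne _ (cpt_mem_vline F r _ j)))
  rw [mul_pow, phi0_sq h _ (cpt_mem_vline F r _ _), phi0_sq h _ (cpt_mem_vline F r _ _), G.prodVV_eq hl]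
  have hφ0 := hφ 0
  have hφM := hφ m
  have hφr : F.φ r ≠ 0 := (G.phi_reg h.dom).ne _ (ofReal_mem_vline r); simp only [nu] at h0 hM; grind

end AdmModel

lemma PropOn.trans {U:Set ℝ} {f g h:ℂ → ℂ} (h1:PropOn U f g) (h2:PropOn U g h) : PropOn U f h := by
  obtain ⟨c, hc, h1⟩ := h1
  obtain ⟨d, hd, h2⟩ := h2; exact ⟨c*d, mul_ne_zero hc hd, fun x hx => by rw [h1 x hx, h2 x hx, mul_assoc]⟩

lemma PropOn.symm {U:Set ℝ} {f g:ℂ → ℂ} (h:PropOn U f g) : PropOn U g f := by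
  obtain ⟨c, hc, h⟩ := h; exact ⟨c⁻¹, inv_ne_zero hc, fun x hx => by rw [h x hx, inv_mul_cancel_left₀ hc]⟩

lemma PropOn.mul {U:Set ℝ} {f g f' g':ℂ → ℂ} (h:PropOn U f g) (h':PropOn U f' g') : PropOn U (fun x => f x*f' x) (fun x => g x*g' x) := by
  obtain ⟨c, hc, h⟩ := h
  obtain ⟨d, hd, h'⟩ := h'; exact ⟨c*d, mul_ne_zero hc hd, fun x hx => by dsimp only; rw [h x hx, h' x hx]; ring⟩

lemma PropOn.of_eq {U:Set ℝ} {f g:ℂ → ℂ} (h:∀ x ∈ U, f (x:ℂ) = g x) : PropOn U f g := ⟨1, one_ne_zero, fun x hx => by rw [h x hx, one_mul]⟩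

/-- Positive functions with proportional fourth powers are proportional. -/
lemma propOn_of_pow {U:Set ℝ} {f g:ℂ → ℂ} (hf:∀ x ∈ U, PosR (f (x:ℂ))) (hg:∀ x ∈ U, PosR (g (x:ℂ))) (c:ℂ) (h:∀ x ∈ U, f (x:ℂ)^4 = c*g x^4) :
    PropOn U f g := by
  rcases U.eq_empty_or_nonempty with rfl | ⟨a, ha⟩
  · exact ⟨1, one_ne_zero, fun x hx => hx.elim⟩
  · have hK : PosR (f (a:ℂ)/g a) := (hf a ha).div (hg a ha)
    refine ⟨f a/g a, hK.ne, fun x hx => ?_⟩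
    refine PosR.eq_of_pow (n := 4) (hf x hx) (hK.mul (hg x hx)) (by norm_num) ?_
    rw [mul_pow, div_pow, h a ha, mul_div_assoc, div_self (pow_ne_zero _ (hg a ha).ne), mul_one, h x hx]

lemma pow_four_sqrt (P W Y:ℂ) : ((P^(1/2:ℂ)/W)^(1/2:ℂ)*Y)^4 = P/W^2*Y^4 := by
  rw [mul_pow, show (4:ℕ) = 2*2 by norm_num, pow_mul, PosR.sqrt_sq, div_pow, PosR.sqrt_sq]

lemma pow_four_div_sqrt (a X:ℂ) : (a/X^(1/2:ℂ))^4 = (a^2)^2/X^2 := by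
  rw [div_pow, show (4:ℕ) = 2*2 by norm_num, pow_mul, pow_mul, PosR.sqrt_sq]

lemma cprod_pos {F:FamilyData} {h:ℂ → ℂ} {r:ℝ} (hreg:LineReg h r) (hconj:∀ z ∈ vline r, conj (h z) = h (conj z)) (hpos:PosR (h r))
    (n:ℕ) : PosR (cprod F h n r) := by
  induction n using Nat.twoStepInduction with
  | zero => simpa [cprod] using PosR.one
  | one =>
    rw [cprod_succ]; simpa [cprod] using hpos
  | more n ih _ =>
    rw [cprod_succ, cprod_succ', add_sub_cancel_right, mul_assoc]
    refine ih.mul ?_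
    have e1 : (r:ℂ)-((n+1:ℕ):ℂ)/2*F.stp = conj (r+F.stp/2+(n:ℂ)/2*F.stp) := by
      rw [FamilyData.stp]; simp [Complex.conj_ofNat]; ring
    have hz : (r:ℂ)+F.stp/2+(n:ℂ)/2*F.stp ∈ vline r := by
      change ((r:ℂ)+F.stp/2+(n:ℂ)/2*F.stp).re = r
      have := re_add_mul_stp F r ((n+1)/2); rw [ofReal_re] at this
      refine Eq.trans ?_ this
      congr 1; push_cast; ring
    rw [e1, ← hconj _ hz]; exact PosR.mul_conj (hreg.ne _ hz)

namespace AdmModel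
variable {F:FamilyData} (G:AdmModel F) {l:F.Par} {r:ℝ}
include G

omit G in
lemma pair_pos (F:FamilyData) {r:ℝ} {h:ℂ → ℂ} (hreg:LineReg h r) (hconj:∀ z ∈ vline r, conj (h z) = h (conj z)) (t:ℝ) :
    PosR (h (r-t*F.stp)*h (r+t*F.stp)) := by
  have hz : (r:ℂ)+t*F.stp ∈ vline r := by
    change ((r:ℂ)+t*F.stp).re = r
    rw [re_add_mul_stp, ofReal_re]
  have e1 : (r:ℂ)-t*F.stp = conj (r+t*F.stp) := by rw [FamilyData.stp]; simp; ring
  rw [e1, ← hconj _ hz]; exact PosR.conj_mul (hreg.ne _ hz)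

lemma phiCen_pos (hr:r ∈ F.dom) (n:ℕ) : PosR (phiCen F n r) := by
  refine PosR.prod _ fun i _ => ?_
  have := pair_pos F (G.phi_reg hr) (fun z _ => (G.φ_conj z).symm) (i/2); push_cast at this; exact this

lemma phiM_pos (hr:r ∈ F.dom) (n:ℕ) : PosR (phiM F n r) := by
  have hp := G.phi_pos hr; unfold phiM
  refine (hp.pow _).mul (PosR.prod _ fun k _ => PosR.pow ?_ _)
  have := pair_pos F (G.phi_reg hr) (fun z _ => (G.φ_conj z).symm) (k/2); push_cast at this
  rwa [FamilyData.stp, show (k:ℂ)/2*(I*F.γ) = I*((k:ℂ)/2)*F.γ by ring] at this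

lemma phiM_pair_pos (hr:r ∈ F.dom) (n:ℕ) : PosR (phiM F n (r-F.stp/2)*phiM F n (r+F.stp/2)) := by
  have h := phiM_succ_sq F n r
  have hc := G.phiCen_pos hr n; rw [mul_comm (phiM F n _), eq_div_of_mul_eq hc.ne h.symm]; exact ((G.phiM_pos hr _).pow 2).div hc

omit G in
lemma cprod_pair_pos {h:ℂ → ℂ} (hreg:LineReg h r) (hconj:∀ z ∈ vline r, conj (h z) = h (conj z)) (hpos:PosR (h r))
    (n:ℕ) : PosR (cprod F h n (r-F.stp/2)*cprod F h n (r+F.stp/2)) := by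
  have h1 := cprod_succ_sq F h n r
  have hc : PosR (h (cpt F.γ (n+1) r 0)*h (cpt F.γ (n+1) r n)) := by
    have := pair_pos F hreg hconj (n/2); push_cast at this; rw [mul_comm, cpt_eq, cpt_eq]; grind
  rw [mul_comm (cprod F h n _), eq_div_of_mul_eq hc.ne h1.symm]; exact ((cprod_pos hreg hconj hpos _).pow 2).div hc

lemma eval_pair_pos (A:ℂ[X]) (hA:A.map conj = A) (hreg:LineReg (fun x => A.eval (F.η x)) r) :
    PosR (A.eval (F.η (r-F.stp/2))*A.eval (F.η (r+F.stp/2))) := by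
  have := pair_pos F hreg (fun z _ => eval_conj (G := G.toGeom) A hA z) (1/2); push_cast at this
  rwa [one_div, inv_mul_eq_div] at this

lemma evalη_reg (A:ℂ[X]) (h:∀ z ∈ vline r, A.eval (F.η z) ≠ 0) : LineReg (fun x => A.eval (F.η x)) r :=
  LineReg.of_entire (A.differentiable.comp G.η_diff) h

lemma psiD_eq (D:List ℕ) (hr:r ∈ F.dom) : psiD F l D r = phi0 F (F.shift l (-(D.length:ℤ))) r /
      ((G.pCas (D.map (G.pT l))).eval (F.η (r-F.stp/2))*(G.pCas (D.map (G.pT l))).eval (F.η (r+F.stp/2)))^(1/2:ℂ) := by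
  have hh := Model.half_re F
  rw [psiD, half_stp, G.Xi_eq _ _ _ (G.phiM_ne _ _ (by rw [sub_re, hh]; simpa using hr)),
    G.Xi_eq _ _ _ (G.phiM_ne _ _ (by rw [add_re, hh]; simpa using hr))]

lemma psiD_pos (D:List ℕ) (hl':F.adm (F.shift l (-(D.length:ℤ)))) (hg:G.Good (F.shift l (-(D.length:ℤ))) r)
    (hA:(G.pCas (D.map (G.pT l))).map conj = G.pCas (D.map (G.pT l))) (hreg:LineReg (fun x => (G.pCas (D.map (G.pT l))).eval (F.η x)) r) :
    PosR (psiD F l D r) := by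
  rw [G.psiD_eq D hg.dom]; exact (phi0_pos hl' hg).div (G.eval_pair_pos _ hA hreg).sqrt

lemma cas_phiD (D:List ℕ) (n:ℕ) (h:G.Good l r) (h':G.Good (F.shift l (-(D.length:ℤ))) r) :
    casoratian F.γ (D.map (phiT F l) ++ [phiN F l n]) r = cprod F (phiT0 F l) (D.length+1) r*nu F (F.shift l (-(D.length:ℤ))) r *
        phiM F (D.length+1) r*PD F l D n r := by
  have hphi := (G.phiM_pos h.dom (D.length+1)).ne
  have hν : nu F (F.shift l (-(D.length:ℤ))) r ≠ 0 := div_ne_zero (h'.w.ne _ (ofReal_mem_vline r)) (G.phi_pos h.dom).ne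
  set B : Matrix (Fin (D.length+1)) (Fin (D.length+1)) ℂ := Matrix.of fun j k =>
      if h : (k:ℕ) < D.length then F.ξ l (D.get ⟨k, h⟩) (cpt F.γ (D.length+1) r j)
      else rFac F l D.length r j*F.P l n (cpt F.γ (D.length+1) r j) with hB
  set ν := nu F (F.shift l (-(D.length:ℤ))) r with hνdef
  rw [casoratian_eq_det F.γ _ (D.length+1) (by simp)
    (fun k => if h : (k:ℕ) < D.length then phiT F l (D.get ⟨k, h⟩) else phiN F l n) (fun k => by grind)]
  have h1 := Matrix.det_mul_row (fun k:Fin (D.length+1) => if (k:ℕ) < D.length then 1 else ν) B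
  have h2 := Matrix.det_mul_column (fun j:Fin (D.length+1) =>
      phiT0 F l (cpt F.γ (D.length+1) r j))
    (Matrix.of fun j k:Fin (D.length+1) => (if (k:ℕ) < D.length then 1 else ν)*B j k : Matrix (Fin (D.length+1)) (Fin (D.length+1)) ℂ)
  rw [h1, Fin.prod_univ_castSucc (f := fun k : Fin (D.length+1) => if (k:ℕ) < D.length then 1 else ν)] at h2
  simp only [Fin.val_castSucc, Fin.is_lt, if_true, prod_const_one, one_mul, Fin.val_last, lt_irrefl, if_false] at h2
  have h3 : (Matrix.of fun j k:Fin (D.length+1) =>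
      (if h:(k:ℕ) < D.length then phiT F l (D.get ⟨k, h⟩) else phiN F l n)
        (cpt F.γ (D.length+1) r j)) = Matrix.of fun j k : Fin (D.length+1) =>
      phiT0 F l (cpt F.γ (D.length+1) r j)*(Matrix.of fun j k:Fin (D.length+1) =>
        (if (k:ℕ) < D.length then 1 else ν)*B j k : Matrix (Fin (D.length+1)) (Fin (D.length+1)) ℂ) j k := by
    ext j k; simp only [Matrix.of_apply, hB]
    have hz := cpt_mem_vline F r (D.length+1) j
    have p0 := (phi0_reg h).ne _ hz
    have f0 := (G.phi_reg h.dom).ne _ hz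
    by_cases hk : (k:ℕ) < D.length
    · simp [hk, phiT]
    · simp only [dif_neg hk, if_neg hk, phiN, rFac, ← hνdef]; rw [nu, ← phi0_sq h _ hz, phiT0]; field_simp
  rw [h3, h2, PD, ← hB, cprod, Finset.prod_range, Nat.add_sub_cancel, mul_comm (D.length+1)]; field_simp

lemma cas_prefactor_pow (h:ℂ → ℂ) (n:ℕ) (P a b k:ℂ) (hr:r ∈ F.dom) (hc:PosR (cprod F h n (r-F.stp/2)*cprod F h n (r+F.stp/2))) :
    ((P^(1/2:ℂ)/(cprod F h n (r-F.stp/2)*(phiM F n (r-F.stp/2)*a)*(cprod F h n (r+F.stp/2)*(phiM F n (r+F.stp/2)*b))))^(1/2:ℂ) *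
      (cprod F h (n+1) r*k*phiM F (n+1) r))^4 =
    P*(h (cpt F.γ (n+1) r 0)*h (cpt F.γ (n+1) r n))^2*phiCen F n r^2*k^4/(a*b)^2 := by
  have h1 := cprod_succ_sq F h n r
  have h2 := phiM_succ_sq F n r
  have hc := hc.ne
  have hp := (G.phiM_pair_pos hr n).ne; rw [pow_four_sqrt]; grind

lemma psiD_pow (D:List ℕ) (h:G.Good (F.shift l (-(D.length:ℤ))) r) : psiD F l D r^4 = F.w (F.shift l (-(D.length:ℤ))) r^2 /
      ((G.pCas (D.map (G.pT l))).eval (F.η (r-F.stp/2))*(G.pCas (D.map (G.pT l))).eval (F.η (r+F.stp/2)))^2 := by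
  rw [G.psiD_eq D h.dom, pow_four_div_sqrt, phi0_sq h _ (ofReal_mem_vline r)]

end AdmModel

/-- The regularity of the vertical lines over `U` for the data attached to `D`. -/
structure GoodOn {F:FamilyData} (G:AdmModel F) (l:F.Par) (N:ℕ) (D:List ℕ) (U:Set ℝ) : Prop where
  bar : F.adm (lamBar F l N)
  le : ∀ d ∈ D, d ≤ N
  len : D.length ≤ N+1
  good : ∀ r ∈ U, ∀ k ≤ N+1, G.Good (F.shift l (-(k:ℤ))) r
  eval_ne : ∀ r ∈ U, ∀ z ∈ vline r, (G.pCas (D.map (G.pT l))).eval (F.η z) ≠ 0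

namespace GoodOn
open AdmModel
variable {F:FamilyData} {G:AdmModel F} {l:F.Par} {r:ℝ} {N:ℕ} {D:List ℕ} {U:Set ℝ}
  (H:GoodOn G l N D U)
include H

lemma good_self (hr:r ∈ U) : G.Good l r := by
  have := H.good r hr 0 (Nat.zero_le _)
  rwa [Nat.cast_zero, neg_zero, G.shift_zero] at this

lemma adm_len : F.adm (F.shift l (-(D.length:ℤ))) := by
  have := G.adm_of_bar H.bar (N+1-D.length)
  have hl := H.len; simp_all

lemma eval_pos (hr:r ∈ U) : PosR ((G.pCas (D.map (G.pT l))).eval (F.η (r-F.stp/2))*(G.pCas (D.map (G.pT l))).eval (F.η (r+F.stp/2))) :=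
  G.eval_pair_pos _ (G.pCas_T_real H.bar H.le) (G.evalη_reg _ (H.eval_ne r hr))

lemma psiD_pos (hr:r ∈ U) : PosR (psiD F l D r) := G.psiD_pos D H.adm_len (H.good r hr _ H.len) (G.pCas_T_real H.bar H.le)
    (G.evalη_reg _ (H.eval_ne r hr))

omit H in
lemma WT_pair (G:AdmModel F) (l:F.Par) (D:List ℕ) (r:ℝ) : WT F l D (r-I*(F.γ/2))*WT F l D (r+I*(F.γ/2)) =
      cprod F (phiT0 F l) D.length (r-F.stp/2)*(phiM F D.length (r-F.stp/2)*(G.pCas (D.map (G.pT l))).eval (F.η (r-F.stp/2))) *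
      (cprod F (phiT0 F l) D.length (r+F.stp/2)*(phiM F D.length (r+F.stp/2)*(G.pCas (D.map (G.pT l))).eval (F.η (r+F.stp/2)))) := by
  rw [half_stp, WT_eq G, WT_eq G]

lemma cprod_pair (hr:r ∈ U) (n:ℕ) : PosR (cprod F (phiT0 F l) n (r-F.stp/2)*cprod F (phiT0 F l) n (r+F.stp/2)) :=
  cprod_pair_pos (phiT0_reg (H.good_self hr)) (phiT0_conj (G.adm_self H.bar) (H.good_self hr))
    (phiT0_pos (G.adm_self H.bar) (H.good_self hr)) n

lemma WT_pair_pos (hr:r ∈ U) : PosR (WT F l D (r-I*(F.γ/2))*WT F l D (r+I*(F.γ/2))) := by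
  rw [WT_pair G l D r]
  have h1 := H.cprod_pair hr D.length
  have h2 := G.phiM_pair_pos (H.good_self hr).dom D.length
  convert (h1.mul h2).mul (H.eval_pos hr) using 1
  ring

/-- The eigenfunctions of the deformed Hamiltonian in terms of `P_{D,n}`. -/
lemma phiD_prop (n:ℕ) : PropOn U (phiD F l D n) (fun x => psiD F l D x*PD F l D n x) := by
  have hl := G.adm_self H.bar
  obtain ⟨C, hC, hT⟩ := G.identity_T hl D.length
  have key : PropOn U (fun x => (prodVV F l D.length x^(1/2:ℂ)/(WT F l D (x-I*(F.γ/2))*WT F l D (x+I*(F.γ/2))))^(1/2:ℂ) *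
      (cprod F (phiT0 F l) (D.length+1) x*nu F (F.shift l (-(D.length:ℤ))) x*phiM F (D.length+1) x)) (psiD F l D) := by
    refine propOn_of_pow (fun r hr => ?_) (fun r hr => H.psiD_pos hr) (C^2)⁻¹ fun r hr => ?_
    · have hg := H.good_self hr
      refine ((G.prodVV_pos hg _).sqrt.div (H.WT_pair_pos hr)).sqrt.mul (PosR.mul (PosR.mul ?_ ?_) (G.phiM_pos hg.dom _))
      · exact cprod_pos (phiT0_reg hg) (phiT0_conj hl hg) (phiT0_pos hl hg) _
      · exact (G.w_pos _ H.adm_len r hg.dom).div (G.phi_pos hg.dom)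
    · have hg := H.good_self hr
      have hg' := H.good r hr _ H.len
      have hid := hT r hg hg'; rw [WT_pair G l D r, G.cas_prefactor_pow _ _ _ _ _ _ hg.dom (H.cprod_pair hr _), G.psiD_pow D hg']
      have hX := (H.eval_pos hr).ne
      have hφ := (G.phi_pos hg.dom).ne
      have hw : F.w (F.shift l (-(D.length:ℤ))) r = nu F (F.shift l (-(D.length:ℤ))) r*F.φ r := by rw [nu]; field_simp
      grind
  have h2 := key.mul (PropOn.of_eq (U := U) (f := PD F l D n) (g := PD F l D n) fun _ _ => rfl)
  refine PropOn.trans (PropOn.of_eq fun r hr => ?_) h2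
  rw [phiD, G.cas_phiD D n (H.good_self hr) (H.good r hr _ H.len)]; ring

/-- The added eigenfunctions of the deformed Hamiltonian. -/
lemma PhiD_prop {d:ℕ} (hd:d ∈ D) : PropOn U (PhiD F l D d) (fun x => psiD F l D x*Xi F l (D.erase d) x) := by
  have hl := G.adm_self H.bar
  obtain ⟨C, hC, hT⟩ := G.identity_T hl D.length
  have hlen : D.length = (D.erase d).length+1 := by grind
  set n := (D.erase d).length with hn
  have key : PropOn U (fun x => prodVV F l D.length x^(-(1/4):ℂ)*(cprod F (phiT0 F l) n x*phiM F n x /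
      (WT F l D (x-I*(F.γ/2))*WT F l D (x+I*(F.γ/2)))^(1/2:ℂ))) (psiD F l D) := by
    refine propOn_of_pow (fun r hr => ?_) (fun r hr => H.psiD_pos hr) (C^2) fun r hr => ?_
    · have hg := H.good_self hr
      have h4 := (G.prodVV_pos hg D.length).rpow (-(1/4)); push_cast at h4
      refine h4.mul ((PosR.mul ?_ (G.phiM_pos hg.dom _)).div (H.WT_pair_pos hr).sqrt)
      exact cprod_pos (phiT0_reg hg) (phiT0_conj hl hg) (phiT0_pos hl hg) _
    · have hg := H.good_self hr
      have hg' := H.good r hr _ H.len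
      have hid := hT r hg hg'
      have hP := (G.prodVV_pos hg D.length).ne
      have h4 : (prodVV F l D.length r^(-(1/4):ℂ))^4 = (prodVV F l D.length r)⁻¹ := by
        rw [← cpow_nat_mul]; norm_num [cpow_neg_one]
      have h1 := cprod_half F (phiT0 F l) n r
      have h2 := phiCen_succ F n r
      have hc := (H.cprod_pair hr D.length).ne
      have hp := (G.phiM_pair_pos hg.dom D.length).ne; rw [mul_pow, h4, pow_four_div_sqrt, WT_pair G l D r, G.psiD_pow D hg']
      have hX := (H.eval_pos hr).ne
      have hφ := (G.phi_pos hg.dom).ne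
      have hw : F.w (F.shift l (-(D.length:ℤ))) r = nu F (F.shift l (-(D.length:ℤ))) r*F.φ r := by rw [nu]; field_simp
      rw [hw]
      have hν : nu F (F.shift l (-(D.length:ℤ))) r ≠ 0 := div_ne_zero (hg'.w.ne _ (ofReal_mem_vline r)) hφ; simp only [hlen] at *
      rw [show cprod F (phiT0 F l) (n+1) (r-F.stp/2)*(phiM F (n+1) (r-F.stp/2)*(G.pCas (D.map (G.pT l))).eval (F.η (r-F.stp/2))) *
        (cprod F (phiT0 F l) (n+1) (r+F.stp/2)*(phiM F (n+1) (r+F.stp/2)*(G.pCas (D.map (G.pT l))).eval (F.η (r+F.stp/2)))) =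
        (cprod F (phiT0 F l) (n+1) (r+F.stp/2)*cprod F (phiT0 F l) (n+1) (r-F.stp/2)) *
        (phiM F (n+1) (r+F.stp/2)*phiM F (n+1) (r-F.stp/2))*((G.pCas (D.map (G.pT l))).eval (F.η (r-F.stp/2)) *
        (G.pCas (D.map (G.pT l))).eval (F.η (r+F.stp/2))) by ring, h1, eq_div_of_mul_eq (pow_ne_zero 2 hφ) h2]
      have hcn : cprod F (phiT0 F l) n r ≠ 0 := (cprod_pos (phiT0_reg hg) (phiT0_conj hl hg) (phiT0_pos hl hg) _).ne
      have hpn := (G.phiM_pos hg.dom n).ne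
      have hcen := (G.phiCen_pos hg.dom (n+1)).ne
      have hT : phiT0 F l (cpt F.γ (n+2) r 0)*phiT0 F l (cpt F.γ (n+2) r (n+1)) ≠ 0 :=
        mul_ne_zero ((phiT0_reg hg).ne _ (cpt_mem_vline F r _ _)) ((phiT0_reg hg).ne _ (cpt_mem_vline F r _ _))
      rw [show n+1+1 = n+2 from rfl] at hid
      generalize phiT0 F l (cpt F.γ (n+2) r 0)*phiT0 F l (cpt F.γ (n+2) r (n+1)) = T at *
      generalize (G.pCas (D.map (G.pT l))).eval (F.η (r-F.stp/2))*(G.pCas (D.map (G.pT l))).eval (F.η (r+F.stp/2)) = X at *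
      field_simp; linear_combination -hid
  have h2 := key.mul (PropOn.of_eq (U := U) (f := Xi F l (D.erase d)) (g := Xi F l (D.erase d)) fun _ _ => rfl)
  refine PropOn.trans (PropOn.of_eq fun r hr => ?_) h2
  have hg := H.good_self hr
  have hg' := H.good r hr _ H.len
  have p0 := (phi0_pos H.adm_len hg').ne
  have hφ := (G.phi_pos hg.dom).ne; rw [PhiD, Cs, phiT0, WT_eq G l (D.erase d), G.Xi_eq _ _ _ (G.phiM_pos hg.dom _).ne, ← hn]
  field_simp

end GoodOn

lemma PropInEta.propOn {η:ℂ → ℂ} {Rf Rg:Set ℂ} {f g:ℂ → ℂ} (h:PropInEta η Rf Rg f g)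
    {U:Set ℝ} (hf:∀ r ∈ U, (r:ℂ) ∈ Rf) (hg:∀ r ∈ U, (r:ℂ) ∈ Rg) : PropOn U f g := by
  obtain ⟨p, q, hp, hq, c, hc, rfl⟩ := h; exact ⟨c, hc, fun r hr => by rw [hp _ (hf r hr), hq _ (hg r hr), eval_mul, eval_C]⟩

namespace GoodOn
open AdmModel
variable {F:FamilyData} {G:AdmModel F} {l:F.Par} {r:ℝ} {N:ℕ} {D:List ℕ} {U:Set ℝ}
  (H:GoodOn G l N D U)
include H

lemma good_bar (hr:r ∈ U) : G.Good (lamBar F l N) r := by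
  have := H.good r hr (N+1) le_rfl
  rwa [Nat.cast_succ] at this

/-- The states with index set `K` of the system with the states of the complement deleted. -/
lemma PhiKA_prop (hD:D.Nodup) (K:List ℕ) (hK:K.length = (Dbar N D).length+1) : PropOn U (PhiKA F (lamBar F l N) (Dbar N D) K)
      (fun x => psiD F l D x*XiBar F (lamBar F l N) K x) := by
  have hcom := compl_Dbar hD H.le
  obtain ⟨c, hc, hA⟩ := G.pCas_dual hcom l (fun d hd => G.adm_nondegT l N H.bar d (H.le d hd)) fun e _ => G.adm_nondeg _ H.bar e
  have hlen := hcom.length_add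
  set b := lamBar F l N with hb
  set B := G.pCas ((Dbar N D).map (G.pP b)) with hB
  set m := (Dbar N D).length with hm
  have hshift : F.shift b m = F.shift l (-(D.length:ℤ)) := by rw [hb, lamBar, G.shift_shift]; congr 1; omega
  obtain ⟨C, hC, hE⟩ := G.identity_E H.bar m
  have hBreal : B.map conj = B := G.pCas_P_real H.bar _
  have hBne : ∀ r ∈ U, ∀ z ∈ vline r, B.eval (F.η z) ≠ 0 := fun r hr z hz h0 => H.eval_ne r hr z hz (by rw [hA, eval_mul, h0, mul_zero])
  have hWE : ∀ r : ℝ, WE F b (Dbar N D) (r-I*(F.γ/2))*WE F b (Dbar N D) (r+I*(F.γ/2)) =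
      cprod F (phi0 F b) m (r-F.stp/2)*(phiM F m (r-F.stp/2)*B.eval (F.η (r-F.stp/2))) *
      (cprod F (phi0 F b) m (r+F.stp/2)*(phiM F m (r+F.stp/2)*B.eval (F.η (r+F.stp/2)))) := fun r => by
    rw [half_stp, WE_eq G, WE_eq G]
  have hBpos : ∀ r ∈ U, PosR (B.eval (F.η (r-F.stp/2))*B.eval (F.η (r+F.stp/2))) :=
    fun r hr => G.eval_pair_pos B hBreal (G.evalη_reg _ (hBne r hr))
  have hcp : ∀ r ∈ U, PosR (cprod F (phi0 F b) m (r-F.stp/2)*cprod F (phi0 F b) m (r+F.stp/2)) := fun r hr =>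
    cprod_pair_pos (phi0_reg (H.good_bar hr)) (phi0_conj H.bar (H.good_bar hr)) (phi0_pos H.bar (H.good_bar hr)) m
  have key : PropOn U (fun x => (prodVV F b m x^(1/2:ℂ)/(WE F b (Dbar N D) (x-I*(F.γ/2))*WE F b (Dbar N D) (x+I*(F.γ/2))))^(1/2:ℂ) *
      (cprod F (phi0 F b) (m+1) x*1*phiM F (m+1) x)) (psiD F l D) := by
    refine propOn_of_pow (fun r hr => ?_) (fun r hr => H.psiD_pos hr) (c^4*(C^2)⁻¹) fun r hr => ?_
    · have hg := H.good_bar hr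
      refine ((G.prodVV_pos hg _).sqrt.div ?_).sqrt.mul (PosR.mul (PosR.mul ?_ PosR.one) (G.phiM_pos hg.dom _))
      · rw [hWE]
        convert ((hcp r hr).mul (G.phiM_pair_pos hg.dom m)).mul (hBpos r hr) using 1
        ring
      · exact cprod_pos (phi0_reg hg) (phi0_conj H.bar hg) (phi0_pos H.bar hg) _
    · have hg := H.good_bar hr
      have hg' := H.good r hr _ H.len
      have hid := hE r hg; rw [← hb] at hid
      rw [hWE, G.cas_prefactor_pow _ _ _ _ _ _ hg.dom (hcp r hr), G.psiD_pow D hg', hA, eval_mul, eval_mul, eval_C, eval_C, ← hshift, ← hid]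
      grind
  have h2 := key.mul (PropOn.of_eq (U := U) (f := XiBar F b K) (g := XiBar F b K) fun _ _ => rfl)
  refine PropOn.trans (PropOn.of_eq fun r hr => ?_) h2
  have hφ := (G.phiM_pos (H.good_bar hr).dom K.length).ne; rw [PhiKA, WE_eq G b K, G.XiBar_eq _ _ _ hφ, hK]; ring

lemma phiD_dual (hD0:D ≠ []) (hD:D.Nodup) (n:ℕ) : PropOn U (phiD F l D n) (PhiKA F (lamBar F l N) (Dbar N D) (Dbar N D ++ [N+1+n])) := by
  refine (H.phiD_prop n).trans (PropOn.trans ?_ (H.PhiKA_prop hD _ (by simp)).symm)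
  refine (PropOn.of_eq (U := U) (f := psiD F l D) (g := psiD F l D) fun _ _ => rfl).mul ?_
  refine (G.polyDualityOne hD0 hD H.le l n (fun d hd => G.adm_nondegT l N H.bar d (H.le d hd))
    (G.adm_nondeg _ (G.adm_self H.bar) n) fun e _ => G.adm_nondeg _ H.bar e).propOn
    (fun r hr => ?_) fun r hr => (G.phiM_pos (H.good_self hr).dom _).ne
  have hg := H.good_self hr
  exact ⟨(G.phiM_pos hg.dom _).ne, (G.phi_pos hg.dom).ne, (H.good r hr _ H.len).w.ne _ (ofReal_mem_vline r), fun j _ =>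
    ⟨(G.phi_reg hg.dom).ne _ (cpt_mem_vline F r _ j), hg.w.ne _ (cpt_mem_vline F r _ j)⟩⟩

lemma PhiD_dual (hD:D.Nodup) {d:ℕ} (hd:d ∈ D) : PropOn U (PhiD F l D d) (PhiKA F (lamBar F l N) (Dbar N D) (Dbar N (D.erase d))) := by
  have hle : ∀ d' ∈ D.erase d, d' ≤ N := fun d' h => H.le d' (List.mem_of_mem_erase h)
  have hcom := compl_Dbar (hD.erase d) hle
  have h1 := hcom.length_add
  have h2 := (compl_Dbar hD H.le).length_add
  have h3 := List.length_erase_of_mem hd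
  have h4 := List.length_pos_of_mem hd
  refine (H.PhiD_prop hd).trans (PropOn.trans ?_ (H.PhiKA_prop hD _ (by omega)).symm)
  refine (PropOn.of_eq (U := U) (f := psiD F l D) (g := psiD F l D) fun _ _ => rfl).mul ?_
  exact (G.propInEta hcom l (fun d hd => G.adm_nondegT l N H.bar d (hle d hd))
    fun e _ => G.adm_nondeg _ H.bar e).propOn (fun r hr => (G.phiM_pos (H.good_self hr).dom _).ne)
    fun r hr => (G.phiM_pos (H.good_self hr).dom _).ne

lemma Vhat_formula (hD0:D ≠ []) (x:ℂ) (hx:x.re ∈ U) : Vhat F l D x = ((F.κ:ℂ)^D.length)⁻¹ *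
      starFun (F.V (F.shift l (-(D.length:ℤ)))) (x-I*(F.γ/2))*(Xi F l D.dropLast (x+I*(F.γ/2))/Xi F l D.dropLast (x-I*(F.γ/2))) *
      (Xi F l D (x-I*F.γ)/Xi F l D x) := by
  have hg := H.good_self hx
  have hdom := hg.dom
  have hh := Model.half_re F
  have hp : (x+F.stp/2).re ∈ F.dom := by rwa [add_re, hh, add_zero]
  have hm : (x-F.stp/2).re ∈ F.dom := by rwa [sub_re, hh, sub_zero]
  have hm' : (x-F.stp).re ∈ F.dom := by rwa [sub_re, stp_re, sub_zero]
  rw [half_stp, I_mul_gamma, Vhat_eq (G.adm_self H.bar) hg D hD0 x rfl,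
    starV H.adm_len _ G, G.nm_shift_neg, G.Xi_eq _ _ _ (G.phiM_ne _ _ hp),
    G.Xi_eq _ _ _ (G.phiM_ne _ _ hm), G.Xi_eq _ _ _ (G.phiM_ne _ _ hm'), G.Xi_eq _ _ _ (G.phiM_ne _ _ hdom), sub_add_cancel,
    show x-F.stp/2-(D.length:ℂ)/2*F.stp = x-((D.length:ℂ)+1)/2*F.stp by ring,
    mul_comm (F.φ (x-F.stp/2)), mul_div_assoc, inv_mul_cancel_left₀ (pow_ne_zero _ G.κ_ne)]

lemma Vhat_reg (hD0:D ≠ []) (hr:r ∈ U) (h':∀ z ∈ vline r, (G.pCas (D.dropLast.map (G.pT l))).eval (F.η z) ≠ 0) :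
    LineReg (Vhat F l D) r := by
  have hg := H.good_self hr
  have hA := G.evalη_reg _ (H.eval_ne r hr)
  have hA' := G.evalη_reg _ h'
  have hc : (((D.length:ℂ)+1)/2*F.stp).re = 0 := by
    have := re_add_mul_stp F 0 (((D.length:ℝ)+1)/2); simp_all
  exact ((((hg.nm.sub_im hc).div ((G.phi_reg hg.dom).mul ((G.phi_reg hg.dom).sub_im
    (Model.half_re F)))).mul ((hA'.add_im (Model.half_re F)).div (hA'.sub_im (Model.half_re F)))).mul
    ((hA.sub_im (stp_re F)).div hA)).congr fun z hz => Vhat_eq (G.adm_self H.bar) hg D hD0 z hz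

lemma HD_dual (hD0:D ≠ []) (hD:D.Nodup) (h':∀ r ∈ U, ∀ z ∈ vline r, (G.pCas (D.dropLast.map (G.pT l))).eval (F.η z) ≠ 0)
    (f:ℂ → ℂ) (x:ℂ) (hx:x.re ∈ U) : HD F l D f x-F.E l (-(N:ℤ)-1)*f x = ((F.κ:ℂ)^(N+1))⁻¹ *
      HKA F (lamBar F l N) (Dbar N D) (N-D.getLastD 0) f x := by
  set k : ℝ := (F.κ^(N+1))⁻¹ with hk
  have hkpos : 0 < k := inv_pos.2 (pow_pos G.κ_pos _)
  have hkne : (k:ℂ) ≠ 0 := by exact_mod_cast hkpos.ne'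
  set W := VKA F (lamBar F l N) (Dbar N D) (N-D.getLastD 0) with hW
  have hVU : ∀ z ∈ vline x.re, Vhat F l D z = k*starFun W (z-I*(F.γ/2)) := fun z hz =>
    G.Vhat_eq_star_VKA hD0 hD H.le H.bar (H.good_self hx) (H.good_bar hx) z hz
  have hV := H.Vhat_reg hD0 hx (h' _ hx)
  have hh : (I*((F.γ:ℂ)/2)).re = 0 := by rw [half_stp]; exact Model.half_re F
  have hU : LineReg W x.re := by
    have h1 : LineReg (starFun W) x.re := by
      refine ((hV.add_im hh).div (LineReg.const hkne)).congr fun z hz => ?_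
      rw [hVU _ (by change (z+_).re = _; rw [add_re, hh, add_zero]; exact hz), add_sub_cancel_right, mul_div_cancel_left₀ _ hkne]
    refine h1.star.congr fun z _ => ?_
    rw [starFun, starFun, conj_conj, conj_conj]
  have h1 := opA_opAdag_eq hkpos hV hU hVU f x rfl
  have hlast : D.getLastD 0 ≤ N := by
    rw [List.getLastD_eq_getLast?, List.getLast?_eq_some_getLast hD0]; exact H.le _ (List.getLast_mem hD0)
  have h2 := G.E_bar l N ((N-D.getLastD 0:ℕ):ℤ)
  rw [show ((N-D.getLastD 0:ℕ):ℤ)-N-1 = -(D.getLastD 0:ℤ)-1 by omega, ← G.Et_eq] at h2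
  have hk' : ((F.κ:ℂ)^(N+1))⁻¹ = k := by rw [hk]; push_cast; rfl
  rw [hk'] at h2 ⊢; rw [HD, HKA, h1, mul_add, ← mul_assoc (k:ℂ) (F.E _ _), h2]; ring

end GoodOn

namespace AdmModel
variable {F:FamilyData} (G:AdmModel F)
include G

theorem identities : Identities F := by
  intro N D l hD0 hD hN
  refine ⟨G.casoratianIdentity hD hN l, G.polyDualityOne hD0 hD hN l, G.polyDualityTwo hD hN l, fun _ hl => ?_⟩
  have hN' : ∀ d ∈ D.dropLast, d ≤ N := fun d hd => hN d (List.dropLast_subset D hd)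
  obtain ⟨S₁, hS₁, h₁⟩ := G.exists_good_all hl
  obtain ⟨S₂, hS₂, h₂⟩ := G.exists_eval_ne _ (G.pCas_T_ne hl hD hN)
  obtain ⟨S₃, hS₃, h₃⟩ := G.exists_eval_ne _ (G.pCas_T_ne hl (hD.sublist (List.dropLast_sublist D)) hN')
  have hsub : ∀ {r:ℝ}, r ∈ F.dom \ (S₁ ∪ S₂ ∪ S₃) → r ∈ F.dom \ S₁ ∧ r ∈ F.dom \ S₂ ∧ r ∈ F.dom \ S₃ := fun h =>
    ⟨⟨h.1, fun h' => h.2 (Or.inl (Or.inl h'))⟩, ⟨h.1, fun h' => h.2 (Or.inl (Or.inr h'))⟩, ⟨h.1, fun h' => h.2 (Or.inr h')⟩⟩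
  have H : GoodOn G l N D (F.dom \ (S₁ ∪ S₂ ∪ S₃)) := by
    refine ⟨hl, hN, ?_, fun r hr => h₁ r (hsub hr).1, fun r hr z hz => h₂ z ?_⟩
    · have := (compl_Dbar hD hN).length_add; omega
    · have h : z.re = r := hz; rw [h]; exact (hsub hr).2.1
  refine ⟨S₁ ∪ S₂ ∪ S₃, (hS₁.union hS₂).union hS₃, ⟨H.Vhat_formula hD0, H.phiD_prop,
    fun d hd => H.PhiD_prop hd⟩, H.HD_dual hD0 hD fun r hr z hz => h₃ z ?_, H.phiD_dual hD0 hD, fun d hd => H.PhiD_dual hD hd⟩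
  have h : z.re = r := hz; rw [h]; exact (hsub hr).2.2

end AdmModel

/-- A finite sum over a basis on which an operator acts bidiagonally is an eigenvector as soon as
the coefficients satisfy the two-term recurrence. -/
lemma sum_eigen (n:ℕ) (c B TB e f:ℕ → ℂ) (E:ℂ) (h0:TB 0 = e 0*B 0) (hT:∀ k, TB (k+1) = e (k+1)*B (k+1)+f (k+1)*B k)
    (hc:∀ k < n, (E-e k)*c k = c (k+1)*f (k+1)) (hE:e n = E) : ∑ k ∈ range (n+1), c k*TB k = E*∑ k ∈ range (n+1), c k*B k := by
  have h : ∀ m ≤ n, ∑ k ∈ range (m+1), c k*TB k = E*∑ k ∈ range (m+1), c k*B k-(E-e m)*c m*B m := by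
    intro m hm
    induction m with
    | zero => simp [h0]; ring
    | succ m ih =>
      rw [sum_range_succ, ih (by omega), sum_range_succ _ (m+1), hT, hc m (by omega)]; ring
  rw [h n le_rfl, hE]; ring

lemma exists_poly_of_sum {η:ℂ → ℂ} (n:ℕ) (c α β:ℕ → ℂ) (B:ℕ → ℂ → ℂ) (h0:∀ x, B 0 x = 1) (hB:∀ k x, B (k+1) x = B k x*(α k*η x+β k)) :
    ∃ p : ℂ[X], p.natDegree ≤ n ∧ (∀ x, ∑ k ∈ range (n+1), c k*B k x = p.eval (η x)) ∧ p.coeff n = c n*∏ i ∈ range n, α i := by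
  have hQ : ∀ k, ∃ Q : ℂ[X], Q.natDegree ≤ k ∧ (∀ x, B k x = Q.eval (η x)) ∧ Q.coeff k = ∏ i ∈ range k, α i := by
    intro k
    induction k with
    | zero => exact ⟨1, by simp, fun x => by simp [h0], by simp⟩
    | succ k ih =>
      obtain ⟨Q, h1, h2, h3⟩ := ih
      have hl : (Polynomial.C (α k)*X+Polynomial.C (β k)).natDegree ≤ 1 := Polynomial.natDegree_linear_le
      refine ⟨Q*(Polynomial.C (α k)*X+Polynomial.C (β k)), ?_, fun x => ?_, ?_⟩
      · exact natDegree_mul_le.trans (add_le_add h1 hl)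
      · rw [hB, h2]; simp
      · rw [coeff_mul_add_eq_of_natDegree_le h1 hl, h3, prod_range_succ]; simp
  choose Q hQ1 hQ2 hQ3 using hQ
  refine ⟨∑ k ∈ range (n+1), Polynomial.C (c k)*Q k, ?_, fun x => ?_, ?_⟩
  · refine natDegree_sum_le_of_forall_le _ _ fun k hk => ?_
    exact (natDegree_C_mul_le _ _).trans ((hQ1 k).trans (by have := mem_range.1 hk; omega))
  · rw [eval_finsetSum]; simp_all
  · rw [finsetSum_coeff, sum_range_succ, sum_eq_zero, zero_add, coeff_C_mul, hQ3]; intro k hk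
    rw [coeff_C_mul, coeff_eq_zero_of_natDegree_lt, mul_zero]; exact (hQ1 k).trans_lt (mem_range.1 hk)

lemma poch_zero (a:ℂ) : poch a 0 = 1 := by simp [poch]

lemma poch_succ (a:ℂ) (n:ℕ) : poch a (n+1) = poch a n*(a+n) := prod_range_succ _ _

lemma poch_succ' (a:ℂ) (n:ℕ) : poch a (n+1) = a*poch (a+1) n := by
  rw [poch, prod_range_succ', poch, mul_comm]; grind

lemma poch_shift (a:ℂ) (n:ℕ) : a*poch (a+1) n = poch a n*(a+n) := by rw [← poch_succ', poch_succ]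

/-- The two-term recurrence of a shifted factorial with a moving start. -/
lemma poch_sub (a:ℂ) {n k:ℕ} (h:k < n) : poch (a+k) (n-k) = (a+k)*poch (a+(k+1:ℕ)) (n-(k+1)) := by
  rw [show n-k = n-(k+1)+1 by omega, poch_succ']; congr 2; push_cast; ring

lemma poch_neg_self (n:ℕ) : poch (-(n:ℂ)) n = (-1)^n*n.factorial := by
  have h : ∀ m ≤ n, poch (-(n:ℂ)) m = (-1)^m*(n.descFactorial m:ℂ) := by
    intro m hm
    induction m with
    | zero => simp [poch_zero]
    | succ m ih =>
      rw [poch_succ, ih (by omega), Nat.descFactorial_succ, Nat.cast_mul, Nat.cast_sub (by omega)]; ring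
  rw [h n le_rfl, Nat.descFactorial_self]

lemma poch_conj (a:ℂ) (n:ℕ) : conj (poch a n) = poch (conj a) n := by simp [poch, map_prod]

/-- The geometry of the sinusoidal coordinate `η(x) = x`. -/
def Geom.linear {F:FamilyData} (hη:F.η = fun x => x) (hφ:F.φ = fun _ => 1) (hγ:F.γ = 1) (hd:F.dom = Set.univ) : Geom F where
  ω n := n
  σ _ := 2
  σ' _ := 0
  τ n := (n:ℂ)^2/4
  ω_ne n hn := by exact_mod_cast hn
  σ_pos _ := two_pos
  η_sub n x := by simp only [hη, hφ, FamilyData.stp, hγ]; push_cast; ring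
  η_add n x := by simp only [hη]; push_cast; ring
  η_mul n x := by
    simp only [hη, FamilyData.stp, hγ]; push_cast; linear_combination -((n:ℂ)/2)^2*I_sq
  φ_ne x _ := by simp [hφ]
  η_diff := by rw [hη]; exact differentiable_id
  φ_diff := by rw [hφ]; exact differentiable_const _
  dom_open := by rw [hd]; exact isOpen_univ
  dom_nonempty := by rw [hd]; exact Set.univ_nonempty
  η_fib c := by simp_all
  η_conj x := by rw [hη]
  φ_conj x := by simp [hφ]
  φ_pos r _ := ⟨1, one_pos, by simp [hφ]⟩

/-- The geometry of the sinusoidal coordinate `η(x) = x²`. -/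
def Geom.quadratic {F:FamilyData} (hη:F.η = fun x => x^2) (hφ:F.φ = fun x => 2*x) (hγ:F.γ = 1) (hd:F.dom = Set.Ioi 0) : Geom F where
  ω n := n
  σ _ := 2
  σ' n := -(n:ℂ)^2/2
  τ n := (n:ℂ)^4/16
  ω_ne n hn := by exact_mod_cast hn
  σ_pos _ := two_pos
  η_sub n x := by simp only [hη, hφ, FamilyData.stp, hγ]; push_cast; ring
  η_add n x := by
    simp only [hη, FamilyData.stp, hγ]; push_cast; linear_combination (n:ℂ)^2/2*I_sq
  η_mul n x := by
    simp only [hη, FamilyData.stp, hγ]; push_cast; linear_combination (-(x^2*n^2/2)+(n:ℂ)^4/16*(I ^ 2-1))*I_sq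
  φ_ne x hx := by
    rw [hd] at hx; simp only [hφ]
    refine mul_ne_zero two_ne_zero fun h => ?_
    rw [h] at hx; simp at hx
  η_diff := by rw [hη]; fun_prop
  φ_diff := by rw [hφ]; fun_prop
  dom_open := by rw [hd]; exact isOpen_Ioi
  dom_nonempty := by rw [hd]; exact ⟨1, Set.mem_Ioi.2 one_pos⟩
  η_fib c := by
    have hsub : {r:ℝ | r ∈ F.dom ∧ ∃ x : ℂ, x.re = r ∧ F.η x = c} ⊆
        {(c^(1/2:ℂ)).re, (-c^(1/2:ℂ)).re} := by
      rintro r ⟨-, x, rfl, h⟩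
      rw [hη] at h; rw [← PosR.sqrt_sq c] at h
      rcases sq_eq_sq_iff_eq_or_eq_neg.1 h with h | h <;> simp [h]
    exact (Set.toFinite _).subset hsub
  η_conj x := by simp [hη]
  φ_conj x := by simp [hφ, Complex.conj_ofNat]
  φ_pos r hr := by
    rw [hd] at hr; exact ⟨2*r, mul_pos two_pos hr, by simp [hφ]⟩

lemma sin_ne_zero_of_re {x:ℂ} (hx:x.re ∈ Set.Ioo 0 Real.pi) : sin x ≠ 0 := by
  rw [Complex.sin_ne_zero_iff]
  rintro k rfl
  rw [show (k:ℂ)*Real.pi = ((k*Real.pi:ℝ):ℂ) by push_cast; rfl, ofReal_re] at hx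
  obtain ⟨h1, h2⟩ := hx
  have hpi := Real.pi_pos
  have a1 : (0:ℝ) < k := by by_contra h; nlinarith [not_lt.1 h]
  have a2 : (k:ℝ) < 1 := by by_contra h; nlinarith [not_lt.1 h]
  have b1 : 0 < k := by exact_mod_cast a1
  have b2 : k < 1 := by exact_mod_cast a2
  omega

lemma re_eq_of_cos_eq {x y:ℂ} (hx:x.re ∈ Set.Ioo 0 Real.pi) (hy:y.re ∈ Set.Ioo 0 Real.pi) (h:cos x = cos y) : x.re = y.re := by
  obtain ⟨k, hk⟩ := Complex.cos_eq_cos_iff.1 h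
  have hpi := Real.pi_pos
  obtain ⟨h1, h2⟩ := hx
  obtain ⟨h3, h4⟩ := hy
  have e : (2*(k:ℂ)*Real.pi) = ((2*k*Real.pi:ℝ):ℂ) := by push_cast; rfl
  rcases hk with hk | hk
  · rw [e] at hk
    have := congrArg Complex.re hk; rw [add_re, ofReal_re] at this
    have a1 : (k:ℝ) < 1 := by by_contra h; nlinarith [not_lt.1 h]
    have a2 : (-1:ℝ) < k := by by_contra h; nlinarith [not_lt.1 h]
    have b1 : k < 1 := by exact_mod_cast a1
    have b2 : -1 < k := by exact_mod_cast a2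
    have : k = 0 := by omega
    subst this; simp at hk; rw [hk]
  · rw [e] at hk
    have := congrArg Complex.re hk; rw [sub_re, ofReal_re] at this
    have a1 : (0:ℝ) < k := by by_contra h; nlinarith [not_lt.1 h]
    have a2 : (k:ℝ) < 1 := by by_contra h; nlinarith [not_lt.1 h]
    have b1 : 0 < k := by exact_mod_cast a1
    have b2 : k < 1 := by exact_mod_cast a2
    omega

/-- The geometry of the sinusoidal coordinate `η(x) = cos x`. -/
def Geom.cosine {F:FamilyData} (hη:F.η = fun x => cos x) (hφ:F.φ = fun x => 2*sin x)
    (hγ:F.γ ≠ 0) (hd:F.dom = Set.Ioo 0 Real.pi) : Geom F where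
  ω n := -Real.sinh (n/2*F.γ)
  σ n := 2*Real.cosh (n/2*F.γ)
  σ' _ := 0
  τ n := Real.sinh (n/2*F.γ)^2
  ω_ne n hn := neg_ne_zero.2 fun h => by simp_all
  σ_pos n := mul_pos two_pos (Real.cosh_pos _)
  η_sub n x := by
    simp only [hη, hφ]
    rw [show (n:ℂ)/2*F.stp = ((n/2*F.γ:ℝ):ℂ)*I by rw [FamilyData.stp]; push_cast; ring, cos_add, cos_sub, sin_mul_I, cos_mul_I]
    push_cast; ring
  η_add n x := by
    simp only [hη]
    rw [show (n:ℂ)/2*F.stp = ((n/2*F.γ:ℝ):ℂ)*I by rw [FamilyData.stp]; push_cast; ring, cos_add, cos_sub, sin_mul_I, cos_mul_I]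
    push_cast; ring
  η_mul n x := by
    simp only [hη]
    rw [show (n:ℂ)/2*F.stp = ((n/2*F.γ:ℝ):ℂ)*I by rw [FamilyData.stp]; push_cast; ring, cos_add, cos_sub, sin_mul_I, cos_mul_I]
    rw [ofReal_sinh]
    linear_combination (-(sin x^2*sinh ((n/2*F.γ:ℝ):ℂ)^2))*I_sq+cos x^2*Complex.cosh_sq ((n/2*F.γ:ℝ):ℂ) +
      sinh ((n/2*F.γ:ℝ):ℂ)^2*sin_sq_add_cos_sq x
  φ_ne x hx := by
    rw [hd] at hx; simp only [hφ]; exact mul_ne_zero two_ne_zero (sin_ne_zero_of_re hx)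
  η_diff := by rw [hη]; exact differentiable_cos
  φ_diff := by rw [hφ]; fun_prop
  dom_open := by rw [hd]; exact isOpen_Ioo
  dom_nonempty := by rw [hd]; exact Set.nonempty_Ioo.2 Real.pi_pos
  η_fib c := by
    refine Set.Subsingleton.finite ?_
    rintro r ⟨hr, x, rfl, h⟩ r' ⟨hr', y, rfl, h'⟩
    rw [hd] at hr hr'; rw [hη] at h h'; exact re_eq_of_cos_eq hr hr' (h.trans h'.symm)
  η_conj x := by simp only [hη]; exact cos_conj x
  φ_conj x := by simp only [hφ]; rw [sin_conj, map_mul, Complex.conj_ofNat]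
  φ_pos r hr := by
    rw [hd] at hr; exact ⟨2*Real.sin r, mul_pos two_pos (Real.sin_pos_of_mem_Ioo hr), by simp [hφ]⟩

namespace Model
variable {F:FamilyData} (G:Model F)
include G

/-- The twisted weight is the pseudo virtual one up to a pseudo-constant factor. -/
lemma twistedGroundState (tw:F.Par → F.Par) (ζ:F.Par → ℂ) (hζ:∀ l, ζ l ≠ 0) (hp:∀ l x, G.np (tw l) x = ζ l*G.nm l (x-F.stp))
    (hm:∀ l x, G.nm (tw l) (x-F.stp) = ζ l*G.np l x) : TwistedGroundState F tw := by
  have step : ∀ l x, F.w l x ≠ 0 → F.w l (x-F.stp) ≠ 0 → G.np l x*nu F l x = G.nm l (x-F.stp)*nu F l (x-F.stp) ∧ G.np l x ≠ 0 ∧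
        G.nm l (x-F.stp) ≠ 0 := fun l x h1 h2 => by
    obtain ⟨a0, -, -, -, a, -⟩ := G.w_step _ _ h1
    obtain ⟨-, b0, -, -, -, b⟩ := G.w_step _ _ h2; grind
  intro l x h
  obtain ⟨w1, w2, f1⟩ := h x (Or.inl rfl)
  obtain ⟨w3, w4, f2⟩ := h (x-I*F.γ) (Or.inr rfl); rw [I_mul_gamma] at *
  obtain ⟨e1, n1, n2⟩ := step l x w1 w3
  obtain ⟨e2, -, -⟩ := step (tw l) x w2 w4; rw [hp, hm] at e2; rw [nu, nu] at e1 e2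
  have h3 : ζ l*G.np l x*G.nm l (x-F.stp) ≠ 0 := mul_ne_zero (mul_ne_zero (hζ l) n1) n2
  refine mul_left_cancel₀ h3 ?_
  linear_combination -(ζ l*G.nm l (x-F.stp)*(F.w (tw l) x/F.φ x))*e1-(G.nm l (x-F.stp)*(F.w l (x-F.stp)/F.φ (x-F.stp)))*e2

end Model

lemma LineReg.gamma {g:ℂ → ℂ} {r:ℝ} (hg:Continuous g) (h:∀ z ∈ vline r, (g z).im ≠ 0) : LineReg (fun z => Gamma (g z)) r := by
  have hne : ∀ z ∈ vline r, ∀ m : ℕ, g z ≠ -m := fun z hz m hm => h z hz (by rw [hm]; simp)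
  refine ⟨fun z hz => ?_, fun z hz => Gamma_ne_zero (hne z hz)⟩
  exact ((differentiableAt_Gamma _ (hne z hz)).continuousAt.comp hg.continuousAt).continuousWithinAt

lemma LineReg.prod {ι:Type*} (s:Finset ι) {f:ι → ℂ → ℂ} {r:ℝ} (h:∀ i ∈ s, LineReg (f i) r) : LineReg (fun z => ∏ i ∈ s, f i z) r := by
  classical
  induction s using Finset.induction_on with
  | empty => simpa using LineReg.const (r := r) one_ne_zero
  | insert a s ha ih =>
    simp only [prod_insert ha]; exact (h a (mem_insert_self a s)).mul (ih fun i hi => h i (mem_insert_of_mem hi))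

lemma ConjClosed.prod_eq {m:ℕ} {a:Fin m → ℂ} (h:ConjClosed a) (f:ℂ → ℂ) : ∏ j, f (conj (a j)) = ∏ j, f (a j) := by
  obtain ⟨σ, hσ⟩ := h; simp only [hσ]; exact Equiv.prod_comp σ fun j => f (a j)

lemma exists_finite_im {ι:Type*} [Fintype ι] (a:ι → ℂ) : ∃ S : Set ℝ, S.Finite ∧
    ∀ r, r ∉ S → ∀ j, ∀ z ∈ vline r, (a j+I*z).im ≠ 0 ∧ (a j-I*z).im ≠ 0 := by
  refine ⟨Set.range (fun j => (a j).im) ∪ Set.range (fun j => -(a j).im),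
    (Set.finite_range _).union (Set.finite_range _), fun r hr j z hz => ?_⟩
  have h : z.re = r := hz; simp only [Set.mem_union, Set.mem_range, not_or, not_exists] at hr
  have := hr.1 j
  have := hr.2 j; simp [h]; grind

lemma E_linear_ne {n k:ℕ} (h:k < n) : (k:ℂ) ≠ n := by exact_mod_cast h.ne

lemma I_mul_sub_I (x:ℂ) : I*(x-I) = I*x+1 := by linear_combination -I_sq

lemma I_mul_add_I (x:ℂ) : I*(x+I) = I*x-1 := by linear_combination I_sq

lemma I_mul_sub_half (x:ℂ) : I*(x-I/2) = I*x+1/2 := by linear_combination -(1/2)*I_sq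

lemma I_mul_add_half (x:ℂ) : I*(x+I/2) = I*x-1/2 := by linear_combination (1/2)*I_sq

lemma mul_I_add_one_ne {x:ℂ} (hx:x.re ≠ 0) : I*x ≠ 0 ∧ 2*(I*x)+1 ≠ 0 ∧ 2*(I*x)-1 ≠ 0 :=
  ⟨mul_ne_zero I_ne_zero fun h => hx (by rw [h]; simp), fun h => hx (by simpa using congrArg Complex.im h),
    fun h => hx (by simpa using congrArg Complex.im h)⟩

namespace ContDualHahn

lemma stp : contDualHahn.stp = I := by simp [FamilyData.stp, contDualHahn]

/-- The basis `(a + y)_k (a - y)_k`. -/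
def basis (a:ℂ) (k:ℕ) (y:ℂ) : ℂ := poch (a+y) k*poch (a-y) k

lemma basis_zero (a y:ℂ) : basis a 0 y = 1 := by simp [basis, poch_zero]

lemma basis_succ (a:ℂ) (k:ℕ) (y:ℂ) : basis a (k+1) y = basis a k y*((a+k)^2-y^2) := by rw [basis, poch_succ, poch_succ, basis]; ring

/-- The coefficients of the continuous dual Hahn polynomial. -/
def coeff (a:Fin 3 → ℂ) (n k:ℕ) : ℂ := poch (-(n:ℂ)) k/(k.factorial:ℂ)*poch (a 0+a 1+k) (n-k)*poch (a 0+a 2+k) (n-k)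

lemma poly_eq (a:Fin 3 → ℂ) (n:ℕ) (x:ℂ) : cdHPoly a n x = ∑ k ∈ range (n+1), coeff a n k*basis (a 0) k (I*x) :=
  sum_congr rfl fun k _ => by rw [coeff, basis]; ring

lemma basis_eq (a b c y:ℂ) (hy:y ≠ 0) (h1:2*y+1 ≠ 0) (h2:2*y-1 ≠ 0) (k:ℕ) : (a+y)*(b+y)*(c+y)/(2*y*(2*y+1)) *
      (basis a (k+1) (y+1)-basis a (k+1) y) +
    (a-y)*(b-y)*(c-y)/(2*y*(2*y-1))*(basis a (k+1) (y-1)-basis a (k+1) y) =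
    ((k+1:ℕ):ℂ)*basis a (k+1) y + -((k+1:ℕ)*(a+b+k)*(a+c+k))*basis a k y := by
  have e1 : (a+y)*(basis a (k+1) (y+1)-basis a (k+1) y) = -(basis a k y*(a+y+k)*(k+1)*(2*y+1)) := by
    have h3 := poch_shift (a+y) k
    rw [basis, show a+(y+1) = a+y+1 by ring, show a-(y+1) = a-y-1 by ring,
      poch_succ, poch_succ' (a-y-1), basis, poch_succ, poch_succ, basis,
      show a-y-1+1 = a-y by ring]
    linear_combination poch (a-y) k*(a+y+1+k)*(a-y-1)*h3
  have e2 : (a-y)*(basis a (k+1) (y-1)-basis a (k+1) y) = basis a k y*(a-y+k)*(k+1)*(2*y-1) := by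
    have h3 := poch_shift (a-y) k
    rw [basis, show a-(y-1) = a-y+1 by ring, show a+(y-1) = a+y-1 by ring,
      poch_succ (a-y+1), poch_succ' (a+y-1), basis, poch_succ, poch_succ, basis,
      show a+y-1+1 = a+y by ring]
    linear_combination poch (a+y) k*(a-y+1+k)*(a+y-1)*h3
  simp only [basis_succ] at *
  have h1' : y*2+1 ≠ 0 := by rwa [mul_comm y]
  have h2' : y*2-1 ≠ 0 := by rwa [mul_comm y]
  push_cast; field_simp; linear_combination (b+y)*(c+y)*(2*y-1)*e1+(b-y)*(c-y)*(2*y+1)*e2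

lemma poly_diff_eq (a:Fin 3 → ℂ) (n:ℕ) (x:ℂ) (hx:x.re ≠ 0) : (∏ j, (a j+I*x))/(2*(I*x)*(2*(I*x)+1))*(cdHPoly a n (x-I)-cdHPoly a n x) +
    (∏ j, (a j-I*x))/(2*(I*x)*(2*(I*x)-1))*(cdHPoly a n (x+I)-cdHPoly a n x) = n*cdHPoly a n x := by
  obtain ⟨hy, h1, h2⟩ := mul_I_add_one_ne hx
  have key := sum_eigen n (coeff a n) (fun k => basis (a 0) k (I*x)) (fun k => (∏ j, (a j+I*x))/(2*(I*x)*(2*(I*x)+1)) *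
      (basis (a 0) k (I*x+1)-basis (a 0) k (I*x)) +
    (∏ j, (a j-I*x))/(2*(I*x)*(2*(I*x)-1))*(basis (a 0) k (I*x-1)-basis (a 0) k (I*x))) (fun k => (k:ℂ))
    (fun k => -(k*(a 0+a 1+(k-1:ℕ))*(a 0+a 2+(k-1:ℕ)))) n
    (by simp [basis_zero])
    (fun k => by
      rw [Fin.prod_univ_three, Fin.prod_univ_three, Nat.add_sub_cancel]
      exact basis_eq _ _ _ _ hy h1 h2 k)
    (fun k hk => by
      have hf0 : (k.factorial:ℂ) ≠ 0 := by exact_mod_cast k.factorial_ne_zero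
      have hk0 : (k:ℂ)+1 ≠ 0 := by exact_mod_cast k.succ_ne_zero
      rw [coeff, coeff, poch_succ, poch_sub _ hk, poch_sub _ hk, Nat.factorial_succ, Nat.add_sub_cancel]; push_cast; field_simp
      ring) rfl
  rw [poly_eq, poly_eq, poly_eq, I_mul_sub_I, I_mul_add_I, ← key, ← sum_sub_distrib, ← sum_sub_distrib, mul_sum, mul_sum, ← sum_add_distrib]
  exact sum_congr rfl fun k _ => by ring

lemma poly_poly (a:Fin 3 → ℂ) (n:ℕ) : ∃ p : ℂ[X], p.natDegree ≤ n ∧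
    (∀ x, cdHPoly a n x = p.eval (contDualHahn.η x)) ∧ p.coeff n = (-1)^n := by
  obtain ⟨p, h1, h2, h3⟩ := exists_poly_of_sum (η := contDualHahn.η) n (coeff a n) (fun _ => 1)
    (fun k => (a 0+k)^2) (fun k x => basis (a 0) k (I*x)) (fun x => basis_zero _ _) (fun k x => by
      rw [basis_succ]
      change _ = _*(1*x^2+_)
      rw [mul_pow, I_sq]; ring)
  refine ⟨p, h1, fun x => by rw [poly_eq, h2], ?_⟩
  simp [h3, coeff, poch_neg_self, poch_zero, n.factorial_ne_zero]

lemma w_eq (a:Fin 3 → ℂ) (x:ℂ) : contDualHahn.w a x = (∏ j, Gamma (a j+I*x)*Gamma (a j-I*x))/(Gamma (2*(I*x))*Gamma (-(2*(I*x)))) := by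
  simp [contDualHahn, mul_assoc]

lemma shift_one (a:Fin 3 → ℂ) (j:Fin 3) : contDualHahn.shift a 1 j = a j+1/2 := by simp [contDualHahn]

lemma w_ne {a:Fin 3 → ℂ} {x:ℂ} (h:contDualHahn.w a x ≠ 0) : (∀ j, a j+I*x ≠ 0) ∧ (∀ j, Gamma (a j+I*x) ≠ 0) ∧ (∀ j, Gamma (a j-I*x) ≠ 0) ∧
      Gamma (2*(I*x)) ≠ 0 ∧ Gamma (-(2*(I*x))) ≠ 0 := by
  rw [w_eq] at h
  obtain ⟨h1, h2⟩ := div_ne_zero_iff.1 h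
  have h3 := fun j => mul_ne_zero_iff.1 (prod_ne_zero_iff.1 h1 j (mem_univ j))
  exact ⟨fun j h0 => (h3 j).1 (by rw [h0, Gamma_zero]), fun j => (h3 j).1, fun j => (h3 j).2, mul_ne_zero_iff.1 h2⟩

lemma w_neg (a:Fin 3 → ℂ) (x:ℂ) : contDualHahn.w a (-x) = contDualHahn.w a x := by simp [contDualHahn, mul_comm, ← sub_eq_add_neg]

lemma w_down {a:Fin 3 → ℂ} {x:ℂ} (h:contDualHahn.w a x ≠ 0) : -(∏ j, (a j+I*x)) ≠ 0 ∧ contDualHahn.w (contDualHahn.shift a 1) (x-I/2) ≠ 0 ∧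
    nu contDualHahn (contDualHahn.shift a 1) (x-I/2) = -(∏ j, (a j+I*x))*nu contDualHahn a x := by
  obtain ⟨h1, h2, h3, h4, h5⟩ := w_ne h
  have hu : I*x ≠ 0 := fun h0 => h4 (by rw [h0, mul_zero, Gamma_zero])
  have hu1 : 2*(I*x)+1 ≠ 0 := fun h0 => h4 (by
    rw [show 2*(I*x) = -((1:ℕ):ℂ) by push_cast; linear_combination h0, Gamma_neg_nat_eq_zero])
  have hp : ∏ j, (a j+I*x) ≠ 0 := prod_ne_zero_iff.2 fun j _ => h1 j
  have g1 : Gamma (2*(I*x+1/2)) = 2*(I*x)*Gamma (2*(I*x)) := by rw [← Gamma_add_one _ (mul_ne_zero two_ne_zero hu)]; congr 1; ring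
  have g2 : -(2*(I*x)+1)*Gamma (-(2*(I*x+1/2))) = Gamma (-(2*(I*x))) := by
    have := Gamma_add_one (-(2*(I*x)+1)) (neg_ne_zero.2 hu1); grind
  have g3 : ∏ j, Gamma (contDualHahn.shift a 1 j+(I*x+1/2))*Gamma (contDualHahn.shift a 1 j-(I*x+1/2)) =
      (∏ j, (a j+I*x))*∏ j, Gamma (a j+I*x)*Gamma (a j-I*x) := by
    rw [← prod_mul_distrib]
    refine prod_congr rfl fun j _ => ?_
    rw [← mul_assoc, ← Gamma_add_one _ (h1 j), shift_one]; congr 2 <;> ring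
  have key : contDualHahn.w (contDualHahn.shift a 1) (x-I/2) = -(2*(I*x)+1)/(2*(I*x))*(∏ j, (a j+I*x))*contDualHahn.w a x := by
    have h6 : Gamma (-(2*(I*x+1/2))) ≠ 0 := fun h0 => h5 (by rw [← g2, h0, mul_zero])
    rw [w_eq (contDualHahn.shift a 1), w_eq, I_mul_sub_half, g3, g1, ← g2]
    clear g2
    generalize 2*(I*x)+1 = d at hu1 ⊢
    field_simp
  have hx : x ≠ 0 := fun h0 => hu (by rw [h0, mul_zero])
  have hx1 : 2*x-I ≠ 0 := fun h0 => hu1 (by linear_combination I*h0+I_sq)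
  refine ⟨neg_ne_zero.2 hp, ?_, ?_⟩
  · rw [key]; exact mul_ne_zero (mul_ne_zero (div_ne_zero (neg_ne_zero.2 hu1) (mul_ne_zero two_ne_zero hu)) hp) h
  · unfold nu; rw [key]
    change _/(2*(x-I/2)) = _*(_/(2*x))
    have hI := I_ne_zero
    have e5 : 2*(I*x)+1 = I*(2*x-I) := by linear_combination I_sq
    rw [e5, show 2*(x-I/2) = 2*x-I by ring]; field_simp

lemma w_conj {a:Fin 3 → ℂ} (ha:ConjClosed a) (x:ℂ) : conj (contDualHahn.w a x) = contDualHahn.w a (conj x) := by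
  have h1 := ha.prod_eq fun z => Gamma (z-I*conj x)*Gamma (z+I*conj x)
  simp only [w_eq, map_div₀, map_mul, map_prod, ← Gamma_conj, map_add, map_sub, map_neg, conj_I,
    Complex.conj_ofNat, neg_mul, mul_neg, sub_neg_eq_add, ← sub_eq_add_neg, neg_neg]
  rw [h1, mul_comm (Gamma (-_))]; simp only [mul_comm]

lemma w_pos {a:Fin 3 → ℂ} (ha:ConjClosed a) (ha':∀ j, 0 < (a j).re) (r:ℝ) (hr:0 < r) : PosR (contDualHahn.w a r) := by
  have h1 := ha.prod_eq fun z => Gamma (z-I*r)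
  have h2 : ∏ j, Gamma (a j-I*r) = conj (∏ j, Gamma (a j+I*r)) := by
    rw [← h1, map_prod]; simp [← Gamma_conj, sub_eq_add_neg]
  have h3 : Gamma (-(2*(I*r))) = conj (Gamma (2*(I*r))) := by rw [← Gamma_conj]; simp [Complex.conj_ofNat]
  rw [w_eq, prod_mul_distrib, h2, h3]
  refine (PosR.mul_conj (prod_ne_zero_iff.2 fun j _ => ?_)).div (PosR.mul_conj ?_)
  · refine Gamma_ne_zero_of_re_pos ?_
    simpa using ha' j
  · refine Gamma_ne_zero fun m hm => ?_
    simpa [hr.ne'] using congrArg Complex.im hm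

lemma w_line (a:Fin 3 → ℂ) : ∃ S : Set ℝ, S.Finite ∧ ∀ r ∈ contDualHahn.dom \ S, LineReg (contDualHahn.w a) r := by
  obtain ⟨S, hS, h⟩ := exists_finite_im a
  refine ⟨S, hS, fun r hr => ?_⟩
  have h2 : ∀ z ∈ vline r, (2*I*z).im ≠ 0 := fun z hz => by
    have : z.re = r := hz; simpa [this] using (Set.mem_Ioi.1 hr.1).ne'
  refine LineReg.div (LineReg.prod _ fun j _ => ?_) (LineReg.mul ?_ ?_)
  · exact (LineReg.gamma (by fun_prop) fun z hz => (h r hr.2 j z hz).1).mul (LineReg.gamma (by fun_prop) fun z hz => (h r hr.2 j z hz).2)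
  · exact LineReg.gamma (by fun_prop) h2
  · exact LineReg.gamma (by fun_prop) fun z hz => by rw [neg_im]; exact neg_ne_zero.2 (h2 z hz)

end ContDualHahn

namespace ContDualHahn

lemma den_sub (x:ℂ) : 2*x*(2*(x-I/2)) = -(2*(I*x)*(2*(I*x)+1)) := by linear_combination 4*x^2*I_sq

lemma den_add (x:ℂ) : 2*x*(2*(x+I/2)) = -(2*(I*x)*(2*(I*x)-1)) := by linear_combination 4*x^2*I_sq

lemma twist_sub (a:Fin 3 → ℂ) (x:ℂ) : -(∏ j, (a j-I*(x-I))) = ∏ j, ((1-a j)+I*x) := by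
  rw [Fin.prod_univ_three, Fin.prod_univ_three]; rw [I_mul_sub_I]; ring

lemma twist_add (a:Fin 3 → ℂ) (x:ℂ) : -(∏ j, (a j+I*(x+I))) = ∏ j, ((1-a j)-I*x) := by
  rw [Fin.prod_univ_three, Fin.prod_univ_three]; rw [I_mul_add_I]; ring

lemma potential_sum (a:Fin 3 → ℂ) (x:ℂ) (hx:x.re ≠ 0) : (∏ j, ((1-a j)+I*x))/(2*x*(2*(x-I/2)))+(∏ j, ((1-a j)-I*x))/(2*x*(2*(x+I/2))) -
    -(∏ j, (a j+I*x))/(2*x*(2*(x-I/2))) - -(∏ j, (a j-I*x))/(2*x*(2*(x+I/2))) = -1 := by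
  obtain ⟨hy, h1, h2⟩ := mul_I_add_one_ne hx; rw [den_sub, den_add]; simp only [Fin.prod_univ_three]
  generalize I*x = y at *
  have h1' : y*2+1 ≠ 0 := by rwa [mul_comm y]
  have h2' : y*2-1 ≠ 0 := by rwa [mul_comm y]
  field_simp; ring

lemma kernel (a:Fin 3 → ℂ) (N x y c:ℂ) (hc:c = (N-1)/2*I) (hx:2*x ≠ 0) (hy:2*y ≠ 0) (h1:(y+c)^2-x^2 ≠ 0) (h2:(y-c)^2-x^2 ≠ 0) :
    I*N*(-(-∏ j, (a j+I*(y+c+I)))/(2*y*((y+c)^2-x^2))+(-∏ j, (a j-I*(y-c-I)))/(2*y*((y-c)^2-x^2)) -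
      (-∏ j, (a j-I*(x-I)))/(2*x*(y^2-(x+c)^2))+(-∏ j, (a j+I*(x+I)))/(2*x*(y^2-(x-c)^2))) = N := by
  have hI := I_sq
  set u := I*x with hu
  set v := I*y with hv
  set d := I*c with hd
  have hN : N = 1-2*d := by rw [hd, hc]; linear_combination (N-1)*hI
  have ex : x = -(I*u) := by rw [hu]; linear_combination x*hI
  have ey : y = -(I*v) := by rw [hv]; linear_combination y*hI
  have ec : c = -(I*d) := by rw [hd]; linear_combination c*hI
  have hu0 : u ≠ 0 := fun h => hx (by rw [ex, h]; ring)
  have hv0 : v ≠ 0 := fun h => hy (by rw [ey, h]; ring)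
  have f1 : (y+c)^2-x^2 = (u-v-d)*(u+v+d) := by rw [hu, hv, hd]; linear_combination (y+c-x)*(y+c+x)*hI
  have f2 : (y-c)^2-x^2 = (u-v+d)*(u+v-d) := by rw [hu, hv, hd]; linear_combination (y-c-x)*(y-c+x)*hI
  have f3 : y^2-(x+c)^2 = (u-v+d)*(u+v+d) := by rw [hu, hv, hd]; linear_combination (y-c-x)*(y+c+x)*hI
  have f4 : y^2-(x-c)^2 = (u-v-d)*(u+v-d) := by rw [hu, hv, hd]; linear_combination (y+c-x)*(y-c+x)*hI
  have g1 : I*(y+c+I) = v+d-1 := by rw [hv, hd]; linear_combination hI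
  have g2 : I*(y-c-I) = v-d+1 := by rw [hv, hd]; linear_combination -hI
  have g3 : I*(x-I) = u+1 := by rw [hu]; linear_combination -hI
  have g4 : I*(x+I) = u-1 := by rw [hu]; linear_combination hI
  rw [f1] at h1; rw [f2] at h2; rw [f1, f2, f3, f4, g1, g2, g3, g4, hN, ex, ey]
  clear_value u v d
  obtain ⟨k1, k2⟩ := mul_ne_zero_iff.1 h1
  obtain ⟨k3, k4⟩ := mul_ne_zero_iff.1 h2
  have hI0 := I_ne_zero; simp only [Fin.prod_univ_three]
  have e1 : ∀ A B : ℂ, A/(2 * -(I*v)*B) = I*(A/(2*v*B)) := fun A B => by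
    rw [show 2 * -(I*v)*B = (2*v*B)*(-I) by ring, ← div_div, div_neg, div_I]; ring
  have e2 : ∀ A B : ℂ, A/(2 * -(I*u)*B) = I*(A/(2*u*B)) := fun A B => by
    rw [show 2 * -(I*u)*B = (2*u*B)*(-I) by ring, ← div_div, div_neg, div_I]; ring
  rw [e1, e1, e2, e2]
  generalize a 0 = a0
  generalize a 1 = a1
  generalize a 2 = a2
  have key : (a0+(v+d-1))*(a1+(v+d-1))*(a2+(v+d-1))/(2*v*((u-v-d)*(u+v+d)))-(a0-(v-d+1))*(a1-(v-d+1))*(a2-(v-d+1)) /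
        (2*v*((u-v+d)*(u+v-d))) +
      (a0-(u+1))*(a1-(u+1))*(a2-(u+1))/(2*u*((u-v+d)*(u+v+d))) -
      (a0+(u-1))*(a1+(u-1))*(a2+(u-1))/(2*u*((u-v-d)*(u+v-d))) =
      -1 := by
    field_simp; ring
  linear_combination (1-2*d)*hI*(-1)+(1-2*d)*I ^ 2*key

end ContDualHahn

open ContDualHahn in
/-- The continuous dual Hahn family. -/
def contDualHahnModel : AdmModel contDualHahn :=
  { Geom.quadratic (F := contDualHahn) rfl rfl rfl rfl with
    np := fun a x => -∏ j, (a j+I*x)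
    nm := fun a x => -∏ j, (a j-I*x)
    np_diff := fun a => (Differentiable.fun_finsetProd fun j _ => by fun_prop).neg
    nm_diff := fun a => (Differentiable.fun_finsetProd fun j _ => by fun_prop).neg
    np_fin := fun a => by
      obtain ⟨S, hS, h⟩ := exists_finite_im a
      refine ⟨S, hS, fun x hx => ⟨neg_ne_zero.2 (prod_ne_zero_iff.2 fun j _ h0 => ?_), neg_ne_zero.2 (prod_ne_zero_iff.2 fun j _ h0 => ?_)⟩⟩
      · exact (h _ hx.2 j x rfl).1 (by rw [h0]; simp)
      · exact (h _ hx.2 j x rfl).2 (by rw [h0]; simp)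
    lcP := fun _ n => (-1)^n
    lcT := fun _ n => (-1)^n
    κ_pos := one_pos
    V_eq := fun (a:Fin 3 → ℂ) x => by
      rw [stp]
      change _/(2*I*x*(2*I*x+1)) = _/(2*x*(2*(x-I/2)))
      rw [den_sub, neg_div_neg_eq, mul_assoc 2]
    shift_shift := fun a s t => by simp [contDualHahn]; grind
    shift_zero := fun a => by simp [contDualHahn]
    np_shift := fun a x => by
      rw [stp]; simp [I_mul_add_half, contDualHahn]; grind
    nm_shift := fun a x => by
      rw [stp]; simp [I_mul_sub_half, contDualHahn]; grind
    P_poly := fun a n => (poly_poly a n).imp fun p h => ⟨h.1, h.2.1, fun _ => h.2.2⟩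
    T_poly := fun a n => (poly_poly (fun j => 1-a j) n).imp fun p h => ⟨h.1, h.2.1, fun _ => h.2.2⟩
    lcP_ne := fun _ _ _ => pow_ne_zero _ (neg_ne_zero.2 one_ne_zero)
    lcT_ne := fun _ _ _ => pow_ne_zero _ (neg_ne_zero.2 one_ne_zero)
    P_eq := fun (a:Fin 3 → ℂ) n _ x hx => by
      rw [stp]
      have := poly_diff_eq a n x (Set.mem_Ioi.1 hx).ne'
      change -(∏ j, (a j+I*x))/(2*x*(2*(x-I/2)))*(cdHPoly a n (x-I)-cdHPoly a n x) +
        -(∏ j, (a j-I*x))/(2*x*(2*(x+I/2)))*(cdHPoly a n (x+I)-cdHPoly a n x) = ((n:ℤ):ℂ)*cdHPoly a n x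
      rw [den_sub, den_add, neg_div_neg_eq, neg_div_neg_eq, this]; simp
    T_eq := fun (a:Fin 3 → ℂ) n _ x hx => by
      have := poly_diff_eq (fun j => 1-a j) n x (Set.mem_Ioi.1 hx).ne'; rw [stp]
      set b : Fin 3 → ℂ := fun j => 1-a j
      change -(∏ j, (a j-I*(x-I)))/(2*x*(2*(x-I/2)))*(cdHPoly b n (x-I)-cdHPoly b n x) + -(∏ j, (a j+I*(x+I)))/(2*x*(2*(x+I/2))) *
          (cdHPoly b n (x+I)-cdHPoly b n x) = ((-1)*(n:ℂ)+(-1)-((-1)*((0:ℕ):ℂ)+(-1)))*cdHPoly b n x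
      rw [twist_sub, twist_add, den_sub, den_add, div_neg, div_neg]; push_cast; linear_combination -this
    VV := fun (a:Fin 3 → ℂ) x hx => by
      have := potential_sum a x (Set.mem_Ioi.1 hx).ne'; rw [← twist_sub, ← twist_add] at this; rw [stp]
      exact this.trans (by simp [contDualHahn])
    E_zero := fun a => by simp [contDualHahn]
    E_step := fun a n => by simp [contDualHahn]
    Et_eq := fun a v => by simp [contDualHahn]; ring
    E_ne := fun a n _ k hk => by simp [contDualHahn, hk.ne]
    kernel := fun a N x y c hc hx hy h1 h2 _ _ => by
      rw [stp] at *; exact (kernel a N x y c hc hx hy h1 h2).trans (by simp [contDualHahn]; ring)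
    w_step := fun (a:Fin 3 → ℂ) y h => by
      rw [stp]
      obtain ⟨h1, h2, h3⟩ := w_down h
      have h' : contDualHahn.w a (-y) ≠ 0 := by rwa [w_neg]
      obtain ⟨k1, k2, k3⟩ := w_down h'
      have e : -y-I/2 = -(y+I/2) := by ring
      have e2 : -(∏ j, (a j+I * -y)) = -(∏ j, (a j-I*y)) := by simp only [mul_neg, ← sub_eq_add_neg]
      have k2' : contDualHahn.w (contDualHahn.shift a 1) (y+I/2) ≠ 0 := fun h0 => k2 (by rw [e]; exact (w_neg _ _).trans h0)
      rw [e2] at k1 k3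
      refine ⟨h1, k1, h2, k2', h3, ?_⟩
      have hnu : ∀ b x, nu contDualHahn b (-x) = -nu contDualHahn b x := fun b x => by
        unfold nu; rw [show contDualHahn.w b (-x) = contDualHahn.w b x from w_neg b x]
        change _/(2 * -x) = -(_/(2*x))
        rw [mul_neg, div_neg]
      rw [e, hnu, show nu contDualHahn a (-y) = -nu contDualHahn a y from hnu a y] at k3; exact neg_injective (by rw [k3]; ring)
    adm_shift := fun (a:Fin 3 → ℂ) ha => by
      obtain ⟨⟨σ, hσ⟩, h2⟩ := ha
      refine ⟨⟨σ, fun j => ?_⟩, fun j => ?_⟩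
      · simp [contDualHahn, hσ, Complex.conj_ofNat]
      · have := h2 j; simp [contDualHahn]; linarith
    np_conj := fun (a:Fin 3 → ℂ) ha x => by
      have := ha.1.prod_eq fun z => z-I*conj x
      change conj (-(∏ j, (a j+I*x))) = -(∏ j, (a j-I*conj x))
      rw [← this]; simp [map_prod, sub_eq_add_neg]
    E_real := fun a _ n => by simp [contDualHahn]
    lcP_real := fun _ _ n => by simp
    lcT_real := fun _ _ n => by simp
    w_pos := fun (a:Fin 3 → ℂ) ha r hr => w_pos ha.1 ha.2 r hr
    w_conj := fun (a:Fin 3 → ℂ) ha x => w_conj ha.1 x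
    w_line := fun a _ => w_line a
    adm_nondeg := fun _ _ _ => trivial
    adm_nondegT := fun _ _ _ _ _ => trivial }

lemma poch_up (z:ℂ) (k:ℕ) : z*(poch (z+1) k-poch z k) = k*poch z k := by rw [mul_sub, poch_shift]; ring

lemma poch_down (z:ℂ) (k:ℕ) : poch (z-1) (k+1)-poch z (k+1) = -(k+1)*poch z k := by rw [poch_succ', poch_succ, sub_add_cancel]; ring

@[fun_prop]
lemma continuous_poch {f:ℝ → ℂ} (hf:Continuous f) (n:ℕ) : Continuous fun t => poch (f t) n := by
  unfold poch; exact continuous_finsetProd _ fun k _ => hf.add continuous_const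

lemma tendsto_pert {f:ℝ → ℂ} (hf:Continuous f) {c:ℂ} (h:f 0 = c) : Tendsto f (𝓝[≠] 0) (𝓝 c) := by
  rw [← h]; exact (hf.tendsto 0).mono_left nhdsWithin_le_nhds

lemma eventually_add_mul_ne (c:ℂ) {d:ℂ} (hd:d ≠ 0) : ∀ᶠ t : ℝ in 𝓝[≠] 0, c+d*t ≠ 0 := by
  rcases eq_or_ne c 0 with rfl | hc
  · filter_upwards [self_mem_nhdsWithin] with t ht
    rw [zero_add]; exact mul_ne_zero hd (by exact_mod_cast ht)
  · have : Tendsto (fun t:ℝ => c+d*t) (𝓝[≠] 0) (𝓝 c) := tendsto_pert (by fun_prop) (by simp); exact this.eventually_ne hc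

namespace ContHahn

lemma stp : contHahn.stp = I := by simp [FamilyData.stp, contHahn]

/-- The coefficients of the continuous Hahn polynomial. -/
def coeff (a:Fin 2 → ℂ) (n k:ℕ) : ℂ := I ^ n/(n.factorial:ℂ)*(poch (-(n:ℂ)) k*poch (n+cHb a-1) k/(k.factorial:ℂ) *
    poch (a 0+conj (a 0)+k) (n-k)*poch (a 0+conj (a 1)+k) (n-k))

lemma poly_eq (a:Fin 2 → ℂ) (n:ℕ) (x:ℂ) : cHPoly a n x = ∑ k ∈ range (n+1), coeff a n k*poch (a 0+I*x) k := by
  rw [cHPoly, mul_sum]; exact sum_congr rfl fun k _ => by rw [coeff]; ring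

lemma basis_eq (a b c d y:ℂ) (k:ℕ) : (a+y)*(b+y)*(poch (a+(y+1)) (k+1)-poch (a+y) (k+1)) +
    (c-y)*(d-y)*(poch (a+(y-1)) (k+1)-poch (a+y) (k+1)) = ((k+1:ℕ):ℂ)*(((k+1:ℕ):ℂ)+(a+b+c+d)-1)*poch (a+y) (k+1) +
      -((k+1:ℕ)*(a+c+k)*(a+d+k))*poch (a+y) k := by
  have h1 := poch_up (a+y) (k+1)
  have h2 := poch_down (a+y) k; rw [← add_assoc, ← add_sub_assoc, h2]; rw [poch_succ (a+y) k] at h1 ⊢; push_cast at h1 ⊢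
  linear_combination (b+y)*h1

lemma poly_diff_eq (a:Fin 2 → ℂ) (n:ℕ) (x:ℂ) : (∏ j, (a j+I*x))*(cHPoly a n (x-I)-cHPoly a n x) +
    (∏ j, (conj (a j)-I*x))*(cHPoly a n (x+I)-cHPoly a n x) = cHE a n*cHPoly a n x := by
  have key := sum_eigen n (coeff a n) (fun k => poch (a 0+I*x) k) (fun k => (∏ j, (a j+I*x))*(poch (a 0+(I*x+1)) k-poch (a 0+I*x) k) +
      (∏ j, (conj (a j)-I*x))*(poch (a 0+(I*x-1)) k-poch (a 0+I*x) k))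
    (fun k => cHE a k)
    (fun k => -(k*(a 0+conj (a 0)+(k-1:ℕ))*(a 0+conj (a 1)+(k-1:ℕ)))) (cHE a n)
    (by simp [poch_zero, cHE])
    (fun k => by
      rw [Fin.prod_univ_two, Fin.prod_univ_two, Nat.add_sub_cancel, cHE, cHb]
      refine (basis_eq _ _ _ _ _ k).trans ?_
      push_cast; ring)
    (fun k hk => by
      have hf0 : (k.factorial:ℂ) ≠ 0 := by exact_mod_cast k.factorial_ne_zero
      have hn0 : (n.factorial:ℂ) ≠ 0 := by exact_mod_cast n.factorial_ne_zero
      have hk0 : (k:ℂ)+1 ≠ 0 := by exact_mod_cast k.succ_ne_zero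
      rw [coeff, coeff, poch_succ, poch_succ, poch_sub _ hk, poch_sub _ hk, Nat.factorial_succ, Nat.add_sub_cancel, cHE, cHE]
      push_cast; field_simp
      ring) rfl
  rw [poly_eq, poly_eq, poly_eq, I_mul_sub_I, I_mul_add_I, ← key, ← sum_sub_distrib, ← sum_sub_distrib, mul_sum, mul_sum, ← sum_add_distrib]
  exact sum_congr rfl fun k _ => by ring

lemma poly_poly (a:Fin 2 → ℂ) (n:ℕ) : ∃ p : ℂ[X], p.natDegree ≤ n ∧ (∀ x, cHPoly a n x = p.eval (contHahn.η x)) ∧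
    p.coeff n = poch (n+cHb a-1) n/n.factorial := by
  obtain ⟨p, h1, h2, h3⟩ := exists_poly_of_sum (η := contHahn.η) n (coeff a n) (fun _ => I)
    (fun k => a 0+k) (fun k x => poch (a 0+I*x) k) (fun x => poch_zero _) (fun k x => by
      rw [poch_succ]
      change _ = _*(I*x+_)
      ring)
  refine ⟨p, h1, fun x => by rw [poly_eq, h2], ?_⟩
  have hf0 : (n.factorial:ℂ) ≠ 0 := by exact_mod_cast n.factorial_ne_zero
  rw [h3, coeff, poch_neg_self, Nat.sub_self, poch_zero, poch_zero, prod_const, card_range]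
  have h4 : I ^ n*(-1)^n*I ^ n = 1 := by rw [← mul_pow, ← mul_pow]; simp
  field_simp; linear_combination poch (n+cHb a-1) n*h4

lemma w_eq (a:Fin 2 → ℂ) (x:ℂ) : contHahn.w a x = ∏ j, Gamma (a j+I*x)*Gamma (conj (a j)-I*x) := rfl

lemma w_ne {a:Fin 2 → ℂ} {x:ℂ} (h:contHahn.w a x ≠ 0) : (∀ j, a j+I*x ≠ 0) ∧ ∀ j, conj (a j)-I*x ≠ 0 := by
  rw [w_eq] at h
  have h3 := fun j => mul_ne_zero_iff.1 (prod_ne_zero_iff.1 h j (mem_univ j))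
  exact ⟨fun j h0 => (h3 j).1 (by rw [h0, Gamma_zero]), fun j h0 => (h3 j).2 (by rw [h0, Gamma_zero])⟩

lemma shift_one (a:Fin 2 → ℂ) (j:Fin 2) : contHahn.shift a 1 j = a j+1/2 := by simp [contHahn]

lemma w_down {a:Fin 2 → ℂ} {x:ℂ} (h:contHahn.w a x ≠ 0) : contHahn.w (contHahn.shift a 1) (x-I/2) = (∏ j, (a j+I*x))*contHahn.w a x := by
  rw [w_eq (contHahn.shift a 1), w_eq, ← prod_mul_distrib]
  refine prod_congr rfl fun j _ => ?_
  rw [← mul_assoc, ← Gamma_add_one _ ((w_ne h).1 j), I_mul_sub_half, shift_one, map_add]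
  simp only [map_div₀, map_one, Complex.conj_ofNat]; congr 2 <;> ring

lemma w_up {a:Fin 2 → ℂ} {x:ℂ} (h:contHahn.w a x ≠ 0) : contHahn.w (contHahn.shift a 1) (x+I/2) =
      (∏ j, (conj (a j)-I*x))*contHahn.w a x := by
  rw [w_eq (contHahn.shift a 1), w_eq, ← prod_mul_distrib]
  refine prod_congr rfl fun j _ => ?_
  rw [mul_left_comm, ← Gamma_add_one _ ((w_ne h).2 j), I_mul_add_half, shift_one, map_add]
  simp only [map_div₀, map_one, Complex.conj_ofNat]; congr 2 <;> ring

lemma w_conj (a:Fin 2 → ℂ) (x:ℂ) : conj (contHahn.w a x) = contHahn.w a (conj x) := by simp [w_eq, ← Gamma_conj, sub_eq_add_neg, mul_comm]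

lemma w_pos {a:Fin 2 → ℂ} (ha:∀ j, 0 < (a j).re) (r:ℝ) : PosR (contHahn.w a r) := by
  rw [w_eq]
  refine PosR.prod _ fun j _ => ?_
  have : Gamma (conj (a j)-I*r) = conj (Gamma (a j+I*r)) := by rw [← Gamma_conj]; simp [sub_eq_add_neg]
  rw [this]
  refine PosR.mul_conj (Gamma_ne_zero_of_re_pos ?_)
  simpa using ha j

lemma exists_finite (a:Fin 2 → ℂ) : ∃ S : Set ℝ, S.Finite ∧ ∀ r, r ∉ S → ∀ j, ∀ z ∈ vline r,
    (a j+I*z).im ≠ 0 ∧ (conj (a j)-I*z).im ≠ 0 := by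
  obtain ⟨S, hS, h⟩ := exists_finite_im a
  obtain ⟨S', hS', h'⟩ := exists_finite_im fun j => conj (a j)
  exact ⟨S ∪ S', hS.union hS', fun r hr j z hz => ⟨(h r (fun h => hr (Or.inl h)) j z hz).1, (h' r (fun h => hr (Or.inr h)) j z hz).2⟩⟩

lemma w_line (a:Fin 2 → ℂ) : ∃ S : Set ℝ, S.Finite ∧ ∀ r ∈ contHahn.dom \ S, LineReg (contHahn.w a) r := by
  obtain ⟨S, hS, h⟩ := exists_finite a
  refine ⟨S, hS, fun r hr => LineReg.prod univ (f := fun j z => Gamma (a j+I*z)*Gamma (conj (a j)-I*z)) fun j _ => ?_⟩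
  exact (LineReg.gamma (by fun_prop) fun z hz => (h r hr.2 j z hz).1).mul (LineReg.gamma (by fun_prop) fun z hz => (h r hr.2 j z hz).2)

lemma kernel (a b c d N x y e:ℂ) (he:e = (N-1)/2*I) (h1:y+e-x ≠ 0) (h2:y-e-x ≠ 0) : I*N*(-((a+I*(y+e+I))*(b+I*(y+e+I)))/(1*(y+e-x)) +
      (c-I*(y-e-I))*(d-I*(y-e-I))/(1*(y-e-x))-(c-I*(x-I))*(d-I*(x-I))/(1*(y-(x+e)))+(a+I*(x+I))*(b+I*(x+I))/(1*(y-(x-e)))) =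
    (2-(a+b+c+d))-(-N-1)*(-N-1+(a+b+c+d)-1) := by
  have hI := I_sq
  have e1 : y-(x+e) = y-e-x := by ring
  have e2 : y-(x-e) = y+e-x := by ring
  rw [e1, e2, one_mul, one_mul]
  have k1 : -((a+I*(y+e+I))*(b+I*(y+e+I)))/(y+e-x)+(a+I*(x+I))*(b+I*(x+I))/(y+e-x) = -I*(a+b+I*(y+e+x)-2) := by
    field_simp; linear_combination (-(I*y)-I*e+I*x)*hI*2
  have k2 : (c-I*(y-e-I))*(d-I*(y-e-I))/(y-e-x)-(c-I*(x-I))*(d-I*(x-I))/(y-e-x) = -I*(c+d-I*(y-e+x)-2) := by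
    field_simp; linear_combination (-(I*y)+I*e+I*x)*hI*2
  have k3 : I*e*2 = 1-N := by rw [he]; linear_combination (N-1)*hI
  linear_combination I*N*k1+I*N*k2-N*(a+b+c+d-4+2*I*e)*hI+N*k3

end ContHahn

open ContHahn in
/-- The continuous Hahn family. -/
def contHahnModel : AdmModel contHahn :=
  { Geom.linear (F := contHahn) rfl rfl rfl rfl with
    np := fun a x => ∏ j, (a j+I*x)
    nm := fun a x => ∏ j, (conj (a j)-I*x)
    np_diff := fun a => Differentiable.fun_finsetProd fun j _ => by fun_prop
    nm_diff := fun a => Differentiable.fun_finsetProd fun j _ => by fun_prop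
    np_fin := fun a => by
      obtain ⟨S, hS, h⟩ := exists_finite a
      refine ⟨S, hS, fun x hx => ⟨prod_ne_zero_iff.2 fun j _ h0 => ?_, prod_ne_zero_iff.2 fun j _ h0 => ?_⟩⟩
      · exact (h _ hx.2 j x rfl).1 (by rw [h0]; simp)
      · exact (h _ hx.2 j x rfl).2 (by rw [h0]; simp)
    lcP := fun a n => poch (n+cHb a-1) n/n.factorial
    lcT := fun a n => poch (n+cHb (cHTwist a)-1) n/n.factorial
    pert := fun a t => fun j => a j+t
    κ_pos := one_pos
    V_eq := fun a x => by simp [contHahn]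
    shift_shift := fun a s t => by simp [contHahn]; grind
    shift_zero := fun a => by simp [contHahn]
    np_shift := fun a x => by
      rw [stp]; simp [I_mul_add_half, contHahn]; grind
    nm_shift := fun a x => by
      rw [stp]; simp [I_mul_sub_half, contHahn, Complex.conj_ofNat]; grind
    P_poly := fun a n => (poly_poly a n).imp fun p h => ⟨h.1, h.2.1, fun _ => h.2.2⟩
    T_poly := fun a n => (poly_poly (cHTwist a) n).imp fun p h => ⟨h.1, h.2.1, fun _ => h.2.2⟩
    lcP_ne := fun a n h => div_ne_zero (prod_ne_zero_iff.2 fun k hk => h k (mem_range.1 hk)) (by exact_mod_cast n.factorial_ne_zero)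
    lcT_ne := fun a n h => div_ne_zero (prod_ne_zero_iff.2 fun k hk => h k (mem_range.1 hk)) (by exact_mod_cast n.factorial_ne_zero)
    P_eq := fun (a:Fin 2 → ℂ) n _ x hx => by
      rw [stp]
      refine Eq.trans ?_ (poly_diff_eq a n x)
      change _/(1*1)*_+_/(1*1)*_ = _
      rw [one_mul, div_one, div_one]; rfl
    T_eq := fun (a:Fin 2 → ℂ) n _ x hx => by
      rw [stp]
      have := poly_diff_eq (cHTwist a) n x
      have h1 : (∏ j, (conj (a j)-I*(x-I))) = ∏ j, (cHTwist a j+I*x) := by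
        rw [Fin.prod_univ_two, Fin.prod_univ_two, I_mul_sub_I, cHTwist, cHTwist]; ring
      have h2 : (∏ j, (a j+I*(x+I))) = ∏ j, (conj (cHTwist a j)-I*x) := by simp [I_mul_add_I, cHTwist]; ring
      change (∏ j, (conj (a j)-I*(x-I)))/(1*1)*(cHPoly (cHTwist a) n (x-I)-cHPoly (cHTwist a) n x)+(∏ j, (a j+I*(x+I)))/(1*1) *
        (cHPoly (cHTwist a) n (x+I)-cHPoly (cHTwist a) n x) = (1*cHE (cHTwist a) n+(2-cHb a)-(1*cHE (cHTwist a) ((0:ℕ):ℤ)+(2-cHb a))) *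
          cHPoly (cHTwist a) n x
      rw [h1, h2, one_mul, div_one, div_one, this, cHE, cHE]; push_cast; ring
    VV := fun (a:Fin 2 → ℂ) x hx => by
      rw [stp]; simp [contHahn, I_mul_sub_I, I_mul_add_I, cHE, cHb]; ring
    E_zero := fun a => by simp [contHahn, cHE]
    E_step := fun a n => by simp [contHahn, cHE, cHb, Complex.conj_ofNat]; ring
    Et_eq := fun a v => by simp [contHahn, cHE, cHb, cHTwist]; ring
    E_ne := fun (a:Fin 2 → ℂ) n hn k hk h => by
      refine mul_ne_zero (sub_ne_zero.2 (E_linear_ne hk).symm) (hn k hk) ?_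
      simp [contHahn, cHE] at h; linear_combination -h
    kernel := fun (a:Fin 2 → ℂ) N x y e he hx hy h1 h2 _ _ => by
      rw [stp] at *
      have := kernel (a 0) (a 1) (conj (a 0)) (conj (a 1)) N x y e he h1 h2; simp only [Fin.prod_univ_two]
      exact this.trans (by simp [contHahn, cHE, cHb, cHTwist])
    w_step := fun (a:Fin 2 → ℂ) y h => by
      rw [stp]
      obtain ⟨h1, h2⟩ := w_ne h
      have h1' : (∏ j, (a j+I*y)) ≠ 0 := prod_ne_zero_iff.2 fun j _ => h1 j
      have h2' : (∏ j, (conj (a j)-I*y)) ≠ 0 := prod_ne_zero_iff.2 fun j _ => h2 j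
      have hd := w_down h
      have hu := w_up h
      refine ⟨h1', h2', fun h0 => mul_ne_zero h1' h (hd.symm.trans h0), fun h0 => mul_ne_zero h2' h (hu.symm.trans h0), ?_, ?_⟩
      · simpa [nu, contHahn] using hd
      · simpa [nu, contHahn] using hu
    pert_shift := fun a k t => by simp [contHahn]; grind
    pert_gen := fun (a:Fin 2 → ℂ) _ n => by
      have h1 : ∀ᶠ t : ℝ in 𝓝[≠] 0, ∀ k ∈ range n, (n:ℂ)+cHb a-1+k+4*t ≠ 0 :=
        (Filter.eventually_all_finset _).2 fun k _ => eventually_add_mul_ne _ (by norm_num)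
      have h2 : ∀ᶠ t : ℝ in 𝓝[≠] 0, ∀ k ∈ range n, (n:ℂ)+cHb (cHTwist a)-1+k+(-4)*t ≠ 0 :=
        (Filter.eventually_all_finset _).2 fun k _ => eventually_add_mul_ne _ (by norm_num)
      filter_upwards [h1, h2] with t h1 h2
      refine ⟨fun k hk h0 => h1 k (mem_range.2 hk) ?_, fun k hk h0 => h2 k (mem_range.2 hk) ?_⟩
      · simp [← h0, cHb]; ring
      · simp [← h0, cHb, cHTwist]; ring
    P_lim := fun (a:Fin 2 → ℂ) n _ x => by
      refine tendsto_pert (f := fun t => cHPoly (fun j => a j+t) n x) ?_ (by simp; rfl)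
      simp only [cHPoly, cHb, map_add, conj_ofReal]
      fun_prop
    T_lim := fun (a:Fin 2 → ℂ) n _ x => by
      refine tendsto_pert (f := fun t => cHPoly (cHTwist fun j => a j+t) n x) ?_ (by simp; rfl)
      simp only [cHPoly, cHb, cHTwist, map_add, map_sub, map_one, conj_conj, conj_ofReal]
      fun_prop
    lcP_lim := fun (a:Fin 2 → ℂ) n _ => by
      refine tendsto_pert (f := fun t => poch (n+cHb (fun j => a j+t)-1) n/n.factorial) ?_ (by simp)
      simp only [cHb, map_add, conj_ofReal]
      fun_prop
    lcT_lim := fun (a:Fin 2 → ℂ) n _ => by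
      refine tendsto_pert (f := fun t => poch (n+cHb (cHTwist fun j => a j+t)-1) n/n.factorial) ?_ (by simp)
      simp only [cHb, cHTwist, map_add, map_sub, map_one, conj_conj, conj_ofReal]
      fun_prop
    np_lim := fun (a:Fin 2 → ℂ) x => by
      refine tendsto_pert (f := fun t => ∏ j, (a j+t+I*x)) ?_ (by simp)
      fun_prop
    nm_lim := fun (a:Fin 2 → ℂ) x => by
      refine tendsto_pert (f := fun t => ∏ j, (conj (a j+t)-I*x)) ?_ (by simp)
      simp only [map_add, conj_ofReal]
      fun_prop
    E_lim := fun (a:Fin 2 → ℂ) n => by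
      refine tendsto_pert (f := fun t => cHE (fun j => a j+t) n) ?_ (by simp; rfl)
      simp only [cHE, cHb, map_add, conj_ofReal]
      fun_prop
    adm_shift := fun (a:Fin 2 → ℂ) ha j => by
      have := ha j; simp [shift_one]; linarith
    np_conj := fun (a:Fin 2 → ℂ) ha x => by simp [sub_eq_add_neg]
    E_real := fun (a:Fin 2 → ℂ) _ n => by simp only [contHahn, cHE, cHb, map_mul, map_add, map_sub, map_one, conj_conj, map_intCast]; ring
    lcP_real := fun (a:Fin 2 → ℂ) _ n => by
      simp [poch_conj, cHb]; congr 2; ring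
    lcT_real := fun (a:Fin 2 → ℂ) _ n => by
      simp [poch_conj, cHb, cHTwist]; congr 2; ring
    w_pos := fun a ha r _ => w_pos ha r
    w_conj := fun a _ x => w_conj a x
    w_line := fun a _ => w_line a
    adm_nondeg := fun (a:Fin 2 → ℂ) ha n k hk h0 => by
      have h1 := ha 0
      have h2 := ha 1
      have h3 := congrArg Complex.re h0; simp only [cHb, add_re, sub_re, natCast_re, conj_re, one_re, zero_re] at h3
      have h4 : (1:ℝ) ≤ n := by exact_mod_cast (by omega:1 ≤ n)
      have h5 : (0:ℝ) ≤ k := k.cast_nonneg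
      linarith
    adm_nondegT := fun (a:Fin 2 → ℂ) N ha v hv k hk h0 => by
      have h1 : 0 < (a 0+((-((N:ℤ)+1):ℤ):ℂ)/2).re := ha 0
      have h2 : 0 < (a 1+((-((N:ℤ)+1):ℤ):ℂ)/2).re := ha 1
      have e : (((-((N:ℤ)+1):ℤ):ℂ)/2).re = -((N:ℝ)+1)/2 := by
        rw [show ((-((N:ℤ)+1):ℤ):ℂ)/2 = ((-((N:ℝ)+1)/2 : ℝ):ℂ) by push_cast; ring, ofReal_re]
      rw [add_re, e] at h1 h2
      have h3 := congrArg Complex.re h0; simp only [cHb, cHTwist, add_re, sub_re, natCast_re, conj_re, one_re, zero_re] at h3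
      have h4 : (v:ℝ) ≤ N := by exact_mod_cast hv
      have h5 : (k:ℝ)+1 ≤ v := by exact_mod_cast hk
      linarith }

lemma qpoch_succ (a p:ℂ) (n:ℕ) : qpoch a p (n+1) = qpoch a p n*(1-a*p^n) := prod_range_succ _ _

lemma qpoch_succ' (a p:ℂ) (n:ℕ) : qpoch a p (n+1) = (1-a)*qpoch (a*p) p n := by
  rw [qpoch, prod_range_succ', qpoch, mul_comm]; grind

lemma qpoch_shift (a p:ℂ) (n:ℕ) : (1-a)*qpoch (a*p) p n = qpoch a p n*(1-a*p^n) := by rw [← qpoch_succ', qpoch_succ]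

lemma qpoch_sub (a p:ℂ) {n k:ℕ} (h:k < n) : qpoch (a*p^k) p (n-k) = (1-a*p^k)*qpoch (a*p^(k+1)) p (n-(k+1)) := by
  rw [show n-k = n-(k+1)+1 by omega, qpoch_succ', pow_succ, mul_assoc]

lemma qpoch_zero (a p:ℂ) : qpoch a p 0 = 1 := by simp [qpoch]

/-- The base of the `q`-shifted factorials is not zero and not a root of unity. -/
def QBase (p:ℂ) : Prop := p ≠ 0 ∧ ∀ k : ℕ, p^(k+1) ≠ 1

lemma QBase.inv {p:ℂ} (hp:QBase p) : QBase p⁻¹ := ⟨inv_ne_zero hp.1, fun k h => hp.2 k (by rwa [inv_pow, inv_eq_one] at h)⟩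

lemma QBase.qpoch_ne {p:ℂ} (hp:QBase p) (n:ℕ) : qpoch p p n ≠ 0 :=
  prod_ne_zero_iff.2 fun k _ h => hp.2 k (by rw [pow_succ']; exact (sub_eq_zero.1 h).symm)

lemma QBase.of_real {q:ℝ} (h0:0 < q) (h1:q < 1) : QBase q :=
  ⟨by exact_mod_cast h0.ne', fun k => by exact_mod_cast (pow_lt_one₀ h0.le h1 k.succ_ne_zero).ne⟩

lemma QBase.qpoch_neg_ne {p:ℂ} (hp:QBase p) (n:ℕ) : qpoch (p^(-(n:ℤ))) p n ≠ 0 := prod_ne_zero_iff.2 fun k hk h => hp.2 (n-1-k) (by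
    have hk := mem_range.1 hk; rw [← zpow_natCast, ← zpow_add₀ hp.1, sub_eq_zero] at h
    rw [show n-1-k+1 = n-k by omega, ← inv_eq_one, ← zpow_natCast, ← zpow_neg, h, Nat.cast_sub hk.le, neg_sub, sub_eq_neg_add])

namespace AskeyWilson

/-- The difference operator of the Askey-Wilson polynomials with base `p` and parameters `b`,
acting on the function `f` with `f (p z) = fp`, `f z = f0`, `f (z / p) = fm`. -/
def op (p:ℂ) (b:Fin 4 → ℂ) (z fp f0 fm:ℂ) : ℂ := (∏ j, (1-b j*z))/((1-z^2)*(1-p*z^2))*(fp-f0) +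
    (∏ j, (1-b j*z⁻¹))/((1-z⁻¹^2)*(1-p*z⁻¹^2))*(fm-f0)

/-- The basis `(a z, a / z; p)_k`. -/
def basis (a p:ℂ) (k:ℕ) (z:ℂ) : ℂ := qpoch (a*z) p k*qpoch (a*z⁻¹) p k

lemma basis_inv (a p:ℂ) (k:ℕ) (z:ℂ) : basis a p k z⁻¹ = basis a p k z := by rw [basis, basis, inv_inv, mul_comm]

lemma basis_succ (a p:ℂ) (k:ℕ) {z:ℂ} (hz:z ≠ 0) : basis a p (k+1) z = basis a p k z*(-(2*a*p^k)*((z+z⁻¹)/2)+(1+(a*p^k)^2)) := by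
  rw [basis, qpoch_succ, qpoch_succ, basis]; field_simp; ring

lemma basis_step (a p:ℂ) (k:ℕ) {z:ℂ} (hz:z ≠ 0) (hp:p ≠ 0) : (1-a*z)*(basis a p (k+1) (p*z)-basis a p (k+1) z) =
      basis a p k z*(1-a*p^k*z)*a*(1-p^(k+1))*(p*z^2-1)/(p*z) := by
  have h1 := qpoch_shift (a*z) p k
  have h2 : basis a p (k+1) (p*z) = qpoch (a*z*p) p k*(1-a*z*p^(k+1))*((1-a*(p*z)⁻¹)*qpoch (a*z⁻¹) p k) := by
    rw [basis, show a*(p*z) = a*z*p by ring, qpoch_succ, qpoch_succ',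
      show a*(p*z)⁻¹*p = a*z⁻¹ by field_simp, pow_succ']
    ring
  rw [h2, show (1-a*z)*(qpoch (a*z*p) p k*(1-a*z*p^(k+1))*((1-a*(p*z)⁻¹)*qpoch (a*z⁻¹) p k)-basis a p (k+1) z) =
      (1-a*z)*qpoch (a*z*p) p k*(1-a*z*p^(k+1))*((1-a*(p*z)⁻¹)*qpoch (a*z⁻¹) p k)-(1-a*z)*basis a p (k+1) z by ring, h1,
    basis, qpoch_succ, qpoch_succ, basis]
  field_simp; ring

lemma op_basis (p:ℂ) (b:Fin 4 → ℂ) (k:ℕ) {z:ℂ} (hp:p ≠ 0) (hz:z ≠ 0) (h0:1-z^2 ≠ 0) (h1:1-p*z^2 ≠ 0) (h2:1-p*z⁻¹^2 ≠ 0) :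
    op p b z (basis (b 0) p (k+1) (p*z)) (basis (b 0) p (k+1) z) (basis (b 0) p (k+1) (z/p)) =
    ((p^(k+1))⁻¹-1)*(1-(∏ j, b j)*p^k)*basis (b 0) p (k+1) z + -(p^(k+1))⁻¹*(1-p^(k+1))*(∏ j:Fin 3, (1-b 0*b j.succ*p^k)) *
        basis (b 0) p k z := by
  have e1 := basis_step (b 0) p k hz hp
  have e2 := basis_step (b 0) p k (inv_ne_zero hz) hp
  rw [basis_inv, basis_inv, ← basis_inv _ _ _ (p*z⁻¹), show (p*z⁻¹)⁻¹ = z/p by field_simp] at e2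
  rw [op, Fin.prod_univ_four, Fin.prod_univ_four, Fin.prod_univ_four, Fin.prod_univ_three]
  have h0' : 1-z⁻¹^2 ≠ 0 := fun h => h0 (by field_simp at h; linear_combination -h)
  simp only [Fin.succ_zero_eq_one, Fin.succ_one_eq_two, show (2:Fin 3).succ = (3:Fin 4) from rfl]
  generalize b 0 = a at *
  generalize b 1 = b at *
  have s1 : ∀ w f B c d : ℂ, w ≠ 0 → 1-w^2 ≠ 0 → 1-p*w^2 ≠ 0 → (1-a*w)*(f-B) = basis a p k z*(1-a*p^k*w)*a*(1-p^(k+1))*(p*w^2-1)/(p*w) →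
      (1-a*w)*(1-b*w)*(1-c*w)*(1-d*w)/((1-w^2)*(1-p*w^2))*(f-B) = -((1-b*w)*(1-c*w)*(1-d*w) *
      (basis a p k z*(1-a*p^k*w)*a*(1-p^(k+1))))/((1-w^2)*(p*w)) :=
    fun w f B c d hw h0 h1 e => by
      rw [div_mul_eq_mul_div, div_eq_div_iff (mul_ne_zero h0 h1) (mul_ne_zero h0 (mul_ne_zero hp hw))]
      rw [eq_div_iff (mul_ne_zero hp hw)] at e; linear_combination (1-b*w)*(1-c*w)*(1-d*w)*(1-w^2)*e
  rw [s1 _ _ _ _ _ hz h0 h1 e1, s1 _ _ _ _ _ (inv_ne_zero hz) h0' h2 e2, basis_succ _ _ _ hz]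
  have e3 : ∀ A : ℂ, A/((1-z⁻¹^2)*(p*z⁻¹)) = -(z^3*A)/p/(1-z^2) := fun A => by
    rw [div_div, div_eq_div_iff (mul_ne_zero h0' (mul_ne_zero hp (inv_ne_zero hz))) (mul_ne_zero hp h0)]; field_simp; ring
  rw [e3]; field_simp; ring

/-- The coefficients of the Askey-Wilson polynomial. -/
def coeff (p:ℂ) (b:Fin 4 → ℂ) (n k:ℕ) : ℂ := qpoch (p^(-(n:ℤ))) p k*qpoch ((∏ j, b j)*p^((n:ℤ)-1)) p k*p^k/qpoch p p k *
    ∏ j : Fin 3, qpoch (b 0*b j.succ*p^k) p (n-k)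

/-- The Askey-Wilson polynomial as a function of `z = exp (i x)`. -/
def poly (p:ℂ) (b:Fin 4 → ℂ) (n:ℕ) (z:ℂ) : ℂ := ∑ k ∈ range (n+1), coeff p b n k*basis (b 0) p k z

/-- The eigenvalue of the Askey-Wilson polynomial, with `d` the product of the parameters. -/
def eig (p d:ℂ) (n:ℤ) : ℂ := (p^(-n)-1)*(1-d*p^(n-1))

/-- The function is an eigenfunction of the Askey-Wilson difference operator. -/
def IsEigen (p:ℂ) (b:Fin 4 → ℂ) (n:ℕ) (f:ℂ → ℂ) : Prop := ∀ z, z ≠ 0 → 1-z^2 ≠ 0 → 1-p*z^2 ≠ 0 → 1-p*z⁻¹^2 ≠ 0 →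
    op p b z (f (p*z)) (f z) (f (z/p)) = eig p (∏ j, b j) n*f z

lemma IsEigen.const_mul {p:ℂ} {b:Fin 4 → ℂ} {n:ℕ} {f:ℂ → ℂ} (h:IsEigen p b n f) (c:ℂ) :
    IsEigen p b n fun z => c*f z := fun z h1 h2 h3 h4 => by
  have := h z h1 h2 h3 h4; rw [op] at this ⊢; linear_combination c*this

lemma isEigen_poly {p:ℂ} (hp:QBase p) (b:Fin 4 → ℂ) (n:ℕ) : IsEigen p b n (poly p b n) := by
  intro z h1 h2 h3 h4
  have key := sum_eigen n (coeff p b n) (fun k => basis (b 0) p k z)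
    (fun k => op p b z (basis (b 0) p k (p*z)) (basis (b 0) p k z) (basis (b 0) p k (z/p)))
    (fun k => eig p (∏ j, b j) k) (fun k => -(p^k)⁻¹*(1-p^k)*∏ j : Fin 3, (1-b 0*b j.succ*p^(k-1))) (eig p (∏ j, b j) n)
    (by simp [basis, qpoch_zero, op, eig]) (fun k => by
      rw [op_basis p b k hp.1 h1 h2 h3 h4, eig, zpow_neg, zpow_natCast, Nat.add_sub_cancel,
        show ((k+1:ℕ):ℤ)-1 = k by push_cast; ring, zpow_natCast])
    (fun k hk => by
      have hk1 := hp.2 k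
      have hpk := pow_ne_zero k hp.1
      have h5 : p*p^k ≠ 0 := mul_ne_zero hp.1 hpk
      have h6 := hp.qpoch_ne k
      have h7 : 1-p*p^k ≠ 0 := fun h => hk1 (by rw [pow_succ']; exact (sub_eq_zero.1 h).symm)
      simp only [coeff, qpoch_succ, qpoch_sub _ _ hk, prod_mul_distrib, Nat.add_sub_cancel, eig]
      rw [zpow_neg _ (k:ℤ), zpow_sub_one₀ hp.1, zpow_sub_one₀ hp.1, zpow_natCast, zpow_natCast, pow_succ']
      have hn := zpow_ne_zero (-(n:ℤ)) hp.1
      have hn2 : p^(-(n:ℤ))*p^n = 1 := by simp_all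
      generalize p^(-(n:ℤ)) = R at *
      generalize p^n = S at *
      have hp1 := hp.1; field_simp
      grind) rfl
  rw [poly, poly, poly, ← key, op]; simp only [op]; rw [← sum_sub_distrib, ← sum_sub_distrib, mul_sum, mul_sum, ← sum_add_distrib]
  exact sum_congr rfl fun k _ => by ring

lemma poly_poly (p:ℂ) (b:Fin 4 → ℂ) (c:ℕ → ℂ) (n:ℕ) : ∃ P : ℂ[X], P.natDegree ≤ n ∧
    (∀ x, ∑ k ∈ range (n+1), c k*basis (b 0) p k (exp (I*x)) = P.eval (cos x)) ∧ P.coeff n = c n*∏ i ∈ range n, (-(2*b 0*p^i)) :=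
  exists_poly_of_sum n c _ (fun k => 1+(b 0*p^k)^2) (fun k x => basis (b 0) p k (exp (I*x)))
    (fun x => by simp [basis, qpoch_zero]) fun k x => by
      rw [basis_succ _ _ _ (exp_ne_zero _), ← exp_neg, cos, mul_comm x, show -x*I = -(I*x) by ring]

end AskeyWilson

section QInf
variable {q:ℝ} (h0:0 < q) (h1:q < 1)
include h0 h1

lemma summable_qpow (a:ℂ) : Summable fun k : ℕ => ‖-(a*(q:ℂ)^k)‖ := by
  simp only [norm_neg, norm_mul, norm_pow, norm_real, Real.norm_eq_abs, abs_of_pos h0]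
  exact (summable_geometric_of_lt_one h0.le h1).mul_left _

lemma multipliable_qpoch (a:ℂ) : Multipliable fun k : ℕ => 1-a*(q:ℂ)^k := by
  simp only [sub_eq_add_neg]; exact multipliable_one_add_of_summable (summable_qpow h0 h1 a)

lemma qpochInf_succ (a:ℂ) : qpochInf a q = (1-a)*qpochInf (a*q) q := by
  have h := multipliable_qpoch h0 h1 (a*q); rw [qpochInf, tprod_eq_zero_mul', pow_zero, mul_one, qpochInf]
  · simp only [pow_succ', mul_assoc]
  · grind

lemma qpochInf_ne {a:ℂ} (h:∀ k : ℕ, 1-a*(q:ℂ)^k ≠ 0) : qpochInf a q ≠ 0 := by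
  rw [qpochInf]; simp only [sub_eq_add_neg] at h ⊢; exact tprod_one_add_ne_zero_of_summable h (summable_qpow h0 h1 a)

lemma qpochInf_conj (a:ℂ) : conj (qpochInf a q) = qpochInf (conj a) q := by
  rw [qpochInf, qpochInf, (multipliable_qpoch h0 h1 a).map_tprod (conj:ℂ →+* ℂ) continuous_conj]; simp

lemma qpochInf_sqrt (a:ℂ) : qpochInf a (Real.sqrt q:ℝ) = qpochInf a q*qpochInf (a*(Real.sqrt q:ℝ)) q := by
  have e : ((Real.sqrt q:ℝ):ℂ)^2 = q := by exact_mod_cast Real.sq_sqrt h0.le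
  have h2 := multipliable_qpoch h0 h1 a
  have h3 := multipliable_qpoch h0 h1 (a*(Real.sqrt q:ℝ)); rw [qpochInf, ← tprod_even_mul_odd]
  · simp only [pow_succ', pow_mul, e, qpochInf, mul_assoc]
  · simpa only [pow_mul, e] using h2
  · simpa only [pow_succ', pow_mul, e, mul_assoc] using h3

lemma continuous_qpochInf : Continuous fun a : ℂ => qpochInf a q := by
  refine continuous_iff_continuousAt.2 fun a => ?_
  have hs : Summable fun k : ℕ => (‖a‖+1)*q^k := (summable_geometric_of_lt_one h0.le h1).mul_left _
  have h := hs.hasProdLocallyUniformlyOn_nat_one_add (K := Metric.ball (0:ℂ) (‖a‖+1))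
    (f := fun k a => -(a*(q:ℂ)^k)) Metric.isOpen_ball (.of_forall fun k x hx => by
      simp only [norm_neg, norm_mul, norm_pow, norm_real, Real.norm_eq_abs, abs_of_pos h0]
      exact mul_le_mul_of_nonneg_right (mem_ball_zero_iff.1 hx).le (pow_nonneg h0.le k))
    fun k => by fun_prop
  have h2 := h.differentiableOn (.of_forall fun s => by
    simpa [Finset.prod_fn] using DifferentiableOn.finsetProd fun _ _ => by fun_prop)
    Metric.isOpen_ball
  have h3 := (h2.continuousOn.continuousAt (Metric.isOpen_ball.mem_nhds (by simp:a ∈ Metric.ball (0:ℂ) (‖a‖+1))))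
  simpa only [qpochInf, sub_eq_add_neg] using h3

lemma qpochInf_factor {a:ℂ} (h:qpochInf a q ≠ 0) : 1-a ≠ 0 ∧ qpochInf (a*q) q ≠ 0 := mul_ne_zero_iff.1 (by rwa [← qpochInf_succ h0 h1])

end QInf

/-- If `b e^{±ix}` is a positive number, then `± Re x` is the argument of `b⁻¹`. -/
lemma re_eq_arg {x b:ℂ} {t:ℝ} (ht:0 < t) (hx:x.re ∈ Set.Ioo (-Real.pi) Real.pi) (h:1-b*exp (I*x)*t = 0) : x.re = arg b⁻¹ := by
  have ht' : (t:ℂ) ≠ 0 := by exact_mod_cast ht.ne'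
  have hb : b ≠ 0 := fun hb => by rw [hb] at h; simp at h
  have e : exp (I*x) = ((t⁻¹:ℝ):ℂ)*b⁻¹ := by push_cast; field_simp; linear_combination -h
  have h2 : (log (exp (I*x))).im = x.re := by rw [log_exp] <;> simp [hx.1, hx.2.le]
  rw [← h2, log_im, e, arg_real_mul _ (inv_pos.2 ht)]

lemma one_sub_ne {x b:ℂ} {t:ℝ} (ht:0 < t) (hx:x.re ∈ Set.Ioo 0 Real.pi) (h1:x.re ≠ arg b⁻¹) (h2:x.re ≠ -arg b⁻¹) :
    1-b*exp (I*x)*t ≠ 0 ∧ 1-b*exp (-(I*x))*t ≠ 0 := by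
  have hpi := Real.pi_pos
  refine ⟨fun h => h1 (re_eq_arg ht ⟨by linarith [hx.1], hx.2⟩ h), fun h => h2 ?_⟩
  rw [← mul_neg] at h; rw [← re_eq_arg ht (by rw [neg_re]; constructor <;> linarith [hx.1, hx.2]) h, neg_re, neg_neg]

lemma one_sub_sq_ne {x:ℂ} {t:ℝ} (ht:0 < t) (hx:x.re ∈ Set.Ioo 0 Real.pi) : 1-exp (2*I*x)*t ≠ 0 ∧ 1-exp (-(2*I*x))*t ≠ 0 := by
  have hs := Real.sqrt_pos.2 ht
  have e : ((Real.sqrt t:ℝ):ℂ)^2 = t := by exact_mod_cast Real.sq_sqrt ht.le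
  obtain ⟨a1, a2⟩ := one_sub_ne (b := 1) hs hx (by simpa using hx.1.ne') (by simpa using hx.1.ne')
  obtain ⟨b1, b2⟩ := one_sub_ne (b := -1) hs hx (by rw [inv_neg, inv_one, arg_neg_one]; exact hx.2.ne)
    (by rw [inv_neg, inv_one, arg_neg_one]; linarith [hx.1, Real.pi_pos])
  rw [mul_assoc, ← mul_neg, two_mul, two_mul, exp_add, exp_add]; grind

open AskeyWilson (eig IsEigen op)

lemma kernel_aux (s t X Y e1 e2 e3 e4:ℂ) (hs:s ≠ 0) (ht:t ≠ 0) (hX:X ≠ 0) (hY:Y ≠ 0)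
    (hX2:1-X^2 ≠ 0) (hY2:1-Y^2 ≠ 0) (hA:Y*s-X*t ≠ 0) (hB:Y*s*X-t ≠ 0) (hC:Y*t-X*s ≠ 0) (hD:Y*t*X-s ≠ 0) (N:ℂ → ℂ)
    (hN:∀ U, N U = U⁻¹^2*(1-e1*U+e2*U^2-e3*U^3+e4*U^4)) : -(t-t⁻¹)*t*X*Y*(N (Y/(t*s))/((1-Y^2)/Y*((Y*s-X*t)*(Y*s*X-t))) -
      N (Y*t*s)⁻¹/((1-Y^2)/Y*((Y*t-X*s)*(Y*t*X-s)))+N (X*s^2)⁻¹/((1-X^2)/X*((Y*t-X*s)*(Y*s*X-t))) -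
      N (X/s^2)/((1-X^2)/X*((Y*s-X*t)*(Y*t*X-s)))) =
    (s^2-1)*(1-e4/s^4)-(s^2*t^2-1)*(1-e4/(t^2*s^4)) := by
  simp only [hN]
  generalize hx : 1-X^2 = x at *
  generalize hy : 1-Y^2 = y at *
  generalize ha : Y*s-X*t = a at *
  generalize hb : Y*s*X-t = b at *
  generalize hc : Y*t-X*s = c at *
  generalize hd : Y*t*X-s = d at *
  field_simp; subst hx hy ha hb hc hd; ring

lemma prod_four (b:Fin 4 → ℂ) (U:ℂ) : ∏ j, (1-b j*U) = 1-(b 0+b 1+b 2+b 3)*U+(b 0*b 1+b 0*b 2+b 0*b 3+b 1*b 2+b 1*b 3+b 2*b 3)*U^2 -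
    (b 0*b 1*b 2+b 0*b 1*b 3+b 0*b 2*b 3+b 1*b 2*b 3)*U^3+(∏ j, b j)*U^4 := by
  rw [Fin.prod_univ_four, Fin.prod_univ_four]; ring

/-- The numerator of the potential function, as a function of `exp (i x)`, with `s = √q`. -/
def potNum (s:ℂ) (b:Fin 4 → ℂ) (U:ℂ) : ℂ := -(s⁻¹*(U⁻¹^2*∏ j, (1-b j*U)))

/-- The data that make a family with `η(x) = cos x` an instance of the abstract model: all of it is
expressed through the four Askey-Wilson parameters `b`, some of which may vanish. -/
structure AWData (q:ℝ) (F:FamilyData) extends Perturbation F where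
  q_pos : 0 < q
  q_lt : q < 1
  γ_eq : F.γ = Real.log q
  κ_eq : F.κ = q⁻¹
  η_eq : F.η = fun x => cos x
  φ_eq : F.φ = fun x => 2*sin x
  dom_eq : F.dom = Set.Ioo 0 Real.pi
  b : F.Par → Fin 4 → ℂ
  V_eq : ∀ l x, F.V l x = (∏ j, (1-b l j*exp (I*x)))/awDen q x
  w_eq : ∀ l x, F.w l x = awNum q x/∏ j, qpairInf (b l j) q x
  E_eq : ∀ l n, F.E l n = eig q (∏ j, b l j) n
  Et_eq : ∀ l (v:ℕ), F.Et l v = eig q (∏ j, b l j) (-(v:ℤ)-1)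
  shift_shift : ∀ l s t, F.shift (F.shift l s) t = F.shift l (s+t)
  shift_zero : ∀ l, F.shift l 0 = l
  b_shift : ∀ l s j, b (F.shift l s) j = b l j*(q:ℂ)^((s:ℂ)/2)
  P_poly : ∀ l n, ∃ p : ℂ[X], p.natDegree ≤ n ∧ (∀ x, F.P l n x = p.eval (cos x)) ∧ (F.nondeg l n → p.coeff n = lcP l n)
  T_poly : ∀ l n, ∃ p : ℂ[X], p.natDegree ≤ n ∧ (∀ x, F.ξ l n x = p.eval (cos x)) ∧ (F.nondegT l n → p.coeff n = lcT l n)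
  lcP_ne : ∀ l n, F.nondeg l n → lcP l n ≠ 0
  lcT_ne : ∀ l n, F.nondegT l n → lcT l n ≠ 0
  E_ne : ∀ l n, F.nondeg l n → ∀ k < n, 1-(∏ j, b l j)*(q:ℂ)^((n:ℤ)+k-1) ≠ 0
  P_eig : ∀ l n, F.nondeg l n → ∃ f : ℂ → ℂ, IsEigen q (b l) n f ∧ ∀ x, F.P l n x = f (exp (I*x))
  T_eig : ∀ l n, F.nondegT l n → ∃ f : ℂ → ℂ, IsEigen (q:ℂ)⁻¹ (fun j => b l j/q) n f ∧ ∀ x, F.ξ l n x = f (exp (I*x))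
  b_lim : ∀ l j, Tendsto (fun t => b (pert l t) j) (𝓝[≠] 0) (𝓝 (b l j)) := by exact fun _ _ => tendsto_const_nhds
  adm_shift : ∀ l, F.adm l → F.adm (F.shift l 1)
  adm_conj : ∀ l, F.adm l → ∀ f : ℂ → ℂ, ∏ j, f (conj (b l j)) = ∏ j, f (b l j)
  adm_norm : ∀ l, F.adm l → ∀ j, ‖b l j‖ < 1 ∨ ‖b l j‖ ≤ 1 ∧ conj (b l j) = b l j
  lcP_real : ∀ l, F.adm l → ∀ n, conj (lcP l n) = lcP l n
  lcT_real : ∀ l, F.adm l → ∀ n, conj (lcT l n) = lcT l n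
  adm_nondeg : ∀ l, F.adm l → ∀ n, F.nondeg l n
  adm_nondegT : ∀ l N, F.adm (lamBar F l N) → ∀ v ≤ N, F.nondegT l v

namespace AWData
variable {q:ℝ} {F:FamilyData} (A:AWData q F)
include A

/-- The square root of `q`. -/
def s (_:AWData q F) : ℂ := (Real.sqrt q:ℝ)

lemma sqrt_sq : A.s^2 = q := by rw [s]; exact_mod_cast Real.sq_sqrt A.q_pos.le

lemma sqrt_ne : A.s ≠ 0 := by rw [s]; exact_mod_cast (Real.sqrt_pos.2 A.q_pos).ne'

lemma q_ne : (q:ℂ) ≠ 0 := by exact_mod_cast A.q_pos.ne'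

lemma exp_half (x:ℂ) : exp (I*(x-F.stp/2)) = exp (I*x)*A.s := by
  rw [show I*(x-F.stp/2) = I*x+((Real.log q/2:ℝ):ℂ) by
    rw [FamilyData.stp, A.γ_eq]; push_cast; linear_combination -(Real.log q/2:ℂ)*I_sq, exp_add,
    ← ofReal_exp, ← Real.log_sqrt A.q_pos.le, Real.exp_log (Real.sqrt_pos.2 A.q_pos), s]

lemma exp_half' (x:ℂ) : exp (I*(x+F.stp/2)) = exp (I*x)/A.s := by rw [eq_div_iff A.sqrt_ne, ← A.exp_half, add_sub_cancel_right]

lemma exp_sub (x:ℂ) : exp (I*(x-F.stp)) = exp (I*x)*q := by rw [← A.sqrt_sq, sq, ← mul_assoc, ← A.exp_half, ← A.exp_half]; congr 2; ring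

lemma exp_add' (x:ℂ) : exp (I*(x+F.stp)) = exp (I*x)/q := by rw [eq_div_iff A.q_ne, ← A.exp_sub, add_sub_cancel_right]

lemma phi_exp (x:ℂ) : F.φ x = I*((1-exp (I*x)^2)/exp (I*x)) := by
  have h := exp_ne_zero (I*x); rw [A.φ_eq]
  change 2*sin x = _
  rw [sin, show -x*I = -(I*x) by ring, exp_neg, mul_comm x]; field_simp

lemma eta_exp (x:ℂ) : F.η x = (exp (I*x)+(exp (I*x))⁻¹)/2 := by
  rw [A.η_eq, ← exp_neg]
  change cos x = _
  rw [cos, show -x*I = -(I*x) by ring, mul_comm x]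

lemma np_shift (l:F.Par) (U:ℂ) : potNum A.s (A.b (F.shift l (-1))) U = (F.κ:ℂ)*potNum A.s (A.b l) (U/A.s) := by
  have e : (q:ℂ)^(((-1:ℤ):ℂ)/2) = A.s⁻¹ := by
    rw [show ((-1:ℤ):ℂ)/2 = -((1/2:ℝ):ℂ) by push_cast; ring, cpow_neg, ← ofReal_cpow A.q_pos.le, s, Real.sqrt_eq_rpow]
  have hs := A.sqrt_ne; rw [potNum, potNum, A.κ_eq, ofReal_inv, ← A.sqrt_sq]; simp only [A.b_shift, e]
  rw [prod_congr rfl fun j _ => show 1-A.b l j*(U/A.s) = 1-A.b l j*A.s⁻¹*U by ring]; field_simp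

lemma exp_ne {x:ℂ} (hx:x.re ∈ F.dom) {t:ℝ} (ht:0 < t) : 1-t*exp (I*x)^2 ≠ 0 ∧ 1-t*(exp (I*x))⁻¹^2 ≠ 0 := by
  rw [A.dom_eq] at hx
  have := one_sub_sq_ne ht hx
  rwa [mul_assoc, ← mul_neg, two_mul, two_mul, exp_add, exp_add, ← sq, ← sq, exp_neg, mul_comm, mul_comm (_^2)] at this

lemma exp_ne_one {x:ℂ} (hx:x.re ∈ F.dom) : 1-exp (I*x)^2 ≠ 0 ∧ 1-(exp (I*x))⁻¹^2 ≠ 0 := by simpa using A.exp_ne hx one_pos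

lemma phi_sub (x:ℂ) : F.φ x*F.φ (x-F.stp/2) = -((1-exp (I*x)^2)*(1-q*exp (I*x)^2)*(A.s*exp (I*x)^2)⁻¹) := by
  have h := exp_ne_zero (I*x)
  have hs := A.sqrt_ne; rw [A.phi_exp, A.phi_exp, A.exp_half, ← A.sqrt_sq]; field_simp; rw [I_sq]; ring

lemma pot_sub (b:Fin 4 → ℂ) (x:ℂ) : potNum A.s b (exp (I*x))/(F.φ x*F.φ (x-F.stp/2)) =
      (∏ j, (1-b j*exp (I*x)))/((1-exp (I*x)^2)*(1-q*exp (I*x)^2)) := by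
  have h := exp_ne_zero (I*x)
  have hs := A.sqrt_ne; rw [A.phi_sub, potNum, neg_div_neg_eq, div_mul_eq_div_div_swap]; congr 1; field_simp

lemma phi_neg (x:ℂ) : F.φ (-x) = -F.φ x := by simp [A.φ_eq]

lemma pot_add (b:Fin 4 → ℂ) (x:ℂ) : potNum A.s b (exp (I*x))⁻¹/(F.φ x*F.φ (x+F.stp/2)) = (∏ j, (1-b j*(exp (I*x))⁻¹)) /
        ((1-(exp (I*x))⁻¹^2)*(1-q*(exp (I*x))⁻¹^2)) := by
  have := A.pot_sub b (-x)
  rwa [← neg_add', A.phi_neg, A.phi_neg, neg_mul_neg, mul_neg, exp_neg] at this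

lemma twist_sub (b:Fin 4 → ℂ) (x:ℂ) : potNum A.s b (exp (I*(x-F.stp)))⁻¹/(F.φ x*F.φ (x-F.stp/2)) = q*((∏ j, (1-b j/q*(exp (I*x))⁻¹)) /
        ((1-(exp (I*x))⁻¹^2)*(1-(q:ℂ)⁻¹*(exp (I*x))⁻¹^2))) := by
  have h := exp_ne_zero (I*x)
  have hs := A.sqrt_ne
  have hq := A.q_ne
  have e : ∀ j, 1-b j*(exp (I*x)*q)⁻¹ = 1-b j/q*(exp (I*x))⁻¹ := fun j => by field_simp
  have e2 : (1-(exp (I*x))⁻¹^2)*(1-(q:ℂ)⁻¹*(exp (I*x))⁻¹^2) = (1-exp (I*x)^2)*(1-q*exp (I*x)^2)*(q*exp (I*x)^4)⁻¹ := by field_simp; ring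
  rw [A.phi_sub, potNum, neg_div_neg_eq, e2, A.exp_sub, div_mul_eq_div_div_swap, div_mul_eq_div_div_swap _ _ (_)⁻¹, ← mul_div_assoc]
  simp only [e]; congr 1; field_simp

lemma twist_add (b:Fin 4 → ℂ) (x:ℂ) : potNum A.s b (exp (I*(x+F.stp)))/(F.φ x*F.φ (x+F.stp/2)) = q*((∏ j, (1-b j/q*exp (I*x))) /
        ((1-exp (I*x)^2)*(1-(q:ℂ)⁻¹*exp (I*x)^2))) := by
  have := A.twist_sub b (-x)
  rwa [← neg_add', ← neg_add', A.phi_neg, A.phi_neg, neg_mul_neg, mul_neg, mul_neg, exp_neg, exp_neg, inv_inv, inv_inv] at this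

lemma P_eq (l:F.Par) (n:ℕ) (hn:F.nondeg l n) (x:ℂ) (hx:x.re ∈ F.dom) : potNum A.s (A.b l) (exp (I*x))/(F.φ x*F.φ (x-F.stp/2)) *
      (F.P l n (x-F.stp)-F.P l n x) +
    potNum A.s (A.b l) (exp (I*x))⁻¹/(F.φ x*F.φ (x+F.stp/2))*(F.P l n (x+F.stp)-F.P l n x) = F.E l n*F.P l n x := by
  obtain ⟨f, hf, hP⟩ := A.P_eig l n hn
  have h1 := A.exp_ne hx A.q_pos
  have := hf _ (exp_ne_zero (I*x)) (A.exp_ne_one hx).1 h1.1 h1.2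
  rw [A.pot_sub, A.pot_add, A.E_eq, hP, hP, hP, A.exp_sub, A.exp_add', mul_comm _ (q:ℂ)]; exact this

lemma exp_ne_inv {x:ℂ} (hx:x.re ∈ F.dom) : 1-(q:ℂ)⁻¹*exp (I*x)^2 ≠ 0 ∧ 1-(q:ℂ)⁻¹*(exp (I*x))⁻¹^2 ≠ 0 := by
  simpa using A.exp_ne hx (inv_pos.2 A.q_pos)

lemma T_eq (l:F.Par) (n:ℕ) (hn:F.nondegT l n) (x:ℂ) (hx:x.re ∈ F.dom) : potNum A.s (A.b l) (exp (I*(x-F.stp)))⁻¹/(F.φ x*F.φ (x-F.stp/2)) *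
      (F.ξ l n (x-F.stp)-F.ξ l n x) +
    potNum A.s (A.b l) (exp (I*(x+F.stp)))/(F.φ x*F.φ (x+F.stp/2))*(F.ξ l n (x+F.stp)-F.ξ l n x) = (F.Et l n-F.Et l 0)*F.ξ l n x := by
  obtain ⟨f, hf, hT⟩ := A.T_eig l n hn
  have h1 := A.exp_ne_inv hx
  have hq := A.q_ne
  have := hf _ (exp_ne_zero (I*x)) (A.exp_ne_one hx).1 h1.1 h1.2
  rw [A.twist_sub, A.twist_add, A.Et_eq, A.Et_eq, hT, hT, hT, A.exp_sub, A.exp_add']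
  rw [op, div_inv_eq_mul, show (q:ℂ)⁻¹*exp (I*x) = exp (I*x)/q from inv_mul_eq_div _ _] at this
  have e : eig q (∏ j, A.b l j) (-(n:ℤ)-1)-eig q (∏ j, A.b l j) (-((0:ℕ):ℤ)-1) = q*eig (q:ℂ)⁻¹ (∏ j, A.b l j/q) n := by
    simp only [prod_div_distrib, prod_const, card_univ, Fintype.card_fin, eig, inv_zpow',
      neg_sub, sub_neg_eq_add, inv_pow, inv_inv, zpow_add₀ hq, zpow_sub₀ hq, zpow_neg, zpow_natCast, zpow_one]
    have hn := pow_ne_zero n hq; field_simp; ring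
  rw [e]; linear_combination q*this

lemma VV (l:F.Par) (x:ℂ) (hx:x.re ∈ F.dom) : potNum A.s (A.b l) (exp (I*(x-F.stp)))⁻¹/(F.φ x*F.φ (x-F.stp/2)) +
    potNum A.s (A.b l) (exp (I*(x+F.stp)))/(F.φ x*F.φ (x+F.stp/2))-potNum A.s (A.b l) (exp (I*x))/(F.φ x*F.φ (x-F.stp/2)) -
    potNum A.s (A.b l) (exp (I*x))⁻¹/(F.φ x*F.φ (x+F.stp/2)) = F.Et l 0 := by
  have hq := A.q_ne
  have h0 := exp_ne_zero (I*x)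
  obtain ⟨h1, h1'⟩ := A.exp_ne_one hx
  obtain ⟨h2, h2'⟩ := A.exp_ne hx A.q_pos
  have e1 : 1-(exp (I*x))⁻¹^2 = -(1-exp (I*x)^2)/exp (I*x)^2 := by field_simp; ring
  have e2 : 1-(q:ℂ)⁻¹*(exp (I*x))⁻¹^2 = -(1-q*exp (I*x)^2)/(q*exp (I*x)^2) := by field_simp; ring
  have e3 : 1-q*(exp (I*x))⁻¹^2 = -(q-exp (I*x)^2)/exp (I*x)^2 := by field_simp; ring
  have e4 : 1-(q:ℂ)⁻¹*exp (I*x)^2 = (q-exp (I*x)^2)/q := by field_simp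
  have h3 : q-exp (I*x)^2 ≠ 0 := fun h => h2' (by rw [e3, h]; simp)
  rw [A.twist_sub, A.twist_add, A.pot_sub, A.pot_add, A.Et_eq, e1, e2, e3, e4]
  rw [prod_four (fun j => A.b l j/q), prod_four (fun j => A.b l j/q), prod_four, prod_four]
  simp only [prod_div_distrib, prod_const, card_univ, Fintype.card_fin, eig, Nat.cast_zero, neg_zero,
    zero_sub, neg_neg, zpow_one, zpow_sub₀ hq, zpow_neg]
  generalize exp (I*x) = z at *
  generalize hd1 : 1-z^2 = d1 at *
  generalize hd2 : 1-q*z^2 = d2 at *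
  generalize hd3 : q-z^2 = d3 at *
  field_simp; subst hd1 hd2 hd3; ring

end AWData

/-- The Askey-Wilson weight as a function of `exp (i x)`. -/
def weight (q:ℝ) (b:Fin 4 → ℂ) (U:ℂ) : ℂ := qpochInf (U^2) q*qpochInf (U⁻¹^2) q/∏ j, (qpochInf (b j*U) q*qpochInf (b j*U⁻¹) q)

lemma weight_inv (q:ℝ) (b:Fin 4 → ℂ) (U:ℂ) : weight q b U⁻¹ = weight q b U := by
  simp only [weight, inv_inv]; rw [mul_comm (qpochInf (U⁻¹^2) q)]; simp only [mul_comm (qpochInf (_*U⁻¹) q)]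

lemma weight_step {q:ℝ} (h0:0 < q) (h1:q < 1) (b:Fin 4 → ℂ) {s U:ℂ} (hs:s^2 = q) (hU:U ≠ 0) (h:weight q b U ≠ 0) : potNum s b U ≠ 0 ∧
    weight q (fun j => b j*s) (U*s) ≠ 0 ∧ weight q (fun j => b j*s) (U*s)*(U*s/(1-(U*s)^2)) = potNum s b U*(weight q b U*(U/(1-U^2))) := by
  have hs0 : s ≠ 0 := fun h => h0.ne' (by rw [h] at hs; exact_mod_cast (by simpa using hs.symm:(q:ℂ) = 0))
  obtain ⟨n, d⟩ := div_ne_zero_iff.1 h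
  obtain ⟨n1, n2⟩ := mul_ne_zero_iff.1 n
  have d' := fun j => mul_ne_zero_iff.1 (prod_ne_zero_iff.1 d j (mem_univ j))
  have hp : ∏ j, (1-b j*U) ≠ 0 := prod_ne_zero_iff.2 fun j _ => (qpochInf_factor h0 h1 (d' j).1).1
  obtain ⟨f1, n3⟩ := qpochInf_factor h0 h1 n1
  have f2 : 1-U^2*q ≠ 0 := (qpochInf_factor h0 h1 n3).1
  have g1 := qpochInf_succ h0 h1 (U^2)
  have g2 := qpochInf_succ h0 h1 ((U*s)⁻¹^2); rw [show (U*s)⁻¹^2*q = U⁻¹^2 by rw [← hs]; field_simp] at g2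
  have hd : ∀ j, (1-b j*U)*(qpochInf (b j*s*(U*s)) q*qpochInf (b j*s*(U*s)⁻¹) q) = qpochInf (b j*U) q*qpochInf (b j*U⁻¹) q := fun j => by
    rw [qpochInf_succ h0 h1 (b j*U), show b j*s*(U*s) = b j*U*q by rw [← hs]; ring,
      show b j*s*(U*s)⁻¹ = b j*U⁻¹ by field_simp]; ring
  have hD : (∏ j, (1-b j*U))*(∏ j, (qpochInf (b j*s*(U*s)) q *
      qpochInf (b j*s*(U*s)⁻¹) q)) = ∏ j, (qpochInf (b j*U) q*qpochInf (b j*U⁻¹) q) := by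
    rw [← prod_mul_distrib]; exact prod_congr rfl fun j _ => hd j
  have e3 : (1-(U*s)⁻¹^2) = -(1-U^2*q)/(U*s)^2 := by rw [← hs]; field_simp; ring
  have e4 : (U*s)^2 = U^2*q := by rw [← hs]; ring
  refine ⟨?_, ?_, ?_⟩
  · exact neg_ne_zero.2 (mul_ne_zero (inv_ne_zero hs0) (mul_ne_zero (pow_ne_zero _ (inv_ne_zero hU)) hp))
  · refine div_ne_zero (mul_ne_zero (by rwa [e4]) ?_) fun h0 => d (by rw [← hD, h0, mul_zero])
    rw [g2, e3]; exact mul_ne_zero (div_ne_zero (neg_ne_zero.2 f2) (pow_ne_zero _ (mul_ne_zero hU hs0))) n2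
  · have hD0 : ∏ j, (qpochInf (b j*s*(U*s)) q*qpochInf (b j*s*(U*s)⁻¹) q) ≠ 0 := fun h0 => d (by rw [← hD, h0, mul_zero])
    rw [weight, weight, potNum, ← hD, g1, g2, e3, e4]
    generalize 1-U^2*q = y at *
    generalize ∏ j, (1-b j*U) = p at *
    rw [← hs]; field_simp

namespace AWData
variable {q:ℝ} {F:FamilyData} (A:AWData q F)
include A

lemma w_exp (l:F.Par) (x:ℂ) : F.w l x = weight q (A.b l) (exp (I*x)) := by
  have e : exp (2*I*x) = exp (I*x)^2 := by rw [← exp_nat_mul]; congr 1; push_cast; ring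
  simp only [A.w_eq, weight, awNum, qpairInf, exp_neg, e, inv_pow]

lemma nu_exp (l:F.Par) (x:ℂ) : nu F l x = weight q (A.b l) (exp (I*x))*(exp (I*x)/(1-exp (I*x)^2))*I⁻¹ := by
  unfold nu; rw [A.w_exp, A.phi_exp, div_mul_eq_div_div, div_div_eq_mul_div]; ring

lemma b_one (l:F.Par) : A.b (F.shift l 1) = fun j => A.b l j*A.s := by
  funext j; rw [A.b_shift, show ((1:ℤ):ℂ)/2 = ((1/2:ℝ):ℂ) by push_cast; ring, ← ofReal_cpow A.q_pos.le, ← Real.sqrt_eq_rpow, s]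

lemma w_step (l:F.Par) (y:ℂ) (h:F.w l y ≠ 0) : potNum A.s (A.b l) (exp (I*y)) ≠ 0 ∧ potNum A.s (A.b l) (exp (I*y))⁻¹ ≠ 0 ∧
    F.w (F.shift l 1) (y-F.stp/2) ≠ 0 ∧ F.w (F.shift l 1) (y+F.stp/2) ≠ 0 ∧ nu F (F.shift l 1) (y-F.stp/2) =
      potNum A.s (A.b l) (exp (I*y))*nu F l y ∧
    nu F (F.shift l 1) (y+F.stp/2) = potNum A.s (A.b l) (exp (I*y))⁻¹*nu F l y := by
  have hy := exp_ne_zero (I*y)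
  have hs := A.sqrt_ne; rw [A.w_exp] at h
  obtain ⟨a1, a2, a3⟩ := weight_step A.q_pos A.q_lt _ A.sqrt_sq hy h; rw [← weight_inv] at h
  obtain ⟨b1, b2, b3⟩ := weight_step A.q_pos A.q_lt _ A.sqrt_sq (inv_ne_zero hy) h
  have e : (exp (I*y))⁻¹*A.s = (exp (I*y)/A.s)⁻¹ := by field_simp
  have k : ∀ U : ℂ, U ≠ 0 → U⁻¹/(1-U⁻¹^2) = -(U/(1-U^2)) := fun U hU => by
    rw [← div_neg, show -(1-U^2) = U^2*(1-U⁻¹^2) by field_simp; ring, div_mul_eq_div_div]; congr 1; field_simp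
  rw [e, weight_inv] at b2; rw [e, weight_inv, weight_inv, k _ (div_ne_zero hy hs), k _ hy] at b3
  rw [A.w_exp, A.w_exp, A.nu_exp, A.nu_exp, A.nu_exp, A.exp_half, A.exp_half', A.b_one]
  exact ⟨a1, b1, a2, b2, by rw [a3]; ring, by linear_combination -I⁻¹*b3⟩

lemma kernel (ω:ℕ → ℝ) (hω:∀ n : ℕ, ω n = -Real.sinh (n/2*F.γ)) (l:F.Par) (N:ℕ) (x y a:ℂ)
    (ha:a = ((N:ℂ)-1)/2*F.stp) (hx:F.φ x ≠ 0) (hy:F.φ y ≠ 0) (h1:F.η (y+a)-F.η x ≠ 0) (h2:F.η (y-a)-F.η x ≠ 0) :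
    I*ω N*(-potNum A.s (A.b l) (exp (I*(y+a+F.stp)))/(F.φ y*(F.η (y+a)-F.η x)) +
      potNum A.s (A.b l) (exp (I*(y-a-F.stp)))⁻¹/(F.φ y*(F.η (y-a)-F.η x)) -
      potNum A.s (A.b l) (exp (I*(x-F.stp)))⁻¹/(F.φ x*(F.η y-F.η (x+a))) +
      potNum A.s (A.b l) (exp (I*(x+F.stp)))/(F.φ x*(F.η y-F.η (x-a)))) = F.Et l 0-F.E l (-(N:ℤ)-1) := by
  have hX := exp_ne_zero (I*x)
  have hY := exp_ne_zero (I*y)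
  have hs := A.sqrt_ne
  have hq := A.q_ne
  obtain ⟨t, ht, ht2, hωt, hat⟩ : ∃ t : ℂ, t ≠ 0 ∧ t^2 = (q:ℂ)^N ∧ (ω N:ℂ) = -(t-t⁻¹)/2 ∧ exp (I*a) = A.s/t := by
    refine ⟨A.s^N, pow_ne_zero _ hs, by rw [← pow_mul, mul_comm, pow_mul, A.sqrt_sq], ?_, ?_⟩
    · have e : Real.exp (N/2*F.γ) = Real.sqrt q^N := by
        rw [A.γ_eq, show (N:ℝ)/2*Real.log q = N*(Real.log q/2) by ring, Real.exp_nat_mul,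
          ← Real.log_sqrt A.q_pos.le, Real.exp_log (Real.sqrt_pos.2 A.q_pos)]
      rw [hω, Real.sinh_eq, Real.exp_neg, e, s]; push_cast; ring
    · have e : I*a = (Real.log q/2:ℝ)-N*(Real.log q/2:ℝ) := by
        rw [ha, FamilyData.stp, A.γ_eq]; push_cast; linear_combination ((N:ℂ)-1)/2*Real.log q*I_sq
      rw [e, Complex.exp_sub, exp_nat_mul, ← ofReal_exp, ← Real.log_sqrt A.q_pos.le, Real.exp_log (Real.sqrt_pos.2 A.q_pos), s]
  have p1 : ∀ u, exp (I*(u+a)) = exp (I*u)*A.s/t := fun u => by rw [mul_add, exp_add, hat, mul_div_assoc]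
  have p2 : ∀ u, exp (I*(u-a)) = exp (I*u)*t/A.s := fun u => by rw [mul_sub, Complex.exp_sub, hat, div_div_eq_mul_div]
  rw [A.phi_exp] at hx hy; simp only [A.eta_exp, A.phi_exp, A.exp_sub, A.exp_add', A.Et_eq, A.E_eq, p1, p2] at h1 h2 ⊢
  have hr := A.sqrt_sq
  generalize exp (I*x) = X at *
  generalize exp (I*y) = Y at *
  generalize A.s = s at *
  have c1 : (Y*s/t+(Y*s/t)⁻¹)/2-(X+X⁻¹)/2 = (Y*s-X*t)*(Y*s*X-t)/(2*t*s*X*Y) := by field_simp; ring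
  have c2 : (Y*t/s+(Y*t/s)⁻¹)/2-(X+X⁻¹)/2 = (Y*t-X*s)*(Y*t*X-s)/(2*t*s*X*Y) := by field_simp; ring
  have c3 : (Y+Y⁻¹)/2-(X*s/t+(X*s/t)⁻¹)/2 = (Y*t-X*s)*(Y*s*X-t)/(2*t*s*X*Y) := by field_simp; ring
  have c4 : (Y+Y⁻¹)/2-(X*t/s+(X*t/s)⁻¹)/2 = (Y*s-X*t)*(Y*t*X-s)/(2*t*s*X*Y) := by field_simp; ring
  rw [c1] at h1 ⊢; rw [c2] at h2 ⊢; rw [c3, c4]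
  obtain ⟨hA, hB⟩ := mul_ne_zero_iff.1 (div_ne_zero_iff.1 h1).1
  obtain ⟨hC, hD⟩ := mul_ne_zero_iff.1 (div_ne_zero_iff.1 h2).1
  have hX2 := (div_ne_zero_iff.1 (mul_ne_zero_iff.1 hx).2).1
  have hY2 := (div_ne_zero_iff.1 (mul_ne_zero_iff.1 hy).2).1
  have key := kernel_aux s t X Y _ _ _ (∏ j, A.b l j) hs ht hX hY hX2 hY2 hA hB hC hD _ fun U => congrArg (U⁻¹^2*·) (prod_four (A.b l) U)
  have eR : eig (q:ℂ) (∏ j, A.b l j) (-((0:ℕ):ℤ)-1)-eig q (∏ j, A.b l j) (-(N:ℤ)-1) = (s^2-1)*(1-(∏ j, A.b l j)/s^4) -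
      (s^2*t^2-1)*(1-(∏ j, A.b l j)/(t^2*s^4)) := by
    rw [ht2, show s^4 = (s^2)^2 by ring, hr]
    have hn := pow_ne_zero N hq
    simp only [eig, Nat.cast_zero, neg_zero, zero_sub, neg_neg, neg_sub, sub_neg_eq_add, zpow_one,
      zpow_add₀ hq, zpow_sub₀ hq, zpow_neg, zpow_natCast]
    field_simp
  rw [eR, ← key, hωt, potNum, potNum, potNum, potNum]
  have f1 : Y*s/t/q = Y/(t*s) := by rw [← hr]; field_simp
  have f2 : (Y*t/s*q)⁻¹ = (Y*t*s)⁻¹ := by rw [← hr]; field_simp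
  rw [f1, f2, hr]
  have f3 : ∀ M u v w : ℂ, -(s⁻¹*M)/(I*u*(v/w)) = I*w*(s⁻¹*(M/(u*v))) := fun M u v w => by
      rw [show I*u*(v/w) = u*v/w*I by ring, div_mul_eq_div_div, div_I, div_div_eq_mul_div]; ring
  have fin : ∀ K1 K2 K3 K4 : ℂ, I*(-(t-t⁻¹)/2)*(-(I*(2*t*s*X*Y)*(s⁻¹*K1))+I*(2*t*s*X*Y)*(s⁻¹*K2)-I*(2*t*s*X*Y)*(s⁻¹*K3) +
      I*(2*t*s*X*Y)*(s⁻¹*K4)) = -(t-t⁻¹)*t*X*Y*(K1-K2+K3-K4) :=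
    fun K1 K2 K3 K4 => by
      field_simp; rw [I_sq]; ring
  rw [show ∀ a b:ℂ, - -a/b = -(-a/b) from fun a b => neg_div _ _, f3, f3, f3, f3, fin]

lemma weight_conj {b:Fin 4 → ℂ} (hb:∀ f : ℂ → ℂ, ∏ j, f (conj (b j)) = ∏ j, f (b j)) (U:ℂ) : conj (weight q b U) = weight q b (conj U) := by
  have h1 := hb fun z => qpochInf (z*conj U) q*qpochInf (z*(conj U)⁻¹) q
  simp only [weight, map_div₀, map_mul, map_prod, qpochInf_conj A.q_pos A.q_lt, map_pow, map_inv₀, h1]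

omit A in
lemma exp_conj_eq (x:ℂ) : exp (I*conj x) = (conj (exp (I*x)))⁻¹ := by rw [← exp_conj, map_mul, conj_I, ← exp_neg]; congr 1; ring

lemma w_pos (l:F.Par) (hl:F.adm l) (r:ℝ) (hr:r ∈ F.dom) : PosR (F.w l r) := by
  have hz : (exp (I*r))⁻¹ = conj (exp (I*r)) := by
    have := exp_conj_eq r; rw [conj_ofReal] at this; exact inv_eq_iff_eq_inv.2 this
  have hn : ‖exp (I*r)‖ = 1 := by rw [mul_comm]; exact norm_exp_ofReal_mul_I r
  have hpos : ∀ k : ℕ, 0 < q^k := fun k => pow_pos A.q_pos k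
  have h1 := A.adm_conj l hl fun z => qpochInf (z*(exp (I*r))⁻¹) q
  rw [A.w_exp, weight, hz, ← map_pow, ← qpochInf_conj A.q_pos A.q_lt, prod_mul_distrib, ← hz, ← h1, hz]
  simp only [← map_mul, ← qpochInf_conj A.q_pos A.q_lt, ← map_prod]
  refine (PosR.mul_conj (qpochInf_ne A.q_pos A.q_lt fun k h => ?_)).div
    (PosR.mul_conj (prod_ne_zero_iff.2 fun j _ => qpochInf_ne A.q_pos A.q_lt fun k h => ?_))
  · exact (A.exp_ne (x := r) (by simpa using hr) (hpos k)).1 (by push_cast; linear_combination h)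
  · have h2 : A.b l j*exp (I*r)*(q:ℂ)^k = 1 := (sub_eq_zero.1 h).symm
    have h3 := congrArg (‖·‖) h2
    simp only [norm_mul, hn, norm_pow, norm_real, Real.norm_eq_abs, abs_of_pos A.q_pos, norm_one, mul_one] at h3
    have h4 : q^k ≤ 1 := pow_le_one₀ A.q_pos.le A.q_lt.le
    rcases A.adm_norm l hl j with h5 | ⟨h5, h6⟩
    · nlinarith [hpos k, norm_nonneg (A.b l j)]
    · obtain ⟨u, hu⟩ := conj_eq_iff_real.1 h6
      have h7 := congrArg Complex.im h2
      rw [hu, show (u:ℂ)*exp (I*r)*(q:ℂ)^k = ((u*q^k:ℝ):ℂ)*exp (I*r) by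
        push_cast; ring, im_ofReal_mul, mul_comm I, exp_ofReal_mul_I_im, one_im] at h7
      rw [A.dom_eq] at hr
      have h8 := (mul_eq_zero.1 h7).resolve_right (Real.sin_pos_of_mem_Ioo hr).ne'; rw [hu, norm_real, Real.norm_eq_abs] at h3
      rcases mul_eq_zero.1 h8 with h8 | h8
      · rw [h8] at h3; simp at h3
      · exact (hpos k).ne' h8

lemma exists_finite (l:F.Par) : ∃ S : Set ℝ, S.Finite ∧ ∀ x : ℂ, x.re ∈ F.dom \ S → ∀ j (t:ℝ),
    0 < t → 1-A.b l j*exp (I*x)*t ≠ 0 ∧ 1-A.b l j*(exp (I*x))⁻¹*t ≠ 0 := by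
  refine ⟨Set.range (fun j => arg (A.b l j)⁻¹) ∪ Set.range (fun j => -arg (A.b l j)⁻¹),
    (Set.finite_range _).union (Set.finite_range _), fun x hx j t ht => ?_⟩
  rw [A.dom_eq] at hx; rw [← exp_neg]
  exact one_sub_ne ht hx.1 (fun h => hx.2 (Or.inl ⟨j, h.symm⟩)) fun h => hx.2 (Or.inr ⟨j, h.symm⟩)

lemma w_line (l:F.Par) : ∃ S : Set ℝ, S.Finite ∧ ∀ r ∈ F.dom \ S, LineReg (F.w l) r := by
  obtain ⟨S, hS, h⟩ := A.exists_finite l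
  have hq : ∀ k : ℕ, 0 < q^k := fun k => pow_pos A.q_pos k
  have reg : ∀ (r:ℝ) (g:ℂ → ℂ), Continuous g → (∀ z ∈ vline r, ∀ k : ℕ, 1-g z*(q^k:ℝ) ≠ 0) → LineReg (fun z => qpochInf (g z) q) r :=
    fun r g hg hk => ⟨((continuous_qpochInf A.q_pos A.q_lt).comp hg).continuousOn,
      fun z hz => qpochInf_ne A.q_pos A.q_lt fun k => by simpa using hk z hz k⟩
  have hc : Continuous fun z : ℂ => (exp (I*z))⁻¹ := by simp only [← exp_neg]; fun_prop
  refine ⟨S, hS, fun r hr => LineReg.congr (f := fun z => weight q (A.b l) (exp (I*z)))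
    (LineReg.div (LineReg.mul (reg _ _ (by fun_prop) fun z hz k => ?_) (reg _ _ (hc.pow 2) fun z hz k => ?_)) (LineReg.prod _ fun j _ =>
      LineReg.mul (reg _ _ (by fun_prop) fun z hz k => ?_) (reg _ _ (continuous_const.mul hc) fun z hz k => ?_))) fun z _ => A.w_exp l z⟩
  all_goals obtain rfl : z.re = r := hz
  · rw [mul_comm]; exact (A.exp_ne hr.1 (hq k)).1
  · rw [mul_comm]; exact (A.exp_ne hr.1 (hq k)).2
  · exact (h z hr j _ (hq k)).1
  · exact (h z hr j _ (hq k)).2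

/-- The model of a family with `η(x) = cos x`. -/
def model : AdmModel F :=
  { Geom.cosine A.η_eq A.φ_eq (A.γ_eq ▸ (Real.log_neg A.q_pos A.q_lt).ne) A.dom_eq, A with
    np := fun l x => potNum A.s (A.b l) (exp (I*x))
    nm := fun l x => potNum A.s (A.b l) (exp (I*x))⁻¹
    np_diff := fun l => by simp only [potNum, ← exp_neg]; fun_prop
    nm_diff := fun l => by simp only [potNum, ← exp_neg]; fun_prop
    np_fin := fun l => by
      obtain ⟨S, hS, h⟩ := A.exists_finite l
      have hp : ∀ U : ℂ, U ≠ 0 → (∀ j, 1-A.b l j*U ≠ 0) → potNum A.s (A.b l) U ≠ 0 :=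
        fun U hU hj => neg_ne_zero.2 (mul_ne_zero (inv_ne_zero A.sqrt_ne)
          (mul_ne_zero (pow_ne_zero _ (inv_ne_zero hU)) (prod_ne_zero_iff.2 fun j _ => hj j)))
      have hx0 := fun x : ℂ => exp_ne_zero (I*x)
      exact ⟨S, hS, fun x hx => ⟨hp _ (hx0 x) fun j => by simpa using (h x hx j 1 one_pos).1,
        hp _ (inv_ne_zero (hx0 x)) fun j => by simpa using (h x hx j 1 one_pos).2⟩⟩
    κ_pos := by rw [A.κ_eq]; exact inv_pos.2 A.q_pos
    V_eq := fun l x => by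
      rw [A.pot_sub, A.V_eq, awDen, show exp (2*I*x) = exp (I*x)^2 by rw [← exp_nat_mul]; congr 1; push_cast; ring]
    np_shift := fun l x => by rw [A.np_shift, A.exp_half']
    nm_shift := fun l x => by rw [A.np_shift, A.exp_half, mul_inv, div_eq_mul_inv]
    P_poly := fun l n => by rw [A.η_eq]; exact A.P_poly l n
    T_poly := fun l n => by rw [A.η_eq]; exact A.T_poly l n
    P_eq := A.P_eq
    T_eq := A.T_eq
    VV := A.VV
    E_zero := fun l => by rw [A.E_eq]; simp [eig]
    E_step := fun l n => by
      have hq := A.q_ne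
      have hn := zpow_ne_zero n hq
      have h1 := A.b_shift l (-1)
      have e : ((q:ℂ)^(((-1:ℤ):ℂ)/2))^4 = ((q:ℂ)^2)⁻¹ := by rw [← cpow_nat_mul, ← cpow_natCast, ← cpow_neg]; congr 1; push_cast; ring
      rw [A.κ_eq, A.E_eq, A.E_eq, A.E_eq]
      simp only [h1, prod_mul_distrib, prod_const, card_univ, Fintype.card_fin, e, eig, neg_neg, zpow_one,
        zpow_add₀ hq, zpow_sub₀ hq, zpow_neg, neg_add, ofReal_inv, inv_inv]
      field_simp; ring
    Et_eq := fun l v => by rw [A.Et_eq, A.E_eq]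
    E_ne := fun l n hn k hk h => by
      have hq := A.q_ne; rw [A.E_eq, A.E_eq, eig, eig] at h
      have h1 : (q:ℂ)^n-(q:ℂ)^k ≠ 0 := fun h => by
        have : q^n = q^k := by exact_mod_cast sub_eq_zero.1 h
        exact hk.ne' (pow_right_injective₀ A.q_pos A.q_lt.ne this)
      refine mul_ne_zero h1 (A.E_ne l n hn k hk) ?_
      simp only [zpow_add₀ hq, zpow_sub₀ hq, zpow_neg, zpow_natCast, zpow_one] at h ⊢
      have a1 := pow_ne_zero n hq
      have a2 := pow_ne_zero k hq; field_simp at h ⊢; linear_combination h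
    kernel := fun l N x y a ha hx hy h1 h2 _ _ => A.kernel _ (fun _ => rfl) l N x y a ha hx hy h1 h2
    w_step := A.w_step
    np_lim := fun l x => by
      exact ((tendsto_const_nhds.mul (tendsto_finsetProd _ fun j _ => tendsto_const_nhds.sub ((A.b_lim l j).mul_const _))).const_mul _).neg
    nm_lim := fun l x => by
      exact ((tendsto_const_nhds.mul (tendsto_finsetProd _ fun j _ => tendsto_const_nhds.sub ((A.b_lim l j).mul_const _))).const_mul _).neg
    E_lim := fun l n => by
      simp only [A.E_eq, eig]
      exact (tendsto_const_nhds.sub ((tendsto_finsetProd _ fun j _ => A.b_lim l j).mul_const _)).const_mul _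
    np_conj := fun l hl x => by
      have := A.adm_conj l hl fun z => 1-z*conj (exp (I*x))
      simp only [exp_conj_eq, inv_inv, potNum, s, map_neg, map_mul, map_inv₀, conj_ofReal, map_pow, map_prod, map_sub, map_one, this]
    E_real := fun l hl n => by
      have := A.adm_conj l hl fun z => z
      simp only [A.E_eq, eig, map_mul, map_sub, map_one, map_zpow₀, conj_ofReal, map_prod, this]
    w_pos := A.w_pos
    w_conj := fun l hl x => by rw [A.w_exp, A.w_exp, A.weight_conj (A.adm_conj l hl), exp_conj_eq, weight_inv]
    w_line := fun l _ => A.w_line l }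

end AWData

open AskeyWilson (eig IsEigen op poly isEigen_poly)

lemma qpoch_zero_left (p:ℂ) (n:ℕ) : qpoch 0 p n = 1 := by simp [qpoch]

lemma qpochInf_zero (p:ℂ) : qpochInf 0 p = 1 := by simp [qpochInf]

lemma qpoch_conj (a p:ℂ) (n:ℕ) : conj (qpoch a p n) = qpoch (conj a) (conj p) n := by simp [qpoch, map_prod]

namespace AskeyWilson

lemma IsEigen.congr_prod {p:ℂ} {b b':Fin 4 → ℂ} {n:ℕ} {f:ℂ → ℂ} (h:IsEigen p b' n f)
    (hb:∀ g : ℂ → ℂ, ∏ j, g (b' j) = ∏ j, g (b j)) : IsEigen p b n f := fun z h1 h2 h3 h4 => by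
  have := h z h1 h2 h3 h4
  rwa [op, hb fun w => 1-w*z, hb fun w => 1-w*z⁻¹, hb fun w => w] at this

/-- The leading coefficient in `cos x` of the Askey-Wilson polynomial, divided by `b_0 ^ n`. -/
def lead (p d:ℂ) (n:ℕ) : ℂ := qpoch (p^(-(n:ℤ))) p n*qpoch (d*p^((n:ℤ)-1)) p n*p^n/qpoch p p n*∏ i ∈ range n, (-(2*p^i))

lemma lead_ne {p d:ℂ} (hp:QBase p) {n:ℕ} (hd:∀ k < n, 1-d*p^((n:ℤ)+k-1) ≠ 0) : lead p d n ≠ 0 := by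
  refine mul_ne_zero (div_ne_zero (mul_ne_zero (mul_ne_zero (hp.qpoch_neg_ne n) ?_) (pow_ne_zero n hp.1)) (hp.qpoch_ne n)) ?_
  · refine prod_ne_zero_iff.2 fun k hk => ?_
    rw [mul_assoc, ← zpow_natCast p k, ← zpow_add₀ hp.1, sub_add_eq_add_sub]; exact hd k (mem_range.1 hk)
  · exact prod_ne_zero_iff.2 fun i _ => neg_ne_zero.2 (mul_ne_zero two_ne_zero (pow_ne_zero i hp.1))

lemma lead_conj {p d:ℂ} (hp:conj p = p) (hd:conj d = d) (n:ℕ) : conj (lead p d n) = lead p d n := by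
  simp [lead, qpoch_conj, map_prod, map_zpow₀, hp, hd, Complex.conj_ofNat]

lemma const_mul_poly (p:ℂ) (b:Fin 4 → ℂ) (c:ℂ) (n:ℕ) : ∃ P : ℂ[X], P.natDegree ≤ n ∧ (∀ x, c*poly p b n (exp (I*x)) = P.eval (cos x)) ∧
    P.coeff n = c*b 0^n*lead p (∏ j, b j) n := by
  obtain ⟨P, h1, h2, h3⟩ := poly_poly p b (fun k => c*AskeyWilson.coeff p b n k) n
  refine ⟨P, h1, fun x => by rw [← h2, poly, mul_sum]; simp only [mul_assoc], ?_⟩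
  have e : ∏ i ∈ range n, (-(2*b 0*p^i)) = b 0^n*∏ i ∈ range n, (-(2*p^i)) := by
    rw [← card_range n, ← prod_const, card_range, ← prod_mul_distrib]; exact prod_congr rfl fun i _ => by ring
  rw [h3, e, AskeyWilson.coeff, lead, Nat.sub_self]; simp only [qpoch_zero, prod_const_one]; ring

end AskeyWilson
open AskeyWilson

/-- The parameters of a family `redAW r`, padded with zeros. -/
def pad {r:ℕ} (a:Fin (r+1) → ℂ) (j:Fin 4) : ℂ := if h : (j:ℕ) < r+1 then a ⟨j, h⟩ else 0

lemma pad_zero {r:ℕ} (a:Fin (r+1) → ℂ) : pad a 0 = a 0 := dif_pos r.succ_pos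

lemma prod_pad {r:ℕ} (hr:r ≤ 2) (a:Fin (r+1) → ℂ) (f:ℂ → ℂ) : ∏ j, f (pad a j) = (∏ j, f (a j))*f 0^(3-r) := by
  interval_cases r <;> simp [pad, Fin.prod_univ_succ] <;> ring

lemma prod_pad_eq_zero {r:ℕ} (hr:r ≤ 2) (a:Fin (r+1) → ℂ) : ∏ j, pad a j = 0 :=
  prod_eq_zero (mem_univ (3:Fin 4)) (dif_neg (by change ¬ 3 < r+1; omega))

lemma redAWPoly_eq {r:ℕ} (hr:r ≤ 2) (p:ℝ) (a:Fin (r+1) → ℂ) (n:ℕ) (x:ℂ) :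
    redAWPoly r p a n x = a 0^(-(n:ℤ))*poly p (pad a) n (exp (I*x)) := by
  rw [redAWPoly, poly]; congr 1
  refine sum_congr rfl fun k _ => ?_
  have h : ∏ j : Fin r, qpoch (a 0*a j.succ*(p:ℂ)^k) p (n-k) = ∏ j : Fin 3, qpoch (a 0*pad a j.succ*(p:ℂ)^k) p (n-k) := by
    interval_cases r <;> simp [pad, Fin.prod_univ_succ, qpoch_zero_left]
  rw [AskeyWilson.coeff, prod_pad_eq_zero hr, zero_mul, qpoch_zero_left, pad_zero, h, basis, qpair, exp_neg]; ring

lemma redAW_poly {r:ℕ} (hr:r ≤ 2) (p:ℝ) (a:Fin (r+1) → ℂ) (n:ℕ) : ∃ P : ℂ[X],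
    P.natDegree ≤ n ∧ (∀ x, redAWPoly r p a n x = P.eval (cos x)) ∧ (a 0 ≠ 0 → P.coeff n = lead p 0 n) := by
  obtain ⟨P, h1, h2, h3⟩ := const_mul_poly p (pad a) (a 0^(-(n:ℤ))) n
  refine ⟨P, h1, fun x => by rw [redAWPoly_eq hr, h2], fun ha => ?_⟩
  rw [h3, prod_pad_eq_zero hr, pad_zero, zpow_neg, zpow_natCast, inv_mul_cancel₀ (pow_ne_zero n ha), one_mul]

lemma eig_zero (p:ℂ) (n:ℤ) : eig p 0 n = p^(-n)-1 := by simp [eig]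

lemma twist_eig {q:ℝ} (h0:0 < q) (v:ℕ) : (q:ℂ)*(((q⁻¹:ℝ):ℂ)^(-(v:ℤ))-1)+(q-1) = eig q 0 (-(v:ℤ)-1) := by
  have hq : (q:ℂ) ≠ 0 := by exact_mod_cast h0.ne'
  rw [eig_zero, ofReal_inv, inv_zpow', neg_neg, show -(-(v:ℤ)-1) = v+1 by ring, zpow_add_one₀ hq]; ring

lemma cpow_half_add {q:ℝ} (h0:0 < q) (s t:ℤ) : (q:ℂ)^((s:ℂ)/2)*(q:ℂ)^((t:ℂ)/2) = (q:ℂ)^(((s+t:ℤ):ℂ)/2) := by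
  rw [← cpow_add _ _ (by exact_mod_cast h0.ne')]; congr 1; push_cast; ring

/-- The families with generic parameters below the continuous dual `q`-Hahn one. -/
def redAWData {q:ℝ} (h0:0 < q) (h1:q < 1) {r:ℕ} (hr:r ≤ 2) : AWData q (redAW r q) where
  q_pos := h0
  q_lt := h1
  γ_eq := rfl
  κ_eq := rfl
  η_eq := rfl
  φ_eq := rfl
  dom_eq := rfl
  b := pad
  V_eq a x := by rw [prod_pad hr a fun w => 1-w*exp (I*x), zero_mul, sub_zero, one_pow, mul_one]; rfl
  w_eq a x := by
    rw [prod_pad hr a fun w => qpairInf w q x, qpairInf, zero_mul, zero_mul, qpochInf_zero, one_mul, one_pow, mul_one]; rfl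
  E_eq := fun (a:Fin (r+1) → ℂ) n => by rw [prod_pad_eq_zero hr, eig_zero]; rfl
  Et_eq := fun (a:Fin (r+1) → ℂ) v => by rw [prod_pad_eq_zero hr]; exact twist_eig h0 v
  shift_shift a s t := funext fun j => by
    change a j*_*_ = a j*_
    rw [mul_assoc, cpow_half_add h0]
  shift_zero a := funext fun j => by
    change a j*_ = a j
    simp
  b_shift a s j := by
    change pad (fun j => a j*(q:ℂ)^((s:ℂ)/2)) j = _
    unfold pad; split_ifs <;> simp
  lcP _ n := lead q 0 n
  lcT _ n := lead (q⁻¹:ℝ) 0 n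
  P_poly a n := redAW_poly hr q a n
  T_poly a n := by
    obtain ⟨P, h2, h3, h4⟩ := redAW_poly hr q⁻¹ (fun j => a j*(q:ℂ)⁻¹) n
    exact ⟨P, h2, h3, fun ha => h4 (mul_ne_zero ha (inv_ne_zero (QBase.of_real h0 h1).1))⟩
  lcP_ne a n _ := lead_ne (QBase.of_real h0 h1) fun k _ => by simp
  lcT_ne a n _ := lead_ne (by rw [ofReal_inv]; exact (QBase.of_real h0 h1).inv) fun k _ => by simp
  E_ne := fun (a:Fin (r+1) → ℂ) n _ k _ => by rw [prod_pad_eq_zero hr]; simp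
  P_eig a n _ := ⟨_, (isEigen_poly (QBase.of_real h0 h1) (pad a) n).const_mul _, redAWPoly_eq hr q a n⟩
  T_eig := fun (a:Fin (r+1) → ℂ) n _ => by
    have e : (fun j => pad a j/(q:ℂ)) = pad fun j => a j*(q:ℂ)⁻¹ := by funext j; unfold pad; split_ifs <;> simp [div_eq_mul_inv]
    rw [e]
    have h := (isEigen_poly (QBase.of_real h0 h1).inv (pad fun j => a j*(q:ℂ)⁻¹) n).const_mul ((a 0*(q:ℂ)⁻¹)^(-(n:ℤ)))
    refine ⟨_, h, fun x => ?_⟩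
    change redAWPoly r q⁻¹ (fun j => a j*(q:ℂ)⁻¹) n x = _
    rw [redAWPoly_eq hr, ofReal_inv]
  base a := a 0 ≠ 0
  nondeg_base _ _ h := h
  nondegT_base _ _ h := h
  base_shift a k h := mul_ne_zero h (cpow_ne_zero_iff.2 (Or.inl (QBase.of_real h0 h1).1))
  pert_gen a h n := .of_forall fun _ => ⟨h, h⟩
  adm_shift a ha := by
    have e : (q:ℂ)^(((1:ℤ):ℂ)/2) = (Real.sqrt q:ℝ) := by
      rw [show ((1:ℤ):ℂ)/2 = ((1/2:ℝ):ℂ) by push_cast; ring, ← ofReal_cpow h0.le, ← Real.sqrt_eq_rpow]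
    obtain ⟨⟨σ, hσ⟩, h2⟩ := ha
    refine ⟨⟨σ, fun j => ?_⟩, fun j => ?_⟩
    · change conj (a j*_) = a (σ j)*_
      rw [map_mul, hσ, e, conj_ofReal]
    · change a j*_ ≠ 0 ∧ ‖a j*_‖ < 1
      have hs := Real.sqrt_pos.2 h0
      have hs1 : Real.sqrt q ≤ 1 := Real.sqrt_le_one.2 h1.le; rw [e, norm_mul, norm_real, Real.norm_eq_abs, abs_of_pos hs]
      exact ⟨mul_ne_zero (h2 j).1 (by exact_mod_cast hs.ne'), (mul_le_of_le_one_right (norm_nonneg _) hs1).trans_lt (h2 j).2⟩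
  adm_conj := fun (a:Fin (r+1) → ℂ) ha f => by
    have e : ∀ j, conj (pad a j) = pad (fun j => conj (a j)) j := fun j => by unfold pad; split_ifs <;> simp
    simp only [e]; rw [prod_pad hr, prod_pad hr, ha.1.prod_eq]
  adm_norm a ha j := by
    unfold pad
    split_ifs
    exacts [Or.inl (ha.2 _).2, Or.inl (by simp)]
  lcP_real _ _ n := lead_conj (conj_ofReal q) (map_zero _) n
  lcT_real _ _ n := lead_conj (conj_ofReal _) (map_zero _) n
  adm_nondeg a ha _ := (ha.2 0).1
  adm_nondegT a N ha v _ := fun h : a 0 = 0 => (ha.2 0).1 (by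
    change a 0*_ = 0
    rw [h, zero_mul])

section RealBase
variable {q:ℝ} (h0:0 < q)
include h0

lemma ofReal_ne : (q:ℂ) ≠ 0 := by exact_mod_cast h0.ne'

lemma arg_ne_pi : arg (q:ℂ) ≠ Real.pi := by rw [arg_ofReal_of_nonneg h0.le]; exact Real.pi_pos.ne

lemma ofReal_inv_cpow (s:ℂ) : ((q⁻¹:ℝ):ℂ)^s = (q:ℂ)^(-s) := by rw [ofReal_inv, inv_cpow _ _ (arg_ne_pi h0), cpow_neg]

lemma conj_cpow_of_real {s:ℂ} (hs:s.im = 0) : conj ((q:ℂ)^s) = (q:ℂ)^s := by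
  have h := conj_cpow (q:ℂ) s (arg_ne_pi h0); rw [conj_ofReal, conj_eq_iff_im.2 hs] at h; exact h.symm

lemma cpow_mul_pow (s:ℂ) (k:ℕ) : (q:ℂ)^s*(q:ℂ)^k = (q:ℂ)^(s+k) := by rw [cpow_add _ _ (ofReal_ne h0), cpow_natCast]

lemma cpow_sqrt (s:ℂ) : (q:ℂ)^s*(Real.sqrt q:ℝ) = (q:ℂ)^(s+1/2) := by
  rw [cpow_add _ _ (ofReal_ne h0), Real.sqrt_eq_rpow, ofReal_cpow h0.le]; norm_num

lemma qpairInf_sqrt (h1:q < 1) (a x:ℂ) : qpairInf a (Real.sqrt q:ℝ) x = qpairInf a q x*qpairInf (a*(Real.sqrt q:ℝ)) q x := by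
  simp only [qpairInf, qpochInf_sqrt h0 h1, mul_right_comm a _ (exp _)]; ring

end RealBase

/-- The Askey-Wilson parameters of the continuous `q`-Laguerre polynomials. -/
def laguerreParam (q:ℝ) (α:ℂ) : Fin 4 → ℂ := ![(q:ℂ)^((α+1/2)/2), (q:ℂ)^((α+3/2)/2), 0, 0]

lemma prod_laguerreParam (q:ℝ) (α:ℂ) : ∏ j, laguerreParam q α j = 0 := by simp [laguerreParam, Fin.prod_univ_succ]

lemma cqLPoly_eq {q:ℝ} (h0:0 < q) (α:ℂ) (n:ℕ) (x:ℂ) : cqLPoly q α n x = 1/qpoch q q n*poly q (laguerreParam q α) n (exp (I*x)) := by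
  rw [cqLPoly, poly]; congr 1
  refine sum_congr rfl fun k _ => ?_
  have e : (q:ℂ)^((α+1/2)/2)*(q:ℂ)^((α+3/2)/2) = (q:ℂ)^(α+1) := by rw [← cpow_add _ _ (ofReal_ne h0)]; congr 1; ring
  rw [AskeyWilson.coeff, prod_laguerreParam, zero_mul, qpoch_zero_left, Fin.prod_univ_three, basis, qpair, exp_neg]
  change _ = _*(qpoch ((q:ℂ)^((α+1/2)/2)*(q:ℂ)^((α+3/2)/2)*_) q (n-k) *
    qpoch (_*0*_) q (n-k)*qpoch (_*0*_) q (n-k))*(qpoch ((q:ℂ)^((α+1/2)/2)*_) q k*qpoch ((q:ℂ)^((α+1/2)/2)*_) q k)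
  rw [e, cpow_mul_pow h0, mul_zero, zero_mul, qpoch_zero_left]; ring

lemma cqL_poly {q:ℝ} (h0:0 < q) (α:ℂ) (n:ℕ) : ∃ P : ℂ[X], P.natDegree ≤ n ∧ (∀ x, cqLPoly q α n x = P.eval (cos x)) ∧
    P.coeff n = 1/qpoch q q n*laguerreParam q α 0^n*lead q 0 n := by
  obtain ⟨P, h1, h2, h3⟩ := const_mul_poly q (laguerreParam q α) (1/qpoch q q n) n
  exact ⟨P, h1, fun x => by rw [cqLPoly_eq h0, h2], by rw [h3, prod_laguerreParam]⟩

lemma cqL_lead_ne {q:ℝ} (h0:0 < q) (hq:QBase q) (α:ℂ) (n:ℕ) : 1/qpoch q q n*laguerreParam q α 0^n*lead q 0 n ≠ 0 :=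
  mul_ne_zero (mul_ne_zero (one_div_ne_zero (hq.qpoch_ne n))
    (pow_ne_zero n (cpow_ne_zero_iff.2 (Or.inl (ofReal_ne h0))))) (lead_ne hq fun k _ => by simp)

lemma cqL_lead_conj {q:ℝ} (h0:0 < q) {α:ℂ} (hα:α.im = 0) (n:ℕ) : conj (1/qpoch q q n*laguerreParam q α 0^n*lead q 0 n) =
      1/qpoch q q n*laguerreParam q α 0^n*lead q 0 n := by
  have h : conj (laguerreParam q α 0) = laguerreParam q α 0 := conj_cpow_of_real h0 (by simp [hα])
  simp [qpoch_conj, lead_conj, h]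

/-- The continuous `q`-Laguerre family. -/
def cqLData {q:ℝ} (h0:0 < q) (h1:q < 1) : AWData q (contQLaguerre q) where
  q_pos := h0
  q_lt := h1
  γ_eq := rfl
  κ_eq := rfl
  η_eq := rfl
  φ_eq := rfl
  dom_eq := rfl
  b := laguerreParam q
  V_eq α x := by simp [contQLaguerre, laguerreParam, Fin.prod_univ_succ]
  w_eq := fun (α:ℂ) x => by
    change awNum q x/qpairInf _ _ x = _
    rw [qpairInf_sqrt h0 h1, cpow_sqrt h0, show (α+1/2)/2+1/2 = (α+3/2)/2 by ring]
    simp [laguerreParam, Fin.prod_univ_succ, qpairInf, qpochInf_zero]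
  E_eq := fun (α:ℂ) n => by rw [prod_laguerreParam, eig_zero]; rfl
  Et_eq := fun (α:ℂ) v => by rw [prod_laguerreParam]; exact twist_eig h0 v
  shift_shift := fun (α:ℂ) s t => by
    change α+s+t = α+((s+t:ℤ):ℂ)
    push_cast; ring
  shift_zero := fun (α:ℂ) => by
    change α+((0:ℤ):ℂ) = α
    simp
  b_shift := fun (α:ℂ) s j => by
    change laguerreParam q (α+s) j = _
    fin_cases j <;> simp [laguerreParam, ← cpow_add _ _ (ofReal_ne h0)] <;> congr 1 <;> ring
  lcP α n := 1/qpoch q q n*laguerreParam q α 0^n*lead q 0 n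
  lcT := fun (α:ℂ) n => 1/qpoch (q⁻¹:ℝ) (q⁻¹:ℝ) n*laguerreParam q⁻¹ (-α) 0^n*lead (q⁻¹:ℝ) 0 n
  P_poly α n := by
    obtain ⟨P, h2, h3, h4⟩ := cqL_poly h0 α n; exact ⟨P, h2, h3, fun _ => h4⟩
  T_poly := fun (α:ℂ) n => by
    obtain ⟨P, h2, h3, h4⟩ := cqL_poly (inv_pos.2 h0) (-α) n; exact ⟨P, h2, h3, fun _ => h4⟩
  lcP_ne α n _ := cqL_lead_ne h0 (QBase.of_real h0 h1) α n
  lcT_ne := fun (α:ℂ) n _ => cqL_lead_ne (inv_pos.2 h0) (by rw [ofReal_inv]; exact (QBase.of_real h0 h1).inv) (-α) n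
  E_ne := fun (α:ℂ) n _ k _ => by rw [prod_laguerreParam]; simp
  P_eig α n _ := ⟨_, (isEigen_poly (QBase.of_real h0 h1) _ n).const_mul _, cqLPoly_eq h0 α n⟩
  T_eig := fun (α:ℂ) n _ => by
    refine ⟨_, IsEigen.congr_prod ((isEigen_poly (QBase.of_real h0 h1).inv
      (laguerreParam q⁻¹ (-α)) n).const_mul (1/qpoch (q:ℂ)⁻¹ (q:ℂ)⁻¹ n)) fun g => ?_, fun x => ?_⟩
    · have e (s:ℂ) : (q:ℂ)^s/q = (q:ℂ)^(s-1) := by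
        rw [cpow_sub _ _ (ofReal_ne h0), cpow_one]
      simp only [laguerreParam, Fin.prod_univ_four, ofReal_inv_cpow h0]; simp only [Matrix.cons_val, e, zero_div]; grind
    · change cqLPoly q⁻¹ (-α) n x = _
      rw [cqLPoly_eq (inv_pos.2 h0), ofReal_inv]
  adm_shift := fun (α:ℂ) (hα:α.im = 0 ∧ _) => by
    change (α+((1:ℤ):ℂ)).im = 0 ∧ -(1/2) < (α+((1:ℤ):ℂ)).re
    simp only [Int.cast_one, add_im, one_im, add_re, one_re]
    constructor <;> linarith [hα.1, hα.2]
  adm_conj := fun (α:ℂ) (hα:α.im = 0 ∧ _) f => prod_congr rfl fun j _ => by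
    congr 1
    fin_cases j
    exacts [conj_cpow_of_real h0 (by simp [hα.1]), conj_cpow_of_real h0 (by simp [hα.1]), map_zero _, map_zero _]
  adm_norm := fun (α:ℂ) (hα:α.im = 0 ∧ -(1/2) < α.re) j => by
    left
    have e {s:ℂ} (hs:0 < s.re) : ‖(q:ℂ)^s‖ < 1 := by rw [norm_cpow_eq_rpow_re_of_pos h0]; exact Real.rpow_lt_one h0.le h1 hs
    fin_cases j
    exacts [e (by norm_num; linarith), e (by norm_num; linarith), by simp [laguerreParam], by simp [laguerreParam]]
  lcP_real := fun (α:ℂ) (hα:α.im = 0 ∧ _) n => cqL_lead_conj h0 hα.1 n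
  lcT_real := fun (α:ℂ) (hα:α.im = 0 ∧ _) n => cqL_lead_conj (inv_pos.2 h0) (by simp [hα.1]) n
  adm_nondeg _ _ _ := trivial
  adm_nondegT _ _ _ _ _ := trivial

/-- The continuous `q`-Hermite polynomials as functions of `z = exp (i x)`. -/
def hermiteFun (p:ℂ) : ℕ → ℂ → ℂ
  | 0, _ => 1
  | 1, z => z+z⁻¹
  | n+2, z => (z+z⁻¹)*hermiteFun p (n+1) z-(1-p^(n+1))*hermiteFun p n z

lemma hermiteFun_inv (p:ℂ) (z:ℂ) : ∀ n, hermiteFun p n z⁻¹ = hermiteFun p n z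
  | 0 => rfl
  | 1 => by rw [hermiteFun, hermiteFun, inv_inv, add_comm]
  | n+2 => by rw [hermiteFun, hermiteFun, hermiteFun_inv p z (n+1), hermiteFun_inv p z n, inv_inv, add_comm z]

lemma hermiteFun_mul {p z:ℂ} (hp:p ≠ 0) (hz:z ≠ 0) : ∀ n, p^n*hermiteFun p n (p*z) =
    (1-p*z^2)*(z*hermiteFun p (n+1) z-z^2*hermiteFun p n z)+p^(n+1)*z^2*hermiteFun p n z
  | 0 => by simp only [hermiteFun]; field_simp; ring
  | 1 => by simp only [hermiteFun]; field_simp; ring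
  | n+2 => by
    have h1 := hermiteFun_mul hp hz (n+1)
    have h2 := hermiteFun_mul hp hz n; rw [hermiteFun, hermiteFun, hermiteFun]; rw [hermiteFun] at h1
    generalize hermiteFun p (n+1) (p*z) = A at *
    generalize hermiteFun p n (p*z) = B at *
    have e : p^(n+2)*((p*z+(p*z)⁻¹)*A-(1-p^(n+1))*B) = (p^2*z+z⁻¹)*(p^(n+1)*A)-p^2*(1-p^(n+1))*(p^n*B) := by field_simp; ring
    rw [e, h1, h2]; field_simp; ring

lemma isEigen_hermiteFun {p:ℂ} (hp:p ≠ 0) (n:ℕ) : IsEigen p (fun _ => 0) n (hermiteFun p n) := by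
  intro z hz h0 h1 h2
  have e1 := hermiteFun_mul hp hz n
  have e2 := hermiteFun_mul hp (inv_ne_zero hz) n
  rw [← hermiteFun_inv, show (p*z⁻¹)⁻¹ = z/p by field_simp, hermiteFun_inv, hermiteFun_inv] at e2
  have h0' : 1-z⁻¹^2 ≠ 0 := fun h => h0 (by field_simp at h; linear_combination -h)
  have hpn := pow_ne_zero n hp; rw [op, eig, zpow_neg, zpow_natCast]
  simp only [zero_mul, sub_zero, prod_const_one, prod_const, zero_pow (card_ne_zero_of_mem (mem_univ (0:Fin 4)))]
  rw [mul_one, div_mul_eq_mul_div, div_mul_eq_mul_div, one_mul, one_mul, ← mul_right_inj' hpn]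
  have f1 : p^n*((hermiteFun p n (p*z)-hermiteFun p n z)/((1-z^2)*(1-p*z^2))) =
      (z*hermiteFun p (n+1) z-z^2*hermiteFun p n z-p^n*hermiteFun p n z)/(1-z^2) := by
    rw [mul_div_assoc', div_eq_div_iff (mul_ne_zero h0 h1) h0]; linear_combination (1-z^2)*e1
  have f2 : p^n*((hermiteFun p n (z/p)-hermiteFun p n z)/((1-z⁻¹^2)*(1-p*z⁻¹^2))) =
      -(z*hermiteFun p (n+1) z-hermiteFun p n z-p^n*z^2*hermiteFun p n z)/(1-z^2) := by
    rw [mul_div_assoc', mul_sub, e2, pow_succ p n, div_eq_div_iff (mul_ne_zero h0' h2) h0]; field_simp; ring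
  grind

lemma hermiteFun_poly (p:ℂ) : ∀ n, ∃ P : ℂ[X], P.natDegree ≤ n ∧ (∀ x, hermiteFun p n (exp (I*x)) = P.eval (cos x)) ∧ P.coeff n = 2^n
  | 0 => ⟨1, by simp, fun x => by simp [hermiteFun], by simp⟩
  | 1 => ⟨C 2*X, by compute_degree, fun x => by
      rw [hermiteFun, eval_mul, eval_C, eval_X, cos, ← exp_neg, mul_comm x, show -x*I = -(I*x) by ring]
      grind, by rw [coeff_C_mul, coeff_X_one]; ring⟩
  | n+2 => by
    obtain ⟨P, h1, h2, h3⟩ := hermiteFun_poly p (n+1)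
    obtain ⟨Q, k1, k2, k3⟩ := hermiteFun_poly p n
    refine ⟨C 2*X*P-C (1-p^(n+1))*Q, ?_, fun x => ?_, ?_⟩
    · refine (natDegree_sub_le_of_le (m := n+2) (n := n+2) ?_ ((natDegree_C_mul_le _ _).trans (by omega))).trans (max_self _).le
      rw [mul_assoc]; exact (natDegree_C_mul_le _ _).trans (natDegree_mul_le.trans (by rw [natDegree_X]; omega))
    · rw [hermiteFun, h2, k2, eval_sub, eval_mul, eval_mul, eval_C, eval_X, eval_mul, eval_C, cos, ← exp_neg,
        mul_comm x, show -x*I = -(I*x) by ring]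
      ring
    · rw [coeff_sub, coeff_C_mul, coeff_eq_zero_of_natDegree_lt (k1.trans_lt (by omega)), mul_assoc, coeff_C_mul, coeff_X_mul, h3]
      ring

/-- The `q`-binomial coefficients. -/
def qbinom (p:ℂ) (n k:ℕ) : ℂ := qpoch (p^(-(n:ℤ))) p k/qpoch p p k*((-1)^k*p^(k*(k-1)/2))⁻¹*(p^n)^k

lemma qbinom_zero (p:ℂ) (n:ℕ) : qbinom p n 0 = 1 := by simp [qbinom, qpoch_zero]

lemma qbinom_eq_zero {p:ℂ} (hp:p ≠ 0) {n k:ℕ} (h:n < k) : qbinom p n k = 0 := by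
  rw [qbinom, qpoch, prod_eq_zero (mem_range.2 h)]
  · simp
  · simp_all

lemma qbinom_up {p:ℂ} (hp:QBase p) (n k:ℕ) : qbinom p (n+1) (k+1)*(1-p^(k+1)) = qbinom p n k*(1-p^(n+1)) := by
  have h1 := hp.1
  have h2 := hp.qpoch_ne k
  have h3 : 1-p*p^k ≠ 0 := fun h => hp.2 k (by rw [pow_succ']; exact (sub_eq_zero.1 h).symm)
  rw [qbinom, qbinom, qpoch_succ', ← zpow_add_one₀ h1, show -((n+1:ℕ):ℤ)+1 = -n by push_cast; ring,
    qpoch_succ, Nat.triangle_succ, zpow_neg _ ((n+1:ℕ):ℤ), zpow_natCast, pow_succ' p k]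
  field_simp; ring

lemma qbinom_right {p:ℂ} (hp:QBase p) (n k:ℕ) : qbinom p n (k+1)*(1-p^(k+1))*p^k = qbinom p n k*(p^k-p^n) := by
  have h1 := hp.1
  have h2 := hp.qpoch_ne k
  have h3 : 1-p*p^k ≠ 0 := fun h => hp.2 k (by rw [pow_succ']; exact (sub_eq_zero.1 h).symm)
  rw [qbinom, qbinom, qpoch_succ, qpoch_succ, Nat.triangle_succ, pow_succ' p k,
    show 1-p^(-(n:ℤ))*p^k = (p^n-p^k)/p^n by rw [zpow_neg, zpow_natCast]; field_simp]
  generalize 1-p*p^k = B at *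
  field_simp; ring

lemma qbinom_three_term {p:ℂ} (hp:QBase p) (n k:ℕ) : qbinom p (n+2) (k+1) =
    qbinom p (n+1) (k+1)+qbinom p (n+1) k-(1-p^(n+1))*qbinom p n k := by
  have h3 : 1-p^(k+1) ≠ 0 := fun h => hp.2 k (sub_eq_zero.1 h).symm
  have e1 := qbinom_up hp (n+1) k
  have e2 := qbinom_up hp n k
  have e3 := qbinom_right hp (n+1) k; grind

lemma sum_qbinom {p:ℂ} (hp:QBase p) {z:ℂ} (hz:z ≠ 0) : ∀ n, z^n*∑ k ∈ range (n+1), qbinom p n k*(z⁻¹^2)^k = hermiteFun p n z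
  | 0 => by simp [hermiteFun, qbinom_zero]
  | 1 => by
    have e := qbinom_up hp 0 0
    have h3 : 1-p ≠ 0 := fun h => hp.2 0 (by simpa using (sub_eq_zero.1 h).symm)
    simp only [zero_add, pow_one, qbinom_zero, one_mul] at e
    rw [sum_range_succ, sum_range_one, qbinom_zero, hermiteFun, (mul_eq_right₀ h3).1 e]; field_simp
  | n+2 => by
    have e1 := sum_qbinom hp hz (n+1)
    have e0 := sum_qbinom hp hz n; rw [hermiteFun, ← e1, ← e0]
    have s1 : ∑ k ∈ range (n+1+1), qbinom p (n+1) k*(z⁻¹^2)^k = ∑ k ∈ range (n+2), qbinom p (n+1) (k+1)*(z⁻¹^2)^(k+1)+1 := by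
      rw [sum_range_succ' _ (n+1), sum_range_succ (fun k => qbinom p (n+1) (k+1)*_) (n+1),
        qbinom_eq_zero hp.1 (Nat.lt_succ_self (n+1)), zero_mul, add_zero, qbinom_zero, pow_zero, one_mul]
    have s0 : ∑ k ∈ range (n+1), qbinom p n k*(z⁻¹^2)^k = ∑ k ∈ range (n+2), qbinom p n k*(z⁻¹^2)^k := by
      rw [sum_range_succ _ (n+1), qbinom_eq_zero hp.1 (Nat.lt_succ_self n), zero_mul, add_zero]
    have s2 : ∑ k ∈ range (n+2+1), qbinom p (n+2) k*(z⁻¹^2)^k = ∑ k ∈ range (n+1+1), qbinom p (n+1) k*(z⁻¹^2)^k +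
        (∑ k ∈ range (n+1+1), qbinom p (n+1) k*(z⁻¹^2)^k)*z⁻¹^2-(1-p^(n+1))*z⁻¹^2*∑ k ∈ range (n+1), qbinom p n k*(z⁻¹^2)^k := by
      conv_rhs => enter [1, 1]; rw [s1]
      rw [s0, sum_range_succ', qbinom_zero, pow_zero, one_mul, sum_mul, mul_sum, add_right_comm, ← sum_add_distrib,
        add_sub_right_comm, ← sum_sub_distrib]
      congr 1
      refine sum_congr rfl fun k _ => ?_
      rw [qbinom_three_term hp]; ring
    rw [s2]; field_simp; ring

lemma cqHPoly_eq {q:ℝ} (hq:QBase q) (n:ℕ) (x:ℂ) : cqHPoly q n x = hermiteFun q n (exp (I*x)) := by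
  rw [← sum_qbinom hq (exp_ne_zero _), cqHPoly, ← exp_nat_mul, show I*n*x = n*(I*x) by ring]; congr 1
  refine sum_congr rfl fun k _ => ?_
  rw [qbinom, mul_pow, ← exp_neg, ← exp_nat_mul _ 2, show ((2:ℕ):ℂ) * -(I*x) = -(2*I*x) by push_cast; ring]; ring

/-- The continuous `q`-Hermite family. -/
def cqHData {q:ℝ} (h0:0 < q) (h1:q < 1) : AWData q (contQHermite q) :=
  have hq : QBase q := QBase.of_real h0 h1
  have hp : QBase (q⁻¹:ℝ) := by rw [ofReal_inv]; exact hq.inv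
  have e : ∏ _j : Fin 4, (0:ℂ) = 0 := by simp
  have key {p:ℝ} (h:QBase p) (n:ℕ) : ∃ P : ℂ[X], P.natDegree ≤ n ∧ (∀ x, cqHPoly p n x = P.eval (cos x)) ∧ (True → P.coeff n = 2^n) := by
    obtain ⟨P, h1, h2, h3⟩ := hermiteFun_poly p n; exact ⟨P, h1, fun x => by rw [cqHPoly_eq h, h2], fun _ => h3⟩
  { q_pos := h0
    q_lt := h1
    γ_eq := rfl
    κ_eq := rfl
    η_eq := rfl
    φ_eq := rfl
    dom_eq := rfl
    b := fun _ _ => 0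
    V_eq := fun _ x => by simp [contQHermite]
    w_eq := fun _ x => by simp [contQHermite, qpairInf, qpochInf_zero]
    E_eq := fun _ n => by rw [e, eig_zero]; rfl
    Et_eq := fun _ v => by rw [e]; exact twist_eig h0 v
    shift_shift := fun _ _ _ => rfl
    shift_zero := fun _ => rfl
    b_shift := fun _ _ _ => (zero_mul _).symm
    lcP := fun _ n => 2^n
    lcT := fun _ n => 2^n
    P_poly := fun _ n => key hq n
    T_poly := fun _ n => key hp n
    lcP_ne := fun _ n _ => pow_ne_zero n two_ne_zero
    lcT_ne := fun _ n _ => pow_ne_zero n two_ne_zero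
    E_ne := fun _ n _ k _ => by rw [e]; simp
    P_eig := fun _ n _ => ⟨_, isEigen_hermiteFun hq.1 n, cqHPoly_eq hq n⟩
    T_eig := fun _ n _ => ⟨_, by
      have := isEigen_hermiteFun hq.inv.1 n
      simpa only [zero_div] using this, fun x => by
        have := cqHPoly_eq hp n x
        rwa [ofReal_inv] at this⟩
    adm_shift := fun _ _ => trivial
    adm_conj := fun _ _ f => by simp only [map_zero]
    adm_norm := fun _ _ _ => .inl (by simp)
    lcP_real := fun _ _ n => by rw [map_pow, Complex.conj_ofNat]
    lcT_real := fun _ _ n => by rw [map_pow, Complex.conj_ofNat]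
    adm_nondeg := fun _ _ _ => trivial
    adm_nondegT := fun _ _ _ _ _ => trivial }

lemma qpoch_add (a p:ℂ) {k n:ℕ} (h:k ≤ n) : qpoch a p n = qpoch a p k*qpoch (a*p^k) p (n-k) := by
  obtain ⟨m, rfl⟩ := Nat.exists_eq_add_of_le h; rw [qpoch, prod_range_add, Nat.add_sub_cancel_left]
  simp only [qpoch, pow_add, mul_assoc]

/-- The product of the numbers `-a p ^ i`. -/
def negProd (a p:ℂ) (n:ℕ) : ℂ := ∏ i ∈ range n, (-(a*p^i))

lemma negProd_add (a p:ℂ) {k n:ℕ} (h:k ≤ n) : negProd a p n = negProd a p k*negProd (a*p^k) p (n-k) := by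
  obtain ⟨m, rfl⟩ := Nat.exists_eq_add_of_le h; rw [negProd, prod_range_add, Nat.add_sub_cancel_left]
  simp only [negProd, pow_add, mul_assoc]

lemma negProd_eq (a p:ℂ) (n:ℕ) : negProd a p n = a^n*negProd 1 p n := by
  simp only [negProd, one_mul, ← mul_neg, prod_mul_distrib, prod_const, card_range]

lemma negProd_ne {a p:ℂ} (ha:a ≠ 0) (hp:p ≠ 0) (n:ℕ) : negProd a p n ≠ 0 :=
  prod_ne_zero_iff.2 fun i _ => neg_ne_zero.2 (mul_ne_zero ha (pow_ne_zero i hp))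

lemma qpoch_inv {a p:ℂ} (ha:a ≠ 0) (hp:p ≠ 0) (n:ℕ) : qpoch a⁻¹ p⁻¹ n = qpoch a p n/negProd a p n := by
  rw [qpoch, qpoch, negProd, ← prod_div_distrib]
  refine prod_congr rfl fun i _ => ?_
  have := pow_ne_zero i hp; rw [inv_pow]; field_simp; ring

/-- The coefficients of the Askey-Wilson polynomial with the normalization of the continuous
`q`-Jacobi polynomial. -/
def jacobiCoeff (p:ℂ) (b:Fin 4 → ℂ) (n k:ℕ) : ℂ := 1/qpoch p p n*(qpoch (p^(-(n:ℤ))) p k*qpoch ((∏ j, b j)*p^((n:ℤ)-1)) p k*p^k /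
    (qpoch p p k*qpoch (b 0*b 2) p k*qpoch (b 0*b 3) p k)*qpoch (b 0*b 1*p^k) p (n-k))

lemma jacobiCoeff_eq (p:ℂ) (b:Fin 4 → ℂ) {n k:ℕ} (hk:k ≤ n) (h2:qpoch (b 0*b 2) p n ≠ 0)
    (h3:qpoch (b 0*b 3) p n ≠ 0) : jacobiCoeff p b n k =
      1/(qpoch p p n*qpoch (b 0*b 2) p n*qpoch (b 0*b 3) p n)*AskeyWilson.coeff p b n k := by
  rw [qpoch_add _ _ hk] at h2 h3
  rw [jacobiCoeff, AskeyWilson.coeff, qpoch_add (b 0*b 2) p hk, qpoch_add (b 0*b 3) p hk, Fin.prod_univ_three]; grind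

lemma jacobiCoeff_inv {p:ℂ} (hp:p ≠ 0) {b:Fin 4 → ℂ} (hb:∀ j, b j ≠ 0) {n k:ℕ} (hk:k ≤ n) {z:ℂ}
    (hz:z ≠ 0) : jacobiCoeff p⁻¹ (fun j => (b j)⁻¹) n k*basis (b 0)⁻¹ p⁻¹ k z =
      negProd p p n/negProd (b 0*b 1) p n*(jacobiCoeff p b n k*basis (b 0) p k z) := by
  have hD : ∏ j, b j ≠ 0 := prod_ne_zero_iff.2 fun j _ => hb j
  have hm := zpow_ne_zero ((n:ℤ)-1) hp
  have h0 := hb 0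
  have h1 := hb 1
  have h2 := hb 2
  have h3 := hb 3; rw [jacobiCoeff, jacobiCoeff, basis, basis, prod_inv_distrib]; simp only [inv_zpow, inv_pow, ← mul_inv]
  rw [show (b 0)⁻¹*z = (b 0*z⁻¹)⁻¹ by field_simp,
    qpoch_inv hp hp, qpoch_inv hp hp, qpoch_inv (zpow_ne_zero _ hp) hp, qpoch_inv (mul_ne_zero hD hm) hp,
    qpoch_inv (mul_ne_zero h0 h2) hp, qpoch_inv (mul_ne_zero h0 h3) hp, qpoch_inv (mul_ne_zero (mul_ne_zero h0 h1) (pow_ne_zero k hp)) hp,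
    qpoch_inv (mul_ne_zero h0 hz) hp, qpoch_inv (mul_ne_zero h0 (inv_ne_zero hz)) hp, negProd_add (b 0*b 1) p hk]
  have hT := negProd_ne one_ne_zero hp k
  have hM := negProd_ne (mul_ne_zero (mul_ne_zero h0 h1) (pow_ne_zero k hp)) hp (n-k)
  have hN := negProd_ne hp hp n
  rw [negProd_eq p p k, negProd_eq (_^_) p k, negProd_eq ((∏ j, b j)*_) p k, negProd_eq (b 0*b 2) p k,
    negProd_eq (b 0*b 3) p k, negProd_eq (b 0*b 1) p k, negProd_eq (b 0*z) p k, negProd_eq (b 0*z⁻¹) p k]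
  have e : (p^(-(n:ℤ)))^k*((∏ j, b j)*p^((n:ℤ)-1))^k*p^k = (b 0*b 1*b 2*b 3)^k := by
    rw [← mul_pow, ← mul_pow, Fin.prod_univ_four, zpow_sub_one₀ hp, zpow_neg]; congr 1; field_simp
  have e1 := pow_ne_zero k (zpow_ne_zero (-(n:ℤ)) hp)
  have e2 := pow_ne_zero k (mul_ne_zero hD hm)
  generalize qpoch ((∏ j, b j)*p^((n:ℤ)-1)) p k = r2 at *
  generalize (p^(-(n:ℤ)))^k = y1 at *
  generalize ((∏ j, b j)*p^((n:ℤ)-1))^k = y2 at *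
  have e3 : (b 0*b 2)^k*(b 0*b 3)^k*(b 0*b 1)^k = y1*y2*p^k*((b 0*z)^k*(b 0*z⁻¹)^k) := by
    rw [e, ← mul_pow, ← mul_pow, ← mul_pow, ← mul_pow]; congr 1; field_simp
  have g1 := pow_ne_zero k (mul_ne_zero h0 h1)
  have g2 := pow_ne_zero k (mul_ne_zero h0 h2)
  have g3 := pow_ne_zero k (mul_ne_zero h0 h3)
  have g4 := pow_ne_zero k (mul_ne_zero h0 hz)
  have g5 := pow_ne_zero k (mul_ne_zero h0 (inv_ne_zero hz))
  have g6 := pow_ne_zero k hp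
  generalize (b 0*b 1)^k = w1 at *
  generalize (b 0*b 2)^k = w2 at *
  generalize (b 0*b 3)^k = w3 at *
  generalize (b 0*z)^k = w4 at *
  generalize (b 0*z⁻¹)^k = w5 at *
  generalize p^k = P at *
  have : w2 = y1*y2*P*(w4*w5)/(w3*w1) := by grind
  rw [this]; field_simp

namespace AskeyWilson

lemma op_inv {p:ℂ} (hp:p ≠ 0) {b:Fin 4 → ℂ} (hb:∀ j, b j ≠ 0) {z:ℂ} (hz:z ≠ 0) (fp f0 fm:ℂ) :
    op p⁻¹ (fun j => (b j)⁻¹) z fm f0 fp = p/(∏ j, b j)*op p b z fp f0 fm := by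
  have key {z:ℂ} (hz:z ≠ 0) : (∏ j, (1-(b j)⁻¹*z))/((1-z^2)*(1-p⁻¹*z^2)) = p/(∏ j, b j)*((∏ j, (1-b j*z⁻¹))/((1-z⁻¹^2)*(1-p*z⁻¹^2))) := by
    have e : ∏ j, (1-(b j)⁻¹*z) = z^4/(∏ j, b j)*∏ j, (1-b j*z⁻¹) := by
      rw [show z^4 = ∏ _j : Fin 4, z by simp, ← prod_div_distrib, ← prod_mul_distrib]
      have : ∀ j, 1-(b j)⁻¹*z = -(z/b j*(1-b j*z⁻¹)) := fun j => by grind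
      simp only [this, prod_neg, card_univ, Fintype.card_fin]; ring
    have e2 : (1-z^2)*(1-p⁻¹*z^2) = z^4/p*((1-z⁻¹^2)*(1-p*z⁻¹^2)) := by
      field_simp; ring
    rw [e, e2, mul_div_mul_comm]; congr 1; field_simp
  rw [op, op, key hz, key (inv_ne_zero hz), inv_inv]; ring

lemma IsEigen.inv {p:ℂ} (hp:p ≠ 0) {b:Fin 4 → ℂ} (hb:∀ j, b j ≠ 0) {n:ℕ} {f:ℂ → ℂ}
    (h:IsEigen p b n f) : IsEigen p⁻¹ (fun j => (b j)⁻¹) n f := fun z h1 h2 h3 h4 => by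
  have e := h z h1 h2 (fun h => h4 (by field_simp at h ⊢; linear_combination -h))
    (fun h => h3 (by field_simp at h ⊢; linear_combination -h))
  rw [div_inv_eq_mul, mul_comm z, inv_mul_eq_div, op_inv hp hb h1, e, ← mul_assoc]; congr 1
  have hD : ∏ j, b j ≠ 0 := prod_ne_zero_iff.2 fun j _ => hb j
  have hn := pow_ne_zero n hp; rw [eig, eig, prod_inv_distrib, inv_zpow, inv_zpow, zpow_neg, zpow_sub_one₀ hp, zpow_natCast]
  field_simp; ring

end AskeyWilson

lemma potNum_dual {q s:ℂ} (hq:q ≠ 0) {b b':Fin 4 → ℂ} (hb:∀ j, b j ≠ 0) (h:∀ g : ℂ → ℂ, ∏ j, g (b' j) = ∏ j, g (q/b j)) {U:ℂ} (hU:U ≠ 0) :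
    potNum s b' U = q^2/(∏ j, b j)*potNum s b (U*q)⁻¹ := by
  have e : ∏ j, (1-b' j*U) = (U*q)^4/(∏ j, b j)*∏ j, (1-b j*(U*q)⁻¹) := by
    rw [h fun w => 1-w*U, show (U*q)^4 = ∏ _j : Fin 4, (U*q) by simp, ← prod_div_distrib, ← prod_mul_distrib]
    have : ∀ j, 1-q/b j*U = -(U*q/b j*(1-b j*(U*q)⁻¹)) := fun j => by grind
    simp only [this, prod_neg, card_univ, Fintype.card_fin]; ring
  rw [potNum, potNum, e]; field_simp

/-- The Askey-Wilson parameters of the continuous `q`-Jacobi polynomials. -/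
def jacobiParam (q:ℝ) (l:ℂ × ℂ) : Fin 4 → ℂ := ![(q:ℂ)^((l.1+1/2)/2), (q:ℂ)^((l.1+3/2)/2), -(q:ℂ)^((l.2+1/2)/2), -(q:ℂ)^((l.2+3/2)/2)]

section Param
variable {q:ℝ} (h0:0 < q)
include h0

lemma jacobiParam_mul (l:ℂ × ℂ) : jacobiParam q l 0*jacobiParam q l 1 = (q:ℂ)^(l.1+1) ∧
    jacobiParam q l 0*jacobiParam q l 2 = -(q:ℂ)^((l.1+l.2+1)/2) ∧ jacobiParam q l 0*jacobiParam q l 3 = -(q:ℂ)^((l.1+l.2+2)/2) := by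
  simp only [jacobiParam, Matrix.cons_val, mul_neg, neg_inj, ← cpow_add _ _ (ofReal_ne h0)]; grind

lemma prod_jacobiParam (l:ℂ × ℂ) : ∏ j, jacobiParam q l j = (q:ℂ)^(l.1+l.2+2) := by
  simp only [jacobiParam, Fin.prod_univ_four, Matrix.cons_val, mul_neg, neg_mul, neg_neg, ← cpow_add _ _ (ofReal_ne h0)]
  congr 1; ring

lemma jacobiParam_ne (l:ℂ × ℂ) (j:Fin 4) : jacobiParam q l j ≠ 0 := by
  have e (s:ℂ) : (q:ℂ)^s ≠ 0 := cpow_ne_zero_iff.2 (Or.inl (ofReal_ne h0))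
  fin_cases j
  exacts [e _, e _, neg_ne_zero.2 (e _), neg_ne_zero.2 (e _)]

lemma jacobiParam_inv (l:ℂ × ℂ) : jacobiParam q⁻¹ l = fun j => (jacobiParam q l j)⁻¹ := by
  funext j
  fin_cases j <;> simp [jacobiParam, ofReal_inv_cpow h0, cpow_neg, -ofReal_inv, inv_neg]

lemma jacobiParam_neg (l:ℂ × ℂ) (g:ℂ → ℂ) : ∏ j, g (jacobiParam q (-l.1, -l.2) j) = ∏ j, g (q/jacobiParam q l j) := by
  have e (s:ℂ) : (q:ℂ)/(q:ℂ)^s = (q:ℂ)^(1-s) := by rw [cpow_sub _ _ (ofReal_ne h0), cpow_one]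
  simp only [jacobiParam, Fin.prod_univ_four, Matrix.cons_val, div_neg, e]; grind

lemma jacobiParam_conj {l:ℂ × ℂ} (h1:l.1.im = 0) (h2:l.2.im = 0) (j:Fin 4) : conj (jacobiParam q l j) = jacobiParam q l j := by
  fin_cases j
  exacts [conj_cpow_of_real h0 (by simp [h1]), conj_cpow_of_real h0 (by simp [h1]),
    (map_neg _ _).trans (congrArg Neg.neg (conj_cpow_of_real h0 (by simp [h2]))),
    (map_neg _ _).trans (congrArg Neg.neg (conj_cpow_of_real h0 (by simp [h2])))]

lemma cqJPoly_eq (l:ℂ × ℂ) (n:ℕ) (x:ℂ) : cqJPoly q l n x = ∑ k ∈ range (n+1),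
    jacobiCoeff q (jacobiParam q l) n k*basis (jacobiParam q l 0) q k (exp (I*x)) := by
  rw [cqJPoly, mul_sum]
  refine sum_congr rfl fun k _ => ?_
  obtain ⟨e1, e2, e3⟩ := jacobiParam_mul h0 l
  rw [jacobiCoeff, e1, e2, e3, cpow_mul_pow h0, prod_jacobiParam h0, ← cpow_intCast, ← cpow_intCast,
    ← cpow_add _ _ (ofReal_ne h0), basis, qpair, exp_neg, show l.1+l.2+2+(((n:ℤ)-1 : ℤ):ℂ) = n+l.1+l.2+1 by push_cast; ring]
  change _ = _*(qpoch ((q:ℂ)^((l.1+1/2)/2)*_) _ _*qpoch ((q:ℂ)^((l.1+1/2)/2)*_) _ _)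
  ring

lemma cqJ_den_ne {l:ℂ × ℂ} {n:ℕ} (h:cqJNondeg q l n) : qpoch (jacobiParam q l 0*jacobiParam q l 2) q n ≠ 0 ∧
      qpoch (jacobiParam q l 0*jacobiParam q l 3) q n ≠ 0 := by
  obtain ⟨-, e2, e3⟩ := jacobiParam_mul h0 l; rw [e2, e3]
  refine ⟨prod_ne_zero_iff.2 fun k hk h' => h.1 (2*k) (by have := mem_range.1 hk; omega) ?_,
    prod_ne_zero_iff.2 fun k hk h' => h.1 (2*k+1) (by have := mem_range.1 hk; omega) ?_⟩
  all_goals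
    rw [neg_mul, cpow_mul_pow h0, sub_neg_eq_add, add_comm] at h'; rw [← eq_neg_of_add_eq_zero_left h']; congr 1; push_cast; ring

lemma cqJ_E_ne {l:ℂ × ℂ} {n:ℕ} (h:cqJNondeg q l n) (k:ℕ) (hk:k < n) :
    1-(∏ j, jacobiParam q l j)*(q:ℂ)^((n:ℤ)+k-1) ≠ 0 := fun h' => h.2 k hk (by
  rw [prod_jacobiParam h0, ← cpow_intCast, ← cpow_add _ _ (ofReal_ne h0)] at h'
  refine Eq.trans ?_ (sub_eq_zero.1 h').symm
  congr 1; push_cast; ring)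

lemma isEigen_cqJ (hq:QBase q) {l:ℂ × ℂ} {n:ℕ} (h:cqJNondeg q l n) : ∃ f : ℂ → ℂ,
    IsEigen q (jacobiParam q l) n f ∧ ∀ x, cqJPoly q l n x = f (exp (I*x)) := by
  obtain ⟨h2, h3⟩ := cqJ_den_ne h0 h
  refine ⟨_, (isEigen_poly hq (jacobiParam q l) n).const_mul (1/(qpoch q q n *
    qpoch (jacobiParam q l 0*jacobiParam q l 2) q n*qpoch (jacobiParam q l 0*jacobiParam q l 3) q n)), fun x => ?_⟩
  rw [cqJPoly_eq h0, poly, mul_sum]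
  refine sum_congr rfl fun k hk => ?_
  rw [jacobiCoeff_eq _ _ (mem_range_succ_iff.1 hk) h2 h3, mul_assoc]

/-- The leading coefficient of the continuous `q`-Jacobi polynomial. -/
def jacobiLead (q:ℝ) (l:ℂ × ℂ) (n:ℕ) : ℂ := jacobiCoeff q (jacobiParam q l) n n*∏ i ∈ range n, (-(2*jacobiParam q l 0*(q:ℂ)^i))

lemma cqJ_poly (l:ℂ × ℂ) (n:ℕ) : ∃ P : ℂ[X], P.natDegree ≤ n ∧ (∀ x, cqJPoly q l n x = P.eval (cos x)) ∧ P.coeff n = jacobiLead q l n := by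
  obtain ⟨P, h1, h2, h3⟩ := poly_poly q (jacobiParam q l) (jacobiCoeff q (jacobiParam q l) n) n
  exact ⟨P, h1, fun x => by rw [cqJPoly_eq h0, h2], h3⟩

lemma jacobiLead_ne (hq:QBase q) {l:ℂ × ℂ} {n:ℕ} (h:cqJNondeg q l n) : jacobiLead q l n ≠ 0 := by
  obtain ⟨h2, h3⟩ := cqJ_den_ne h0 h
  refine mul_ne_zero ?_ (prod_ne_zero_iff.2 fun i _ => neg_ne_zero.2 (mul_ne_zero (mul_ne_zero two_ne_zero
    (jacobiParam_ne h0 l 0)) (pow_ne_zero i hq.1)))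
  rw [jacobiCoeff, Nat.sub_self, qpoch_zero, mul_one]
  refine mul_ne_zero (one_div_ne_zero (hq.qpoch_ne n)) (div_ne_zero (mul_ne_zero (mul_ne_zero (hq.qpoch_neg_ne n)
    (prod_ne_zero_iff.2 fun k hk => ?_)) (pow_ne_zero n hq.1)) (mul_ne_zero (mul_ne_zero (hq.qpoch_ne n) h2) h3))
  rw [mul_assoc, ← zpow_natCast (q:ℂ) k, ← zpow_add₀ hq.1, sub_add_eq_add_sub]; exact cqJ_E_ne h0 h k (mem_range.1 hk)

lemma jacobiLead_conj {l:ℂ × ℂ} (h1:l.1.im = 0) (h2:l.2.im = 0) (n:ℕ) : conj (jacobiLead q l n) = jacobiLead q l n := by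
  simp [jacobiLead, jacobiCoeff, qpoch_conj, map_prod, map_zpow₀, jacobiParam_conj h0 h1 h2, Complex.conj_ofNat]

lemma continuous_jacobiParam (l:ℂ × ℂ) (s:ℂ) (j:Fin 4) : Continuous fun t : ℝ => jacobiParam q (l.1+s*t, l.2+s*t) j := by
  have e : ∀ c : ℂ, Continuous fun t : ℝ => (q:ℂ)^((c+s*t+1/2)/2) := fun c => Continuous.const_cpow (by fun_prop) (Or.inl (ofReal_ne h0))
  have e' : ∀ c : ℂ, Continuous fun t : ℝ => (q:ℂ)^((c+s*t+3/2)/2) := fun c => Continuous.const_cpow (by fun_prop) (Or.inl (ofReal_ne h0))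
  fin_cases j
  exacts [e _, e' _, (e _).neg, (e' _).neg]

lemma tendsto_jacobiCoeff {l:ℂ × ℂ} {n:ℕ} (h:cqJNondeg q l n) (hq:QBase q) (s:ℂ) {k:ℕ} (hk:k ≤ n) :
    Tendsto (fun t:ℝ => jacobiCoeff q (jacobiParam q (l.1+s*t, l.2+s*t)) n k) (𝓝[≠] 0) (𝓝 (jacobiCoeff q (jacobiParam q l) n k)) := by
  obtain ⟨h2, h3⟩ := cqJ_den_ne h0 h; rw [qpoch_add _ _ hk] at h2 h3
  have hb := continuous_jacobiParam h0 l s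
  have hc : ∀ (n:ℕ) (f:ℝ → ℂ), Continuous f → Continuous fun t => qpoch (f t) q n := fun n f hf =>
    continuous_finsetProd _ fun i _ => by fun_prop
  have h : ContinuousAt (fun t:ℝ => jacobiCoeff q (jacobiParam q (l.1+s*t, l.2+s*t)) n k) 0 := by
    unfold jacobiCoeff
    refine continuousAt_const.mul ((ContinuousAt.div ?_ ?_ ?_).mul ?_)
    · exact ((continuous_const.mul (hc _ _ (by fun_prop))).mul continuous_const).continuousAt
    · exact ((continuous_const.mul (hc _ _ (by fun_prop))).mul (hc _ _ (by fun_prop))).continuousAt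
    · simpa [hq.qpoch_ne k] using And.intro (left_ne_zero_of_mul h2) (left_ne_zero_of_mul h3)
    · exact (hc _ _ (by fun_prop)).continuousAt
  have h' := h.tendsto; simp only [ofReal_zero, mul_zero, add_zero] at h'; exact h'.mono_left nhdsWithin_le_nhds

lemma tendsto_jacobiLead {l:ℂ × ℂ} {n:ℕ} (h:cqJNondeg q l n) (hq:QBase q) (s:ℂ) :
    Tendsto (fun t:ℝ => jacobiLead q (l.1+s*t, l.2+s*t) n) (𝓝[≠] 0) (𝓝 (jacobiLead q l n)) := by
  have hb := continuous_jacobiParam h0 l s 0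
  have h' : Continuous fun t : ℝ => ∏ i ∈ range n,
    (-(2*jacobiParam q (l.1+s*t, l.2+s*t) 0*(q:ℂ)^i)) := continuous_finsetProd _ fun i _ => by fun_prop
  have h'' := h'.tendsto 0; simp only [ofReal_zero, mul_zero, add_zero] at h''
  exact (tendsto_jacobiCoeff h0 h hq s le_rfl).mul (h''.mono_left nhdsWithin_le_nhds)

lemma tendsto_cqJPoly {l:ℂ × ℂ} {n:ℕ} (h:cqJNondeg q l n) (hq:QBase q) (s x:ℂ) :
    Tendsto (fun t:ℝ => cqJPoly q (l.1+s*t, l.2+s*t) n x) (𝓝[≠] 0) (𝓝 (cqJPoly q l n x)) := by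
  simp only [cqJPoly_eq h0]
  refine tendsto_finsetSum _ fun k hk => (tendsto_jacobiCoeff h0 h hq s (mem_range_succ_iff.1 hk)).mul ?_
  have hb := continuous_jacobiParam h0 l s 0
  have h' : Continuous fun t : ℝ => basis (jacobiParam q (l.1+s*t, l.2+s*t) 0) q k (exp (I*x)) :=
    (continuous_finsetProd _ fun i _ => by fun_prop).mul (continuous_finsetProd _ fun i _ => by fun_prop)
  have h'' := h'.tendsto 0; simp only [ofReal_zero, mul_zero, add_zero] at h''; exact h''.mono_left nhdsWithin_le_nhds

lemma eventually_cpow_ne (h1:q < 1) (z w:ℂ) {m:ℝ} (hm:m ≠ 0) : ∀ᶠ t : ℝ in 𝓝[≠] 0, (q:ℂ)^(z+m*t) ≠ w := by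
  have h : {t:ℝ | (q:ℂ)^(z+m*t) = w}.Subsingleton := fun s hs t ht => by
    have e := congrArg norm ((Set.mem_ofPred.1 hs).trans (Set.mem_ofPred.1 ht).symm)
    rw [norm_cpow_eq_rpow_re_of_pos h0, norm_cpow_eq_rpow_re_of_pos h0, Real.rpow_right_inj h0 h1.ne] at e; simpa [hm] using e
  exact nhdsNE_le_cofinite (0:ℝ) h.finite.compl_mem_cofinite

lemma eventually_cqJNondeg (h1:q < 1) (l:ℂ × ℂ) {s:ℝ} (hs:s ≠ 0) (n:ℕ) : ∀ᶠ t : ℝ in 𝓝[≠] 0, cqJNondeg q (l.1+s*t, l.2+s*t) n := by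
  refine .and ((eventually_all_finite (Set.finite_Iio (2*n))).2 fun j _ => ?_) ((eventually_all_finite (Set.finite_Iio n)).2 fun k _ => ?_)
  · filter_upwards [eventually_cpow_ne h0 h1 ((l.1+l.2+1+j)/2) (-1) hs] with t ht
    grind
  · filter_upwards [eventually_cpow_ne h0 h1 (n+l.1+l.2+1+k) 1 (mul_ne_zero two_ne_zero hs)] with t ht
    rwa [show n+(l.1+s*t)+(l.2+s*t)+1+k = n+l.1+l.2+1+k+((2*s:ℝ):ℂ)*t by push_cast; ring]

lemma cqJNondeg_of_real (h1:q < 1) {l:ℂ × ℂ} (e1:l.1.im = 0) (e2:l.2.im = 0) {n:ℕ}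
    (h:∀ k < n, n+l.1.re+l.2.re+1+k ≠ 0) : cqJNondeg q l n := by
  refine ⟨fun j _ h' => ?_, fun k hk h' => ?_⟩
  · have e := conj_eq_iff_im.2 (show ((l.1+l.2+1+j)/2).im = 0 by simp [e1, e2]); rw [conj_eq_iff_re] at e
    rw [← e, ← ofReal_cpow h0.le] at h'
    have := Real.rpow_pos_of_pos h0 ((l.1+l.2+1+j)/2).re
    have h3 : q^((l.1+l.2+1+j)/2).re = -1 := by exact_mod_cast h'
    linarith
  · have e := congrArg norm h'
    rw [norm_cpow_eq_rpow_re_of_pos h0, norm_one, ← Real.rpow_zero q, Real.rpow_right_inj h0 h1.ne] at e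
    exact h k hk (by simpa using e)

end Param

/-- The continuous `q`-Jacobi family. -/
def cqJData {q:ℝ} (h0:0 < q) (h1:q < 1) : AWData q (contQJacobi q) where
  q_pos := h0
  q_lt := h1
  γ_eq := rfl
  κ_eq := rfl
  η_eq := rfl
  φ_eq := rfl
  dom_eq := rfl
  b := jacobiParam q
  V_eq l x := by simp [contQJacobi, jacobiParam, Fin.prod_univ_succ, mul_assoc]
  w_eq := fun (l:ℂ × ℂ) x => by
    change awNum q x/(qpairInf _ _ x*qpairInf _ _ x) = _
    rw [qpairInf_sqrt h0 h1, qpairInf_sqrt h0 h1, neg_mul, cpow_sqrt h0, cpow_sqrt h0,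
      show (l.1+1/2)/2+1/2 = (l.1+3/2)/2 by ring,
      show (l.2+1/2)/2+1/2 = (l.2+3/2)/2 by ring]
    simp [jacobiParam, Fin.prod_univ_succ, mul_assoc]
  E_eq := fun (l:ℂ × ℂ) n => by
    rw [prod_jacobiParam h0, eig, ← cpow_intCast _ (n-1), ← cpow_add _ _ (ofReal_ne h0),
      show l.1+l.2+2+((n-1:ℤ):ℂ) = n+l.1+l.2+1 by push_cast; ring]
    rfl
  Et_eq := fun (l:ℂ × ℂ) v => by
    have hq := ofReal_ne h0
    change _*(((q:ℂ)^(-(v:ℤ))-1)*(1-(q:ℂ)^(((v:ℤ):ℂ) + -l.1 + -l.2+1)))+_ = _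
    have hY := pow_ne_zero v hq
    have hX : (q:ℂ)^(l.1+l.2) ≠ 0 := cpow_ne_zero_iff.2 (Or.inl hq)
    rw [prod_jacobiParam h0, eig, show ((v:ℤ):ℂ) + -l.1 + -l.2+1 = ((v+1:ℕ):ℂ)-(l.1+l.2) by
      push_cast; ring, cpow_sub _ _ hq, cpow_natCast, show l.1+l.2+2 = l.1+l.2+(2:ℕ) by norm_num,
      ← cpow_mul_pow h0, zpow_neg, zpow_natCast, show -(-(v:ℤ)-1) = ((v+1:ℕ):ℤ) by push_cast; ring,
      show -(v:ℤ)-1-1 = -((v+2:ℕ):ℤ) by push_cast; ring, zpow_neg, zpow_natCast, zpow_natCast]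
    field_simp; ring
  shift_shift := fun (l:ℂ × ℂ) s t => by
    change (l.1+s+t, l.2+s+t) = (l.1+((s+t:ℤ):ℂ), l.2+((s+t:ℤ):ℂ))
    push_cast; simp only [add_assoc]
  shift_zero := fun (l:ℂ × ℂ) => by
    change (l.1+((0:ℤ):ℂ), l.2+((0:ℤ):ℂ)) = l
    simp
  b_shift := fun (l:ℂ × ℂ) s j => by
    change jacobiParam q (l.1+s, l.2+s) j = _
    fin_cases j <;> simp [jacobiParam, ← cpow_add _ _ (ofReal_ne h0)] <;> congr 1 <;> ring
  lcP := jacobiLead q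
  lcT := fun (l:ℂ × ℂ) => jacobiLead q (-l.1, -l.2)
  P_poly l n := by
    obtain ⟨P, h2, h3, h4⟩ := cqJ_poly h0 l n; exact ⟨P, h2, h3, fun _ => h4⟩
  T_poly := fun (l:ℂ × ℂ) n => by
    obtain ⟨P, h2, h3, h4⟩ := cqJ_poly h0 (-l.1, -l.2) n; exact ⟨P, h2, h3, fun _ => h4⟩
  lcP_ne _ _ h := jacobiLead_ne h0 (QBase.of_real h0 h1) h
  lcT_ne _ _ h := jacobiLead_ne h0 (QBase.of_real h0 h1) h
  E_ne _ _ h := cqJ_E_ne h0 h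
  P_eig _ _ h := isEigen_cqJ h0 (QBase.of_real h0 h1) h
  T_eig := fun (l:ℂ × ℂ) n h => by
    obtain ⟨f, h2, h3⟩ := isEigen_cqJ h0 (QBase.of_real h0 h1) h
    refine ⟨f, (h2.inv (ofReal_ne h0) (jacobiParam_ne h0 _)).congr_prod fun g => ?_, h3⟩
    rw [jacobiParam_neg h0 l fun w => g w⁻¹]; simp only [inv_div]
  pert l t := (l.1+t, l.2+t)
  pert_shift := fun (l:ℂ × ℂ) k t => by
    change (l.1+k+t, l.2+k+t) = (l.1+t+k, l.2+t+k)
    simp only [add_right_comm]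
  pert_gen := fun (l:ℂ × ℂ) _ n => by
    have e1 := eventually_cqJNondeg h0 h1 l one_ne_zero n
    have e2 := eventually_cqJNondeg h0 h1 (-l.1, -l.2) (neg_ne_zero.2 one_ne_zero) n
    filter_upwards [e1, e2] with t h2 h3
    change cqJNondeg q (l.1+t, l.2+t) n ∧ cqJNondeg q (-(l.1+t), -(l.2+t)) n
    push_cast at h2 h3; simp only [neg_mul, one_mul, neg_add] at h2 h3 ⊢; exact ⟨h2, h3⟩
  P_lim := fun (l:ℂ × ℂ) n h x => by
    have := tendsto_cqJPoly h0 h (QBase.of_real h0 h1) 1 x; simp only [one_mul] at this; exact this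
  T_lim := fun (l:ℂ × ℂ) n h x => by
    have := tendsto_cqJPoly h0 h (QBase.of_real h0 h1) (-1) x; simp only [neg_mul, one_mul, ← neg_add] at this; exact this
  lcP_lim := fun (l:ℂ × ℂ) n h => by
    have := tendsto_jacobiLead h0 h (QBase.of_real h0 h1) 1; simp only [one_mul] at this; exact this
  lcT_lim := fun (l:ℂ × ℂ) n h => by
    have := tendsto_jacobiLead h0 h (QBase.of_real h0 h1) (-1); simp only [neg_mul, one_mul, ← neg_add] at this; exact this
  b_lim := fun (l:ℂ × ℂ) j => by
    have := (continuous_jacobiParam h0 l 1 j).tendsto 0; simp only [one_mul, ofReal_zero, add_zero] at this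
    exact this.mono_left nhdsWithin_le_nhds
  adm_shift := fun (l:ℂ × ℂ) (hl:l.1.im = 0 ∧ -(1/2) ≤ l.1.re ∧ l.2.im = 0 ∧ -(1/2) ≤ l.2.re) => by
    change (l.1+((1:ℤ):ℂ)).im = 0 ∧ -(1/2) ≤ (l.1+((1:ℤ):ℂ)).re ∧ (l.2+((1:ℤ):ℂ)).im = 0 ∧ -(1/2) ≤ (l.2+((1:ℤ):ℂ)).re
    simp only [Int.cast_one, add_im, one_im, add_re, one_re]
    refine ⟨?_, ?_, ?_, ?_⟩ <;> linarith [hl.1, hl.2.1, hl.2.2.1, hl.2.2.2]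
  adm_conj _ hl f := prod_congr rfl fun j _ => by rw [jacobiParam_conj h0 hl.1 hl.2.2.1]
  adm_norm := fun (l:ℂ × ℂ) (hl:l.1.im = 0 ∧ -(1/2) ≤ l.1.re ∧ l.2.im = 0 ∧ -(1/2) ≤ l.2.re) j => by
    refine Or.inr ⟨?_, jacobiParam_conj h0 hl.1 hl.2.2.1 j⟩
    have e {s:ℂ} (hs:0 ≤ s.re) : ‖(q:ℂ)^s‖ ≤ 1 := by rw [norm_cpow_eq_rpow_re_of_pos h0]; exact Real.rpow_le_one h0.le h1.le hs
    fin_cases j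
    exacts [e (by norm_num; linarith [hl.2.1]), e (by norm_num; linarith [hl.2.1]),
      (norm_neg _).trans_le (e (by norm_num; linarith [hl.2.2.2])), (norm_neg _).trans_le (e (by norm_num; linarith [hl.2.2.2]))]
  lcP_real _ hl n := jacobiLead_conj h0 hl.1 hl.2.2.1 n
  lcT_real := fun (l:ℂ × ℂ) hl n => jacobiLead_conj h0 (by simpa using hl.1) (by simpa using hl.2.2.1) n
  adm_nondeg := fun (l:ℂ × ℂ) (hl:l.1.im = 0 ∧ -(1/2) ≤ l.1.re ∧ l.2.im = 0 ∧ -(1/2) ≤ l.2.re) n =>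
    cqJNondeg_of_real h0 h1 hl.1 hl.2.2.1 fun k hk => by
      have : (1:ℝ) ≤ n := by exact_mod_cast Nat.one_le_of_lt hk
      have := hl.2.1
      have := hl.2.2.2; exact ne_of_gt (by have := k.cast_nonneg (α := ℝ); linarith)
  adm_nondegT := fun (l:ℂ × ℂ) N hl v hv => by
    obtain ⟨e1, e2, e3, e4⟩ := hl
    change (l.1+((-((N:ℤ)+1):ℤ):ℂ)).im = 0 at e1
    change -(1/2) ≤ (l.1+((-((N:ℤ)+1):ℤ):ℂ)).re at e2
    change (l.2+((-((N:ℤ)+1):ℤ):ℂ)).im = 0 at e3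
    change -(1/2) ≤ (l.2+((-((N:ℤ)+1):ℤ):ℂ)).re at e4
    simp at e1 e2 e3 e4
    refine cqJNondeg_of_real h0 h1 (by simp [e1]) (by simp [e3]) fun k hk => ?_
    have a1 : (k:ℝ)+1 ≤ v := by exact_mod_cast hk
    have a2 : (v:ℝ) ≤ N := by exact_mod_cast hv
    simp only [neg_re]; exact ne_of_lt (by linarith)

lemma cqJ_twistedGroundState {q:ℝ} (h0:0 < q) (h1:q < 1) : TwistedGroundState (contQJacobi q) (fun l => (-l.1, -l.2)) := by
  have key (l:ℂ × ℂ) {U:ℂ} (hU:U ≠ 0) : potNum (Real.sqrt q:ℝ) (jacobiParam q (-l.1, -l.2)) U =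
        q^2/(∏ j, jacobiParam q l j)*potNum (Real.sqrt q:ℝ) (jacobiParam q l) (U*q)⁻¹ :=
    potNum_dual (ofReal_ne h0) (jacobiParam_ne h0 l) (jacobiParam_neg h0 l) hU
  have hq := ofReal_ne h0
  refine (cqJData h0 h1).model.twistedGroundState _ (fun l => q^2/(∏ j, jacobiParam q l j))
    (fun l => div_ne_zero (pow_ne_zero 2 hq) (prod_ne_zero_iff.2 fun j _ => jacobiParam_ne h0 l j)) (fun l x => ?_) fun l x => ?_
  · refine (key l (exp_ne_zero _)).trans ?_
    rw [← (cqJData h0 h1).exp_sub]; rfl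
  · refine (key l (inv_ne_zero (exp_ne_zero _))).trans ?_
    have e := (cqJData h0 h1).exp_sub x; rw [e, show ((exp (I*x)*(q:ℂ))⁻¹*q)⁻¹ = exp (I*x) by field_simp]; rfl

lemma cqJ_qInverse {q:ℝ} (h0:0 < q) (h1:q < 1) : QInverse (contQJacobi q) (fun l => cqJPoly q⁻¹ (-l.1, -l.2)) := by
  refine (cqJData h0 h1).model.qInverse_of_prop fun (l:ℂ × ℂ) n _ => ?_
  have hq := ofReal_ne h0
  have hb := jacobiParam_ne h0 (-l.1, -l.2)
  refine ⟨_, div_ne_zero (negProd_ne hq hq n) (negProd_ne (mul_ne_zero (hb 0) (hb 1)) hq n), fun x => ?_⟩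
  change _ = _*cqJPoly q (-l.1, -l.2) n x
  rw [cqJPoly_eq (inv_pos.2 h0), cqJPoly_eq h0, mul_sum, jacobiParam_inv h0, ofReal_inv]
  exact sum_congr rfl fun k hk => jacobiCoeff_inv hq hb (mem_range_succ_iff.1 hk) (exp_ne_zero _)

namespace MeixnerPollaczek

lemma stp : meixnerPollaczek.stp = I := by simp [FamilyData.stp, meixnerPollaczek]

/-- The phase `exp (i (π / 2 - ϕ))`. -/
def phase (ϕ:ℂ) : ℂ := exp (I*(Real.pi/2-ϕ))

lemma phase_ne (ϕ:ℂ) : phase ϕ ≠ 0 := exp_ne_zero _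

lemma phase_twist (ϕ:ℂ) : phase (Real.pi-ϕ) = (phase ϕ)⁻¹ := by rw [phase, phase, ← exp_neg]; congr 1; ring

lemma phase_eq (ϕ:ℂ) : phase ϕ = I*exp (-(I*ϕ)) := by
  rw [phase, show I*(Real.pi/2-ϕ) = Real.pi/2*I + -(I*ϕ) by ring, exp_add, exp_pi_div_two_mul_I]

lemma phase_inv (ϕ:ℂ) : (phase ϕ)⁻¹ = -I*exp (I*ϕ) := by rw [phase_eq, mul_inv, inv_I, ← exp_neg, neg_neg]

lemma phase_add (ϕ:ℂ) : phase ϕ+(phase ϕ)⁻¹ = 2*sin ϕ := by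
  rw [phase_inv, phase_eq, sin, show -ϕ*I = -(I*ϕ) by ring, mul_comm ϕ]; ring

lemma phase_conj {ϕ:ℂ} (h:ϕ.im = 0) : conj (phase ϕ) = (phase ϕ)⁻¹ := by
  rw [phase, ← exp_conj, ← exp_neg, map_mul, conj_I, map_sub, conj_eq_iff_im.2 h, map_div₀, conj_ofReal, Complex.conj_ofNat, neg_mul]

/-- The coefficients of the Meixner-Pollaczek polynomial. -/
def coeff (l:ℂ × ℂ) (n k:ℕ) : ℂ := (I*(phase l.2)⁻¹)^n/(n.factorial:ℂ) *
  (poch (-(n:ℂ)) k/(k.factorial:ℂ)*(phase l.2*(2*sin l.2))^k*poch (2*l.1+k) (n-k))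

lemma poly_eq (l:ℂ × ℂ) (n:ℕ) (x:ℂ) : mpPoly l n x = ∑ k ∈ range (n+1), coeff l n k*poch (l.1+I*x) k := by
  have e1 : exp (I*n*l.2) = (I*(phase l.2)⁻¹)^n := by
    rw [phase_inv, ← mul_assoc, mul_neg, I_mul_I, neg_neg, one_mul, ← exp_nat_mul]; congr 1; ring
  have e2 : 1-exp (-(2*I*l.2)) = phase l.2*(2*sin l.2) := by
    rw [← phase_add, mul_add, mul_inv_cancel₀ (phase_ne _), phase_eq, show -(2*I*l.2) = -(I*l.2) + -(I*l.2) by ring, exp_add]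
    linear_combination -exp (-(I*l.2))^2*I_sq
  rw [mpPoly, mul_sum, e1, e2]; exact sum_congr rfl fun k _ => by rw [coeff]; ring

lemma poly_diff_eq (l:ℂ × ℂ) (n:ℕ) (x:ℂ) : phase l.2*(l.1+I*x)*(mpPoly l n (x-I)-mpPoly l n x) +
    (phase l.2)⁻¹*(l.1-I*x)*(mpPoly l n (x+I)-mpPoly l n x) = 2*n*sin l.2*mpPoly l n x := by
  have e1 : l.1+I*(x-I) = l.1+I*x+1 := by linear_combination -I_sq
  have e2 : l.1+I*(x+I) = l.1+I*x-1 := by linear_combination I_sq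
  have hp := phase_ne l.2
  have hs := phase_add l.2
  have key := sum_eigen n (coeff l n) (fun k => poch (l.1+I*x) k) (fun k => phase l.2*(l.1+I*x)*(poch (l.1+I*x+1) k-poch (l.1+I*x) k) +
      (phase l.2)⁻¹*(l.1-I*x)*(poch (l.1+I*x-1) k-poch (l.1+I*x) k))
    (fun k => 2*k*sin l.2)
    (fun k => -((phase l.2)⁻¹*k*(2*l.1+(k-1:ℕ)))) (2*n*sin l.2)
    (by simp [poch_zero])
    (fun k => by
      have h1 := poch_up (l.1+I*x) (k+1); rw [poch_down, Nat.add_sub_cancel]; rw [poch_succ (l.1+I*x) k] at h1 ⊢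
      push_cast at h1 ⊢
      linear_combination phase l.2*h1+(k+1)*(poch (l.1+I*x) k*(l.1+I*x+k))*hs)
    (fun k hk => by
      have hf0 : (k.factorial:ℂ) ≠ 0 := by exact_mod_cast k.factorial_ne_zero
      have hn0 : (n.factorial:ℂ) ≠ 0 := by exact_mod_cast n.factorial_ne_zero
      have hk0 : (k:ℂ)+1 ≠ 0 := by exact_mod_cast k.succ_ne_zero
      rw [coeff, coeff, poch_succ, poch_sub _ hk, Nat.factorial_succ, Nat.add_sub_cancel]; push_cast; field_simp
      ring) rfl
  rw [poly_eq, poly_eq, poly_eq, e1, e2, ← key, ← sum_sub_distrib, ← sum_sub_distrib, mul_sum, mul_sum, ← sum_add_distrib]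
  exact sum_congr rfl fun k _ => by ring

lemma poly_poly (l:ℂ × ℂ) (n:ℕ) : ∃ p : ℂ[X], p.natDegree ≤ n ∧
    (∀ x, mpPoly l n x = p.eval (meixnerPollaczek.η x)) ∧ p.coeff n = (2*sin l.2)^n/n.factorial := by
  obtain ⟨p, h1, h2, h3⟩ := exists_poly_of_sum (η := meixnerPollaczek.η) n (coeff l n) (fun _ => I)
    (fun k => l.1+k) (fun k x => poch (l.1+I*x) k) (fun x => poch_zero _) (fun k x => by
      rw [poch_succ]
      change _ = _*(I*x+_)
      ring)
  refine ⟨p, h1, fun x => by rw [poly_eq, h2], ?_⟩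
  have hf0 : (n.factorial:ℂ) ≠ 0 := by exact_mod_cast n.factorial_ne_zero
  rw [h3, coeff, poch_neg_self, Nat.sub_self, poch_zero, prod_const, card_range]
  have h4 : (I*(phase l.2)⁻¹)^n*(-1)^n*(phase l.2*(2*sin l.2))^n*I ^ n = (2*sin l.2)^n := by
    rw [← mul_pow, ← mul_pow, ← mul_pow]; congr 1
    linear_combination -(2*sin l.2)*I ^ 2*mul_inv_cancel₀ (phase_ne l.2)-2*sin l.2*I_sq
  rw [← h4]; field_simp

lemma w_eq (l:ℂ × ℂ) (x:ℂ) : meixnerPollaczek.w l x = exp (2*(l.2-Real.pi/2)*x)*(Gamma (l.1+I*x)*Gamma (l.1-I*x)) := rfl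

lemma w_shift (l:ℂ × ℂ) (x:ℂ) : meixnerPollaczek.w (meixnerPollaczek.shift l 1) x =
    exp (2*(l.2-Real.pi/2)*x)*(Gamma (l.1+1/2+I*x)*Gamma (l.1+1/2-I*x)) := by
  simp [meixnerPollaczek]

lemma w_up_down {l:ℂ × ℂ} {x:ℂ} (h:meixnerPollaczek.w l x ≠ 0) : (l.1+I*x ≠ 0 ∧ l.1-I*x ≠ 0) ∧
    meixnerPollaczek.w (meixnerPollaczek.shift l 1) (x-I/2) = phase l.2*(l.1+I*x)*meixnerPollaczek.w l x ∧
    meixnerPollaczek.w (meixnerPollaczek.shift l 1) (x+I/2) = (phase l.2)⁻¹*(l.1-I*x)*meixnerPollaczek.w l x := by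
  rw [w_eq] at h
  obtain ⟨h1, h2⟩ := mul_ne_zero_iff.1 (right_ne_zero_of_mul h)
  have h1' : l.1+I*x ≠ 0 := fun h0 => h1 (by rw [h0, Gamma_zero])
  have h2' : l.1-I*x ≠ 0 := fun h0 => h2 (by rw [h0, Gamma_zero])
  refine ⟨⟨h1', h2'⟩, ?_, ?_⟩
  · rw [w_shift, w_eq, I_mul_sub_half, show l.1+1/2+(I*x+1/2) = l.1+I*x+1 by ring,
      Gamma_add_one _ h1', show l.1+1/2-(I*x+1/2) = l.1-I*x by ring,
      show 2*(l.2-Real.pi/2)*(x-I/2) = I*(Real.pi/2-l.2)+2*(l.2-Real.pi/2)*x by ring,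
      exp_add, phase]
    ring
  · rw [w_shift, w_eq, I_mul_add_half, show l.1+1/2+(I*x-1/2) = l.1+I*x by ring,
      show l.1+1/2-(I*x-1/2) = l.1-I*x+1 by ring, Gamma_add_one _ h2',
      show 2*(l.2-Real.pi/2)*(x+I/2) = -(I*(Real.pi/2-l.2))+2*(l.2-Real.pi/2)*x by ring,
      exp_add, phase, ← exp_neg]
    ring

lemma gamma_sub_eq {a:ℂ} (ha:a.im = 0) (x:ℂ) : Gamma (a-I*conj x) = conj (Gamma (a+I*x)) := by
  rw [← Gamma_conj, map_add, map_mul, conj_I, conj_eq_iff_im.2 ha, neg_mul, sub_eq_add_neg]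

lemma w_conj {l:ℂ × ℂ} (h1:l.1.im = 0) (h2:l.2.im = 0) (x:ℂ) : conj (meixnerPollaczek.w l x) = meixnerPollaczek.w l (conj x) := by
  have h := gamma_sub_eq h1 (conj x); rw [conj_conj] at h
  rw [w_eq, w_eq, gamma_sub_eq h1, h, map_mul, map_mul, conj_conj, ← exp_conj]
  simp only [map_mul, map_sub, map_div₀, conj_ofReal, Complex.conj_ofNat, conj_eq_iff_im.2 h2]; ring

lemma w_pos {l:ℂ × ℂ} (h1:l.1.im = 0) (h2:l.2.im = 0) (h:0 < l.1.re) (r:ℝ) : PosR (meixnerPollaczek.w l r) := by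
  have e := gamma_sub_eq h1 r; rw [conj_ofReal] at e
  have e2 : 2*(l.2-Real.pi/2)*r = ((2*(l.2.re-Real.pi/2)*r : ℝ):ℂ) := by push_cast; rw [conj_eq_iff_re.1 (conj_eq_iff_im.2 h2)]
  rw [w_eq, e, e2, ← ofReal_exp]
  exact PosR.mul ⟨_, Real.exp_pos _, rfl⟩ (PosR.mul_conj (Gamma_ne_zero_of_re_pos (by simpa using h)))

lemma sin_ne {z:ℂ} (h1:z.im = 0) (h2:0 < z.re ∧ z.re < Real.pi) : sin z ≠ 0 := by
  rw [← conj_eq_iff_re.1 (conj_eq_iff_im.2 h1), ← ofReal_sin]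
  exact_mod_cast (Real.sin_pos_of_pos_of_lt_pi h2.1 h2.2).ne'

end MeixnerPollaczek

open MeixnerPollaczek in
/-- The Meixner-Pollaczek family. -/
def meixnerPollaczekModel : AdmModel meixnerPollaczek :=
  { Geom.linear (F := meixnerPollaczek) rfl rfl rfl rfl with
    np := fun l x => phase l.2*(l.1+I*x)
    nm := fun l x => (phase l.2)⁻¹*(l.1-I*x)
    np_diff := fun l => by fun_prop
    nm_diff := fun l => by fun_prop
    np_fin := fun (l:ℂ × ℂ) => by
      obtain ⟨S, hS, h⟩ := exists_finite_im fun _ : Fin 1 => l.1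
      refine ⟨S, hS, fun x hx => ⟨mul_ne_zero (phase_ne _) fun h0 => ?_, mul_ne_zero (inv_ne_zero (phase_ne _)) fun h0 => ?_⟩⟩
      · exact (h _ hx.2 0 x rfl).1 (by rw [h0]; simp)
      · exact (h _ hx.2 0 x rfl).2 (by rw [h0]; simp)
    lcP := fun (l:ℂ × ℂ) n => (2*sin l.2)^n/n.factorial
    lcT := fun (l:ℂ × ℂ) n => (2*sin l.2)^n/n.factorial
    base := fun (l:ℂ × ℂ) => sin l.2 ≠ 0
    nondeg_base := fun _ _ h => h
    nondegT_base := fun _ _ h => h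
    base_shift := fun _ _ h => h
    pert_gen := fun _ h _ => .of_forall fun _ => ⟨h, h⟩
    κ_pos := one_pos
    V_eq := fun l x => by simp [meixnerPollaczek, phase]
    shift_shift := fun l s t => by simp [meixnerPollaczek]; ring
    shift_zero := fun l => by simp [meixnerPollaczek]; rfl
    np_shift := fun l x => by
      rw [stp]; simp [I_mul_add_half, meixnerPollaczek]; grind
    nm_shift := fun l x => by
      rw [stp]; simp [I_mul_sub_half, meixnerPollaczek]; grind
    P_poly := fun l n => (poly_poly l n).imp fun p h => ⟨h.1, h.2.1, fun _ => h.2.2⟩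
    T_poly := fun (l:ℂ × ℂ) n => (poly_poly (1-l.1, Real.pi-l.2) n).imp fun p h => ⟨h.1, h.2.1, fun _ => by rw [h.2.2, sin_pi_sub]⟩
    lcP_ne := fun (l:ℂ × ℂ) n h => div_ne_zero (pow_ne_zero n (mul_ne_zero two_ne_zero h)) (by exact_mod_cast n.factorial_ne_zero)
    lcT_ne := fun (l:ℂ × ℂ) n h => div_ne_zero (pow_ne_zero n (mul_ne_zero two_ne_zero h)) (by exact_mod_cast n.factorial_ne_zero)
    P_eq := fun (l:ℂ × ℂ) n _ x hx => by
      rw [stp]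
      refine Eq.trans ?_ (poly_diff_eq l n x)
      change _/(1*1)*_+_/(1*1)*_ = _
      rw [one_mul, div_one, div_one]; rfl
    T_eq := fun (l:ℂ × ℂ) n _ x hx => by
      rw [stp]
      have := poly_diff_eq (1-l.1, Real.pi-l.2) n x; rw [phase_twist, inv_inv, sin_pi_sub] at this
      simp [meixnerPollaczek, I_mul_add_I, I_mul_sub_I, sin_pi_sub] at this ⊢; linear_combination -this
    VV := fun (l:ℂ × ℂ) x hx => by
      rw [stp]; simp [meixnerPollaczek, I_mul_add_I, I_mul_sub_I, ← phase_add]; ring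
    E_zero := fun l => by simp [meixnerPollaczek]
    E_step := fun l n => by simp [meixnerPollaczek]; ring
    Et_eq := fun l v => by simp [meixnerPollaczek, sin_pi_sub]; ring
    E_ne := fun (l:ℂ × ℂ) n hn k hk => by
      have hn : sin l.2 ≠ 0 := hn; simp [meixnerPollaczek, hn, hk.ne]
    kernel := fun (l:ℂ × ℂ) N x y e he hx hy h1 h2 _ _ => by
      rw [stp] at *
      change y+e-x ≠ 0 at h1
      change y-e-x ≠ 0 at h2
      have e1 : y-(x+e) = y-e-x := by ring
      have e2 : y-(x-e) = y+e-x := by ring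
      have k1 : -(phase l.2*(l.1+I*(y+e+I)))/(y+e-x)+phase l.2*(l.1+I*(x+I))/(y+e-x) = -I*phase l.2 := by
        rw [← add_div, div_eq_iff h1]; ring
      have k2 : (phase l.2)⁻¹*(l.1-I*(y-e-I))/(y-e-x)-(phase l.2)⁻¹*(l.1-I*(x-I))/(y-e-x) = -I*(phase l.2)⁻¹ := by
        rw [← sub_div, div_eq_iff h2]; ring
      simp [meixnerPollaczek, Geom.linear, sin_pi_sub, e1, e2]
      linear_combination I*N*k1+I*N*k2-N*(phase l.2+(phase l.2)⁻¹)*I_sq+N*phase_add l.2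
    w_step := fun (l:ℂ × ℂ) y h => by
      rw [stp]
      obtain ⟨⟨h1, h2⟩, hd, hu⟩ := w_up_down h
      have h1' := mul_ne_zero (phase_ne l.2) h1
      have h2' := mul_ne_zero (inv_ne_zero (phase_ne l.2)) h2
      refine ⟨h1', h2', fun h0 => mul_ne_zero h1' h (hd.symm.trans h0), fun h0 => mul_ne_zero h2' h (hu.symm.trans h0), ?_, ?_⟩
      · simpa [nu, meixnerPollaczek] using hd
      · simpa [nu, meixnerPollaczek] using hu
    adm_shift := fun l hl => by
      simp [meixnerPollaczek] at hl ⊢; exact ⟨hl.1, by linarith, hl.2.2⟩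
    np_conj := fun (l:ℂ × ℂ) hl x => by
      simp only [map_mul, phase_conj hl.2.2.1, map_add, conj_I, conj_eq_iff_im.2 hl.1, neg_mul, sub_eq_add_neg]
    E_real := fun l hl n => by simp [meixnerPollaczek, Complex.conj_ofNat, ← sin_conj, conj_eq_iff_im.2 hl.2.2.1]
    lcP_real := fun l hl n => by simp [Complex.conj_ofNat, ← sin_conj, conj_eq_iff_im.2 hl.2.2.1]
    lcT_real := fun l hl n => by simp [Complex.conj_ofNat, ← sin_conj, conj_eq_iff_im.2 hl.2.2.1]
    w_pos := fun l hl r _ => w_pos hl.1 hl.2.2.1 hl.2.1 r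
    w_conj := fun l hl x => w_conj hl.1 hl.2.2.1 x
    w_line := fun (l:ℂ × ℂ) _ => by
      obtain ⟨S, hS, h⟩ := exists_finite_im fun _ : Fin 1 => l.1
      exact ⟨S, hS, fun r hr => (LineReg.of_entire (f := fun x => exp (2*(l.2-Real.pi/2)*x)) (by fun_prop)
        fun _ _ => exp_ne_zero _).mul ((LineReg.gamma (by fun_prop) fun z hz => (h r hr.2 0 z hz).1).mul
          (LineReg.gamma (by fun_prop) fun z hz => (h r hr.2 0 z hz).2))⟩
    adm_nondeg := fun l hl _ => sin_ne hl.2.2.1 hl.2.2.2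
    adm_nondegT := fun _ N hl v _ => sin_ne hl.2.2.1 hl.2.2.2 }

end CasoratiDuality

end

open Complex Finset CasoratiDuality
open scoped ComplexConjugate

theorem mainTheorem4 :
    (CasoratiDuality.Identities CasoratiDuality.contDualHahn ∧
      CasoratiDuality.Identities CasoratiDuality.contHahn ∧
      CasoratiDuality.Identities CasoratiDuality.meixnerPollaczek ∧
      CasoratiDuality.TwistedGroundState CasoratiDuality.contDualHahn (fun a j => 1 - a j) ∧
      CasoratiDuality.TwistedGroundState CasoratiDuality.contHahn CasoratiDuality.cHTwist ∧
      CasoratiDuality.TwistedGroundState CasoratiDuality.meixnerPollaczek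
        (fun l => (1 - l.1, Real.pi - l.2))) ∧
    ∀ q : ℝ, 0 < q → q < 1 →
      (CasoratiDuality.Identities (CasoratiDuality.contQJacobi q) ∧
        CasoratiDuality.Identities (CasoratiDuality.contDualQHahn q) ∧
        CasoratiDuality.Identities (CasoratiDuality.alSalamChihara q) ∧
        CasoratiDuality.Identities (CasoratiDuality.contBigQHermite q) ∧
        CasoratiDuality.Identities (CasoratiDuality.contQHermite q) ∧
        CasoratiDuality.Identities (CasoratiDuality.contQLaguerre q) ∧
        CasoratiDuality.TwistedGroundState (CasoratiDuality.contQJacobi q)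
          (fun l => (-l.1, -l.2))) ∧
      CasoratiDuality.QInverse (CasoratiDuality.contQJacobi q)
        (fun l => CasoratiDuality.cqJPoly q⁻¹ (-l.1, -l.2)) ∧
      CasoratiDuality.QInverse (CasoratiDuality.contDualQHahn q)
        (fun a => CasoratiDuality.redAWPoly 2 q⁻¹ (fun j => a j * (q : ℂ)⁻¹)) ∧
      CasoratiDuality.QInverse (CasoratiDuality.alSalamChihara q)
        (fun a => CasoratiDuality.redAWPoly 1 q⁻¹ (fun j => a j * (q : ℂ)⁻¹)) ∧
      CasoratiDuality.QInverse (CasoratiDuality.contBigQHermite q)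
        (fun a => CasoratiDuality.redAWPoly 0 q⁻¹ (fun j => a j * (q : ℂ)⁻¹)) ∧
      CasoratiDuality.QInverse (CasoratiDuality.contQHermite q)
        (fun _ => CasoratiDuality.cqHPoly q⁻¹) ∧
      CasoratiDuality.QInverse (CasoratiDuality.contQLaguerre q)
        (fun (α : ℂ) => CasoratiDuality.cqLPoly q⁻¹ (-α)) := by
  refine ⟨⟨contDualHahnModel.identities, contHahnModel.identities, meixnerPollaczekModel.identities, ?_, ?_, ?_⟩,
    fun q h0 h1 => ⟨⟨(cqJData h0 h1).model.identities, (redAWData h0 h1 le_rfl).model.identities,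
      (redAWData h0 h1 one_le_two).model.identities, (redAWData h0 h1 zero_le_two).model.identities,
      (cqHData h0 h1).model.identities, (cqLData h0 h1).model.identities, cqJ_twistedGroundState h0 h1⟩,
      cqJ_qInverse h0 h1, (redAWData h0 h1 le_rfl).model.qInverse, (redAWData h0 h1 one_le_two).model.qInverse,
      (redAWData h0 h1 zero_le_two).model.qInverse, (cqHData h0 h1).model.qInverse,
      (cqLData h0 h1).model.qInverse⟩⟩
  · refine contDualHahnModel.twistedGroundState _ (fun _ => -1) (fun _ => neg_ne_zero.2 one_ne_zero)
      (fun (a : Fin 3 → ℂ) x => ?_) fun (a : Fin 3 → ℂ) x => ?_ <;> rw [ContDualHahn.stp]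
    · change -(∏ j, (1 - a j + I * x)) = -1 * -(∏ j, (a j - I * (x - I)))
      rw [ContDualHahn.twist_sub, neg_one_mul]
    · change -(∏ j, (1 - a j - I * (x - I))) = -1 * -(∏ j, (a j + I * x))
      rw [ContDualHahn.twist_sub fun j => 1 - a j, neg_one_mul, neg_neg]
      simp only [sub_sub_cancel]
  · refine contHahnModel.twistedGroundState _ (fun _ => 1) (fun _ => one_ne_zero) (fun (a : Fin 2 → ℂ) x => ?_)
      fun (a : Fin 2 → ℂ) x => ?_ <;> rw [ContHahn.stp, one_mul]
    · change (∏ j, (1 - conj (a j) + I * x)) = ∏ j, (conj (a j) - I * (x - I))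
      rw [Fin.prod_univ_two, Fin.prod_univ_two, mul_sub I, I_mul_I]; ring
    · change (∏ j, (conj (1 - conj (a j)) - I * (x - I))) = ∏ j, (a j + I * x)
      simp only [map_sub, map_one, conj_conj]
      rw [Fin.prod_univ_two, Fin.prod_univ_two, mul_sub I, I_mul_I]; ring
  · refine meixnerPollaczekModel.twistedGroundState _ (fun _ => -1) (fun _ => neg_ne_zero.2 one_ne_zero)
      (fun (l : ℂ × ℂ) x => ?_) fun (l : ℂ × ℂ) x => ?_ <;> rw [MeixnerPollaczek.stp]
    · change MeixnerPollaczek.phase (Real.pi - l.2) * (1 - l.1 + I * x) = -1 * ((MeixnerPollaczek.phase l.2)⁻¹ * _)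
      rw [MeixnerPollaczek.phase_twist, mul_sub I, I_mul_I]; ring
    · change (MeixnerPollaczek.phase (Real.pi - l.2))⁻¹ * (1 - l.1 - I * (x - I)) = -1 * (MeixnerPollaczek.phase l.2 * _)
      rw [MeixnerPollaczek.phase_twist, inv_inv, mul_sub I, I_mul_I]; ring
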